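/- Notation. For a set $\Omega\subset\mathbb R^2$, $\partial\Omega$ is its boundary, $\dim_{\mathcal H}$ is Hausdorff dimension, $\log$ is the natural logarithm and $\|\cdot\|$ is the Euclidean norm. A *Jordan domain* is a bounded domain $\Omega\subset\mathbb R^2$ (a nonempty connected open set) whose boundary is a Jordan curve, i.e. the image of an injective continuous map from the circle to the plane. For $J>0$, a domain $\Omega$ is *$J$-John* if there is $x_0\in\Omega$ such that for every $x\in\Omega$ there exists a unit speed curve $\gamma\colon[0,\ell(\gamma)]\to\Omega$ with $\gamma(0)=x$, $\gamma(\ell(\gamma))=x_0$ and $$\operatorname{dist}(\gamma(t),\partial\Omega)\ge Jt\qquad\text{for all }t\in[0,\ell(\gamma)].$$ For $p\in(1,2)$, $\Omega$ *satisfies the curve condition with exponent $p$ and constant $C$* if any $z_1,z_2\in\mathbb R^2\setminus\Omega$ can be joined by a rectifiable curve $\gamma\subset\mathbb R^2\setminus\Omega$ with $$\int_\gamma \operatorname{dist}(z,\partial\Omega)^{1-p}\,ds(z)\le C\,\|z_1-z_2\|^{2-p}.$$ **Theorem.** 1. For every $J\in(0,1/2)$ there exists a Jordan domain $\Omega\subset\mathbb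 R^2$ that is $J$-John and satisfies $$\dim_{\mathcal H}(\partial\Omega)\ge 2-\frac{2}{\log 2}\,J.$$ 2. For every $p\in(1,2)$ and every $C\in\bigl(\tfrac{72}{2-p},\infty\bigr)$ there exists a Jordan domain $\Omega\subset\mathbb R^2$ satisfying the curve condition with exponent $p$ and constant $C$, for which $$\dim_{\mathcal H}(\partial\Omega)\ge 2-\frac{24}{\log(2)\,(2-p)\,C}.$$ 3. There exists a universal constant $c>0$ such that for every $p\in(1,2)$ and every $C\in\bigl(\tfrac{c}{2-p},\infty\bigr)$ there exists a Jordan domain $\Omega\subset\mathbb R^2$ satisfying the curve condition with exponent $p$ and constant $C$, but which is not $J$-John for any $$J\ge c\,\bigl((2-p)C\bigr)^{\frac1{p-2}}.$$ -/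

import Mathlib

/-- A Jordan domain in the Euclidean plane: a bounded domain (nonempty connected open set) whose
boundary is a Jordan curve, i.e. the image of the circle under an injective continuous map. -/
def IsJordanDomain (Ω : Set (EuclideanSpace ℝ (Fin 2))) : Prop :=
  IsOpen Ω ∧ IsConnected Ω ∧ Bornology.IsBounded Ω ∧
    ∃ φ : Circle → EuclideanSpace ℝ (Fin 2),
      Continuous φ ∧ Function.Injective φ ∧ Set.range φ = frontier Ω

/-- `Ω` is a `J`-John domain: for some center `x₀ ∈ Ω`, every `x ∈ Ω` can be joined to `x₀` inside
`Ω` by a unit speed curve `γ : [0, l] → Ω` with `dist (γ t, ∂Ω) ≥ J t`. -/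
def IsJohnDomain (J : ℝ) (Ω : Set (EuclideanSpace ℝ (Fin 2))) : Prop :=
  0 < J ∧ ∃ x₀ ∈ Ω, ∀ x ∈ Ω, ∃ (l : ℝ) (γ : ℝ → EuclideanSpace ℝ (Fin 2)),
    0 ≤ l ∧ HasUnitSpeedOn γ (Set.Icc 0 l) ∧ γ 0 = x ∧ γ l = x₀ ∧
      ∀ t ∈ Set.Icc 0 l, γ t ∈ Ω ∧ J * t ≤ Metric.infDist (γ t) (frontier Ω)

/-- The curve condition with exponent `p` and constant `C`: any two points of the complement of
`Ω` can be joined in the complement by a rectifiable curve `γ` (parametrized by arc length) with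
`∫_γ dist (z, ∂Ω) ^ (1 - p) ds(z) ≤ C ‖z₁ - z₂‖ ^ (2 - p)`. The integral takes values in `[0, ∞]`,
and the integrand is `∞` on `∂Ω` when `p > 1`. -/
def SatisfiesCurveCondition (p C : ℝ) (Ω : Set (EuclideanSpace ℝ (Fin 2))) : Prop :=
  ∀ z₁ ∈ Ωᶜ, ∀ z₂ ∈ Ωᶜ, ∃ (l : ℝ) (γ : ℝ → EuclideanSpace ℝ (Fin 2)),
    0 ≤ l ∧ HasUnitSpeedOn γ (Set.Icc 0 l) ∧ γ 0 = z₁ ∧ γ l = z₂ ∧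
      (∀ t ∈ Set.Icc 0 l, γ t ∈ Ωᶜ) ∧
      ∫⁻ t in Set.Icc 0 l, (ENNReal.ofReal (Metric.infDist (γ t) (frontier Ω))) ^ (1 - p)
        ≤ ENNReal.ofReal (C * ‖z₁ - z₂‖ ^ (2 - p))

open Set Filter Topology MeasureTheory Metric
open scoped ENNReal NNReal ComplexConjugate

set_option linter.unusedSectionVars false

/-! Two constructions carry the theorem: a Koch curve with a width parameter for the dimension
bounds, and a meandering corridor for the failure of the John condition. Throughout, a = 2 - p.

Koch curve. The apex of the triangle `kochT` over [0, 1] has modulus √((1-g)/2). The orientation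
reversing similarities `kochL` and `kochR` of this ratio send the base to the two legs and the
triangle to two subtriangles, which meet only at the apex and leave between them an opening `kochM`
whose mouth on the base has width g. The invariant curve `kochK` is a simple arc. The openings keep
the two halves apart (`separation_L`), so the inverse of the parametrization is Hölder continuous
(`dist_curve_ge`), and this bounds the dimension from below by 2 log 2 / (log 2 - log (1 - g)),
which is at least 2 - 2g / log 2 (`two_sub_le_dimH_K`). Each similarity exchanges the sides of the
curve, so the openings of even level lie below it and those of odd level above it. The domain is a
convex pentagon with the part above the curve removed.

John condition. From a point of an opening one goes to its axis and leaves through the mouth at a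
right angle. Then one either continues in the same direction, or crosses the side of a larger
opening and turns at the axis of that opening. A carrot of aperture g fits all the way.
`KochDescent` is the invariant that makes this an induction over levels (`KochDescent.LL`,
`KochDescent.LR`, `john_of_U`). So g = J works for J < 2/5, and for larger J a disc suffices.

Curve condition. The weighted length of a curve scales with the power a. The similarities of the
second level move the center `kochHub` of the triangle below the base at a cost that forms a
geometric series, so every point below the curve is joined to the hub at cost of order g ^ (a - 1) /
a (`conn_hub`). Points of different second level pieces are joined through a common vertex, an
opening or the hub, and points of the same piece are rescaled; this gives cost at most (12 / (a g))
|z - w| ^ a (`conn_pair`). Since the part above the curve consists of two similar copies of the part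
below, the complement of the domain satisfies the same bound (`conn_compl`). The value g = 12 / (a
C) gives the second claim, and C > 72 / a is the requirement g < 1/6.

Corridor. A path of unit cells is refined by replacing each cell by a 7 × 7 block that is crossed in
9 cells. After n refinements 9 ^ n cells lie in a square of side 7 ^ n. Distances to the boundary
inside the corridor stay bounded, while some point is at inner distance of order 9 ^ n from any
given center, so J is at most 27 / 9 ^ n (`john_le_of_snakeDomain`). In the complement one climbs
from each grid to the next coarser one at bounded cost relative to the cell size (`escape_step`),
and the sum gives the curve condition with constant 1000 (7 ^ a) ^ n / a (`conn_snakeDomain_compl`).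
It is essential that the number of cells grows faster than the side: with n chosen to exhaust C, (a
C) ^ (1 / a) is comparable to 7 ^ n only up to a factor like 1000 ^ (1 / a), unbounded as a tends to
0, and the gain (9/7) ^ n absorbs it (`exists_generation`). The corridor is a Jordan domain because
squares are attached one at a time along single edges (`IsJordanRegion.add_square`). -/

namespace UnitSpeed
-- Curves of unit speed
variable {E : Type*} [PseudoEMetricSpace E]

/-- For ordered points of [0, l] the intersection with the domain in the general definition
disappears. All operations on curves below are checked in this form. -/
theorem iff_le {f : ℝ → E} {l : ℝ} :
    HasUnitSpeedOn f (Icc 0 l) ↔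
      ∀ x y, 0 ≤ x → x ≤ y → y ≤ l → eVariationOn f (Icc x y) = ENNReal.ofReal (y - x) := by
  unfold HasUnitSpeedOn
  rw [hasConstantSpeedOnWith_iff_ordered]
  constructor
  · intro h x y hx hxy hy
    have := h (x := x) ⟨hx, hxy.trans hy⟩ (y := y) ⟨hx.trans hxy, hy⟩ hxy
    rw [inter_eq_self_of_subset_right] at this
    · simpa using this
    · exact fun t ht => ⟨hx.trans ht.1, ht.2.trans hy⟩
  · intro h x hx y hy hxy
    rw [inter_eq_self_of_subset_right (Icc_subset_Icc hx.1 hy.2)]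
    simpa using h x y hx.1 hxy hy.2

theorem congr {f g : ℝ → E} {l : ℝ} (hf : HasUnitSpeedOn f (Icc 0 l))
    (h : EqOn f g (Icc 0 l)) : HasUnitSpeedOn g (Icc 0 l) := by
  rw [iff_le] at hf ⊢
  intro x y hx hxy hy
  rw [← hf x y hx hxy hy]
  exact (eVariationOn.eq_of_eqOn (h.mono (Icc_subset_Icc hx hy))).symm

theorem mono {f : ℝ → E} {l l' : ℝ} (hf : HasUnitSpeedOn f (Icc 0 l)) (h : l' ≤ l) :
    HasUnitSpeedOn f (Icc 0 l') := by
  rw [iff_le] at hf ⊢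
  exact fun x y hx hxy hy => hf x y hx hxy (hy.trans h)

theorem edist_le {f : ℝ → E} {l : ℝ} (hf : HasUnitSpeedOn f (Icc 0 l)) {x y : ℝ} (hx : 0 ≤ x)
    (hxy : x ≤ y) (hy : y ≤ l) : edist (f x) (f y) ≤ ENNReal.ofReal (y - x) := by
  rw [← iff_le.1 hf x y hx hxy hy]
  exact eVariationOn.edist_le f (left_mem_Icc.2 hxy) (right_mem_Icc.2 hxy)

theorem lipschitzOnWith {f : ℝ → E} {l : ℝ} (hf : HasUnitSpeedOn f (Icc 0 l)) :
    LipschitzOnWith 1 f (Icc 0 l) := by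
  intro x hx y hy
  rw [ENNReal.coe_one, one_mul, edist_dist x y, Real.dist_eq]
  rcases le_total x y with h | h
  · rw [abs_sub_comm, abs_of_nonneg (sub_nonneg.2 h)]
    exact edist_le hf hx.1 h hy.2
  · rw [abs_of_nonneg (sub_nonneg.2 h), edist_comm]
    exact edist_le hf hy.1 h hx.2

theorem eVariationOn_comp_sub (f : ℝ → E) (a x y : ℝ) :
    eVariationOn (fun t => f (t - a)) (Icc x y) = eVariationOn f (Icc (x - a) (y - a)) := by
  have := eVariationOn.comp_eq_of_monotoneOn f (t := Icc x y) (fun t => t - a)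
    (fun _ _ _ _ h => sub_le_sub_right h a)
  rw [Set.image_sub_const_Icc] at this
  exact this

theorem concat {f g : ℝ → E} {l m : ℝ}
    (hf : HasUnitSpeedOn f (Icc 0 l)) (hg : HasUnitSpeedOn g (Icc 0 m)) (h : f l = g 0) :
    HasUnitSpeedOn (fun t => if t ≤ l then f t else g (t - l)) (Icc 0 (l + m)) := by
  refine HasUnitSpeedOn.Icc_Icc (y := l) (congr hf fun t ht => (if_pos ht.2).symm) ?_
  have key : EqOn (fun t => g (t - l)) (fun t => if t ≤ l then f t else g (t - l))
      (Icc l (l + m)) := by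
    intro t ht
    rcases ht.1.eq_or_lt with rfl | h'
    · simp [h]
    · simp [not_le.2 h']
  unfold HasUnitSpeedOn
  rw [hasConstantSpeedOnWith_iff_ordered]
  intro x hx y hy hxy
  have hsub : Icc x y ⊆ Icc l (l + m) := Icc_subset_Icc hx.1 hy.2
  rw [inter_eq_self_of_subset_right hsub, ← eVariationOn.eq_of_eqOn (key.mono hsub),
    eVariationOn_comp_sub, iff_le.1 hg _ _ (by linarith [hx.1]) (by linarith)
      (by linarith [hy.2])]
  simp

theorem reverse {f : ℝ → E} {l : ℝ} (hf : HasUnitSpeedOn f (Icc 0 l)) :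
    HasUnitSpeedOn (fun t => f (l - t)) (Icc 0 l) := by
  rw [iff_le] at hf ⊢
  intro x y hx hxy hy
  have := eVariationOn.comp_eq_of_antitoneOn f (t := Icc x y) (fun t => l - t)
    (fun _ _ _ _ h => sub_le_sub_left h l)
  rw [Set.image_const_sub_Icc] at this
  refine Eq.trans this ?_
  rw [hf _ _ (by linarith) (by linarith) (by linarith)]
  ring_nf

theorem _root_.eVariationOn.comp_similar {F : Type*} [PseudoEMetricSpace F] {φ : E → F} {ρ : ℝ≥0∞}
    (hφ : ∀ x y, edist (φ x) (φ y) = ρ * edist x y) (f : ℝ → E) (s : Set ℝ) :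
    eVariationOn (fun t => φ (f t)) s = ρ * eVariationOn f s := by
  simp only [eVariationOn, hφ, ← Finset.mul_sum, ENNReal.mul_iSup]

theorem similar {F : Type*} [PseudoEMetricSpace F] {φ : E → F} {ρ : ℝ} (hρ : 0 < ρ)
    (hφ : ∀ x y, edist (φ x) (φ y) = ENNReal.ofReal ρ * edist x y) {f : ℝ → E} {l : ℝ}
    (hf : HasUnitSpeedOn f (Icc 0 l)) :
    HasUnitSpeedOn (fun t => φ (f (t / ρ))) (Icc 0 (ρ * l)) := by
  rw [iff_le] at hf ⊢
  intro x y hx hxy hy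
  rw [eVariationOn.comp_similar hφ (fun t => f (t / ρ))]
  have := eVariationOn.comp_eq_of_monotoneOn f (t := Icc x y) (fun t => t / ρ)
    (fun _ _ _ _ h => div_le_div_of_nonneg_right h hρ.le)
  have him : (fun t => t / ρ) '' Icc x y = Icc (x / ρ) (y / ρ) := by
    simp only [div_eq_mul_inv]
    exact Set.image_mul_right_Icc hxy (inv_nonneg.2 hρ.le)
  rw [him] at this
  have h2 : eVariationOn (fun t => f (t / ρ)) (Icc x y) = ENNReal.ofReal (y / ρ - x / ρ) := by
    refine Eq.trans this (hf _ _ (by positivity) (by gcongr) ?_)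
    rw [div_le_iff₀ hρ]; linarith
  rw [h2, ← ENNReal.ofReal_mul hρ.le]
  congr 1
  field_simp

theorem isometry_like {f : ℝ → E} {l : ℝ}
    (h : ∀ x y, 0 ≤ x → x ≤ y → y ≤ l → edist (f x) (f y) = ENNReal.ofReal (y - x)) :
    HasUnitSpeedOn f (Icc 0 l) := by
  rw [iff_le]
  intro x y hx hxy hy
  apply le_antisymm
  · have hL : LipschitzOnWith 1 f (Icc x y) := by
      intro s hs t ht
      rw [ENNReal.coe_one, one_mul, edist_dist s t, Real.dist_eq]
      rcases le_total s t with h' | h'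
      · rw [abs_sub_comm, abs_of_nonneg (sub_nonneg.2 h')]
        exact (h s t (hx.trans hs.1) h' (ht.2.trans hy)).le
      · rw [abs_of_nonneg (sub_nonneg.2 h'), edist_comm]
        exact (h t s (hx.trans ht.1) h' (hs.2.trans hy)).le
    have := hL.comp_eVariationOn_le (g := id) (s := Icc x y) (fun _ h => h)
    refine this.trans ?_
    simp
  · rw [← h x y hx hxy hy]
    exact eVariationOn.edist_le f (left_mem_Icc.2 hxy) (right_mem_Icc.2 hxy)

/-- A curve of unit speed on every `[0, l']`, `l' < l`, and continuous at `l`. -/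
theorem of_forall_lt {f : ℝ → E} {l : ℝ} (h : ∀ l' < l, HasUnitSpeedOn f (Icc 0 l'))
    (hc : ContinuousWithinAt f (Iic l) l) : HasUnitSpeedOn f (Icc 0 l) := by
  rw [iff_le]
  intro x y hx hxy hy
  rcases hy.lt_or_eq with hy | rfl
  · exact iff_le.1 (h y hy) x y hx hxy le_rfl
  rcases hxy.eq_or_lt with rfl | hxy
  · simp [eVariationOn.subsingleton]
  -- Continuity at the end makes the last point irrelevant to the variation. The half-open interval
  -- is then exhausted by closed ones on which the speed is known.
  rw [← eVariationOn.eVariationOn_Ico_eq_Icc_of_continuousWithinAt hc]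
  apply le_antisymm
  · rw [eVariationOn.eq_biSup_inter_Icc]
    refine iSup₂_le fun p hp => ?_
    obtain ⟨hp1, hp2, hp3⟩ := hp
    rw [inter_eq_self_of_subset_right
      (show Icc p.1 p.2 ⊆ Ico x y from fun t ht => ⟨hp1.1.trans ht.1, ht.2.trans_lt hp2.2⟩),
      iff_le.1 (h p.2 hp2.2) _ _ (hx.trans hp1.1) hp3 le_rfl]
    exact ENNReal.ofReal_le_ofReal (by linarith [hp1.1, hp2.2])
  · refine ENNReal.le_of_forall_pos_le_add fun ε hε _ => ?_
    set z := max x (y - ε) with hz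
    have hzy : z < y := max_lt hxy (by linarith [NNReal.coe_pos.2 hε])
    have := iff_le.1 (h z hzy) x z hx (le_max_left _ _) le_rfl
    calc ENNReal.ofReal (y - x) ≤ ENNReal.ofReal ((z - x) + ε) :=
          ENNReal.ofReal_le_ofReal (by linarith [le_max_right x (y - ε)])
      _ ≤ ENNReal.ofReal (z - x) + ENNReal.ofReal ε := ENNReal.ofReal_add_le
      _ = eVariationOn f (Icc x z) + ε := by rw [this, ENNReal.ofReal_coe_nnreal]
      _ ≤ _ := by
        gcongr
        exact eVariationOn.mono f fun t ht => ⟨ht.1, ht.2.trans_lt hzy⟩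
end UnitSpeed

/-- The segment from `u` to `v` parametrized by arc length. -/
noncomputable def arcSegment (u v : ℂ) (t : ℝ) : ℂ := AffineMap.lineMap u v (t / ‖v - u‖)

theorem arcSegment_zero (u v : ℂ) : arcSegment u v 0 = u := by simp [arcSegment]
theorem arcSegment_end (u v : ℂ) : arcSegment u v ‖v - u‖ = v := by
  rcases eq_or_ne u v with rfl | h
  · simp [arcSegment]
  · have : ‖v - u‖ ≠ 0 := norm_ne_zero_iff.2 (sub_ne_zero.2 h.symm)
    simp [arcSegment, div_self this]

theorem arcSegment_unitSpeed (u v : ℂ) : HasUnitSpeedOn (arcSegment u v) (Icc 0 ‖v - u‖) := by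
  apply UnitSpeed.isometry_like
  intro x y hx hxy hy
  rcases eq_or_ne u v with rfl | h
  · simp only [sub_self, norm_zero] at hy
    have h1 : x = 0 := le_antisymm (hxy.trans hy) hx
    have h2 : y = 0 := le_antisymm hy (hx.trans hxy)
    simp [h1, h2]
  · have hn : 0 < ‖v - u‖ := norm_pos_iff.2 (sub_ne_zero.2 h.symm)
    rw [edist_dist]
    congr 1
    rw [arcSegment, arcSegment, dist_lineMap_lineMap, Real.dist_eq, ← sub_div, abs_div, abs_sub_comm,
      abs_of_nonneg (sub_nonneg.2 hxy), abs_of_pos hn, dist_eq_norm, norm_sub_rev u v]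
    field_simp

theorem arcSegment_eq (u v : ℂ) (t : ℝ) :
    arcSegment u v t = u + ((t / ‖v - u‖ : ℝ) : ℂ) * (v - u) := by
  rw [arcSegment, AffineMap.lineMap_apply]
  simp [add_comm]

theorem ENNReal.rpow_anti_of_nonpos {x y : ℝ≥0∞} {q : ℝ} (hq : q ≤ 0) (h : x ≤ y) :
    y ^ q ≤ x ^ q := by
  obtain ⟨r, rfl⟩ : ∃ r, q = -r := ⟨-q, by simp⟩
  rw [ENNReal.rpow_neg, ENNReal.rpow_neg]
  exact ENNReal.inv_le_inv.2 (ENNReal.rpow_le_rpow h (by linarith))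

theorem ENNReal.mul_rpow_of_nonpos {x : ℝ≥0∞} {ρ q : ℝ} (hq : q ≤ 0) (hρ : 0 < ρ) :
    (ENNReal.ofReal ρ * x) ^ q = ENNReal.ofReal (ρ ^ q) * x ^ q := by
  obtain ⟨r, rfl⟩ : ∃ r, q = -r := ⟨-q, by simp⟩
  have hr : 0 ≤ r := by linarith
  have h0 : ENNReal.ofReal ρ ^ r ≠ 0 := by
    rw [ENNReal.ofReal_rpow_of_pos hρ]
    exact (ENNReal.ofReal_pos.2 (Real.rpow_pos_of_pos hρ r)).ne'
  have h1 : ENNReal.ofReal ρ ^ r ≠ ∞ := ENNReal.rpow_ne_top_of_nonneg hr ENNReal.ofReal_ne_top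
  rw [ENNReal.rpow_neg, ENNReal.rpow_neg, ENNReal.mul_rpow_of_nonneg _ _ hr,
    ENNReal.mul_inv (Or.inl h0) (Or.inl h1), ← ENNReal.ofReal_rpow_of_pos hρ, ENNReal.rpow_neg]

theorem setLIntegral_comp_div {ρ : ℝ} (hρ : 0 < ρ) (L : ℝ) (F : ℝ → ℝ≥0∞) :
    ∫⁻ t in Icc 0 (ρ * L), F (t / ρ) = ENNReal.ofReal ρ * ∫⁻ t in Icc 0 L, F t := by
  have hemb : MeasurableEmbedding (fun t : ℝ => ρ * t) :=
    (Homeomorph.mulLeft₀ ρ hρ.ne').measurableEmbedding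
  have hv := Real.smul_map_volume_mul_left hρ.ne'
  rw [abs_of_pos hρ] at hv
  conv_lhs => rw [← hv]
  rw [Measure.restrict_smul, lintegral_smul_measure, hemb.restrict_map, hemb.lintegral_map]
  have hpre : (fun t => ρ * t) ⁻¹' Icc 0 (ρ * L) = Icc 0 L := by
    ext t
    simp only [mem_preimage, mem_Icc]
    constructor
    · rintro ⟨h1, h2⟩
      exact ⟨(mul_nonneg_iff_of_pos_left hρ).1 h1, (mul_le_mul_iff_right₀ hρ).1 h2⟩
    · rintro ⟨h1, h2⟩
      exact ⟨by positivity, by gcongr⟩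
  rw [hpre]
  congr 2
  funext t
  rw [mul_div_cancel_left₀ _ hρ.ne']

/-! ### Weighted length of curves in a set -/

/-- `x` and `y` are the ends of a unit speed curve of length `L` in `X` along which the integral
of `dist (·, Xᶜ) ^ (a - 1)` is at most `I`. -/
def Joins (a : ℝ) (X : Set ℂ) (x y : ℂ) (L : ℝ) (I : ℝ≥0∞) : Prop :=
  0 ≤ L ∧ ∃ γ : ℝ → ℂ, HasUnitSpeedOn γ (Icc 0 L) ∧ γ 0 = x ∧ γ L = y ∧
    (∀ t ∈ Icc 0 L, γ t ∈ X) ∧ ∫⁻ t in Icc 0 L, infEDist (γ t) Xᶜ ^ (a - 1) ≤ I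

/-- `x` and `y` can be joined in `X` by a curve of cost at most `I`. -/
def Conn (a : ℝ) (X : Set ℂ) (x y : ℂ) (I : ℝ) : Prop :=
  0 ≤ I ∧ ∃ L, Joins a X x y L (ENNReal.ofReal I)

namespace Joins
variable {a : ℝ} {X Y : Set ℂ} {x y z : ℂ} {L M : ℝ} {I J : ℝ≥0∞}

theorem refl (hx : x ∈ X) : Joins a X x x 0 0 := by
  refine ⟨le_rfl, fun _ => x, ?_, rfl, rfl, fun _ _ => hx, by simp⟩
  rw [Icc_self]
  exact hasConstantSpeedOnWith_of_subsingleton (fun _ => x) subsingleton_singleton 1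

theorem symm (h : Joins a X x y L I) : Joins a X y x L I := by
  obtain ⟨hL, γ, hγ, h0, h1, hX, hI⟩ := h
  refine ⟨hL, fun t => γ (L - t), UnitSpeed.reverse hγ, by simp [h1], by simp [h0],
    fun t ht => hX _ ⟨by linarith [ht.2], by linarith [ht.1]⟩, ?_⟩
  have hmp : MeasurePreserving (fun t : ℝ => L - t) volume volume :=
    Measure.measurePreserving_sub_left volume L
  have := hmp.setLIntegral_comp_emb (MeasurableEquiv.subLeft L).measurableEmbedding
    (fun t => infEDist (γ t) Xᶜ ^ (a - 1)) (Icc 0 L)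
  rw [this, Set.image_const_sub_Icc]
  simpa using hI

theorem trans (h : Joins a X x y L I) (h' : Joins a X y z M J) :
    Joins a X x z (L + M) (I + J) := by
  obtain ⟨hL, γ, hγ, h0, h1, hX, hI⟩ := h
  obtain ⟨hM, δ, hδ, k0, k1, kX, kI⟩ := h'
  have hglue : γ L = δ 0 := by rw [h1, k0]
  have key : ∀ t ∈ Icc L (L + M), (if t ≤ L then γ t else δ (t - L)) = δ (t - L) := by
    intro t ht
    rcases ht.1.eq_or_lt with rfl | h'
    · simp [hglue]
    · simp [not_le.2 h']
  refine ⟨by positivity, _, UnitSpeed.concat hγ hδ hglue, by simp [hL, h0], ?_, ?_, ?_⟩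
  · rw [key _ ⟨by linarith, le_rfl⟩]; simpa using k1
  · intro t ht
    rcases le_or_gt t L with h | h
    · simpa [h] using hX t ⟨ht.1, h⟩
    · rw [key t ⟨h.le, ht.2⟩]
      exact kX _ ⟨by linarith, by linarith [ht.2]⟩
  · have hsub : Icc 0 (L + M) ⊆ Icc 0 L ∪ Icc L (L + M) := by
      intro t ht
      rcases le_total t L with h | h
      · exact Or.inl ⟨ht.1, h⟩
      · exact Or.inr ⟨h, ht.2⟩
    refine (lintegral_mono_set hsub).trans ((lintegral_union_le _ _ _).trans ?_)
    gcongr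
    · refine le_trans (le_of_eq (setLIntegral_congr_fun measurableSet_Icc fun t ht => ?_)) hI
      simp [ht.2]
    · have h1 : ∫⁻ t in Icc L (L + M),
          infEDist (if t ≤ L then γ t else δ (t - L)) Xᶜ ^ (a - 1) =
          ∫⁻ t in Icc L (L + M), infEDist (δ (t - L)) Xᶜ ^ (a - 1) :=
        setLIntegral_congr_fun measurableSet_Icc fun t ht => by simp only [key t ht]
      have := (measurePreserving_sub_right volume L).setLIntegral_comp_emb
        (MeasurableEquiv.subRight L).measurableEmbedding
        (fun t => infEDist (δ t) Xᶜ ^ (a - 1)) (Icc L (L + M))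
      rw [h1, this, Set.image_sub_const_Icc]
      simpa using kI

theorem mono (h : Joins a X x y L I) (ha : a ≤ 1) (hXY : X ⊆ Y) (hIJ : I ≤ J) :
    Joins a Y x y L J := by
  obtain ⟨hL, γ, hγ, h0, h1, hX, hI⟩ := h
  refine ⟨hL, γ, hγ, h0, h1, fun t ht => hXY (hX t ht), le_trans ?_ (hI.trans hIJ)⟩
  exact lintegral_mono fun t => ENNReal.rpow_anti_of_nonpos (by linarith)
    (infEDist_anti (compl_subset_compl.2 hXY))

/-- Length gains the factor ρ and the weight the factor ρ ^ (a - 1), so cost gains ρ ^ a, which is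
how |x - y| ^ a behaves. This homogeneity underlies every self-similar estimate below. Surjectivity
makes the complement of the image the image of the complement, so distances to the complement scale
exactly. -/
theorem similar (h : Joins a X x y L I) (ha : a ≤ 1) {ρ : ℝ} (hρ : 0 < ρ) {φ : ℂ → ℂ}
    (hφ : ∀ x y, edist (φ x) (φ y) = ENNReal.ofReal ρ * edist x y)
    (hs : Function.Surjective φ) :
    Joins a (φ '' X) (φ x) (φ y) (ρ * L) (ENNReal.ofReal (ρ ^ a) * I) := by
  obtain ⟨hL, γ, hγ, h0, h1, hX, hI⟩ := h
  have hinj : Function.Injective φ := by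
    intro u v huv
    have h2 := hφ u v
    rw [huv, edist_self, eq_comm, mul_eq_zero] at h2
    rcases h2 with h2 | h2
    · exact absurd h2 (ENNReal.ofReal_pos.2 hρ).ne'
    · exact edist_eq_zero.1 h2
  refine ⟨by positivity, _, UnitSpeed.similar hρ hφ hγ, by simp [h0], ?_, ?_, ?_⟩
  · rw [mul_div_cancel_left₀ _ hρ.ne', h1]
  · intro t ht
    refine mem_image_of_mem φ (hX _ ⟨by have := ht.1; positivity, ?_⟩)
    rw [div_le_iff₀ hρ]; linarith [ht.2]
  · have hinf : ∀ u, infEDist (φ u) (φ '' X)ᶜ = ENNReal.ofReal ρ * infEDist u Xᶜ := by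
      intro u
      rw [← Set.image_compl_eq ⟨hinj, hs⟩]
      simp only [infEDist, iInf_image, hφ]
      rw [ENNReal.mul_iInf_of_ne (ENNReal.ofReal_pos.2 hρ).ne' ENNReal.ofReal_ne_top]
      congr 1
      funext v
      rw [ENNReal.mul_iInf_of_ne (ENNReal.ofReal_pos.2 hρ).ne' ENNReal.ofReal_ne_top]
    simp only [hinf]
    simp only [ENNReal.mul_rpow_of_nonpos (show a - 1 ≤ 0 by linarith) hρ]
    rw [lintegral_const_mul' _ _ ENNReal.ofReal_ne_top,
      setLIntegral_comp_div hρ L (fun t => infEDist (γ t) Xᶜ ^ (a - 1)), ← mul_assoc,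
      ← ENNReal.ofReal_mul (by positivity), ← Real.rpow_add_one hρ.ne']
    simp only [sub_add_cancel]
    gcongr

/-- Concatenation of infinitely many curves of summable length. -/
theorem infinite {x : ℕ → ℂ} {L : ℕ → ℝ} {I : ℕ → ℝ≥0∞}
    (h : ∀ k, Joins a X (x k) (x (k + 1)) (L k) (I k)) (hs : Summable L) {z : ℂ}
    (hz : Tendsto x atTop (𝓝 z)) (hzX : z ∈ X) :
    Joins a X (x 0) z (∑' k, L k) (∑' k, I k) := by
  choose hL γ hγ h0 h1 hX hI using h
  set t : ℕ → ℝ := fun n => ∑ k ∈ Finset.range n, L k with ht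
  have ht0 : t 0 = 0 := by simp [ht]
  have hts : ∀ n, t (n + 1) = t n + L n := fun n => by simp [ht, Finset.sum_range_succ]
  have htm : Monotone t := monotone_nat_of_le_succ fun n => by rw [hts]; linarith [hL n]
  have htn : ∀ n, 0 ≤ t n := fun n => ht0 ▸ htm (Nat.zero_le n)
  set l := ∑' k, L k with hl
  have htl : Tendsto t atTop (𝓝 l) := hs.hasSum.tendsto_sum_nat
  have htle : ∀ n, t n ≤ l := fun n => htm.ge_of_tendsto htl n
  have hl0 : 0 ≤ l := ht0 ▸ htle 0
  -- `G n` runs through the first n pieces and is meaningful up to time `t n`; later ones agree with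
  -- it there.
  let G : ℕ → ℝ → ℂ := fun n => Nat.rec (fun _ => x 0)
    (fun n Gn s => if s ≤ t n then Gn s else γ n (s - t n)) n
  have G0 : G 0 = fun _ => x 0 := rfl
  have Gs : ∀ n, G (n + 1) = fun s => if s ≤ t n then G n s else γ n (s - t n) := fun n => rfl
  have Gprop : ∀ n, HasUnitSpeedOn (G n) (Icc 0 (t n)) ∧ G n (t n) = x n ∧ G n 0 = x 0 ∧
      ∀ s ∈ Icc 0 (t n), G n s ∈ X := by
    intro n
    induction n with
    | zero =>
      rw [ht0, Icc_self]
      refine ⟨hasConstantSpeedOnWith_of_subsingleton _ subsingleton_singleton 1, rfl, rfl, ?_⟩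
      intro s _
      have := hX 0 0 (left_mem_Icc.2 (hL 0))
      rw [h0] at this
      exact this
    | succ n ih =>
      obtain ⟨i1, i2, i3, i4⟩ := ih
      have glue : G n (t n) = γ n 0 := by rw [i2, h0]
      rw [Gs, hts]
      refine ⟨UnitSpeed.concat i1 (hγ n) glue, ?_, by simp [htn n, i3], ?_⟩
      · rcases (hL n).eq_or_lt with h | h
        · have h3 := h1 n
          rw [← h] at h3
          simp [← h, glue, h3]
        · simp [h, h1]
      · intro s hs
        rcases le_or_gt s (t n) with h | h
        · simpa [h] using i4 s ⟨hs.1, h⟩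
        · simpa [not_le.2 h] using hX n (s - t n) ⟨by linarith, by linarith [hs.2]⟩
  have Gcons : ∀ n m, n ≤ m → ∀ s, s ≤ t n → G m s = G n s := by
    intro n m hnm s hsn
    induction m, hnm using Nat.le_induction with
    | base => rfl
    | succ m hm ih => rw [Gs]; simp [hsn.trans (htm hm), ih]
  classical
  -- The default value z matters only at s = l, when no partial sum of the lengths reaches l. If
  -- some partial sum does, the tail of the sequence is constant and its value is z by uniqueness of
  -- limits.
  let Γ : ℝ → ℂ := fun s => if h : ∃ n, s ≤ t n then G (Nat.find h) s else z
  have ΓG : ∀ n s, s ≤ t n → Γ s = G n s := by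
    intro n s hsn
    have hex : ∃ n, s ≤ t n := ⟨n, hsn⟩
    have : Γ s = G (Nat.find hex) s := dif_pos hex
    rw [this, Gcons _ n (Nat.find_min' hex hsn) s (Nat.find_spec hex)]
  have Γus : ∀ n, HasUnitSpeedOn Γ (Icc 0 (t n)) := fun n =>
    UnitSpeed.congr (Gprop n).1 fun s hs => (ΓG n s hs.2).symm
  have Γl : Γ l = z := by
    by_cases hex : ∃ n, l ≤ t n
    · obtain ⟨n, hn⟩ := hex
      refine tendsto_nhds_unique (tendsto_const_nhds.congr' ?_) hz
      filter_upwards [eventually_ge_atTop n] with m hm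
      have htm' : t m = l := le_antisymm (htle m) (hn.trans (htm hm))
      rw [ΓG m l htm'.ge, ← (Gprop m).2.1, htm']
    · exact dif_neg hex
  have Γmem : ∀ s ∈ Icc 0 l, Γ s ∈ X := by
    intro s hs
    by_cases hex : ∃ n, s ≤ t n
    · obtain ⟨n, hn⟩ := hex
      rw [ΓG n s hn]
      exact (Gprop n).2.2.2 s ⟨hs.1, hn⟩
    · have : Γ s = z := dif_neg hex
      rwa [this]
  refine ⟨hl0, Γ, ?_, ?_, Γl, Γmem, ?_⟩
  · by_cases hex : ∃ n, l ≤ t n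
    · obtain ⟨n, hn⟩ := hex
      exact UnitSpeed.mono (Γus n) hn
    · push Not at hex
      refine UnitSpeed.of_forall_lt (fun l' hl' => ?_) ?_
      · obtain ⟨n, hn⟩ := (htl.eventually (lt_mem_nhds hl')).exists
        exact UnitSpeed.mono (Γus n) hn.le
      · rw [ContinuousWithinAt, Γl, Metric.tendsto_nhds]
        intro ε hε
        obtain ⟨n, hn1, hn2⟩ := ((htl.eventually (lt_mem_nhds
          (show l - ε / 2 < l by linarith))).and (Metric.tendsto_nhds.1 hz (ε / 2)
            (by linarith))).exists
        have hmem : Ici (t n) ∈ 𝓝 l := Ici_mem_nhds (hex n)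
        filter_upwards [mem_nhdsWithin_of_mem_nhds hmem, self_mem_nhdsWithin] with s hs1 hs2
        rcases (show s ≤ l from hs2).eq_or_lt with rfl | hs2
        · rw [Γl]; simpa using hε
        · obtain ⟨m, hm⟩ := (htl.eventually (lt_mem_nhds hs2)).exists
          have hd := UnitSpeed.edist_le (Γus m) (htn n) hs1 hm.le
          rw [edist_dist, ENNReal.ofReal_le_ofReal_iff (sub_nonneg.2 hs1),
            ΓG n (t n) le_rfl, (Gprop n).2.1] at hd
          calc dist (Γ s) z ≤ dist (x n) (Γ s) + dist (x n) z := dist_triangle_left _ _ _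
            _ < ε := by linarith
  · rw [ΓG 0 0 ht0.ge, G0]
  -- The pieces cover everything except possibly the end point, which is a null set.
  · have hsub : Icc 0 l ⊆ (⋃ n, Icc (t n) (t (n + 1))) ∪ {l} := by
      intro s hs
      rcases hs.2.eq_or_lt with rfl | hs2
      · exact Or.inr rfl
      · left
        have hex : ∃ n, s ≤ t n := by
          obtain ⟨m, hm⟩ := (htl.eventually (lt_mem_nhds hs2)).exists
          exact ⟨m, hm.le⟩
        rw [mem_iUnion]
        rcases hfn : Nat.find hex with _ | k
        · have := Nat.find_spec hex
          rw [hfn, ht0] at this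
          exact ⟨0, by rw [ht0]; exact hs.1, this.trans (htn 1)⟩
        · have hk := Nat.find_min hex (m := k) (by lia)
          have := Nat.find_spec hex
          rw [hfn] at this
          exact ⟨k, (not_le.1 hk).le, this⟩
    refine (lintegral_mono_set hsub).trans ((lintegral_union_le _ _ _).trans ?_)
    rw [Measure.restrict_singleton]
    simp only [Real.volume_singleton, zero_smul, lintegral_zero_measure, add_zero]
    refine (lintegral_iUnion_le _ _).trans (ENNReal.tsum_le_tsum fun n => ?_)
    have key : ∀ s ∈ Icc (t n) (t (n + 1)), Γ s = γ n (s - t n) := by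
      intro s hs
      rw [ΓG (n + 1) s hs.2, Gs]
      rcases hs.1.eq_or_lt with rfl | h'
      · simp [(Gprop n).2.1, h0]
      · simp [not_le.2 h']
    have e1 : ∫⁻ s in Icc (t n) (t (n + 1)), infEDist (Γ s) Xᶜ ^ (a - 1) =
        ∫⁻ s in Icc (t n) (t (n + 1)), infEDist (γ n (s - t n)) Xᶜ ^ (a - 1) :=
      setLIntegral_congr_fun measurableSet_Icc fun s hs => by simp only [key s hs]
    have e2 := (measurePreserving_sub_right volume (t n)).setLIntegral_comp_emb
      (MeasurableEquiv.subRight (t n)).measurableEmbedding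
      (fun s => infEDist (γ n s) Xᶜ ^ (a - 1)) (Icc (t n) (t (n + 1)))
    rw [e1, e2, Set.image_sub_const_Icc, hts]
    simpa using hI n

/-- A segment along which the distance to the complement grows at least linearly. -/
theorem segment (ha : 0 < a) (ha1 : a ≤ 1) {u v : ℂ} {R κ : ℝ} (hR : 0 < R) (hκ : 0 ≤ κ)
    (hκ1 : κ < 1) (hu : u ∈ X)
    (hX : ∀ t : ℝ, 0 ≤ t → t ≤ 1 → t ≠ 0 →
      ball (u + t * (v - u)) (R * (κ + (1 - κ) * t)) ⊆ X) :
    Joins a X u v ‖v - u‖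
      (ENNReal.ofReal (‖v - u‖ / (1 - κ) * R ^ (a - 1) * ((1 - κ ^ a) / a))) := by
  rcases eq_or_ne u v with rfl | hne
  · have := Joins.refl (a := a) hu
    simpa using this
  have hn : 0 < ‖v - u‖ := norm_pos_iff.2 (sub_ne_zero.2 hne.symm)
  have hpos : ∀ t : ℝ, 0 < t → t ≤ 1 → 0 < R * (κ + (1 - κ) * t) := fun t ht _ => by
    have : 0 < 1 - κ := by linarith
    positivity
  refine ⟨hn.le, arcSegment u v, arcSegment_unitSpeed u v, arcSegment_zero u v,
    arcSegment_end u v, ?_, ?_⟩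
  · intro t ht
    rcases ht.1.eq_or_lt with rfl | h0
    · rwa [arcSegment_zero]
    · rw [arcSegment_eq]
      have ht1 : 0 < t / ‖v - u‖ := by positivity
      have ht2 : t / ‖v - u‖ ≤ 1 := (div_le_one hn).2 ht.2
      exact hX _ ht1.le ht2 ht1.ne' (mem_ball_self (hpos _ ht1 ht2))
  · set L := ‖v - u‖ with hL
    have hB : 0 < (1 - κ) / L := div_pos (by linarith) hn
    have bound : ∫⁻ t in Icc 0 L, infEDist (arcSegment u v t) Xᶜ ^ (a - 1) ≤
        ∫⁻ t in Icc 0 L, ENNReal.ofReal (R ^ (a - 1) * (κ + (1 - κ) / L * t) ^ (a - 1)) := by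
      -- At time 0 no ball is available, and for κ = 0 the integrand may be infinite there; the
      -- point is discarded as a null set.
      rw [← setLIntegral_congr Ioc_ae_eq_Icc, ← setLIntegral_congr Ioc_ae_eq_Icc]
      refine setLIntegral_mono' measurableSet_Ioc fun t ht => ?_
      have ht1 : 0 < t / L := div_pos ht.1 hn
      have ht2 : t / L ≤ 1 := (div_le_one hn).2 ht.2
      have hp := hpos _ ht1 ht2
      have hle : ENNReal.ofReal (R * (κ + (1 - κ) * (t / L))) ≤
          infEDist (arcSegment u v t) Xᶜ := by
        rw [le_infEDist]
        intro y hy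
        rw [edist_dist]
        refine ENNReal.ofReal_le_ofReal ?_
        by_contra hlt
        push Not at hlt
        rw [arcSegment_eq, dist_comm] at hlt
        exact hy (hX _ ht1.le ht2 ht1.ne' hlt)
      refine (ENNReal.rpow_anti_of_nonpos (by linarith) hle).trans (le_of_eq ?_)
      rw [ENNReal.ofReal_rpow_of_pos hp]
      have e : (1 - κ) * (t / L) = (1 - κ) / L * t := by ring
      rw [Real.mul_rpow hR.le (by rw [e]; have := ht.1; positivity), e]
    refine bound.trans (le_of_eq ?_)
    have hint : IntervalIntegrable (fun t => R ^ (a - 1) * (κ + (1 - κ) / L * t) ^ (a - 1))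
        volume 0 L := by
      refine IntervalIntegrable.const_mul ?_ _
      have h1 : IntervalIntegrable (fun x : ℝ => x ^ (a - 1)) volume κ 1 :=
        intervalIntegral.intervalIntegrable_rpow' (by linarith)
      have h2 := (h1.comp_add_left κ).comp_mul_left (c := (1 - κ) / L)
      have e1 : (κ - κ) / ((1 - κ) / L) = 0 := by simp
      have e2 : (1 - κ) / ((1 - κ) / L) = L := by
        have : 1 - κ ≠ 0 := by linarith
        field_simp
      rwa [e1, e2] at h2
    have hint' : IntegrableOn (fun t => R ^ (a - 1) * (κ + (1 - κ) / L * t) ^ (a - 1))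
        (Icc 0 L) volume := by
      rw [integrableOn_Icc_iff_integrableOn_Ioc]
      exact (intervalIntegrable_iff_integrableOn_Ioc_of_le hn.le).1 hint
    rw [← ofReal_integral_eq_lintegral_ofReal hint']
    · congr 1
      rw [integral_Icc_eq_integral_Ioc, ← intervalIntegral.integral_of_le hn.le,
        intervalIntegral.integral_const_mul,
        intervalIntegral.integral_comp_add_mul (fun x => x ^ (a - 1)) hB.ne',
        integral_rpow (Or.inl (by linarith))]
      have e2 : κ + (1 - κ) / L * L = 1 := by field_simp; ring
      rw [mul_zero, add_zero, e2, sub_add_cancel, Real.one_rpow, smul_eq_mul]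
      field_simp
    · refine (ae_restrict_iff' measurableSet_Icc).2 (Eventually.of_forall fun t ht => ?_)
      have h3 := ht.1
      have h4 : 0 ≤ κ + (1 - κ) / L * t := by positivity
      show 0 ≤ R ^ (a - 1) * (κ + (1 - κ) / L * t) ^ (a - 1)
      positivity
end Joins

/-- A segment staying at distance `R` from the complement. -/
theorem Joins.segment_const {a : ℝ} {X : Set ℂ} (ha1 : a ≤ 1) {u v : ℂ} {R : ℝ} (hR : 0 < R)
    (hX : ∀ t : ℝ, 0 ≤ t → t ≤ 1 → ball (u + t * (v - u)) R ⊆ X) :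
    Joins a X u v ‖v - u‖ (ENNReal.ofReal (‖v - u‖ * R ^ (a - 1))) := by
  have hX' : ∀ t ∈ Icc 0 ‖v - u‖, ball (arcSegment u v t) R ⊆ X := by
    intro t ht
    rw [arcSegment_eq]
    exact hX _ (div_nonneg ht.1 (norm_nonneg _)) (div_le_one_of_le₀ ht.2 (norm_nonneg _))
  refine ⟨norm_nonneg _, arcSegment u v, arcSegment_unitSpeed u v, arcSegment_zero u v,
    arcSegment_end u v, fun t ht => hX' t ht (mem_ball_self hR), ?_⟩
  have : ∀ t ∈ Icc 0 ‖v - u‖, infEDist (arcSegment u v t) Xᶜ ^ (a - 1) ≤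
      ENNReal.ofReal (R ^ (a - 1)) := by
    intro t ht
    rw [← ENNReal.ofReal_rpow_of_pos hR]
    refine ENNReal.rpow_anti_of_nonpos (by linarith) (le_infEDist.2 fun y hy => ?_)
    rw [edist_dist]
    refine ENNReal.ofReal_le_ofReal ?_
    by_contra hlt
    push Not at hlt
    rw [dist_comm] at hlt
    exact hy (hX' t ht hlt)
  refine (setLIntegral_mono' measurableSet_Icc this).trans (le_of_eq ?_)
  rw [setLIntegral_const, Real.volume_Icc, sub_zero, mul_comm, ENNReal.ofReal_mul (norm_nonneg _)]

/-- (1 - t)(u + κη) + t(v + η) is the point at parameter t displaced by (κ + (1 - κ)t)η. So the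
balls of radius κR at u and R at v interpolate linearly inside a convex set. For κ = 0 only the
point u itself is needed. -/
theorem Convex.ball_lineMap_subset {Q : Set ℂ} (hQ : Convex ℝ Q) {u v : ℂ} {R κ t : ℝ} (hκ : 0 ≤ κ)
    (hκ1 : κ < 1) (hu : ∀ η : ℂ, ‖η‖ < R → u + κ * η ∈ Q) (hv : ball v R ⊆ Q) (ht0 : 0 ≤ t)
    (ht1 : t ≤ 1) (ht : t ≠ 0) : ball (u + t * (v - u)) (R * (κ + (1 - κ) * t)) ⊆ Q := by
  intro p hp
  have hk1 : 0 < 1 - κ := by linarith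
  have ht' : 0 < t := lt_of_le_of_ne ht0 ht.symm
  have hk : 0 < κ + (1 - κ) * t := by positivity
  set k := κ + (1 - κ) * t with hkdef
  rw [mem_ball, dist_eq_norm] at hp
  set η : ℂ := (k : ℂ)⁻¹ * (p - (u + t * (v - u))) with hη
  have hkc : (k : ℂ) ≠ 0 := by exact_mod_cast hk.ne'
  have hηn : ‖η‖ < R := by
    rw [hη, norm_mul, norm_inv, Complex.norm_real, Real.norm_of_nonneg hk.le, inv_mul_lt_iff₀ hk]
    linarith
  have h1 := hQ (hu η hηn) (hv (show v + η ∈ ball v R by simpa [dist_eq_norm] using hηn))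
    (sub_nonneg.2 ht1) ht0 (by ring)
  convert h1 using 1
  have : p = u + t * (v - u) + k * η := by rw [hη]; field_simp; ring
  rw [this, hkdef]
  simp only [Complex.real_smul]
  push_cast
  ring

namespace Conn
variable {a : ℝ} {X Y : Set ℂ} {x y z : ℂ} {I J : ℝ}

theorem refl (hx : x ∈ X) : Conn a X x x 0 :=
  ⟨le_rfl, 0, by simpa using Joins.refl hx⟩

theorem symm (h : Conn a X x y I) : Conn a X y x I := ⟨h.1, _, h.2.choose_spec.symm⟩

theorem trans (h : Conn a X x y I) (h' : Conn a X y z J) : Conn a X x z (I + J) := by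
  obtain ⟨hI, L, hL⟩ := h
  obtain ⟨hJ, M, hM⟩ := h'
  refine ⟨add_nonneg hI hJ, L + M, ?_⟩
  rw [ENNReal.ofReal_add hI hJ]
  exact hL.trans hM

theorem mono (h : Conn a X x y I) (ha : a ≤ 1) (hXY : X ⊆ Y) (hIJ : I ≤ J) : Conn a Y x y J :=
  ⟨h.1.trans hIJ, _, h.2.choose_spec.mono ha hXY (ENNReal.ofReal_le_ofReal hIJ)⟩

theorem le (h : Conn a X x y I) (ha : a ≤ 1) (hIJ : I ≤ J) : Conn a X x y J :=
  h.mono ha Subset.rfl hIJ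

theorem similar (h : Conn a X x y I) (ha : a ≤ 1) {ρ : ℝ} (hρ : 0 < ρ) {φ : ℂ → ℂ}
    (hφ : ∀ x y, dist (φ x) (φ y) = ρ * dist x y) (hs : Function.Surjective φ)
    (hXY : φ '' X ⊆ Y) : Conn a Y (φ x) (φ y) (ρ ^ a * I) := by
  obtain ⟨hI, L, hL⟩ := h
  refine ⟨by positivity, ρ * L, ?_⟩
  rw [ENNReal.ofReal_mul (by positivity)]
  refine (hL.similar ha hρ (fun x y => ?_) hs).mono ha hXY le_rfl
  rw [edist_dist, edist_dist, hφ, ENNReal.ofReal_mul hρ.le]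

/-- Joining a point of a convex set to the center of a ball in it. -/
theorem of_convex {Q : Set ℂ} (ha : 0 < a) (ha1 : a ≤ 1) (hQ : Convex ℝ Q) (hQX : Q ⊆ X) {u v : ℂ}
    {R : ℝ} (hR : 0 < R) (hu : u ∈ Q) (hv : ball v R ⊆ Q) :
    Conn a X u v (‖v - u‖ * R ^ (a - 1) / a) := by
  refine ⟨by positivity, ‖v - u‖, ?_⟩
  have := Joins.segment (X := X) ha ha1 hR le_rfl one_pos (hQX hu) (v := v)
    fun t h0 h1 h2 => (hQ.ball_lineMap_subset (u := u) le_rfl one_pos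
      (by simpa using fun _ _ => hu) hv h0 h1 h2).trans hQX
  rw [Real.zero_rpow ha.ne'] at this
  refine this.mono ha1 Subset.rfl (ENNReal.ofReal_le_ofReal (le_of_eq ?_))
  ring

/-- Joining two points of a convex set which contains a ball. -/
theorem pair_convex {Q : Set ℂ} (ha : 0 < a) (ha1 : a ≤ 1) (hQ : Convex ℝ Q) (hQX : Q ⊆ X)
    {u v σ : ℂ} {R D μ : ℝ} (hR : 0 < R) (hu : u ∈ Q) (hv : v ∈ Q) (hσ : ball σ R ⊆ Q)
    (huD : ‖σ - u‖ ≤ D) (hvD : ‖σ - v‖ ≤ D) (hμ : 0 < μ) (hμ1 : μ ≤ 1) :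
    Conn a X u v (2 * ((‖v - u‖ / 2 + μ * D) * (μ * R) ^ (a - 1) / a)) := by
  -- The detour goes from the midpoint the fraction μ of the way to σ. There a ball of radius μR is
  -- available, at distance at most |u - v| / 2 + μD from both points. With μ proportional to |u -
  -- v| the cost becomes proportional to |u - v| ^ a.
  set m : ℂ := ((1 / 2 : ℝ) : ℂ) * u + ((1 / 2 : ℝ) : ℂ) * v with hm
  have hmQ : m ∈ Q := hQ hu hv (by norm_num) (by norm_num) (by norm_num)
  set p : ℂ := m + μ * (σ - m) with hp
  have hball : ball p (μ * R) ⊆ Q := by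
    have := hQ.ball_lineMap_subset (u := m) (κ := 0) (R := R) (t := μ) le_rfl one_pos
      (by simpa using fun _ _ => hmQ) hσ hμ.le hμ1 hμ.ne'
    simpa [hp, mul_comm] using this
  have hR' : 0 < μ * R := by positivity
  have est : ∀ w : ℂ, ‖σ - w‖ ≤ D → ‖m - w‖ ≤ ‖v - u‖ / 2 →
      ‖p - w‖ ≤ ‖v - u‖ / 2 + μ * D := by
    intro w h1 h2
    have e : p - w = ((1 - μ : ℝ) : ℂ) * (m - w) + (μ : ℂ) * (σ - w) := by
      rw [hp]; push_cast; ring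
    rw [e]
    refine (norm_add_le _ _).trans ?_
    rw [norm_mul, norm_mul, Complex.norm_real, Complex.norm_real, Real.norm_of_nonneg hμ.le,
      Real.norm_of_nonneg (by linarith)]
    have : (1 - μ) * ‖m - w‖ ≤ ‖v - u‖ / 2 := by nlinarith [norm_nonneg (m - w)]
    gcongr
  have hmu : ‖m - u‖ ≤ ‖v - u‖ / 2 := by
    have e : m - u = ((1 / 2 : ℝ) : ℂ) * (v - u) := by rw [hm]; push_cast; ring
    rw [e, norm_mul, Complex.norm_real]; norm_num; linarith
  have hmv : ‖m - v‖ ≤ ‖v - u‖ / 2 := by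
    have e : m - v = ((-(1 / 2) : ℝ) : ℂ) * (v - u) := by rw [hm]; push_cast; ring
    rw [e, norm_mul, Complex.norm_real]; norm_num; linarith
  have c1 := of_convex ha ha1 hQ hQX hR' hu hball
  have c2 := of_convex ha ha1 hQ hQX hR' hv hball
  refine (c1.trans c2.symm).le ha1 ?_
  have b1 := est u huD hmu
  have b2 := est v hvD hmv
  have h3 : 0 ≤ (μ * R) ^ (a - 1) / a := by positivity
  rw [mul_div_assoc, mul_div_assoc, mul_div_assoc, ← add_mul, ← mul_assoc]
  gcongr
  linarith
end Conn

/-! ### The generating triangle and its two similarities -/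

/-- Parameters of a Koch curve: the openings have relative width `g`, the peaks height `h`. -/
structure KochParam (g h : ℝ) : Prop where
  g_pos : 0 < g
  g_lt : g < 2 / 5
  h_pos : 0 < h
  sq : 4 * h ^ 2 = 1 - 2 * g

/-- The apex of the triangle over `[0, 1]`. -/
noncomputable def kochApex (h : ℝ) : ℂ := ⟨1 / 2, h⟩

/-- The similarity onto the left half. -/
noncomputable def kochL (h : ℝ) (z : ℂ) : ℂ := kochApex h * conj z

/-- The similarity onto the right half. -/
noncomputable def kochR (h : ℝ) (z : ℂ) : ℂ := kochApex h + conj (kochApex h * z)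

/-- The triangle with vertices `0`, `1` and the apex. -/
def kochT (h : ℝ) : Set ℂ :=
  {z | 0 ≤ z.im ∧ z.im ≤ 2 * h * z.re ∧ z.im ≤ 2 * h * (1 - z.re)}

/-- The opening between the two halves. -/
def kochM (g h : ℝ) : Set ℂ :=
  {z | 0 ≤ z.im ∧ g / 2 * z.im ≤ h * (z.re - (1 - g) / 2) ∧
    g / 2 * z.im ≤ h * ((1 + g) / 2 - z.re)}

section Maps
variable (h : ℝ) (z : ℂ)

@[simp] theorem kochApex_re : (kochApex h).re = 1 / 2 := rfl
@[simp] theorem kochApex_im : (kochApex h).im = h := rfl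
@[simp] theorem kochL_re : (kochL h z).re = z.re / 2 + h * z.im := by
  simp [kochL]; ring

@[simp] theorem kochL_im : (kochL h z).im = h * z.re - z.im / 2 := by
  simp [kochL]; ring

@[simp] theorem kochR_re : (kochR h z).re = (1 + z.re) / 2 - h * z.im := by
  simp [kochR]; ring

@[simp] theorem kochR_im : (kochR h z).im = h * (1 - z.re) - z.im / 2 := by
  simp [kochR]; ring

@[simp] theorem kochL_zero : kochL h 0 = 0 := by simp [kochL]
@[simp] theorem kochL_one : kochL h 1 = kochApex h := by simp [kochL]
@[simp] theorem kochR_zero : kochR h 0 = kochApex h := by simp [kochR]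
@[simp] theorem kochR_one : kochR h 1 = 1 := by
  apply Complex.ext <;> simp

theorem continuous_kochL : Continuous (kochL h) := by unfold kochL; fun_prop
theorem continuous_kochR : Continuous (kochR h) := by unfold kochR; fun_prop

theorem dist_kochL (z w : ℂ) : dist (kochL h z) (kochL h w) = ‖kochApex h‖ * dist z w := by
  rw [dist_eq_norm, dist_eq_norm, kochL, kochL, ← mul_sub, ← map_sub, norm_mul, RCLike.norm_conj]

theorem dist_kochR (z w : ℂ) : dist (kochR h z) (kochR h w) = ‖kochApex h‖ * dist z w := by
  rw [dist_eq_norm, dist_eq_norm, kochR, kochR, add_sub_add_left_eq_sub, ← map_sub, ← mul_sub,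
    RCLike.norm_conj, norm_mul]
end Maps

namespace KochParam
variable {g h : ℝ} (H : KochParam g h)
include H

omit H in
theorem apex_ne : kochApex h ≠ 0 := fun h0 => by
  have := congrArg Complex.re h0
  simp at this

/-- This is the point of 4h² = 1 - 2g. The maps of the second level have ratio (1 - g) / 2, so the
two of them that sit on the base leave a gap of width exactly g. -/
theorem norm_sq_apex : ‖kochApex h‖ ^ 2 = (1 - g) / 2 := by
  rw [← Complex.normSq_eq_norm_sq, Complex.normSq_apply]
  simp only [kochApex_re, kochApex_im]
  linarith [H.sq]

theorem apex_pos : 0 < ‖kochApex h‖ := norm_pos_iff.2 apex_ne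

theorem apex_lt_one : ‖kochApex h‖ < 1 := by
  have := H.norm_sq_apex
  nlinarith [H.apex_pos, H.g_pos]

theorem h_lt : h < 1 / 2 := by nlinarith [H.sq, H.g_pos, H.h_pos]

theorem lt_h : 1 / 5 < h := by nlinarith [H.sq, H.g_lt, H.h_pos]

theorem surjective_L : Function.Surjective (kochL h) := fun z => by
  refine ⟨conj (z / kochApex h), ?_⟩
  rw [kochL, Complex.conj_conj, mul_div_cancel₀ _ apex_ne]

theorem surjective_R : Function.Surjective (kochR h) := fun z => by
  refine ⟨conj (z - kochApex h) / kochApex h, ?_⟩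
  rw [kochR, mul_div_cancel₀ _ apex_ne, Complex.conj_conj]
  ring

theorem injective_L : Function.Injective (kochL h) := fun z w hzw => by
  have := dist_kochL h z w
  rw [hzw, dist_self, eq_comm, mul_eq_zero] at this
  exact dist_eq_zero.1 (this.resolve_left H.apex_pos.ne')

theorem injective_R : Function.Injective (kochR h) := fun z w hzw => by
  have := dist_kochR h z w
  rw [hzw, dist_self, eq_comm, mul_eq_zero] at this
  exact dist_eq_zero.1 (this.resolve_left H.apex_pos.ne')

/-- The similarity carries the base to the left leg, the left leg to the base and the right leg to
the left edge of the opening. The three inequalities of the triangle translate accordingly, and the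
inequality of the right leg at the image follows from them. -/
theorem L_mem_iff {w : ℂ} : w ∈ kochT h ↔
    kochL h w ∈ kochT h ∧ h * ((kochL h w).re - (1 - g) / 2) ≤ g / 2 * (kochL h w).im := by
  have h1 := H.sq
  have h2 := H.h_pos
  have h3 := H.g_pos
  have h4 := H.g_lt
  have e1 : h * (kochL h w).re - g / 2 * (kochL h w).im =
    (1 - g) / 2 * (h * w.re + w.im / 2) := by
    simp only [kochL_re, kochL_im]; linear_combination w.im / 4 * h1
  have e2 : 2 * h * (kochL h w).re - (kochL h w).im = (1 - g) * w.im := by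
    simp only [kochL_re, kochL_im]; linear_combination w.im / 2 * h1
  have hg : 0 < 1 - g := by linarith
  have e3 : h * (kochL h w).re - g / 2 * (kochL h w).im ≤ h * (1 - g) / 2 ↔
      h * w.re + w.im / 2 ≤ h := by
    rw [e1]; constructor <;> intro h <;> nlinarith
  have e4 : 0 ≤ 2 * h * (kochL h w).re - (kochL h w).im ↔ 0 ≤ w.im := by
    rw [e2]; constructor <;> intro h <;> nlinarith
  have e5 : 2 * h * (kochL h w).re + (kochL h w).im = 2 * h * w.re - g * w.im := by
    simp only [kochL_re, kochL_im]; linear_combination w.im / 2 * h1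
  simp only [kochT, mem_ofPred_eq]
  have e6 : 0 ≤ (kochL h w).im ↔ w.im ≤ 2 * h * w.re := by
    rw [kochL_im]; constructor <;> intro h <;> linarith
  constructor
  · rintro ⟨p1, p2, p3⟩
    refine ⟨⟨e6.2 p2, by linarith [e4.2 p1], ?_⟩, by linarith [e3.2 (by linarith)]⟩
    nlinarith
  · rintro ⟨⟨p1, p2, p3⟩, p4⟩
    refine ⟨e4.1 (by linarith), e6.1 p1, ?_⟩
    linarith [e3.1 (by linarith)]

omit H in
theorem reflect_LR (w : ℂ) : kochR h w = 1 - conj (kochL h (1 - conj w)) := by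
  apply Complex.ext
  · simp; ring
  · simp

theorem R_mem_iff {w : ℂ} : w ∈ kochT h ↔
    kochR h w ∈ kochT h ∧ h * ((1 + g) / 2 - (kochR h w).re) ≤ g / 2 * (kochR h w).im := by
  have hT : ∀ z : ℂ, z ∈ kochT h ↔ 1 - conj z ∈ kochT h := by
    intro z
    simp only [kochT, mem_ofPred_eq, Complex.sub_im, Complex.one_im, Complex.conj_im,
      Complex.sub_re, Complex.one_re, Complex.conj_re, zero_sub, neg_neg, sub_sub_cancel]
    tauto
  have := H.L_mem_iff (w := 1 - conj w)
  rw [← hT] at this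
  rw [this, reflect_LR w, ← hT]
  refine and_congr_right fun _ => ?_
  simp only [Complex.sub_im, Complex.one_im, Complex.conj_im,
      Complex.sub_re, Complex.one_re, Complex.conj_re, zero_sub, neg_neg]
  have : (1 + g) / 2 - (1 - (kochL h (1 - conj w)).re) =
    (kochL h (1 - conj w)).re - (1 - g) / 2 := by ring
  rw [this]

theorem image_L : kochL h '' kochT h =
    {z | z ∈ kochT h ∧ h * (z.re - (1 - g) / 2) ≤ g / 2 * z.im} := by
  ext z
  obtain ⟨w, rfl⟩ := H.surjective_L z
  rw [H.injective_L.mem_set_image]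
  exact H.L_mem_iff

theorem image_R : kochR h '' kochT h =
    {z | z ∈ kochT h ∧ h * ((1 + g) / 2 - z.re) ≤ g / 2 * z.im} := by
  ext z
  obtain ⟨w, rfl⟩ := H.surjective_R z
  rw [H.injective_R.mem_set_image]
  exact H.R_mem_iff

theorem mapsTo_L : MapsTo (kochL h) (kochT h) (kochT h) := fun _ hw => (H.L_mem_iff.1 hw).1

theorem mapsTo_R : MapsTo (kochR h) (kochT h) (kochT h) := fun _ hw => (H.R_mem_iff.1 hw).1

theorem M_subset : kochM g h ⊆ kochT h := by
  have h1 := H.sq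
  have h2 := H.h_pos
  have h3 := H.g_pos
  have h4 := H.g_lt
  have h5 := H.lt_h
  rintro z ⟨p1, p2, p3⟩
  have key : z.im * g ≤ g * h := by nlinarith
  have key : z.im ≤ h := by nlinarith
  refine ⟨p1, ?_, ?_⟩ <;> nlinarith

theorem T_eq : kochT h = kochL h '' kochT h ∪ kochM g h ∪ kochR h '' kochT h := by
  apply Subset.antisymm
  · intro z hz
    rw [H.image_L, H.image_R]
    rcases le_total (h * (z.re - (1 - g) / 2)) (g / 2 * z.im) with h1 | h1
    · exact Or.inl (Or.inl ⟨hz, h1⟩)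
    rcases le_total (h * ((1 + g) / 2 - z.re)) (g / 2 * z.im) with h2 | h2
    · exact Or.inr ⟨hz, h2⟩
    · exact Or.inl (Or.inr ⟨hz.1, h1, h2⟩)
  · rintro z ((hz | hz) | hz)
    · exact H.mapsTo_L.image_subset hz
    · exact H.M_subset hz
    · exact H.mapsTo_R.image_subset hz

theorem im_le_of_mem_T {z : ℂ} (hz : z ∈ kochT h) : z.im ≤ h := by
  have := H.h_pos
  nlinarith [hz.1, hz.2.1, hz.2.2]

theorem re_nonneg_of_mem_T {z : ℂ} (hz : z ∈ kochT h) : 0 ≤ z.re := by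
  have := H.h_pos
  nlinarith [hz.1, hz.2.1, hz.2.2]

theorem re_le_of_mem_T {z : ℂ} (hz : z ∈ kochT h) : z.re ≤ 1 := by
  have := H.h_pos
  nlinarith [hz.1, hz.2.1, hz.2.2]

/-- The edges of the opening meet only in the apex: adding the two edge inequalities forces height
h. -/
theorem inter_LR : kochL h '' kochT h ∩ kochR h '' kochT h ⊆ {kochApex h} := by
  rw [H.image_L, H.image_R]
  rintro z ⟨⟨hz, h1⟩, -, h2⟩
  have hh := H.h_pos
  have h3 := H.g_pos
  have h4 : h ≤ z.im := by nlinarith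
  have h5 : z.im = h := le_antisymm (H.im_le_of_mem_T hz) h4
  refine Complex.ext ?_ (by simpa using h5)
  simp only [kochApex_re]
  have := hz.2.1
  have := hz.2.2
  rw [h5] at *
  nlinarith

omit H in
theorem isClosed_T : IsClosed (kochT h) := by
  unfold kochT
  refine (isClosed_le continuous_const Complex.continuous_im).inter
    ((isClosed_le Complex.continuous_im (by fun_prop)).inter
      (isClosed_le Complex.continuous_im (by fun_prop)))

theorem isClosed_M : IsClosed (kochM g h) := by
  have h1 : IsClosed {z : ℂ | g / 2 * z.im ≤ h * (z.re - (1 - g) / 2)} :=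
    isClosed_le (by fun_prop) (by fun_prop)
  have h2 : IsClosed {z : ℂ | g / 2 * z.im ≤ h * ((1 + g) / 2 - z.re)} :=
    isClosed_le (by fun_prop) (by fun_prop)
  exact (isClosed_le continuous_const Complex.continuous_im).inter (h1.inter h2)

theorem dist_le_of_mem_T {z w : ℂ} (hz : z ∈ kochT h) (hw : w ∈ kochT h) : dist z w ≤ 2 := by
  have h1 := H.re_nonneg_of_mem_T hz
  have h2 := H.re_nonneg_of_mem_T hw
  have h3 := H.re_le_of_mem_T hz
  have h4 := H.re_le_of_mem_T hw
  have h5 := H.im_le_of_mem_T hz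
  have h6 := H.im_le_of_mem_T hw
  have h7 := hz.1
  have h8 := hw.1
  have := H.h_lt
  rw [dist_eq_norm]
  refine (Complex.norm_le_abs_re_add_abs_im _).trans ?_
  rw [Complex.sub_re, Complex.sub_im]
  have a1 : |z.re - w.re| ≤ 1 := abs_le.2 ⟨by linarith, by linarith⟩
  have a2 : |z.im - w.im| ≤ 1 := abs_le.2 ⟨by linarith, by linarith⟩
  linarith

theorem isCompact_T : IsCompact (kochT h) :=
  Metric.isCompact_of_isClosed_isBounded isClosed_T
    (Metric.isBounded_iff.2 ⟨2, fun _ hz _ hw => H.dist_le_of_mem_T hz hw⟩)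
end KochParam

/-! ### The Koch curve and its parametrization -/

/-- Polygonal approximations of the Koch curve. -/
noncomputable def kochPoly (h : ℝ) : ℕ → ℝ → ℂ
  | 0 => fun t => (t : ℂ)
  | n + 1 => fun t =>
      if t ≤ 1 / 2 then kochL h (kochPoly h n (2 * t)) else kochR h (kochPoly h n (2 * t - 1))

/-- The parametrized Koch curve on `[0, 1]`. -/
noncomputable def kochCurve (h : ℝ) (t : ℝ) : ℂ := limUnder atTop fun n => kochPoly h n t

/-- The Koch curve. -/
noncomputable def kochK (h : ℝ) : Set ℂ := kochCurve h '' Icc 0 1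

namespace KochParam
variable {g h : ℝ} (H : KochParam g h)
include H

theorem real_mem_T {t : ℝ} (ht : t ∈ Icc (0 : ℝ) 1) : (t : ℂ) ∈ kochT h := by
  have := H.h_pos
  have h1 := ht.1
  have h2 : 0 ≤ 1 - t := by linarith [ht.2]
  refine ⟨by simp, ?_, ?_⟩
  · simp only [Complex.ofReal_im, Complex.ofReal_re]; positivity
  · simp only [Complex.ofReal_im, Complex.ofReal_re]; positivity

theorem poly_props (n : ℕ) : kochPoly h n 0 = 0 ∧ kochPoly h n 1 = 1 ∧
    Continuous (kochPoly h n) ∧ ∀ t ∈ Icc (0 : ℝ) 1, kochPoly h n t ∈ kochT h := by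
  induction n with
  | zero => exact ⟨by simp [kochPoly], by simp [kochPoly], Complex.continuous_ofReal,
      fun t ht => H.real_mem_T ht⟩
  | succ n ih =>
    obtain ⟨i1, i2, i3, i4⟩ := ih
    refine ⟨by simp [kochPoly, i1], ?_, ?_, ?_⟩
    · have : ¬ (1 : ℝ) ≤ 1 / 2 := by norm_num
      have e : (2 : ℝ) * 1 - 1 = 1 := by norm_num
      simp only [kochPoly, this, if_false, e, i2, kochR_one]
    · refine Continuous.if_le ((continuous_kochL h).comp (i3.comp (by fun_prop)))
        ((continuous_kochR h).comp (i3.comp (by fun_prop))) continuous_id continuous_const ?_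
      intro t ht
      have ht : t = 1 / 2 := ht
      subst ht
      norm_num [i1, i2]
    · intro t ht
      simp only [kochPoly]
      split_ifs with h1
      · exact H.mapsTo_L (i4 _ ⟨by linarith [ht.1], by linarith⟩)
      · exact H.mapsTo_R (i4 _ ⟨by linarith, by linarith [ht.2]⟩)

/-- The approximations of levels n and n + 1 run through the same copies of the triangle under words
of length n, and these have diameter at most 2‖apex‖ ^ n. -/
theorem dist_poly (n : ℕ) : ∀ t ∈ Icc (0 : ℝ) 1,
    dist (kochPoly h n t) (kochPoly h (n + 1) t) ≤ 2 * ‖kochApex h‖ ^ n := by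
  induction n with
  | zero =>
    intro t ht
    simpa using H.dist_le_of_mem_T ((H.poly_props 0).2.2.2 t ht) ((H.poly_props 1).2.2.2 t ht)
  | succ n ih =>
    intro t ht
    have e1 : kochPoly h (n + 1) t = if t ≤ 1 / 2 then kochL h (kochPoly h n (2 * t)) else
      kochR h (kochPoly h n (2 * t - 1)) := rfl
    have e2 : kochPoly h (n + 1 + 1) t = if t ≤ 1 / 2 then kochL h (kochPoly h (n + 1) (2 * t)) else
      kochR h (kochPoly h (n + 1) (2 * t - 1)) := rfl
    rw [e1, e2]
    split_ifs with h1
    · rw [dist_kochL, pow_succ]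
      have := ih (2 * t) ⟨by linarith [ht.1], by linarith⟩
      nlinarith [H.apex_pos]
    · rw [dist_kochR, pow_succ]
      have := ih (2 * t - 1) ⟨by linarith, by linarith [ht.2]⟩
      nlinarith [H.apex_pos]

theorem tendsto_poly {t : ℝ} (ht : t ∈ Icc (0 : ℝ) 1) :
    Tendsto (fun n => kochPoly h n t) atTop (𝓝 (kochCurve h t)) :=
  (cauchySeq_of_le_geometric _ _ H.apex_lt_one fun n => H.dist_poly n t ht).tendsto_limUnder

theorem dist_poly_curve {t : ℝ} (ht : t ∈ Icc (0 : ℝ) 1) (n : ℕ) :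
    dist (kochPoly h n t) (kochCurve h t) ≤ 2 * ‖kochApex h‖ ^ n / (1 - ‖kochApex h‖) :=
  dist_le_of_le_geometric_of_tendsto _ _ H.apex_lt_one (fun n => H.dist_poly n t ht)
    (H.tendsto_poly ht) n

theorem continuousOn_curve : ContinuousOn (kochCurve h) (Icc 0 1) := by
  have : TendstoUniformlyOn (fun n => kochPoly h n) (kochCurve h) atTop (Icc 0 1) := by
    rw [Metric.tendstoUniformlyOn_iff]
    intro ε hε
    have hlim : Tendsto (fun n => 2 * ‖kochApex h‖ ^ n / (1 - ‖kochApex h‖)) atTop (𝓝 0) := by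
      have := (tendsto_pow_atTop_nhds_zero_of_lt_one (norm_nonneg (kochApex h))
        H.apex_lt_one).const_mul 2 |>.div_const (1 - ‖kochApex h‖)
      simpa using this
    filter_upwards [hlim.eventually (gt_mem_nhds hε)] with n hn t ht
    rw [dist_comm]
    exact (H.dist_poly_curve ht n).trans_lt hn
  exact this.continuousOn (Frequently.of_forall fun n => (H.poly_props n).2.2.1.continuousOn)

theorem curve_zero : kochCurve h 0 = 0 :=
  tendsto_nhds_unique (H.tendsto_poly (by simp))
    (tendsto_const_nhds.congr fun n => ((H.poly_props n).1).symm)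

theorem curve_one : kochCurve h 1 = 1 :=
  tendsto_nhds_unique (H.tendsto_poly (by simp))
    (tendsto_const_nhds.congr fun n => ((H.poly_props n).2.1).symm)

theorem curve_mem {t : ℝ} (ht : t ∈ Icc (0 : ℝ) 1) : kochCurve h t ∈ kochT h :=
  isClosed_T.mem_of_tendsto (H.tendsto_poly ht)
    (Eventually.of_forall fun n => (H.poly_props n).2.2.2 t ht)

theorem curve_L {t : ℝ} (ht : t ∈ Icc (0 : ℝ) 1) :
    kochCurve h (t / 2) = kochL h (kochCurve h t) := by
  have h1 : t / 2 ≤ 1 / 2 := by linarith [ht.2]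
  refine tendsto_nhds_unique ((H.tendsto_poly ⟨by linarith [ht.1], by linarith⟩).comp
    (tendsto_add_atTop_nat 1)) ?_
  refine (((continuous_kochL h).tendsto _).comp (H.tendsto_poly ht)).congr fun n => ?_
  simp only [Function.comp, kochPoly, h1, if_true]
  congr 2; ring

theorem curve_R {t : ℝ} (ht : t ∈ Icc (0 : ℝ) 1) :
    kochCurve h ((1 + t) / 2) = kochR h (kochCurve h t) := by
  rcases ht.1.eq_or_lt with rfl | h0
  · have := H.curve_L (t := 1) (by simp)
    rw [H.curve_one, kochL_one] at this
    rw [add_zero, this, H.curve_zero, kochR_zero]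
  have h1 : ¬ (1 + t) / 2 ≤ 1 / 2 := by linarith
  refine tendsto_nhds_unique ((H.tendsto_poly ⟨by linarith [ht.1], by linarith [ht.2]⟩).comp
    (tendsto_add_atTop_nat 1)) ?_
  refine (((continuous_kochR h).tendsto _).comp (H.tendsto_poly ht)).congr fun n => ?_
  simp only [Function.comp, kochPoly, h1, if_false]
  congr 2; ring

theorem curve_cases {t : ℝ} (ht : t ∈ Icc (0 : ℝ) 1) :
    (t ≤ 1 / 2 ∧ 2 * t ∈ Icc (0 : ℝ) 1 ∧ kochCurve h t = kochL h (kochCurve h (2 * t))) ∨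
    (1 / 2 ≤ t ∧ 2 * t - 1 ∈ Icc (0 : ℝ) 1 ∧
      kochCurve h t = kochR h (kochCurve h (2 * t - 1))) := by
  rcases le_total t (1 / 2) with h1 | h1
  · have h2 : 2 * t ∈ Icc (0 : ℝ) 1 := ⟨by linarith [ht.1], by linarith⟩
    refine Or.inl ⟨h1, h2, ?_⟩
    rw [← H.curve_L h2]; congr 1; ring
  · have h2 : 2 * t - 1 ∈ Icc (0 : ℝ) 1 := ⟨by linarith, by linarith [ht.2]⟩
    refine Or.inr ⟨h1, h2, ?_⟩
    rw [← H.curve_R h2]; congr 1; ring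

theorem K_eq : kochK h = kochL h '' kochK h ∪ kochR h '' kochK h := by
  apply Subset.antisymm
  · rintro _ ⟨t, ht, rfl⟩
    rcases H.curve_cases ht with ⟨-, h2, h3⟩ | ⟨-, h2, h3⟩
    · exact Or.inl ⟨_, mem_image_of_mem _ h2, h3.symm⟩
    · exact Or.inr ⟨_, mem_image_of_mem _ h2, h3.symm⟩
  · rintro _ (⟨_, ⟨t, ht, rfl⟩, rfl⟩ | ⟨_, ⟨t, ht, rfl⟩, rfl⟩)
    · exact ⟨t / 2, ⟨by linarith [ht.1], by linarith [ht.2]⟩, H.curve_L ht⟩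
    · exact ⟨(1 + t) / 2, ⟨by linarith [ht.1], by linarith [ht.2]⟩, H.curve_R ht⟩

theorem isCompact_K : IsCompact (kochK h) := isCompact_Icc.image_of_continuousOn H.continuousOn_curve

theorem K_subset : kochK h ⊆ kochT h := by
  rintro _ ⟨t, ht, rfl⟩
  exact H.curve_mem ht

theorem zero_mem_K : (0 : ℂ) ∈ kochK h := ⟨0, by simp, H.curve_zero⟩
theorem one_mem_K : (1 : ℂ) ∈ kochK h := ⟨1, by simp, H.curve_one⟩
theorem apex_mem_K : kochApex h ∈ kochK h := by
  rw [H.K_eq]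
  exact Or.inl ⟨1, H.one_mem_K, by simp⟩

theorem re_ge_of_mem_R {z : ℂ} (hz : z ∈ kochT h) : 1 / 2 ≤ (kochR h z).re := by
  have := H.h_pos
  have h1 := H.re_nonneg_of_mem_T hz
  have h2 : h * z.im ≤ h * (2 * h * z.re) := mul_le_mul_of_nonneg_left hz.2.1 this.le
  have h3 : h * h ≤ 1 / 4 := by nlinarith [H.h_lt]
  rw [kochR_re]
  nlinarith

theorem re_le_of_mem_L {z : ℂ} (hz : z ∈ kochT h) : (kochL h z).re ≤ 1 / 2 := by
  have := H.h_pos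
  have h1 := H.re_le_of_mem_T hz
  have h2 : h * z.im ≤ h * (2 * h * (1 - z.re)) := mul_le_mul_of_nonneg_left hz.2.2 this.le
  have h3 : h * h ≤ 1 / 4 := by nlinarith [H.h_lt]
  rw [kochL_re]
  nlinarith

/-- Points of the two halves are separated by the opening between them. -/
theorem separation_L {z w : ℂ} (hz : z ∈ kochL h '' kochT h) (hw : w ∈ kochR h '' kochT h) :
    g * dist z (kochApex h) ≤ dist z w := by
  obtain ⟨z, hz, rfl⟩ := hz
  rw [H.image_R] at hw
  have hw := hw.2
  have hsq := H.sq
  have hg := H.g_pos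
  have hg' := H.g_lt
  have hh := H.h_pos
  have hh1 := H.h_lt
  have hh2 := H.lt_h
  have hu : 0 ≤ 1 - z.re := by linarith [H.re_le_of_mem_T hz]
  have hy : z.im ≤ 2 * h * (1 - z.re) := hz.2.2
  have hy0 : 0 ≤ z.im := hz.1
  -- With λ = (1 - g) / 2, the vector (h, g / 2) is normal to the right edge of the opening and has
  -- length λ. The left point is at distance at least 2gλ(1 - z.re) from the line of that edge
  -- (`e2`), and w lies beyond the edge, so this also bounds |z - w| from below (`e3`). The distance
  -- to the apex is at most 2λ(1 - z.re) (`e4`).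
  have e1 : h * ((1 + g) / 2 - (kochL h z).re) - g / 2 * (kochL h z).im =
      h * (1 + g) / 2 * (1 - z.re) - (1 - 3 * g) / 4 * z.im := by
    rw [kochL_re, kochL_im]
    linear_combination (-z.im / 4) * hsq
  have hlam : ((1 - g) / 2) ^ 2 = h ^ 2 + (g / 2) ^ 2 := by linarith
  have hl2 : ((1 - g) / 2) ^ 2 ≤ h := by nlinarith
  have e2 : 2 * g * ((1 - g) / 2) ^ 2 * (1 - z.re) ≤
      h * ((1 + g) / 2 - (kochL h z).re) - g / 2 * (kochL h z).im := by
    rw [e1]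
    rcases le_total 0 (1 - 3 * g) with h3 | h3
    · have i1 : (1 - 3 * g) / 4 * z.im ≤ (1 - 3 * g) / 4 * (2 * h * (1 - z.re)) :=
        mul_le_mul_of_nonneg_left hy (by linarith)
      have i2 : 2 * g * ((1 - g) / 2) ^ 2 * (1 - z.re) ≤ 2 * g * h * (1 - z.re) := by gcongr
      nlinarith
    · have i1 : (1 - 3 * g) / 4 * z.im ≤ 0 := mul_nonpos_of_nonpos_of_nonneg (by linarith) hy0
      have i2 : 2 * g * ((1 - g) / 2) ^ 2 ≤ h * (1 + g) / 2 := by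
        have : ((1 - g) / 2) ^ 2 ≤ 1 / 8 := by nlinarith
        nlinarith
      have i3 := mul_le_mul_of_nonneg_right i2 hu
      linarith
  have e3 : h * (w.re - (kochL h z).re) + g / 2 * (w.im - (kochL h z).im) ≤
      (1 - g) / 2 * dist (kochL h z) w := by
    refine abs_le_of_sq_le_sq ?_ (by have := @dist_nonneg _ _ (kochL h z) w; nlinarith) |> (le_abs_self _).trans
    rw [mul_pow, dist_eq_norm, ← Complex.normSq_eq_norm_sq, Complex.normSq_apply, hlam,
      Complex.sub_re, Complex.sub_im]
    nlinarith [sq_nonneg (h * (w.im - (kochL h z).im) - g / 2 * (w.re - (kochL h z).re))]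
  have e4 : dist (kochL h z) (kochApex h) ≤ 2 * ((1 - g) / 2) * (1 - z.re) := by
    rw [← kochL_one, dist_kochL]
    refine (le_abs_self _).trans (abs_le_of_sq_le_sq ?_ (by nlinarith))
    rw [mul_pow, H.norm_sq_apex, dist_eq_norm, ← Complex.normSq_eq_norm_sq, Complex.normSq_apply,
      Complex.sub_re, Complex.sub_im, Complex.one_re, Complex.one_im, sub_zero]
    have i1 : z.im * z.im ≤ (2 * h * (1 - z.re)) * (2 * h * (1 - z.re)) :=
      mul_self_le_mul_self hy0 hy
    have i2 : (2 * h * (1 - z.re)) * (2 * h * (1 - z.re)) = (1 - 2 * g) * (1 - z.re) ^ 2 := by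
      rw [← hsq]; ring
    have i3 := mul_le_mul_of_nonneg_left (i1.trans_eq i2) (show 0 ≤ (1 - g) / 2 by linarith)
    nlinarith
  have h0 : 0 < (1 - g) / 2 := by linarith
  refine le_of_mul_le_mul_left ?_ h0
  have e5 := mul_le_mul_of_nonneg_left e4 (mul_pos hg h0).le
  nlinarith

theorem separation_R {z w : ℂ} (hz : z ∈ kochL h '' kochT h) (hw : w ∈ kochR h '' kochT h) :
    g * dist w (kochApex h) ≤ dist z w := by
  have hT : ∀ z : ℂ, z ∈ kochT h → 1 - conj z ∈ kochT h := by
    intro z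
    simp only [kochT, mem_ofPred_eq, Complex.sub_im, Complex.one_im, Complex.conj_im,
      Complex.sub_re, Complex.one_re, Complex.conj_re, zero_sub, neg_neg, sub_sub_cancel]
    tauto
  have hd : ∀ z w : ℂ, dist (1 - conj z) (1 - conj w) = dist z w := by
    intro z w
    rw [dist_eq_norm, dist_eq_norm, sub_sub_sub_cancel_left, ← map_sub, RCLike.norm_conj,
      norm_sub_rev]
  obtain ⟨z, hz, rfl⟩ := hz
  obtain ⟨w, hw, rfl⟩ := hw
  have e1 : 1 - conj (kochR h w) = kochL h (1 - conj w) := by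
    rw [reflect_LR]; simp
  have e2 : 1 - conj (kochL h z) = kochR h (1 - conj z) := by
    rw [reflect_LR]; simp
  have e3 : 1 - conj (kochApex h) = kochApex h := by
    apply Complex.ext
    · simp; norm_num
    · simp
  have := H.separation_L (mem_image_of_mem _ (hT w hw)) (mem_image_of_mem (kochR h) (hT z hz))
  rw [← e1, ← e2, hd, ← e3, hd, dist_comm (kochR h w) (kochL h z)] at this
  exact this
end KochParam

/-! ### The regions above and below the curve -/

/-- The images of the opening under words of length `n`. -/
def kochU (g h : ℝ) : ℕ → Set ℂ
  | 0 => kochM g h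
  | n + 1 => kochL h '' kochU g h n ∪ kochR h '' kochU g h n

/-- The Koch curve with the openings of the levels in `S`. -/
def kochLevels (g h : ℝ) (S : Set ℕ) : Set ℂ := kochK h ∪ ⋃ n ∈ S, kochU g h n

/-- The part of the triangle above the Koch curve. -/
def kochA (g h : ℝ) : Set ℂ := kochLevels g h {n | Odd n}

/-- The part of the triangle below the Koch curve. -/
def kochB (g h : ℝ) : Set ℂ := kochLevels g h {n | Even n}

namespace KochParam
variable {g h : ℝ} (H : KochParam g h)
include H

theorem U_subset_T (n : ℕ) : kochU g h n ⊆ kochT h := by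
  induction n with
  | zero => exact H.M_subset
  | succ n ih =>
    rintro _ (⟨z, hz, rfl⟩ | ⟨z, hz, rfl⟩)
    · exact H.mapsTo_L (ih hz)
    · exact H.mapsTo_R (ih hz)

theorem isCompact_M : IsCompact (kochM g h) :=
  H.isCompact_T.of_isClosed_subset H.isClosed_M H.M_subset

theorem isCompact_U (n : ℕ) : IsCompact (kochU g h n) := by
  induction n with
  | zero => exact H.isCompact_M
  | succ n ih => exact (ih.image (continuous_kochL h)).union (ih.image (continuous_kochR h))

theorem L_mem_K {z : ℂ} (hz : z ∈ kochK h) : kochL h z ∈ kochK h := by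
  rw [H.K_eq]; exact Or.inl (mem_image_of_mem _ hz)

theorem R_mem_K {z : ℂ} (hz : z ∈ kochK h) : kochR h z ∈ kochK h := by
  rw [H.K_eq]; exact Or.inr (mem_image_of_mem _ hz)

theorem of_L_mem_K {z : ℂ} (hz : z ∈ kochT h) (hK : kochL h z ∈ kochK h) : z ∈ kochK h := by
  rw [H.K_eq] at hK
  rcases hK with ⟨w, hw, e⟩ | ⟨w, hw, e⟩
  · rwa [← H.injective_L e]
  · have : kochL h z ∈ ({kochApex h} : Set ℂ) :=
      H.inter_LR ⟨mem_image_of_mem _ hz, ⟨w, H.K_subset hw, e⟩⟩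
    rw [mem_singleton_iff, ← kochL_one] at this
    rw [H.injective_L this]
    exact H.one_mem_K

theorem of_R_mem_K {z : ℂ} (hz : z ∈ kochT h) (hK : kochR h z ∈ kochK h) : z ∈ kochK h := by
  rw [H.K_eq] at hK
  rcases hK with ⟨w, hw, e⟩ | ⟨w, hw, e⟩
  · have : kochR h z ∈ ({kochApex h} : Set ℂ) :=
      H.inter_LR ⟨⟨w, H.K_subset hw, e⟩, mem_image_of_mem _ hz⟩
    rw [mem_singleton_iff, ← kochR_zero] at this
    rw [H.injective_R this]
    exact H.zero_mem_K
  · rwa [← H.injective_R e]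

theorem U_near_K (n : ℕ) : ∀ z ∈ kochU g h n, ∃ k ∈ kochK h, dist z k ≤ 2 * ‖kochApex h‖ ^ n := by
  induction n with
  | zero =>
    intro z hz
    exact ⟨0, H.zero_mem_K, by
      simpa using H.dist_le_of_mem_T (H.M_subset hz) (H.K_subset H.zero_mem_K)⟩
  | succ n ih =>
    rintro _ (⟨z, hz, rfl⟩ | ⟨z, hz, rfl⟩)
    · obtain ⟨k, hk, h1⟩ := ih z hz
      refine ⟨_, H.L_mem_K hk, ?_⟩
      rw [dist_kochL, pow_succ]
      nlinarith [H.apex_pos]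
    · obtain ⟨k, hk, h1⟩ := ih z hz
      refine ⟨_, H.R_mem_K hk, ?_⟩
      rw [dist_kochR, pow_succ]
      nlinarith [H.apex_pos]

theorem half_notMem_K : (1 / 2 : ℂ) ∉ kochK h := by
  intro hK
  rw [H.K_eq] at hK
  have hh := mul_pos H.h_pos H.g_pos
  have e : (1 / 2 : ℂ).re = 1 / 2 := by norm_num
  have e' : (1 / 2 : ℂ).im = 0 := by norm_num
  rcases hK with hK | hK
  · have := image_mono H.K_subset hK
    rw [H.image_L] at this
    have := this.2
    rw [e, e'] at this
    nlinarith
  · have := image_mono H.K_subset hK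
    rw [H.image_R] at this
    have := this.2
    rw [e, e'] at this
    nlinarith

theorem half_mem_M : (1 / 2 : ℂ) ∈ kochM g h := by
  have hh := mul_pos H.h_pos H.g_pos
  have e : (1 / 2 : ℂ).re = 1 / 2 := by norm_num
  have e' : (1 / 2 : ℂ).im = 0 := by norm_num
  refine ⟨by simp, ?_, ?_⟩ <;> rw [e, e'] <;> nlinarith

/-- The point 1/2 of the mouth is off the curve, and its images under words of length n come close
to every point of the curve. Hence points of the curve are limits of interior points of the domain.
-/
theorem K_near_U (n : ℕ) : ∀ k ∈ kochK h, ∃ z ∈ kochU g h n, z ∉ kochK h ∧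
    dist z k ≤ 2 * ‖kochApex h‖ ^ n := by
  induction n with
  | zero =>
    intro k hk
    exact ⟨1 / 2, H.half_mem_M, H.half_notMem_K, by
      simpa using H.dist_le_of_mem_T (H.M_subset H.half_mem_M) (H.K_subset hk)⟩
  | succ n ih =>
    intro k hk
    rw [H.K_eq] at hk
    rcases hk with ⟨k, hk, rfl⟩ | ⟨k, hk, rfl⟩
    · obtain ⟨z, hz, h1, h2⟩ := ih k hk
      refine ⟨_, Or.inl (mem_image_of_mem _ hz), fun h3 => h1 (H.of_L_mem_K (H.U_subset_T n hz) h3),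
        ?_⟩
      rw [dist_kochL, pow_succ]
      nlinarith [H.apex_pos]
    · obtain ⟨z, hz, h1, h2⟩ := ih k hk
      refine ⟨_, Or.inr (mem_image_of_mem _ hz), fun h3 => h1 (H.of_R_mem_K (H.U_subset_T n hz) h3),
        ?_⟩
      rw [dist_kochR, pow_succ]
      nlinarith [H.apex_pos]

theorem tendsto_apex_pow : Tendsto (fun n : ℕ => 2 * ‖kochApex h‖ ^ n) atTop (𝓝 0) := by
  simpa using (tendsto_pow_atTop_nhds_zero_of_lt_one (norm_nonneg (kochApex h))
    H.apex_lt_one).const_mul 2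

/-- Levels beyond N lie in a thin neighborhood of the curve, so near a point off the curve only
finitely many compact sets count. -/
theorem isClosed_levels (S : Set ℕ) : IsClosed (kochLevels g h S) := by
  refine isClosed_of_closure_subset fun z hz => ?_
  by_contra hzS
  have hK : z ∉ kochK h := fun h => hzS (Or.inl h)
  have hd : 0 < infDist z (kochK h) :=
    (H.isCompact_K.isClosed.notMem_iff_infDist_pos ⟨0, H.zero_mem_K⟩).1 hK
  obtain ⟨N, hN⟩ := eventually_atTop.1 (H.tendsto_apex_pow.eventually (gt_mem_nhds hd))
  set d := 2 * ‖kochApex h‖ ^ N with hd_def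
  have hsub : kochLevels g h S ⊆ (⋃ n ∈ S ∩ Iio N, kochU g h n) ∪ cthickening d (kochK h) := by
    rintro w (hw | hw)
    · exact Or.inr (self_subset_cthickening _ hw)
    · obtain ⟨n, hn, hw⟩ := mem_iUnion₂.1 hw
      rcases lt_or_ge n N with h1 | h1
      · exact Or.inl (mem_iUnion₂.2 ⟨n, ⟨hn, h1⟩, hw⟩)
      · obtain ⟨k, hk, h2⟩ := H.U_near_K n w hw
        refine Or.inr (mem_cthickening_of_dist_le w k d _ hk (h2.trans ?_))
        rw [hd_def]
        have := pow_le_pow_of_le_one (norm_nonneg (kochApex h)) H.apex_lt_one.le h1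
        linarith
  have hcl : IsClosed ((⋃ n ∈ S ∩ Iio N, kochU g h n) ∪ cthickening d (kochK h)) :=
    (((finite_Iio N).subset inter_subset_right).isClosed_biUnion
      fun n _ => (H.isCompact_U n).isClosed).union isClosed_cthickening
  rcases closure_minimal hsub hcl hz with h1 | h1
  · obtain ⟨n, hn, hw⟩ := mem_iUnion₂.1 h1
    exact hzS (Or.inr (mem_iUnion₂.2 ⟨n, hn.1, hw⟩))
  · rw [mem_cthickening_iff, ← ENNReal.ofReal_toReal (infEDist_ne_top ⟨0, H.zero_mem_K⟩)] at h1
    rw [ENNReal.ofReal_le_ofReal_iff (by positivity)] at h1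
    exact absurd (hN N le_rfl) (not_lt.2 h1)

theorem isClosed_A : IsClosed (kochA g h) := H.isClosed_levels _
theorem isClosed_B : IsClosed (kochB g h) := H.isClosed_levels _

omit H in
theorem K_subset_A : kochK h ⊆ kochA g h := subset_union_left
omit H in
theorem K_subset_B : kochK h ⊆ kochB g h := subset_union_left

theorem levels_subset_T (S : Set ℕ) : kochLevels g h S ⊆ kochT h :=
  union_subset H.K_subset (iUnion₂_subset fun n _ => H.U_subset_T n)

theorem A_subset_T : kochA g h ⊆ kochT h := H.levels_subset_T _
theorem B_subset_T : kochB g h ⊆ kochT h := H.levels_subset_T _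

/-- A similarity of the first level raises the level of an opening by one and thus switches parity:
it exchanges above and below. -/
theorem A_eq : kochA g h = kochL h '' kochB g h ∪ kochR h '' kochB g h := by
  apply Subset.antisymm
  · rintro z (hz | hz)
    · rw [H.K_eq] at hz
      exact hz.imp (fun h => image_mono K_subset_B h) (fun h => image_mono K_subset_B h)
    · obtain ⟨n, hn, hz⟩ := mem_iUnion₂.1 hz
      obtain ⟨k, rfl⟩ := hn
      refine hz.imp (fun h => image_mono ?_ h) (fun h => image_mono ?_ h) <;>
      exact fun w hw => Or.inr (mem_iUnion₂.2 ⟨2 * k, even_two_mul k, hw⟩)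
  · rintro _ (⟨z, hz | hz, rfl⟩ | ⟨z, hz | hz, rfl⟩)
    · exact Or.inl (H.L_mem_K hz)
    · obtain ⟨n, hn, hz⟩ := mem_iUnion₂.1 hz
      exact Or.inr (mem_iUnion₂.2 ⟨n + 1, Even.add_one hn, Or.inl (mem_image_of_mem _ hz)⟩)
    · exact Or.inl (H.R_mem_K hz)
    · obtain ⟨n, hn, hz⟩ := mem_iUnion₂.1 hz
      exact Or.inr (mem_iUnion₂.2 ⟨n + 1, Even.add_one hn, Or.inr (mem_image_of_mem _ hz)⟩)

theorem B_eq : kochB g h = kochM g h ∪ (kochL h '' kochA g h ∪ kochR h '' kochA g h) := by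
  apply Subset.antisymm
  · rintro z (hz | hz)
    · rw [H.K_eq] at hz
      exact Or.inr (hz.imp (fun h => image_mono K_subset_A h) (fun h => image_mono K_subset_A h))
    · obtain ⟨n, hn, hz⟩ := mem_iUnion₂.1 hz
      rcases n with _ | n
      · exact Or.inl hz
      · have hn : Odd n := by
          have : Even (n + 1) := hn
          rwa [Nat.even_add_one, Nat.not_even_iff_odd] at this
        refine Or.inr (hz.imp (fun h => image_mono ?_ h) (fun h => image_mono ?_ h)) <;>
        exact fun w hw => Or.inr (mem_iUnion₂.2 ⟨n, hn, hw⟩)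
  · rintro z (hz | ⟨z, hz | hz, rfl⟩ | ⟨z, hz | hz, rfl⟩)
    · exact Or.inr (mem_iUnion₂.2 ⟨0, Even.zero, hz⟩)
    · exact Or.inl (H.L_mem_K hz)
    · obtain ⟨n, hn, hz⟩ := mem_iUnion₂.1 hz
      exact Or.inr (mem_iUnion₂.2 ⟨n + 1, Odd.add_one hn, Or.inl (mem_image_of_mem _ hz)⟩)
    · exact Or.inl (H.R_mem_K hz)
    · obtain ⟨n, hn, hz⟩ := mem_iUnion₂.1 hz
      exact Or.inr (mem_iUnion₂.2 ⟨n + 1, Odd.add_one hn, Or.inr (mem_image_of_mem _ hz)⟩)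

theorem L_mem_base {w : ℂ} : (kochL h w).im = 0 ↔ w.im = 2 * h * w.re := by
  rw [kochL_im]; constructor <;> intro h <;> linarith

theorem R_mem_base {w : ℂ} : (kochR h w).im = 0 ↔ w.im = 2 * h * (1 - w.re) := by
  rw [kochR_im]; constructor <;> intro h <;> linarith

theorem of_L_mem_legs {w : ℂ} (hw : w ∈ kochT h) (hl : (kochL h w).im = 2 * h * (kochL h w).re ∨
    (kochL h w).im = 2 * h * (1 - (kochL h w).re)) : w.im = 0 := by
  have h1 := H.sq
  have h2 := H.h_pos
  have h3 := H.g_pos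
  have h4 := H.g_lt
  have h0 := hw.1
  have h5 := H.re_le_of_mem_T hw
  simp only [kochL_re, kochL_im] at hl
  rcases hl with hl | hl
  · have : (1 - g) * w.im = 0 := by linear_combination -hl - w.im / 2 * h1
    rcases mul_eq_zero.1 this with h6 | h6
    · linarith
    · exact h6
  · have : 2 * h * w.re - g * w.im = 2 * h := by linear_combination hl - w.im / 2 * h1
    nlinarith

theorem of_R_mem_legs {w : ℂ} (hw : w ∈ kochT h) (hl : (kochR h w).im = 2 * h * (kochR h w).re ∨
    (kochR h w).im = 2 * h * (1 - (kochR h w).re)) : w.im = 0 := by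
  have h1 := H.sq
  have h2 := H.h_pos
  have h3 := H.g_pos
  have h4 := H.g_lt
  have h0 := hw.1
  have h5 := H.re_nonneg_of_mem_T hw
  simp only [kochR_re, kochR_im] at hl
  rcases hl with hl | hl
  · have : 2 * h * w.re + g * w.im = 0 := by linear_combination -hl + w.im / 2 * h1
    nlinarith
  · have : (1 - g) * w.im = 0 := by linear_combination -hl - w.im / 2 * h1
    rcases mul_eq_zero.1 this with h6 | h6
    · linarith
    · exact h6

theorem eq_apex_of_mem_M {z : ℂ} (hz : z ∈ kochM g h)
    (hl : z.im = 2 * h * z.re ∨ z.im = 2 * h * (1 - z.re)) : z = kochApex h := by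
  obtain ⟨p1, p2, p3⟩ := hz
  have h1 := H.sq
  have h2 := H.h_pos
  have h3 := H.g_pos
  have h4 := H.g_lt
  have key : z.im ≤ h := by nlinarith
  have k2 : z.re = 1 / 2 ∧ z.im = h := by
    rcases hl with hl | hl
    · have : 1 / 2 ≤ z.re := by nlinarith
      have : z.im = h := by nlinarith
      exact ⟨by nlinarith, this⟩
    · have : z.re ≤ 1 / 2 := by nlinarith
      have : z.im = h := by nlinarith
      exact ⟨by nlinarith, this⟩
  exact Complex.ext k2.1 k2.2

/-- The similarities send the base into a leg and one leg into the base, so the two claims feed each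
other in the induction. It starts with the opening itself, which touches the legs only at the apex.
The consequence is that the part below the curve never leaves through the legs, nor the part above
through the base. -/
theorem U_boundary (n : ℕ) : ∀ z ∈ kochU g h n,
    (Even n → (z.im = 2 * h * z.re ∨ z.im = 2 * h * (1 - z.re)) → z ∈ kochK h) ∧
    (Odd n → z.im = 0 → z ∈ kochK h) := by
  induction n with
  | zero =>
    intro z hz
    refine ⟨fun _ hl => ?_, fun h0 => by simp at h0⟩
    rw [H.eq_apex_of_mem_M hz hl]
    exact H.apex_mem_K
  | succ n ih =>
    rintro _ (⟨z, hz, rfl⟩ | ⟨z, hz, rfl⟩)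
    · refine ⟨fun hn hl => H.L_mem_K ((ih z hz).2 ?_ (H.of_L_mem_legs (H.U_subset_T n hz) hl)),
        fun hn hl => H.L_mem_K ((ih z hz).1 ?_ (Or.inl (H.L_mem_base.1 hl)))⟩
      · simpa [Nat.even_add_one] using hn
      · simpa [Nat.odd_add_one] using hn
    · refine ⟨fun hn hl => H.R_mem_K ((ih z hz).2 ?_ (H.of_R_mem_legs (H.U_subset_T n hz) hl)),
        fun hn hl => H.R_mem_K ((ih z hz).1 ?_ (Or.inr (H.R_mem_base.1 hl)))⟩
      · simpa [Nat.even_add_one] using hn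
      · simpa [Nat.odd_add_one] using hn

theorem B_inter_legs {z : ℂ} (hz : z ∈ kochB g h)
    (hl : z.im = 2 * h * z.re ∨ z.im = 2 * h * (1 - z.re)) : z ∈ kochK h := by
  rcases hz with hz | hz
  · exact hz
  · obtain ⟨n, hn, hz⟩ := mem_iUnion₂.1 hz
    exact (H.U_boundary n z hz).1 hn hl

theorem A_inter_base {z : ℂ} (hz : z ∈ kochA g h) (hl : z.im = 0) : z ∈ kochK h := by
  rcases hz with hz | hz
  · exact hz
  · obtain ⟨n, hn, hz⟩ := mem_iUnion₂.1 hz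
    exact (H.U_boundary n z hz).2 hn hl

theorem leg_of_L_mem_M {w : ℂ} (hw : w ∈ kochT h) (hM : kochL h w ∈ kochM g h) :
    w.im = 2 * h * (1 - w.re) := by
  have h1 := H.sq
  have h4 := H.g_lt
  have h5 := (H.L_mem_iff.1 hw).2
  have h6 := hM.2.1
  have e1 : h * (kochL h w).re - g / 2 * (kochL h w).im =
    (1 - g) / 2 * (h * w.re + w.im / 2) := by
    simp only [kochL_re, kochL_im]; linear_combination w.im / 4 * h1
  have e2 : (1 - g) / 2 * (h * w.re + w.im / 2 - h) = 0 := by linarith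
  rcases mul_eq_zero.1 e2 with h7 | h7 <;> linarith

theorem leg_of_R_mem_M {w : ℂ} (hw : w ∈ kochT h) (hM : kochR h w ∈ kochM g h) :
    w.im = 2 * h * w.re := by
  have h1 := H.sq
  have h4 := H.g_lt
  have h5 := (H.R_mem_iff.1 hw).2
  have h6 := hM.2.2
  have e1 : h * (kochR h w).re + g / 2 * (kochR h w).im =
    h * (1 + g) / 2 + (1 - g) / 2 * (h * w.re - w.im / 2) := by
    simp only [kochR_re, kochR_im]; linear_combination -w.im / 4 * h1
  have e2 : (1 - g) / 2 * (h * w.re - w.im / 2) = 0 := by linarith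
  rcases mul_eq_zero.1 e2 with h7 | h7 <;> linarith

/-- Common first letters are stripped until either the first letters differ, so that only the apex
is shared, or one of the openings is `kochM`. In the second case the other one touches it along the
image of a leg, and `U_boundary` applies to its preimage. -/
theorem U_inter_U (m : ℕ) : ∀ n, Even m → Odd n →
    (kochU g h m ∩ kochU g h n ⊆ kochK h) := by
  have key : ∀ n, Odd n → kochM g h ∩ kochU g h n ⊆ kochK h := by
    rintro n hn z ⟨h1, h2⟩
    rcases n with _ | n
    · simp at hn
    have hn : Even n := by simpa [Nat.odd_add_one] using hn
    rcases h2 with ⟨w, hw, rfl⟩ | ⟨w, hw, rfl⟩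
    · exact H.L_mem_K ((H.U_boundary n w hw).1 hn (Or.inr (H.leg_of_L_mem_M (H.U_subset_T n hw) h1)))
    · exact H.R_mem_K ((H.U_boundary n w hw).1 hn (Or.inl (H.leg_of_R_mem_M (H.U_subset_T n hw) h1)))
  have main : ∀ m n, ((Even m ∧ Odd n) ∨ (Odd m ∧ Even n)) →
      kochU g h m ∩ kochU g h n ⊆ kochK h := by
    intro m
    induction m with
    | zero =>
      rintro n (⟨-, hn⟩ | ⟨hn, -⟩)
      · exact key n hn
      · simp at hn
    | succ m ih =>
      rintro n hmn z ⟨h1, h2⟩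
      rcases n with _ | n
      · rcases hmn with ⟨-, hn⟩ | ⟨hm, -⟩
        · simp at hn
        · exact key _ hm ⟨h2, h1⟩
      have hmn' : (Even m ∧ Odd n) ∨ (Odd m ∧ Even n) := by
        simpa [Nat.even_add_one, Nat.odd_add_one, or_comm] using hmn
      rcases h1 with ⟨w, hw, rfl⟩ | ⟨w, hw, rfl⟩ <;> rcases h2 with ⟨v, hv, e⟩ | ⟨v, hv, e⟩
      · rw [H.injective_L e] at hv
        exact H.L_mem_K (ih n hmn' ⟨hw, hv⟩)
      · rw [show kochL h w = kochApex h from H.inter_LR ⟨mem_image_of_mem _ (H.U_subset_T m hw),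
          ⟨v, H.U_subset_T n hv, e⟩⟩]
        exact H.apex_mem_K
      · rw [show kochR h w = kochApex h from H.inter_LR ⟨⟨v, H.U_subset_T n hv, e⟩,
          mem_image_of_mem _ (H.U_subset_T m hw)⟩]
        exact H.apex_mem_K
      · rw [H.injective_R e] at hv
        exact H.R_mem_K (ih n hmn' ⟨hw, hv⟩)
  exact fun n hm hn => main m n (Or.inl ⟨hm, hn⟩)

theorem A_inter_B : kochA g h ∩ kochB g h = kochK h := by
  apply Subset.antisymm
  · rintro z ⟨hA | hA, hB | hB⟩
    · exact hA
    · exact hA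
    · exact hB
    · obtain ⟨n, hn, h1⟩ := mem_iUnion₂.1 hA
      obtain ⟨m, hm, h2⟩ := mem_iUnion₂.1 hB
      exact H.U_inter_U m n hm hn ⟨h2, h1⟩
  · exact subset_inter K_subset_A K_subset_B

/-- A point in no opening lies, for every n, in a copy of the triangle under a word of length n. The
diameters tend to 0 and each copy meets the curve. -/
theorem A_union_B : kochA g h ∪ kochB g h = kochT h := by
  refine Subset.antisymm (union_subset H.A_subset_T H.B_subset_T) fun z hz => ?_
  have key : ∀ n : ℕ, ∀ z ∈ kochT h, (∃ m, z ∈ kochU g h m) ∨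
      ∃ k ∈ kochK h, dist z k ≤ 2 * ‖kochApex h‖ ^ n := by
    intro n
    induction n with
    | zero => exact fun z hz => Or.inr ⟨0, H.zero_mem_K, by
        simpa using H.dist_le_of_mem_T hz (H.K_subset H.zero_mem_K)⟩
    | succ n ih =>
      intro z hz
      rw [H.T_eq] at hz
      rcases hz with (⟨w, hw, rfl⟩ | hz) | ⟨w, hw, rfl⟩
      · rcases ih w hw with ⟨m, hm⟩ | ⟨k, hk, hd⟩
        · exact Or.inl ⟨m + 1, Or.inl (mem_image_of_mem _ hm)⟩
        · refine Or.inr ⟨_, H.L_mem_K hk, ?_⟩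
          rw [dist_kochL, pow_succ]
          nlinarith [H.apex_pos]
      · exact Or.inl ⟨0, hz⟩
      · rcases ih w hw with ⟨m, hm⟩ | ⟨k, hk, hd⟩
        · exact Or.inl ⟨m + 1, Or.inr (mem_image_of_mem _ hm)⟩
        · refine Or.inr ⟨_, H.R_mem_K hk, ?_⟩
          rw [dist_kochR, pow_succ]
          nlinarith [H.apex_pos]
  by_cases hU : ∃ m, z ∈ kochU g h m
  · obtain ⟨m, hm⟩ := hU
    rcases Nat.even_or_odd m with h1 | h1
    · exact Or.inr (Or.inr (mem_iUnion₂.2 ⟨m, h1, hm⟩))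
    · exact Or.inl (Or.inr (mem_iUnion₂.2 ⟨m, h1, hm⟩))
  · refine Or.inl (Or.inl ?_)
    have hcl := H.isCompact_K.isClosed
    rw [hcl.mem_iff_infDist_zero ⟨0, H.zero_mem_K⟩]
    refine le_antisymm (ge_of_tendsto' H.tendsto_apex_pow fun n => ?_) infDist_nonneg
    obtain ⟨k, hk, hd⟩ := (key n z hz).resolve_left hU
    exact (infDist_le_dist_of_mem hk).trans hd

theorem LL_mem {z : ℂ} (hz : z ∈ kochB g h) : kochL h (kochL h z) ∈ kochB g h := by
  rw [H.B_eq, H.A_eq]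
  exact Or.inr (Or.inl (mem_image_of_mem _ (Or.inl (mem_image_of_mem _ hz))))

theorem LR_mem {z : ℂ} (hz : z ∈ kochB g h) : kochL h (kochR h z) ∈ kochB g h := by
  rw [H.B_eq, H.A_eq]
  exact Or.inr (Or.inl (mem_image_of_mem _ (Or.inr (mem_image_of_mem _ hz))))

theorem RL_mem {z : ℂ} (hz : z ∈ kochB g h) : kochR h (kochL h z) ∈ kochB g h := by
  rw [H.B_eq, H.A_eq]
  exact Or.inr (Or.inr (mem_image_of_mem _ (Or.inl (mem_image_of_mem _ hz))))

theorem RR_mem {z : ℂ} (hz : z ∈ kochB g h) : kochR h (kochR h z) ∈ kochB g h := by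
  rw [H.B_eq, H.A_eq]
  exact Or.inr (Or.inr (mem_image_of_mem _ (Or.inr (mem_image_of_mem _ hz))))
end KochParam

/-! ### Hölder continuity of the inverse parametrization and dimension -/

/-- The Hölder exponent of the inverse of the parametrization. -/
noncomputable def kochExp (h : ℝ) : ℝ := -Real.logb 2 ‖kochApex h‖

namespace KochParam
variable {g h : ℝ} (H : KochParam g h)
include H

theorem exp_pos : 0 < kochExp h :=
  neg_pos.2 (Real.logb_neg one_lt_two H.apex_pos H.apex_lt_one)

theorem apex_mul_two_rpow {t : ℝ} (ht : 0 ≤ t) :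
    ‖kochApex h‖ * (2 * t) ^ kochExp h = t ^ kochExp h := by
  rw [Real.mul_rpow zero_le_two ht, ← mul_assoc, kochExp, Real.rpow_neg zero_le_two,
    Real.rpow_logb two_pos (by norm_num) H.apex_pos, mul_inv_cancel₀ H.apex_pos.ne', one_mul]

/-- Halving the parameter multiplies the modulus by ‖apex‖ = 2 ^ (-`kochExp h`), so t can be doubled
until it is at least 1/2. There the curve is in the right half, where the real part is at least 1/2.
-/
theorem norm_curve_ge {t : ℝ} (ht : t ∈ Icc (0 : ℝ) 1) :
    1 / 2 * t ^ kochExp h ≤ ‖kochCurve h t‖ := by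
  have key : ∀ n : ℕ, ∀ t ∈ Icc (0 : ℝ) 1, (1 / 2) ^ n ≤ t →
      1 / 2 * t ^ kochExp h ≤ ‖kochCurve h t‖ := by
    intro n
    have hbig : ∀ t ∈ Icc (0 : ℝ) 1, 1 / 2 ≤ t → 1 / 2 * t ^ kochExp h ≤ ‖kochCurve h t‖ := by
      intro t ht h1
      have h2 : 2 * t - 1 ∈ Icc (0 : ℝ) 1 := ⟨by linarith, by linarith [ht.2]⟩
      have e : kochCurve h t = kochR h (kochCurve h (2 * t - 1)) := by
        rw [← H.curve_R h2]; congr 1; ring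
      have h3 := H.re_ge_of_mem_R (H.curve_mem h2)
      rw [← e] at h3
      have h4 := (le_abs_self _).trans (Complex.abs_re_le_norm (kochCurve h t))
      have h5 := Real.rpow_le_one ht.1 ht.2 H.exp_pos.le
      linarith
    induction n with
    | zero => exact fun t ht h1 => hbig t ht (by norm_num at h1; linarith)
    | succ n ih =>
      intro t ht h1
      rcases le_total (1 / 2) t with h2 | h2
      · exact hbig t ht h2
      · have h3 : 2 * t ∈ Icc (0 : ℝ) 1 := ⟨by linarith [ht.1], by linarith⟩
        have e : kochCurve h t = kochL h (kochCurve h (2 * t)) := by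
          rw [← H.curve_L h3]; congr 1; ring
        have h4 := ih (2 * t) h3 (by rw [pow_succ] at h1; linarith)
        have h5 := dist_kochL h (kochCurve h (2 * t)) 0
        rw [kochL_zero, dist_zero_right, dist_zero_right] at h5
        rw [e, h5, ← H.apex_mul_two_rpow ht.1]
        nlinarith [H.apex_pos]
  rcases ht.1.eq_or_lt with rfl | h0
  · rw [Real.zero_rpow H.exp_pos.ne', mul_zero]; exact norm_nonneg _
  · obtain ⟨n, hn⟩ := exists_pow_lt_of_lt_one h0 (by norm_num : (1 / 2 : ℝ) < 1)
    exact key n t ht hn.le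

theorem dist_curve_one_ge {t : ℝ} (ht : t ∈ Icc (0 : ℝ) 1) :
    1 / 2 * (1 - t) ^ kochExp h ≤ dist (kochCurve h t) 1 := by
  have key : ∀ n : ℕ, ∀ t ∈ Icc (0 : ℝ) 1, (1 / 2) ^ n ≤ 1 - t →
      1 / 2 * (1 - t) ^ kochExp h ≤ dist (kochCurve h t) 1 := by
    intro n
    have hbig : ∀ t ∈ Icc (0 : ℝ) 1, t ≤ 1 / 2 →
        1 / 2 * (1 - t) ^ kochExp h ≤ dist (kochCurve h t) 1 := by
      intro t ht h1
      have h2 : 2 * t ∈ Icc (0 : ℝ) 1 := ⟨by linarith [ht.1], by linarith⟩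
      have e : kochCurve h t = kochL h (kochCurve h (2 * t)) := by
        rw [← H.curve_L h2]; congr 1; ring
      have h3 := H.re_le_of_mem_L (H.curve_mem h2)
      rw [← e] at h3
      have h4 := (neg_le_abs _).trans (Complex.abs_re_le_norm (kochCurve h t - 1))
      rw [Complex.sub_re, Complex.one_re] at h4
      have h5 := Real.rpow_le_one (sub_nonneg.2 ht.2) (by linarith [ht.1]) H.exp_pos.le
      rw [dist_eq_norm]
      linarith
    induction n with
    | zero => exact fun t ht h1 => hbig t ht (by norm_num at h1; linarith)
    | succ n ih =>
      intro t ht h1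
      rcases le_total t (1 / 2) with h2 | h2
      · exact hbig t ht h2
      · have h3 : 2 * t - 1 ∈ Icc (0 : ℝ) 1 := ⟨by linarith, by linarith [ht.2]⟩
        have e : kochCurve h t = kochR h (kochCurve h (2 * t - 1)) := by
          rw [← H.curve_R h3]; congr 1; ring
        have h4 := ih (2 * t - 1) h3 (by rw [pow_succ] at h1; linarith)
        have h5 := dist_kochR h (kochCurve h (2 * t - 1)) 1
        rw [kochR_one] at h5
        rw [e, h5, ← H.apex_mul_two_rpow (sub_nonneg.2 ht.2),
          show 2 * (1 - t) = 1 - (2 * t - 1) by ring]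
        nlinarith [H.apex_pos]
  rcases ht.2.eq_or_lt with rfl | h0
  · rw [sub_self, Real.zero_rpow H.exp_pos.ne', mul_zero]; exact dist_nonneg
  · obtain ⟨n, hn⟩ := exists_pow_lt_of_lt_one (sub_pos.2 h0) (by norm_num : (1 / 2 : ℝ) < 1)
    exact key n t ht hn.le

/-- Doubling the parameters reduces to the case in which they lie on different sides of 1/2. Then (1
- 2t) + (2t' - 1) = 2(t' - t), so one of the two summands is at least t' - t. The corresponding
point is far from the apex, and the separation lemma turns this into a bound for the distance of the
two points. -/
theorem dist_curve_ge {t t' : ℝ} (ht : t ∈ Icc (0 : ℝ) 1) (ht' : t' ∈ Icc (0 : ℝ) 1)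
    (hlt : t < t') :
    g * ‖kochApex h‖ / 2 * (t' - t) ^ kochExp h ≤ dist (kochCurve h t) (kochCurve h t') := by
  have hs := H.apex_pos
  have hg := H.g_pos
  have hsep : ∀ t ∈ Icc (0 : ℝ) 1, ∀ t' ∈ Icc (0 : ℝ) 1, t ≤ 1 / 2 → 1 / 2 ≤ t' →
      g * ‖kochApex h‖ / 2 * (t' - t) ^ kochExp h ≤ dist (kochCurve h t) (kochCurve h t') := by
    intro t ht t' ht' h1 h2
    have m1 : 2 * t ∈ Icc (0 : ℝ) 1 := ⟨by linarith [ht.1], by linarith⟩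
    have m2 : 2 * t' - 1 ∈ Icc (0 : ℝ) 1 := ⟨by linarith, by linarith [ht'.2]⟩
    have e1 : kochCurve h t = kochL h (kochCurve h (2 * t)) := by
      rw [← H.curve_L m1]; congr 1; ring
    have e2 : kochCurve h t' = kochR h (kochCurve h (2 * t' - 1)) := by
      rw [← H.curve_R m2]; congr 1; ring
    have q1 : kochCurve h t ∈ kochL h '' kochT h := ⟨_, H.curve_mem m1, e1.symm⟩
    have q2 : kochCurve h t' ∈ kochR h '' kochT h := ⟨_, H.curve_mem m2, e2.symm⟩
    have s1 := H.separation_L q1 q2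
    have s2 := H.separation_R q1 q2
    have d1 := dist_kochL h (kochCurve h (2 * t)) 1
    have d2 := dist_kochR h (kochCurve h (2 * t' - 1)) 0
    rw [kochL_one, ← e1] at d1
    rw [kochR_zero, ← e2, dist_zero_right] at d2
    have n1 := H.dist_curve_one_ge m1
    have n2 := H.norm_curve_ge m2
    rcases le_total (t' - t) (1 - 2 * t) with h3 | h3
    · have h4 := Real.rpow_le_rpow (by linarith) h3 H.exp_pos.le
      have h5 : (t' - t) ^ kochExp h / 2 ≤ dist (kochCurve h (2 * t)) 1 := by linarith
      rw [d1] at s1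
      have := mul_le_mul_of_nonneg_left h5 (mul_pos hg hs).le
      linarith
    · have h4 := Real.rpow_le_rpow (by linarith) (show t' - t ≤ 2 * t' - 1 by linarith) H.exp_pos.le
      have h5 : (t' - t) ^ kochExp h / 2 ≤ ‖kochCurve h (2 * t' - 1)‖ := by linarith
      rw [d2] at s2
      have := mul_le_mul_of_nonneg_left h5 (mul_pos hg hs).le
      linarith
  have key : ∀ n : ℕ, ∀ t ∈ Icc (0 : ℝ) 1, ∀ t' ∈ Icc (0 : ℝ) 1, t < t' → (1 / 2) ^ n ≤ t' - t →
      g * ‖kochApex h‖ / 2 * (t' - t) ^ kochExp h ≤ dist (kochCurve h t) (kochCurve h t') := by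
    intro n
    induction n with
    | zero =>
      intro t ht t' ht' hlt h1
      rw [pow_zero] at h1
      exact hsep t ht t' ht' (by linarith [ht'.2]) (by linarith [ht.1])
    | succ n ih =>
      intro t ht t' ht' hlt h1
      rw [pow_succ] at h1
      rcases le_total t' (1 / 2) with h2 | h2
      · have m1 : 2 * t ∈ Icc (0 : ℝ) 1 := ⟨by linarith [ht.1], by linarith⟩
        have m2 : 2 * t' ∈ Icc (0 : ℝ) 1 := ⟨by linarith [ht'.1], by linarith⟩
        have e1 : kochCurve h t = kochL h (kochCurve h (2 * t)) := by
          rw [← H.curve_L m1]; congr 1; ring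
        have e2 : kochCurve h t' = kochL h (kochCurve h (2 * t')) := by
          rw [← H.curve_L m2]; congr 1; ring
        have := ih _ m1 _ m2 (by linarith) (by linarith)
        rw [e1, e2, dist_kochL, ← H.apex_mul_two_rpow (t := t' - t) (by linarith),
          show 2 * (t' - t) = 2 * t' - 2 * t by ring]
        have := mul_le_mul_of_nonneg_left this hs.le
        linarith
      rcases le_total t (1 / 2) with h3 | h3
      · exact hsep t ht t' ht' h3 h2
      · have m1 : 2 * t - 1 ∈ Icc (0 : ℝ) 1 := ⟨by linarith, by linarith [ht.2]⟩
        have m2 : 2 * t' - 1 ∈ Icc (0 : ℝ) 1 := ⟨by linarith, by linarith [ht'.2]⟩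
        have e1 : kochCurve h t = kochR h (kochCurve h (2 * t - 1)) := by
          rw [← H.curve_R m1]; congr 1; ring
        have e2 : kochCurve h t' = kochR h (kochCurve h (2 * t' - 1)) := by
          rw [← H.curve_R m2]; congr 1; ring
        have := ih _ m1 _ m2 (by linarith) (by linarith)
        rw [e1, e2, dist_kochR, ← H.apex_mul_two_rpow (t := t' - t) (by linarith),
          show 2 * (t' - t) = 2 * t' - 1 - (2 * t - 1) by ring]
        have := mul_le_mul_of_nonneg_left this hs.le
        linarith
  obtain ⟨n, hn⟩ := exists_pow_lt_of_lt_one (sub_pos.2 hlt) (by norm_num : (1 / 2 : ℝ) < 1)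
  exact key n t ht t' ht' hlt hn.le

theorem injOn_curve : InjOn (kochCurve h) (Icc 0 1) := by
  have key : ∀ t ∈ Icc (0 : ℝ) 1, ∀ t' ∈ Icc (0 : ℝ) 1, t < t' → kochCurve h t ≠ kochCurve h t' := by
    intro t ht t' ht' hlt e
    have := H.dist_curve_ge ht ht' hlt
    rw [e, dist_self] at this
    have h1 := Real.rpow_pos_of_pos (sub_pos.2 hlt) (kochExp h)
    have := mul_pos (mul_pos H.g_pos H.apex_pos) h1
    linarith
  intro t ht t' ht' e
  rcases lt_trichotomy t t' with h1 | h1 | h1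
  · exact absurd e (key t ht t' ht' h1)
  · exact h1
  · exact absurd e.symm (key t' ht' t ht h1)

/-- The inverse of the parametrization maps the curve onto [0, 1] and is Hölder continuous with
exponent 1 / `kochExp h`, so 1 is at most the dimension of the curve divided by this exponent. -/
theorem le_dimH_K : ENNReal.ofReal (1 / kochExp h) ≤ dimH (kochK h) := by
  have hb := H.exp_pos
  set A := g * ‖kochApex h‖ / 2 with hA
  have hA0 : 0 < A := by have := mul_pos H.g_pos H.apex_pos; positivity
  set φ := Function.invFunOn (kochCurve h) (Icc 0 1)
  have hφ : ∀ t ∈ Icc (0 : ℝ) 1, φ (kochCurve h t) = t := fun t ht =>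
    H.injOn_curve.leftInvOn_invFunOn ht
  set r : ℝ≥0 := ⟨1 / kochExp h, by positivity⟩ with hr
  have hr0 : 0 < r := by rw [← NNReal.coe_pos]; show 0 < 1 / kochExp h; positivity
  have hdist : ∀ t ∈ Icc (0 : ℝ) 1, ∀ t' ∈ Icc (0 : ℝ) 1,
      dist t t' ≤ A⁻¹ ^ (1 / kochExp h) * dist (kochCurve h t) (kochCurve h t') ^ (1 / kochExp h) := by
    have key : ∀ t ∈ Icc (0 : ℝ) 1, ∀ t' ∈ Icc (0 : ℝ) 1, t < t' →
      dist t t' ≤ A⁻¹ ^ (1 / kochExp h) * dist (kochCurve h t) (kochCurve h t') ^ (1 / kochExp h) := by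
      intro t ht t' ht' hlt
      have h1 := H.dist_curve_ge ht ht' hlt
      have h2 : (t' - t) ^ kochExp h ≤ A⁻¹ * dist (kochCurve h t) (kochCurve h t') := by
        rw [← hA] at h1
        rw [inv_mul_eq_div, le_div_iff₀ hA0]; linarith
      have h3 := Real.rpow_le_rpow (by have := sub_pos.2 hlt; positivity) h2
        (show 0 ≤ 1 / kochExp h by positivity)
      rw [← Real.rpow_mul (by linarith), mul_one_div_cancel hb.ne', Real.rpow_one,
        Real.mul_rpow (by positivity) dist_nonneg] at h3
      rwa [dist_comm, Real.dist_eq, abs_of_pos (by linarith)]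
    intro t ht t' ht'
    rcases lt_trichotomy t t' with h1 | rfl | h1
    · exact key t ht t' ht' h1
    · rw [dist_self]; positivity
    · rw [dist_comm, dist_comm (kochCurve h t)]; exact key t' ht' t ht h1
  have hC : 0 ≤ A⁻¹ ^ (1 / kochExp h) := by positivity
  have hH : HolderOnWith ⟨A⁻¹ ^ (1 / kochExp h), hC⟩ r φ (kochK h) := by
    rintro _ ⟨t, ht, rfl⟩ _ ⟨t', ht', rfl⟩
    rw [hφ t ht, hφ t' ht', edist_dist, edist_dist]
    refine (ENNReal.ofReal_le_ofReal (hdist t ht t' ht')).trans_eq ?_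
    rw [ENNReal.ofReal_mul hC, ← ENNReal.ofReal_rpow_of_nonneg dist_nonneg (by positivity)]
    congr 1
    exact ENNReal.ofReal_eq_coe_nnreal hC
  have h1 := hH.dimH_image_le hr0
  have h2 : φ '' kochK h = Icc 0 1 := by
    rw [kochK, image_image]
    exact (image_congr hφ).trans (image_id _)
  have h3 : dimH (Icc (0 : ℝ) 1) = 1 := by
    rw [Real.dimH_of_nonempty_interior (by simp)]; simp
  rw [h2, h3, ENNReal.le_div_iff_mul_le (Or.inl (by exact_mod_cast hr0.ne'))
    (Or.inl ENNReal.coe_ne_top), one_mul] at h1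
  exact (ENNReal.ofReal_eq_coe_nnreal _).trans_le h1

/-- 1 / `kochExp h` equals 2 log 2 / (log 2 - log (1 - g)). After inserting -log (1 - g) ≤ g / (1 -
g), what remains is log 2 ≤ 1. -/
theorem two_sub_le_dimH_K : ENNReal.ofReal (2 - 2 / Real.log 2 * g) ≤ dimH (kochK h) := by
  refine (ENNReal.ofReal_le_ofReal ?_).trans H.le_dimH_K
  have hl : 0 < Real.log 2 := Real.log_pos one_lt_two
  have hl1 : Real.log 2 < 0.7 := Real.log_two_lt_d9.trans (by norm_num)
  have hl2 : 0.4 < Real.log 2 := lt_trans (by norm_num) Real.log_two_gt_d9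
  have hg := H.g_pos
  have hg' := H.g_lt
  set x := -Real.log (1 - g) with hx
  have e1 : kochExp h = (Real.log 2 + x) / (2 * Real.log 2) := by
    have : 2 * Real.log ‖kochApex h‖ = Real.log (1 - g) - Real.log 2 := by
      rw [← Real.log_div (by linarith) (by norm_num), ← H.norm_sq_apex, Real.log_pow]; norm_num
    rw [kochExp, Real.logb, hx]
    field_simp
    linarith
  have hx1 : x * (1 - g) ≤ g := by
    have := Real.log_le_sub_one_of_pos (show 0 < (1 - g)⁻¹ by have : 0 < 1 - g := by linarith
                                                              positivity)
    rw [Real.log_inv] at this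
    have h1 : 0 < 1 - g := by linarith
    have h2 := mul_le_mul_of_nonneg_right this h1.le
    rw [sub_mul, inv_mul_cancel₀ h1.ne'] at h2
    linarith
  have hx0 : 0 ≤ x := neg_nonneg.2 (Real.log_nonpos (by linarith) (by linarith))
  rw [e1, one_div_div, le_div_iff₀ (by linarith)]
  have h3 : (2 - 2 / Real.log 2 * g) * (Real.log 2 + x) =
      2 * Real.log 2 + (2 / Real.log 2) * (x * (Real.log 2 - g) - g * Real.log 2) := by
    field_simp; ring
  rw [h3]
  have h4 : x * (Real.log 2 - g) - g * Real.log 2 ≤ 0 := by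
    have : x * (1 - g) * (Real.log 2 - g) ≤ g * (Real.log 2 - g) :=
      mul_le_mul_of_nonneg_right hx1 (by linarith)
    have h5 : (x * (Real.log 2 - g) - g * Real.log 2) * (1 - g) ≤ 0 := by
      have := mul_nonneg (sq_nonneg g) (show 0 ≤ 1 - Real.log 2 by linarith)
      linarith
    exact nonpos_of_mul_nonpos_left h5 (by linarith)
  have := mul_nonpos_of_nonneg_of_nonpos (show 0 ≤ 2 / Real.log 2 by positivity) h4
  linarith
end KochParam

/-! ### The Koch domain and its boundary curve -/

/-- The image of the circle under an injective continuous map. -/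
def IsJordanCurve {X : Type*} [TopologicalSpace X] (Γ : Set X) : Prop :=
  ∃ φ : Circle → X, Continuous φ ∧ Function.Injective φ ∧ range φ = Γ

theorem IsJordanCurve.image {X Y : Type*} [TopologicalSpace X] [TopologicalSpace Y] {Γ : Set X}
    (hΓ : IsJordanCurve Γ) {F : X → Y} (hF : ContinuousOn F Γ) (hinj : InjOn F Γ) :
    IsJordanCurve (F '' Γ) := by
  obtain ⟨φ, h1, h2, rfl⟩ := hΓ
  exact ⟨F ∘ φ, hF.comp_continuous h1 mem_range_self,
    fun x y h => h2 (hinj (mem_range_self x) (mem_range_self y) h), range_comp F φ⟩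

theorem isJordanCurve_sphere : IsJordanCurve (sphere (0 : ℂ) 1) := by
  refine ⟨fun z => (z : ℂ), continuous_subtype_val, Subtype.val_injective, ?_⟩
  ext z
  simp only [mem_range, mem_sphere, dist_zero_right]
  exact ⟨fun ⟨y, hy⟩ => hy ▸ Circle.norm_coe y, fun h => ⟨⟨z, mem_sphere_zero_iff_norm.2 h⟩, rfl⟩⟩

/-- A homeomorphism of the plane carries the boundary of a bounded convex set with interior to the
unit circle. -/
theorem Convex.isJordanCurve_frontier {P : Set ℂ} (hP : Convex ℝ P) (ho : IsOpen P)
    (hne : P.Nonempty) (hb : Bornology.IsBounded P) : IsJordanCurve (frontier P) := by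
  obtain ⟨e, -, -, h3⟩ := exists_homeomorph_image_interior_closure_frontier_eq_unitBall hP
    (by rwa [ho.interior_eq]) hb
  have := isJordanCurve_sphere.image (F := e.symm) e.symm.continuous.continuousOn
    e.symm.injective.injOn
  rwa [← h3, ← image_comp, e.symm_comp_self, image_id] at this

/-- The convex pentagon below the two legs of the triangle. -/
def kochP (h : ℝ) : Set ℂ :=
  {z | z.im < 2 * h * z.re ∧ z.im < 2 * h * (1 - z.re) ∧ -1 < z.re ∧ z.re < 2 ∧ -2 < z.im}

/-- The closed pentagon. -/
def kochPbar (h : ℝ) : Set ℂ :=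
  {z | z.im ≤ 2 * h * z.re ∧ z.im ≤ 2 * h * (1 - z.re) ∧ -1 ≤ z.re ∧ z.re ≤ 2 ∧ -2 ≤ z.im}

/-- The domain below the Koch curve. -/
def kochDomain (g h : ℝ) : Set ℂ := kochP h \ kochA g h

/-- The center of the Koch domain. -/
noncomputable def kochCenter : ℂ := ⟨1 / 2, -1⟩

@[simp] theorem kochCenter_re : kochCenter.re = 1 / 2 := rfl
@[simp] theorem kochCenter_im : kochCenter.im = -1 := rfl
theorem isOpen_kochP (h : ℝ) : IsOpen (kochP h) := by
  have h1 : IsOpen {z : ℂ | z.im < 2 * h * z.re} := isOpen_lt (by fun_prop) (by fun_prop)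
  have h2 : IsOpen {z : ℂ | z.im < 2 * h * (1 - z.re)} := isOpen_lt (by fun_prop) (by fun_prop)
  have h3 : IsOpen {z : ℂ | -1 < z.re} := isOpen_lt (by fun_prop) (by fun_prop)
  have h4 : IsOpen {z : ℂ | z.re < 2} := isOpen_lt (by fun_prop) (by fun_prop)
  have h5 : IsOpen {z : ℂ | -2 < z.im} := isOpen_lt (by fun_prop) (by fun_prop)
  exact h1.inter (h2.inter (h3.inter (h4.inter h5)))

theorem isClosed_kochPbar (h : ℝ) : IsClosed (kochPbar h) := by
  have h1 : IsClosed {z : ℂ | z.im ≤ 2 * h * z.re} := isClosed_le (by fun_prop) (by fun_prop)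
  have h2 : IsClosed {z : ℂ | z.im ≤ 2 * h * (1 - z.re)} := isClosed_le (by fun_prop) (by fun_prop)
  have h3 : IsClosed {z : ℂ | -1 ≤ z.re} := isClosed_le (by fun_prop) (by fun_prop)
  have h4 : IsClosed {z : ℂ | z.re ≤ 2} := isClosed_le (by fun_prop) (by fun_prop)
  have h5 : IsClosed {z : ℂ | -2 ≤ z.im} := isClosed_le (by fun_prop) (by fun_prop)
  exact h1.inter (h2.inter (h3.inter (h4.inter h5)))

theorem convex_kochP (h : ℝ) : Convex ℝ (kochP h) := by
  rintro z ⟨a1, a2, a3, a4, a5⟩ w ⟨b1, b2, b3, b4, b5⟩ s t hs ht hst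
  have key : ∀ x y : ℝ, 0 < x → 0 < y → 0 < s * x + t * y := by
    intro x y hx hy
    rcases hs.eq_or_lt with rfl | hs
    · have : t = 1 := by linarith
      subst this; linarith
    · have := mul_pos hs hx
      have := mul_nonneg ht hy.le
      linarith
  have k1 := key _ _ (sub_pos.2 a1) (sub_pos.2 b1)
  have k2 := key _ _ (sub_pos.2 a2) (sub_pos.2 b2)
  have k3 := key _ _ (sub_pos.2 a3) (sub_pos.2 b3)
  have k4 := key _ _ (sub_pos.2 a4) (sub_pos.2 b4)
  have k5 := key _ _ (sub_pos.2 a5) (sub_pos.2 b5)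
  have e : s = 1 - t := by linarith
  refine ⟨?_, ?_, ?_, ?_, ?_⟩ <;>
  simp only [Complex.add_re, Complex.add_im, Complex.real_smul, Complex.mul_re, Complex.mul_im,
    Complex.ofReal_re, Complex.ofReal_im, zero_mul, sub_zero, add_zero] <;> subst e <;> linarith

theorem kochP_subset_kochPbar (h : ℝ) : kochP h ⊆ kochPbar h :=
  fun _ ⟨a1, a2, a3, a4, a5⟩ => ⟨a1.le, a2.le, a3.le, a4.le, a5.le⟩

namespace KochParam
variable {g h : ℝ} (H : KochParam g h)
include H

theorem center_mem_P : kochCenter ∈ kochP h := by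
  have := H.h_pos
  refine ⟨?_, ?_, ?_, ?_, ?_⟩ <;> simp only [kochCenter_re, kochCenter_im] <;> linarith

theorem lineMap_center_mem_P {z : ℂ} (hz : z ∈ kochPbar h) {t : ℝ} (ht : 0 < t) (ht1 : t ≤ 1) :
    AffineMap.lineMap z kochCenter t ∈ kochP h := by
  obtain ⟨a1, a2, a3, a4, a5⟩ := hz
  obtain ⟨b1, b2, b3, b4, b5⟩ := H.center_mem_P
  have key : ∀ x y : ℝ, 0 ≤ x → 0 < y → 0 < (1 - t) * x + t * y := fun x y hx hy => by
    have := mul_pos ht hy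
    have := mul_nonneg (sub_nonneg.2 ht1) hx
    linarith
  have k1 := key _ _ (sub_nonneg.2 a1) (sub_pos.2 b1)
  have k2 := key _ _ (sub_nonneg.2 a2) (sub_pos.2 b2)
  have k3 := key _ _ (sub_nonneg.2 a3) (sub_pos.2 b3)
  have k4 := key _ _ (sub_nonneg.2 a4) (sub_pos.2 b4)
  have k5 := key _ _ (sub_nonneg.2 a5) (sub_pos.2 b5)
  refine ⟨?_, ?_, ?_, ?_, ?_⟩ <;>
  simp only [AffineMap.lineMap_apply, vsub_eq_sub, vadd_eq_add, Complex.add_re, Complex.add_im,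
    Complex.sub_re, Complex.sub_im, Complex.real_smul, Complex.mul_re, Complex.mul_im,
    Complex.ofReal_re, Complex.ofReal_im, zero_mul, sub_zero, add_zero] <;> linarith

theorem tendsto_lineMap_center (z : ℂ) :
    Tendsto (fun t : ℝ => AffineMap.lineMap z kochCenter t) (𝓝[>] (0 : ℝ)) (𝓝 z) := by
  have : Continuous fun t : ℝ => (AffineMap.lineMap z kochCenter t : ℂ) :=
    AffineMap.lineMap_continuous
  have h := this.tendsto 0
  rw [AffineMap.lineMap_apply_zero] at h
  exact h.mono_left nhdsWithin_le_nhds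

theorem closure_P : closure (kochP h) = kochPbar h := by
  refine Subset.antisymm (closure_minimal (kochP_subset_kochPbar h) (isClosed_kochPbar h))
    fun z hz => mem_closure_of_tendsto (H.tendsto_lineMap_center z) ?_
  filter_upwards [Ioo_mem_nhdsGT one_pos] with t ht
  exact H.lineMap_center_mem_P hz ht.1 ht.2.le

theorem frontier_P : frontier (kochP h) = kochPbar h \ kochP h := by
  rw [(isOpen_kochP h).frontier_eq, H.closure_P]

theorem isBounded_P : Bornology.IsBounded (kochP h) := by
  refine isBounded_iff_forall_norm_le.2 ⟨5, ?_⟩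
  rintro z ⟨a1, a2, a3, a4, a5⟩
  have := H.h_lt
  have := H.h_pos
  have h1 : z.im ≤ h := by nlinarith
  refine (Complex.norm_le_abs_re_add_abs_im z).trans ?_
  have e1 : |z.re| ≤ 2 := abs_le.2 ⟨by linarith, by linarith⟩
  have e2 : |z.im| ≤ 2 := abs_le.2 ⟨by linarith, by linarith⟩
  linarith

theorem mem_T_of_mem_Pbar {z : ℂ} (hz : z ∈ kochPbar h) (him : 0 ≤ z.im) : z ∈ kochT h :=
  ⟨him, hz.1, hz.2.1⟩

theorem T_subset_Pbar : kochT h ⊆ kochPbar h := fun _ hz =>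
  ⟨hz.2.1, hz.2.2, by linarith [H.re_nonneg_of_mem_T hz], by linarith [H.re_le_of_mem_T hz],
    by linarith [hz.1]⟩

theorem mem_P_of_mem_T {z : ℂ} (hz : z ∈ kochT h) (h1 : z.im ≠ 2 * h * z.re)
    (h2 : z.im ≠ 2 * h * (1 - z.re)) : z ∈ kochP h :=
  ⟨lt_of_le_of_ne hz.2.1 h1, lt_of_le_of_ne hz.2.2 h2, by linarith [H.re_nonneg_of_mem_T hz],
    by linarith [H.re_le_of_mem_T hz], by linarith [hz.1]⟩

theorem leg_of_notMem_P {z : ℂ} (hz : z ∈ kochT h) (hP : z ∉ kochP h) :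
    z.im = 2 * h * z.re ∨ z.im = 2 * h * (1 - z.re) := by
  by_contra hc
  push Not at hc
  exact hP (H.mem_P_of_mem_T hz hc.1 hc.2)

theorem B_diff_K_subset : kochB g h \ kochK h ⊆ kochDomain g h := by
  rintro z ⟨hB, hK⟩
  refine ⟨?_, fun hA => hK (H.A_inter_B ▸ ⟨hA, hB⟩)⟩
  by_contra hP
  exact hK (H.B_inter_legs hB (H.leg_of_notMem_P (H.B_subset_T hB) hP))

theorem below_subset : kochP h ∩ {z | z.im < 0} ⊆ kochDomain g h := fun _ hz =>
  ⟨hz.1, fun hA => absurd (H.A_subset_T hA).1 (not_le.2 hz.2)⟩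

theorem domain_subset : kochDomain g h ⊆ (kochB g h \ kochK h) ∪ {z | z.im < 0} := by
  rintro z ⟨hP, hA⟩
  rcases lt_or_ge z.im 0 with h1 | h1
  · exact Or.inr h1
  · have := H.mem_T_of_mem_Pbar (kochP_subset_kochPbar h hP) h1
    rw [← H.A_union_B] at this
    exact Or.inl ⟨this.resolve_left hA, fun hK => hA (K_subset_A hK)⟩

theorem isOpen_domain : IsOpen (kochDomain g h) := (isOpen_kochP h).sdiff H.isClosed_A

theorem center_mem_domain : kochCenter ∈ kochDomain g h :=
  H.below_subset ⟨H.center_mem_P, by simp⟩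

/-- Below the base nothing has been removed from the pentagon, so there only its own boundary
counts. Above the base a boundary point is in the closed part below the curve, and it lies either in
the part above or on a leg; both put it on the curve. Conversely, `K_near_U` with even levels
approximates the curve from inside the domain. -/
theorem frontier_domain : frontier (kochDomain g h) =
    kochK h ∪ (frontier (kochP h) ∩ {z | z.im ≤ 0}) := by
  rw [H.isOpen_domain.frontier_eq, H.frontier_P]
  apply Subset.antisymm
  · rintro z ⟨hc, hz⟩
    have hPb : z ∈ kochPbar h := H.closure_P ▸ closure_mono sdiff_subset hc
    have hcl : IsClosed (kochB g h ∪ {z : ℂ | z.im ≤ 0}) :=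
      H.isClosed_B.union (isClosed_le Complex.continuous_im continuous_const)
    have hz2 : z ∈ kochB g h ∪ {z : ℂ | z.im ≤ 0} := closure_minimal (H.domain_subset.trans
      (union_subset_union sdiff_subset fun w (hw : w.im < 0) => hw.le)) hcl hc
    by_cases hP : z ∈ kochP h
    · have hA : z ∈ kochA g h := by
        by_contra hA
        exact hz ⟨hP, hA⟩
      rcases hz2 with h1 | h1
      · exact Or.inl (H.A_inter_B ▸ ⟨hA, h1⟩)
      · exact Or.inl (H.A_inter_base hA (le_antisymm h1 (H.A_subset_T hA).1))
    · rcases hz2 with h1 | h1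
      · exact Or.inl (H.B_inter_legs h1 (H.leg_of_notMem_P (H.B_subset_T h1) hP))
      · exact Or.inr ⟨⟨hPb, hP⟩, h1⟩
  · rintro z (hK | ⟨⟨h1, h2⟩, h3⟩)
    · refine ⟨Metric.mem_closure_iff.2 fun ε hε => ?_, fun hz => hz.2 (K_subset_A hK)⟩
      obtain ⟨N, hN⟩ := eventually_atTop.1 (H.tendsto_apex_pow.eventually (gt_mem_nhds hε))
      obtain ⟨w, hw, hwK, hd⟩ := H.K_near_U (2 * N) z hK
      refine ⟨w, H.B_diff_K_subset ⟨Or.inr (mem_iUnion₂.2 ⟨_, even_two_mul N, hw⟩), hwK⟩, ?_⟩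
      rw [dist_comm]
      exact hd.trans_lt (hN _ (by omega))
    · refine ⟨mem_closure_of_tendsto (H.tendsto_lineMap_center z) ?_, fun hz => h2 hz.1⟩
      filter_upwards [Ioo_mem_nhdsGT one_pos] with t ht
      refine H.below_subset ⟨H.lineMap_center_mem_P h1 ht.1 ht.2.le, ?_⟩
      have h3 : z.im ≤ 0 := h3
      simp only [mem_ofPred_eq, AffineMap.lineMap_apply, vsub_eq_sub, vadd_eq_add, Complex.add_im,
        Complex.sub_im, Complex.real_smul, Complex.mul_im, Complex.ofReal_re,
        Complex.ofReal_im, zero_mul, add_zero, kochCenter_im]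
      have := ht.1
      have := mul_nonneg (sub_nonneg.2 ht.2.le) (neg_nonneg.2 h3)
      linarith

/-- The two legs form a graph over [0, 1]. Replacing each of their points by the point of the Koch
curve with its abscissa as parameter fixes 0 and 1, so it glues with the identity on the rest of the
boundary of the pentagon. The glued map is injective because the curve is simple and stays at height
at least 0. -/
theorem isJordanCurve_frontier : IsJordanCurve (frontier (kochDomain g h)) := by
  classical
  have hh := H.h_pos
  have hJ := (convex_kochP h).isJordanCurve_frontier (isOpen_kochP h) ⟨_, H.center_mem_P⟩
    H.isBounded_P
  rw [H.frontier_domain, H.frontier_P]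
  rw [H.frontier_P] at hJ
  set Γ := kochPbar h \ kochP h
  set F : ℂ → ℂ := fun z => if 0 ≤ z.im then kochCurve h z.re else z with hF
  have hup : ∀ z ∈ Γ, 0 ≤ z.im → z ∈ kochT h ∧ (z.im = 2 * h * z.re ∨ z.im = 2 * h * (1 - z.re)) :=
    fun z hz h0 => ⟨H.mem_T_of_mem_Pbar hz.1 h0, H.leg_of_notMem_P (H.mem_T_of_mem_Pbar hz.1 h0) hz.2⟩
  have hre : ∀ z ∈ Γ, 0 ≤ z.im → z.re ∈ Icc (0 : ℝ) 1 := fun z hz h0 =>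
    ⟨H.re_nonneg_of_mem_T (hup z hz h0).1, H.re_le_of_mem_T (hup z hz h0).1⟩
  have hbase : ∀ z ∈ Γ, z.im = 0 → z = 0 ∨ z = 1 := by
    intro z hz h0
    rcases (hup z hz h0.ge).2 with h1 | h1
    · refine Or.inl (Complex.ext ?_ h0)
      rw [h0] at h1
      have : z.re = 0 := by nlinarith
      simpa using this
    · refine Or.inr (Complex.ext ?_ (by simpa using h0))
      rw [h0] at h1
      have : z.re = 1 := by nlinarith
      simpa using this
  have hfix : ∀ z ∈ Γ, z.im ≤ 0 → F z = z := by
    intro z hz h0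
    rcases h0.lt_or_eq with h1 | h1
    · simp only [hF, not_le.2 h1, if_false]
    · rcases hbase z hz h1 with rfl | rfl
      · simp [hF, H.curve_zero]
      · simp [hF, H.curve_one]
  have hcurve : ∀ z : ℂ, 0 ≤ z.im → F z = kochCurve h z.re := fun z hz => by simp [hF, hz]
  have himage : F '' Γ = kochK h ∪ (Γ ∩ {z | z.im ≤ 0}) := by
    apply Subset.antisymm
    · rintro _ ⟨z, hz, rfl⟩
      rcases le_total 0 z.im with h0 | h0
      · rw [hcurve z h0]
        exact Or.inl (mem_image_of_mem _ (hre z hz h0))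
      · rw [hfix z hz h0]
        exact Or.inr ⟨hz, h0⟩
    · rintro z (⟨t, ht, rfl⟩ | ⟨hz, h0⟩)
      · set w : ℂ := ⟨t, 2 * h * min t (1 - t)⟩
        have hw0 : 0 ≤ w.im := by
          have : 0 ≤ min t (1 - t) := le_min ht.1 (sub_nonneg.2 ht.2)
          show 0 ≤ 2 * h * min t (1 - t)
          positivity
        have hwT : w ∈ kochT h := ⟨hw0, by show 2 * h * min t (1 - t) ≤ 2 * h * t; gcongr; exact min_le_left _ _,
            by show 2 * h * min t (1 - t) ≤ 2 * h * (1 - t); gcongr; exact min_le_right _ _⟩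
        refine ⟨w, ⟨H.T_subset_Pbar hwT, ?_⟩, hcurve w hw0⟩
        rintro ⟨a1, a2, -⟩
        have a1 : 2 * h * min t (1 - t) < 2 * h * t := a1
        have a2 : 2 * h * min t (1 - t) < 2 * h * (1 - t) := a2
        rcases min_choice t (1 - t) with h1 | h1 <;> rw [h1] at a1 a2 <;> linarith
      · exact ⟨z, hz, hfix z hz h0⟩
  rw [← himage]
  refine hJ.image ?_ ?_
  · have hsplit : Γ = (Γ ∩ {z | 0 ≤ z.im}) ∪ (Γ ∩ {z | z.im ≤ 0}) := by
      ext z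
      have := le_total 0 z.im
      simp only [mem_union, mem_inter_iff, mem_ofPred_eq]
      tauto
    have hΓc : IsClosed Γ := (isClosed_kochPbar h).sdiff (isOpen_kochP h)
    rw [hsplit]
    refine ContinuousOn.union_of_isClosed ?_ ?_
      (hΓc.inter (isClosed_le continuous_const Complex.continuous_im))
      (hΓc.inter (isClosed_le Complex.continuous_im continuous_const))
    · refine ContinuousOn.congr (f := fun z : ℂ => kochCurve h z.re) ?_
        fun z hz => hcurve z hz.2
      exact H.continuousOn_curve.comp Complex.continuous_re.continuousOn
        fun z hz => hre z hz.1 hz.2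
    · exact continuousOn_id.congr fun z hz => hfix z hz.1 hz.2
  · have hmix : ∀ z ∈ Γ, ∀ w ∈ Γ, 0 ≤ z.im → w.im < 0 → F z ≠ F w := by
      intro z hz w hw h1 h2 e
      rw [hcurve z h1, hfix w hw h2.le] at e
      have := (H.curve_mem (hre z hz h1)).1
      rw [e] at this
      linarith
    intro z hz w hw e
    rcases le_or_gt 0 z.im with h1 | h1 <;> rcases le_or_gt 0 w.im with h2 | h2
    · rw [hcurve z h1, hcurve w h2] at e
      have e1 := H.injOn_curve (hre z hz h1) (hre w hw h2) e
      have him : ∀ z ∈ Γ, 0 ≤ z.im → z.im = 2 * h * min z.re (1 - z.re) := by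
        intro z hz h0
        obtain ⟨k1, k2⟩ := hup z hz h0
        refine le_antisymm ?_ ?_
        · rcases min_choice z.re (1 - z.re) with h | h <;> rw [h]
          · exact k1.2.1
          · exact k1.2.2
        · rcases k2 with h | h <;> rw [h]
          · gcongr; exact min_le_left _ _
          · gcongr; exact min_le_right _ _
      exact Complex.ext e1 (by rw [him z hz h1, him w hw h2, e1])
    · exact absurd e (hmix z hz w hw h1 h2)
    · exact absurd e.symm (hmix w hw z hz h2 h1)
    · rwa [hfix z hz h1.le, hfix w hw h2.le] at e

theorem two_sub_le_dimH_frontier :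
    ENNReal.ofReal (2 - 2 / Real.log 2 * g) ≤ dimH (frontier (kochDomain g h)) := by
  refine H.two_sub_le_dimH_K.trans (dimH_mono ?_)
  rw [H.frontier_domain]
  exact subset_union_left
end KochParam

/-! ### Carrots, and their passage through the cells -/

/-- A unit speed curve from `q` to `x₀` satisfying the John condition in `Ω` for a carrot which
has length `t₀` at `q`. -/
def JohnFrom (J : ℝ) (Ω : Set ℂ) (x₀ : ℂ) (t₀ : ℝ) (q : ℂ) : Prop :=
  ∃ (l : ℝ) (γ : ℝ → ℂ), 0 ≤ l ∧ HasUnitSpeedOn γ (Icc 0 l) ∧ γ 0 = q ∧ γ l = x₀ ∧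
    ∀ t ∈ Icc 0 l, ball (γ t) (J * (t₀ + t)) ⊆ Ω

/-- Surjective similarities with ratio `κ`. -/
structure IsSimilarity (Φ : ℂ → ℂ) (κ : ℝ) : Prop where
  pos : 0 < κ
  dist_eq : ∀ z w, dist (Φ z) (Φ w) = κ * dist z w
  surj : Function.Surjective Φ

namespace IsSimilarity
variable {Φ Ψ : ℂ → ℂ} {κ μ : ℝ}

theorem id : IsSimilarity (fun z => z) 1 := ⟨one_pos, fun _ _ => (one_mul _).symm, fun z => ⟨z, rfl⟩⟩

theorem comp (hΦ : IsSimilarity Φ κ) (hΨ : IsSimilarity Ψ μ) :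
    IsSimilarity (fun z => Φ (Ψ z)) (κ * μ) :=
  ⟨mul_pos hΦ.pos hΨ.pos, fun z w => by rw [hΦ.dist_eq, hΨ.dist_eq, mul_assoc],
    hΦ.surj.comp hΨ.surj⟩

theorem ball_subset_image (hΦ : IsSimilarity Φ κ) (z : ℂ) (r : ℝ) :
    ball (Φ z) (κ * r) ⊆ Φ '' ball z r := by
  intro p hp
  obtain ⟨w, rfl⟩ := hΦ.surj p
  refine ⟨w, ?_, rfl⟩
  rw [mem_ball, hΦ.dist_eq] at hp
  exact lt_of_mul_lt_mul_left hp hΦ.pos.le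
end IsSimilarity

/-- The reflection in the axis of the triangle. -/
def kochReflect (z : ℂ) : ℂ := 1 - conj z

@[simp] theorem kochReflect_re (z : ℂ) : (kochReflect z).re = 1 - z.re := by simp [kochReflect]
@[simp] theorem kochReflect_im (z : ℂ) : (kochReflect z).im = z.im := by simp [kochReflect]
@[simp] theorem kochReflect_reflect (z : ℂ) : kochReflect (kochReflect z) = z := by
  simp [kochReflect]

theorem isSimilarity_reflect : IsSimilarity kochReflect 1 := by
  refine ⟨one_pos, fun z w => ?_, fun z => ⟨_, kochReflect_reflect z⟩⟩
  rw [kochReflect, kochReflect, dist_eq_norm, dist_eq_norm, sub_sub_sub_cancel_left, ← map_sub,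
    RCLike.norm_conj, norm_sub_rev, one_mul]

theorem reflect_kochL (h : ℝ) (z : ℂ) : kochReflect (kochL h z) = kochR h (kochReflect z) := by
  apply Complex.ext
  · simp; ring
  · simp

theorem reflect_kochR (h : ℝ) (z : ℂ) : kochReflect (kochR h z) = kochL h (kochReflect z) := by
  apply Complex.ext
  · simp; ring
  · simp

/-- A linear functional of norm at most `N` on a disc of radius `r`. -/
theorem linear_gt_of_norm_lt {α β N r : ℝ} (hN : 0 < N) (h : α ^ 2 + β ^ 2 ≤ N ^ 2) {ζ c : ℂ}
    (hζ : ‖ζ - c‖ < r) : α * c.re + β * c.im - N * r < α * ζ.re + β * ζ.im := by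
  have h1 : |α * (ζ.re - c.re) + β * (ζ.im - c.im)| ≤ N * ‖ζ - c‖ := by
    refine abs_le_of_sq_le_sq ?_ (by positivity)
    rw [mul_pow, ← Complex.normSq_eq_norm_sq, Complex.normSq_apply, Complex.sub_re, Complex.sub_im]
    have h2 : 0 ≤ (ζ.re - c.re) * (ζ.re - c.re) + (ζ.im - c.im) * (ζ.im - c.im) := by
      nlinarith [mul_self_nonneg (ζ.re - c.re), mul_self_nonneg (ζ.im - c.im)]
    nlinarith [mul_le_mul_of_nonneg_right h h2,
      sq_nonneg (α * (ζ.im - c.im) - β * (ζ.re - c.re))]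
  have h2 := mul_lt_mul_of_pos_left hζ hN
  linarith [(abs_le.1 h1).1]

namespace JohnFrom
variable {J κ t t' : ℝ} {Ω : Set ℂ} {x₀ u v : ℂ} {Φ : ℂ → ℂ}

theorem mono (hJ : 0 ≤ J) (h : JohnFrom J Ω x₀ t' u) (ht : t ≤ t') : JohnFrom J Ω x₀ t u := by
  obtain ⟨l, γ, h1, h2, h3, h4, h5⟩ := h
  exact ⟨l, γ, h1, h2, h3, h4, fun s hs => (ball_subset_ball (by gcongr)).trans (h5 s hs)⟩

theorem refl (h : ball x₀ (J * t) ⊆ Ω) : JohnFrom J Ω x₀ t x₀ := by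
  refine ⟨0, fun _ => x₀, le_rfl, ?_, rfl, rfl, fun s hs => ?_⟩
  · rw [Icc_self]
    exact hasConstantSpeedOnWith_of_subsingleton (fun _ => x₀) subsingleton_singleton 1
  · rw [Icc_self, mem_singleton_iff] at hs
    rwa [hs, add_zero]

/-- The discs along the first segment are checked in the coordinates of Φ, so a single computation
in the model triangle serves cells of all sizes. -/
theorem step (hΦ : IsSimilarity Φ κ)
    (hs : ∀ τ ∈ Icc (0 : ℝ) 1, ∀ ζ, ‖ζ - (u + τ * (v - u))‖ < J * (t + τ * ‖v - u‖) → Φ ζ ∈ Ω)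
    (hv : JohnFrom J Ω x₀ (κ * (t + ‖v - u‖)) (Φ v)) : JohnFrom J Ω x₀ (κ * t) (Φ u) := by
  obtain ⟨m, δ, h1, h2, h3, h4, h5⟩ := hv
  set L := κ * ‖v - u‖ with hL
  have hL0 : 0 ≤ L := mul_nonneg hΦ.pos.le (norm_nonneg _)
  have hκ := hΦ.pos
  have hu : HasUnitSpeedOn (fun r => Φ (arcSegment u v (r / κ))) (Icc 0 L) :=
    UnitSpeed.similar hΦ.pos (fun x y => by
      rw [edist_dist, edist_dist, hΦ.dist_eq, ENNReal.ofReal_mul hΦ.pos.le])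
      (arcSegment_unitSpeed u v)
  have hend : Φ (arcSegment u v (L / κ)) = Φ v := by
    rw [hL, mul_div_cancel_left₀ _ hΦ.pos.ne', arcSegment_end]
  refine ⟨L + m, _, by positivity, UnitSpeed.concat hu h2 (hend.trans h3.symm), ?_, ?_, ?_⟩
  · simp only [hL0, if_true, zero_div, arcSegment_zero]
  · split_ifs with hm
    · have hm0 : m = 0 := by linarith
      rw [hm0, add_zero, hend, ← h4, hm0, h3]
    · simp [h4]
  · intro r hr
    split_ifs with hrL
    · rw [arcSegment_eq]
      have e : J * (κ * t + r) = κ * (J * (t + r / κ)) := by field_simp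
      rw [e]
      refine (hΦ.ball_subset_image _ _).trans ?_
      rintro _ ⟨ζ, hζ, rfl⟩
      rcases (norm_nonneg (v - u)).eq_or_lt with h0 | h0
      · have hr0 : r = 0 := le_antisymm (by rwa [hL, ← h0, mul_zero] at hrL) hr.1
        refine hs 0 (by simp) ζ ?_
        rw [mem_ball, dist_eq_norm, hr0] at hζ
        simpa using hζ
      · refine hs (r / κ / ‖v - u‖) ⟨by have := hr.1; positivity, ?_⟩ ζ ?_
        · rw [div_div, div_le_one (by positivity)]; exact hrL
        · rw [mem_ball, dist_eq_norm] at hζ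
          rwa [div_mul_cancel₀ _ h0.ne']
    · push Not at hrL
      have := h5 (r - L) ⟨by linarith, by linarith [hr.2]⟩
      refine (ball_subset_ball (le_of_eq ?_)).trans this
      rw [hL]; ring

/-- Descending a vertical segment. -/
theorem descend (hΦ : IsSimilarity Φ κ) {x y₁ y₂ : ℝ} (hy : y₂ ≤ y₁)
    (hs : ∀ y ∈ Icc y₂ y₁, ∀ ζ : ℂ, ‖ζ - ⟨x, y⟩‖ < J * (t + (y₁ - y)) → Φ ζ ∈ Ω)
    (hv : JohnFrom J Ω x₀ (κ * (t + (y₁ - y₂))) (Φ ⟨x, y₂⟩)) :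
    JohnFrom J Ω x₀ (κ * t) (Φ ⟨x, y₁⟩) := by
  have e : (⟨x, y₂⟩ - ⟨x, y₁⟩ : ℂ) = ((y₂ - y₁ : ℝ) : ℂ) * Complex.I := by
    apply Complex.ext <;> simp
  have hn : ‖(⟨x, y₂⟩ - ⟨x, y₁⟩ : ℂ)‖ = y₁ - y₂ := by
    rw [e, norm_mul, Complex.norm_I, mul_one, Complex.norm_real, Real.norm_eq_abs,
      abs_of_nonpos (by linarith)]
    ring
  refine step hΦ (v := ⟨x, y₂⟩) (fun τ hτ ζ hζ => ?_) (by rwa [hn])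
  refine hs (y₁ + τ * (y₂ - y₁)) ⟨?_, ?_⟩ ζ ?_
  · nlinarith [hτ.2]
  · nlinarith [hτ.1]
  · rw [hn] at hζ
    have e2 : (⟨x, y₁⟩ + τ * (⟨x, y₂⟩ - ⟨x, y₁⟩) : ℂ) = ⟨x, y₁ + τ * (y₂ - y₁)⟩ := by
      apply Complex.ext <;> simp
    rw [e2] at hζ
    convert hζ using 2
    ring
end JohnFrom

/-- The wedge above a mouth of relative size `ρ` at `x`. -/
def kochWedge (g h ρ x : ℝ) : Set ℂ :=
  {ζ | 0 ≤ ζ.im ∧ h * |ζ.re - x| + g / 2 * ζ.im < h * g * ρ / 2}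

/-- The thin triangle below the base. -/
def kochThin (g h : ℝ) : Set ℂ :=
  {ζ | ζ.im < 0 ∧ 0 < 2 * h * ζ.im + g * ζ.re ∧ 0 < 2 * h * ζ.im + g * (1 - ζ.re)}

/-- A cell, given by a similarity, from whose mouths one can descend along carrots. -/
structure KochDescent (g h : ℝ) (Φ : ℂ → ℂ) (κ : ℝ) : Prop where
  sim : IsSimilarity Φ κ
  thin : MapsTo Φ (kochThin g h) (kochDomain g h)
  -- Here ρ is the width of a cell on the base whose opening is the wedge, and hρ is the length of a
  -- carrot that started at the tip of that wedge. The start may already lie at depth s below the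
  -- base. The bound for s is the largest depth at which a path coming sideways into an opening can
  -- meet its axis below the mouth.
  down : ∀ ρ x s : ℝ, 0 < ρ → ρ / 2 ≤ x → x ≤ 1 - ρ / 2 → 0 ≤ s → s ≤ ρ * g ^ 2 / (4 * h) →
    MapsTo Φ (kochWedge g h ρ x) (kochDomain g h) →
    JohnFrom g (kochDomain g h) kochCenter (κ * (h * ρ + s)) (Φ ⟨x, -s⟩)

namespace KochParam
variable {g h : ℝ} (H : KochParam g h)
include H

/-- The upper half of the discs of a carrot with tip at the apex of a wedge lies in the wedge. -/
theorem mem_wedge {ρ x y : ℝ} (hy : y ≤ h * ρ) {ζ : ℂ} (hζ : ‖ζ - ⟨x, y⟩‖ < g * (h * ρ - y))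
    (h0 : 0 ≤ ζ.im) : ζ ∈ kochWedge g h ρ x := by
  have hg := H.g_pos
  have hl : h ^ 2 + (g / 2) ^ 2 ≤ ((1 - g) / 2) ^ 2 := by linarith [H.sq]
  have h1 := linear_gt_of_norm_lt (α := -h) (β := -(g / 2)) (N := (1 - g) / 2)
    (by linarith [H.g_lt]) (by rwa [neg_sq, neg_sq]) hζ
  have h2 := linear_gt_of_norm_lt (α := h) (β := -(g / 2)) (N := (1 - g) / 2)
    (by linarith [H.g_lt]) (by rwa [neg_sq]) hζ
  have h3 : (1 - g) / 2 * (g * (h * ρ - y)) ≤ 1 / 2 * (g * (h * ρ - y)) :=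
    mul_le_mul_of_nonneg_right (by linarith) (mul_nonneg hg.le (by linarith))
  simp only at h1 h2
  refine ⟨h0, ?_⟩
  rcases abs_cases (ζ.re - x) with ⟨e, -⟩ | ⟨e, -⟩ <;> rw [e] <;> linarith

theorem below_wedge_mem {ρ x s y : ℝ} (hx : ρ / 2 ≤ x) (hx1 : x ≤ 1 - ρ / 2) (hρ : 0 < ρ)
    (hs : 0 ≤ s) (hy : y ∈ Icc (-1) (-s)) {ζ : ℂ} (hζ : ‖ζ - ⟨x, y⟩‖ < g * (h * ρ - y))
    (h0 : ζ.im < 0) : ζ ∈ kochDomain g h := by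
  have hg := H.g_pos
  have hg' := H.g_lt
  have hh := H.h_pos
  have hh' := H.h_lt
  have hy1 := hy.1
  have hy0 : y ≤ 0 := by linarith [hy.2]
  have hr : g * (h * ρ - y) ≤ 2 / 5 * (h * ρ - y) :=
    mul_le_mul_of_nonneg_right hg'.le (by nlinarith)
  have hρ1 : ρ ≤ 1 := by linarith
  have hr2 : h * ρ ≤ 1 / 2 := by nlinarith
  have l1 := linear_gt_of_norm_lt (α := 2 * h) (β := -1) (N := 3 / 2) (by norm_num)
    (by nlinarith [H.sq]) hζ
  have l2 := linear_gt_of_norm_lt (α := -(2 * h)) (β := -1) (N := 3 / 2) (by norm_num)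
    (by nlinarith [H.sq]) hζ
  have l3 := linear_gt_of_norm_lt (α := 1) (β := 0) (N := 1) (by norm_num) (by norm_num) hζ
  have l4 := linear_gt_of_norm_lt (α := -1) (β := 0) (N := 1) (by norm_num) (by norm_num) hζ
  have l5 := linear_gt_of_norm_lt (α := 0) (β := 1) (N := 1) (by norm_num) (by norm_num) hζ
  simp only at l1 l2 l3 l4 l5
  refine H.below_subset ⟨⟨?_, ?_, ?_, ?_, ?_⟩, h0⟩
  · nlinarith
  · nlinarith
  · linarith
  · linarith
  · linarith

/-- A carrot from a wedge of size ρ ≤ 2 min(x, 1 - x) has length hρ + 1 when it reaches height -1.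
The final move to the center is horizontal, and the discs stay inside the lower part of the pentagon
because g < 2/5. -/
theorem center_of_bottom {x t : ℝ} (hx : x ∈ Icc (0 : ℝ) 1)
    (ht : t ≤ 2 * h * min x (1 - x) + 1) :
    JohnFrom g (kochDomain g h) kochCenter t ⟨x, -1⟩ := by
  have hg := H.g_pos
  have hg' := H.g_lt
  have hh := H.h_pos
  have hh' := H.h_lt
  have hx0 := hx.1
  have hx1 := hx.2
  have hm1 : min x (1 - x) ≤ x := min_le_left _ _
  have hm2 : min x (1 - x) ≤ 1 - x := min_le_right _ _
  have hm0 : 0 ≤ min x (1 - x) := le_min hx.1 (sub_nonneg.2 hx.2)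
  have hm3 : min x (1 - x) ≤ 1 / 2 := by linarith
  have e : (kochCenter - ⟨x, -1⟩ : ℂ) = ((1 / 2 - x : ℝ) : ℂ) := by
    apply Complex.ext <;> simp
  have hn : ‖(kochCenter - ⟨x, -1⟩ : ℂ)‖ = 1 / 2 - min x (1 - x) := by
    rw [e, Complex.norm_real, Real.norm_eq_abs]
    rcases le_total x (1 - x) with h1 | h1
    · rw [min_eq_left h1, abs_of_nonneg (by linarith)]
    · rw [min_eq_right h1, abs_of_nonpos (by linarith)]; ring
  have key : ∀ τ ∈ Icc (0 : ℝ) 1, ∀ ζ : ℂ, ‖ζ - (⟨x, -1⟩ + τ * (kochCenter - ⟨x, -1⟩))‖ <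
      g * (t + τ * ‖(kochCenter - ⟨x, -1⟩ : ℂ)‖) → ζ ∈ kochDomain g h := by
    intro τ hτ ζ hζ
    have e2 : (⟨x, -1⟩ + τ * (kochCenter - ⟨x, -1⟩) : ℂ) = ⟨x + τ * (1 / 2 - x), -1⟩ := by
      rw [e]; apply Complex.ext <;> simp
    rw [e2, hn] at hζ
    set m := min x (1 - x) with hm
    set p := m + τ * (1 / 2 - m) with hp
    have hp1 : p ≤ x + τ * (1 / 2 - x) := by
      nlinarith [mul_nonneg (sub_nonneg.2 hτ.2) (sub_nonneg.2 hm1)]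
    have hp2 : p ≤ 1 - (x + τ * (1 / 2 - x)) := by
      nlinarith [mul_nonneg (sub_nonneg.2 hτ.2) (sub_nonneg.2 hm2)]
    have hpm : m ≤ p := by nlinarith [hτ.1]
    have hp0 : 0 ≤ p := hm0.trans hpm
    have hph : p ≤ 1 / 2 := by nlinarith [hτ.2]
    have hr : g * (t + τ * (1 / 2 - m)) ≤ 2 / 5 * (2 * h * m + 1 + (p - m)) := by
      have : 0 ≤ 2 * h * m + 1 + (p - m) := by have := mul_nonneg hh.le hm0; linarith
      refine le_trans (mul_le_mul_of_nonneg_left (show _ ≤ 2 * h * m + 1 + (p - m) by linarith)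
        hg.le) (mul_le_mul_of_nonneg_right hg'.le this)
    have hhm : h * m ≤ h * p := by gcongr
    have hhm2 : h * m ≤ 1 / 2 * m := by gcongr
    have l1 := linear_gt_of_norm_lt (α := 2 * h) (β := -1) (N := 3 / 2) (by norm_num)
      (by nlinarith [H.sq]) hζ
    have l2 := linear_gt_of_norm_lt (α := -(2 * h)) (β := -1) (N := 3 / 2) (by norm_num)
      (by nlinarith [H.sq]) hζ
    have l3 := linear_gt_of_norm_lt (α := 1) (β := 0) (N := 1) (by norm_num) (by norm_num) hζ
    have l4 := linear_gt_of_norm_lt (α := -1) (β := 0) (N := 1) (by norm_num) (by norm_num) hζ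
    have l5 := linear_gt_of_norm_lt (α := 0) (β := 1) (N := 1) (by norm_num) (by norm_num) hζ
    have l6 := linear_gt_of_norm_lt (α := 0) (β := -1) (N := 1) (by norm_num) (by norm_num) hζ
    simp only at l1 l2 l3 l4 l5 l6
    have hq1 := mul_le_mul_of_nonneg_left hp1 hh.le
    have hq2 := mul_le_mul_of_nonneg_left hp2 hh.le
    have : 0 ≤ h * m := by positivity
    refine H.below_subset ⟨⟨?_, ?_, ?_, ?_, ?_⟩, ?_⟩
    · linarith
    · linarith
    · linarith
    · linarith
    · linarith
    · show ζ.im < 0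
      linarith
  have hfin : JohnFrom g (kochDomain g h) kochCenter (1 * (t + ‖(kochCenter - ⟨x, -1⟩ : ℂ)‖))
      kochCenter := by
    refine JohnFrom.refl ?_
    intro ζ hζ
    rw [mem_ball, dist_eq_norm] at hζ
    exact key 1 (by simp) ζ (by simpa using hζ)
  have := JohnFrom.step IsSimilarity.id (u := ⟨x, -1⟩) key hfin
  rwa [one_mul] at this

theorem descent_id : KochDescent g h (fun z => z) 1 := by
  have hg := H.g_pos
  have hg' := H.g_lt
  have hh := H.h_pos
  have hh' := H.h_lt
  have hh2 := H.lt_h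
  refine ⟨IsSimilarity.id, ?_, ?_⟩
  · rintro ζ ⟨h0, h1, h2⟩
    have h3 : 0 < ζ.re := pos_of_mul_pos_right (a := g) (by nlinarith) hg.le
    have h4 : 0 < 1 - ζ.re := pos_of_mul_pos_right (a := g) (by nlinarith) hg.le
    have h5 := mul_pos hh h3
    have h6 := mul_pos hh h4
    refine H.below_subset ⟨⟨?_, ?_, ?_, ?_, ?_⟩, h0⟩ <;> nlinarith
  · intro ρ x s hρ hx hx1 hs hs1 hW
    have hs2 : s ≤ 1 := by
      refine hs1.trans ?_
      rw [div_le_one (by positivity)]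
      nlinarith
    refine JohnFrom.descend IsSimilarity.id (y₂ := -1) (by linarith) (fun y hy ζ hζ => ?_) ?_
    · have hζ' : ‖ζ - ⟨x, y⟩‖ < g * (h * ρ - y) := by convert hζ using 2; ring
      rcases lt_or_ge ζ.im 0 with h0 | h0
      · exact H.below_wedge_mem hx hx1 hρ hs hy hζ' h0
      · exact hW (H.mem_wedge (by nlinarith [hy.2]) hζ' h0)
    · refine H.center_of_bottom ⟨by linarith, by linarith⟩ ?_
      have : ρ / 2 ≤ min x (1 - x) := le_min hx (by linarith)
      nlinarith
end KochParam

namespace KochParam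
variable {g h : ℝ} (H : KochParam g h)
include H

theorem isSimilarity_L : IsSimilarity (kochL h) ‖kochApex h‖ :=
  ⟨H.apex_pos, dist_kochL h, H.surjective_L⟩

theorem isSimilarity_R : IsSimilarity (kochR h) ‖kochApex h‖ :=
  ⟨H.apex_pos, dist_kochR h, H.surjective_R⟩

theorem apex_mul_apex : ‖kochApex h‖ * ‖kochApex h‖ = (1 - g) / 2 := by
  rw [← pow_two, H.norm_sq_apex]

theorem LL_re (z : ℂ) : (kochL h (kochL h z)).re = (1 - g) / 2 * z.re := by
  simp only [kochL_re, kochL_im]; linear_combination z.re / 4 * H.sq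

theorem LL_im (z : ℂ) : (kochL h (kochL h z)).im = (1 - g) / 2 * z.im := by
  simp only [kochL_re, kochL_im]; linear_combination z.im / 4 * H.sq

theorem LR_re (z : ℂ) : (kochL h (kochR h z)).re = (1 - g) / 2 + g / 2 * z.re - h * z.im := by
  simp only [kochL_re, kochR_re, kochR_im]; linear_combination (1 - z.re) / 4 * H.sq

theorem LR_im (z : ℂ) : (kochL h (kochR h z)).im = h * z.re + g / 2 * z.im := by
  simp only [kochL_im, kochR_re, kochR_im]; linear_combination -z.im / 4 * H.sq

theorem sq_gt : (g / 2) ^ 2 < h ^ 2 := by nlinarith [H.sq, H.g_lt, H.g_pos]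

theorem lambda_sq : ((1 - g) / 2) ^ 2 = h ^ 2 + (g / 2) ^ 2 := by linarith [H.sq]
end KochParam

namespace KochDescent
variable {g h κ : ℝ} {Φ : ℂ → ℂ}

theorem reflect (hΦ : KochDescent g h Φ κ) : KochDescent g h (fun z => Φ (kochReflect z)) κ := by
  refine ⟨by simpa using hΦ.sim.comp isSimilarity_reflect, ?_, ?_⟩
  · rintro ζ ⟨h0, h1, h2⟩
    exact hΦ.thin ⟨by simpa using h0, by simpa using h2, by simpa using h1⟩
  · intro ρ x s hρ hx hx1 hs hs1 hW
    have := hΦ.down ρ (1 - x) s hρ (by linarith) (by linarith) hs hs1 ?_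
    · have e : kochReflect ⟨x, -s⟩ = ⟨1 - x, -s⟩ := by apply Complex.ext <;> simp
      rwa [e]
    · intro ζ hζ
      have := @hW (kochReflect ζ) ⟨by simpa using hζ.1, ?_⟩
      · simpa using this
      · have h2 := hζ.2
        have e : ζ.re - (1 - x) = -(1 - ζ.re - x) := by ring
        rw [e, abs_neg] at h2
        simpa using h2

/-- This map is the homothety with center 0 and ratio (1 - g) / 2. It preserves the base line and
the vertical direction, so a mouth of the smaller cell is just a smaller mouth of the given one. -/
theorem LL (H : KochParam g h) (hΦ : KochDescent g h Φ κ) :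
    KochDescent g h (fun z => Φ (kochL h (kochL h z))) (κ * ((1 - g) / 2)) := by
  have hg := H.g_pos
  have hg' := H.g_lt
  have hl : 0 < (1 - g) / 2 := by linarith
  refine ⟨?_, ?_, ?_⟩
  · have := hΦ.sim.comp (H.isSimilarity_L.comp H.isSimilarity_L)
    rwa [H.apex_mul_apex] at this
  · rintro ζ ⟨h0, h1, h2⟩
    refine hΦ.thin ⟨?_, ?_, ?_⟩
    · rw [H.LL_im]; nlinarith
    · rw [H.LL_im, H.LL_re]; nlinarith
    · rw [H.LL_im, H.LL_re]; nlinarith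
  · intro ρ x s hρ hx hx1 hs hs1 hW
    have := hΦ.down ((1 - g) / 2 * ρ) ((1 - g) / 2 * x) ((1 - g) / 2 * s) (by positivity)
      (by nlinarith) (by nlinarith) (by positivity) ?_ ?_
    · have e : kochL h (kochL h ⟨x, -s⟩) = ⟨(1 - g) / 2 * x, -((1 - g) / 2 * s)⟩ := by
        apply Complex.ext
        · rw [H.LL_re]
        · rw [H.LL_im]; ring
      rw [e]
      convert this using 1
      ring
    · have := mul_le_mul_of_nonneg_left hs1 hl.le
      refine this.trans_eq ?_
      ring
    · intro ζ hζ
      obtain ⟨ξ, rfl⟩ := (H.isSimilarity_L.comp H.isSimilarity_L).surj ζ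
      refine hW ⟨?_, ?_⟩
      · have := hζ.1
        rw [H.LL_im] at this
        exact nonneg_of_mul_nonneg_right this hl
      · have := hζ.2
        rw [H.LL_im, H.LL_re, ← mul_sub, abs_mul, abs_of_pos hl] at this
        refine lt_of_mul_lt_mul_left (a := (1 - g) / 2) ?_ hl.le
        linarith

/-- Descending along the axis of a cell. -/
theorem axis (H : KochParam g h) (hΦ : KochDescent g h Φ κ)
    (hM : MapsTo Φ (kochWedge g h 1 (1 / 2)) (kochDomain g h)) {y : ℝ} (hy : 0 ≤ y)
    (hy1 : y ≤ h + g ^ 2 / (4 * h)) :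
    JohnFrom g (kochDomain g h) kochCenter (κ * y) (Φ ⟨1 / 2, h - y⟩) := by
  have hg := H.g_pos
  have hg' := H.g_lt
  have hh := H.h_pos
  have hh' := H.h_lt
  rcases le_total h y with h1 | h1
  · have := hΦ.down 1 (1 / 2) (y - h) one_pos le_rfl (by norm_num) (by linarith)
      (by rw [one_mul]; linarith) hM
    convert this using 2
    · ring
    · congr 1; ring
  · have h2 := hΦ.down 1 (1 / 2) 0 one_pos le_rfl (by norm_num) le_rfl (by positivity) hM
    refine JohnFrom.descend hΦ.sim (y₂ := -0) (by linarith) (fun y' hy' ζ hζ => ?_)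
      (by convert h2 using 2; ring)
    have hζ' : ‖ζ - ⟨1 / 2, y'⟩‖ < g * (h * 1 - y') := by convert hζ using 2; ring
    have hy0 : 0 ≤ y' := by simpa using hy'.1
    have hy2 := hy'.2
    rcases le_or_gt 0 ζ.im with h0 | h0
    · exact hM (H.mem_wedge (by linarith) hζ' h0)
    · have e : (2 * h) ^ 2 + g ^ 2 ≤ (1 - g) ^ 2 := by nlinarith [H.sq]
      have l1 := linear_gt_of_norm_lt (α := g) (β := 2 * h) (N := 1 - g) (by linarith)
        (by linarith) hζ'
      have l2 := linear_gt_of_norm_lt (α := -g) (β := 2 * h) (N := 1 - g) (by linarith)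
        (by rw [neg_sq]; linarith) hζ'
      simp only at l1 l2
      have h3 : (1 - g) * (g * (h * 1 - y')) ≤ g / 2 := by
        have : (1 - g) * (h - y') ≤ 1 / 2 := by nlinarith
        nlinarith
      have h4 : 0 ≤ h * y' := by positivity
      refine hΦ.thin ⟨h0, ?_, ?_⟩ <;> linarith

/-- The map sends the base onto the left edge of the opening and the lower side to the inside, and
the thin triangle is flat enough to fit into the opening. -/
theorem thin_LR (H : KochParam g h) {ζ : ℂ} (hζ : ζ ∈ kochThin g h) :
    kochL h (kochR h ζ) ∈ kochWedge g h 1 (1 / 2) := by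
  have hg := H.g_pos
  have hg' := H.g_lt
  have hh := H.h_pos
  have hh' := H.h_lt
  have hs := H.sq_gt
  obtain ⟨h0, h1, h2⟩ := hζ
  have p1 : 0 < ζ.re := pos_of_mul_pos_right (a := g) (by nlinarith) hg.le
  have p2 : 0 < 1 - ζ.re := pos_of_mul_pos_right (a := g) (by nlinarith) hg.le
  refine ⟨?_, ?_⟩
  · rw [H.LR_im]
    have : 0 ≤ 2 * h * (h * ζ.re + g / 2 * ζ.im) := by
      have := mul_pos (sub_pos.2 hs) p1
      nlinarith
    exact nonneg_of_mul_nonneg_right this (by linarith)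
  · rw [H.LR_im, H.LR_re]
    have q1 : 0 < g * h * (1 - ζ.re) + (h ^ 2 - (g / 2) ^ 2) * ζ.im := by
      have : 0 < 2 * h * (g * h * (1 - ζ.re) + (h ^ 2 - (g / 2) ^ 2) * ζ.im) := by
        have i1 := mul_pos (sub_pos.2 hs) h2
        have i2 : 0 < g * (1 - ζ.re) * (h ^ 2 + (g / 2) ^ 2) := by positivity
        nlinarith
      exact pos_of_mul_pos_right this (by linarith)
    have q2 : 0 < -ζ.im * (h ^ 2 + (g / 2) ^ 2) := mul_pos (by linarith) (by positivity)
    rcases abs_cases ((1 - g) / 2 + g / 2 * ζ.re - h * ζ.im - 1 / 2) with ⟨e, -⟩ | ⟨e, -⟩ <;>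
      rw [e] <;> linarith

/-- The arithmetic for discs that protrude through the mouth of the opening: they stay on the inner
side of the right edge of the thin triangle under the mouth. -/
theorem ball_LR_aux (H : KochParam g h) {x y r p l : ℝ} (hx0 : 0 ≤ x) (hx2 : 0 ≤ 1 - x)
    (hyb : -y ≤ 5 / 2 * (g * (1 - x))) (hy2 : -y * (2 * h) ≤ g * (1 - x))
    (hr : r ≤ g * (h * (2 * x) - y)) (hl : l = (1 - g) / 2)
    (hp : 2 * (h ^ 2 - (g / 2) ^ 2) * x + 2 * g * h * y - 2 * l ^ 2 * r < p) :
    0 < p + g * (1 - l) := by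
  have hg := H.g_pos
  have hg' := H.g_lt
  have hh := H.h_pos
  have hh' := H.h_lt
  have hs := H.sq_gt
  have hl0 : 0 < l := by rw [hl]; linarith
  have hl1 : l < 1 / 2 := by rw [hl]; linarith
  have k1 := mul_le_mul_of_nonneg_left hr (show 0 ≤ 2 * l ^ 2 by positivity)
  have k2 := mul_le_mul_of_nonneg_left hyb (show 0 ≤ 2 * l ^ 2 * g by positivity)
  have k3 := mul_le_mul_of_nonneg_left hy2 hg.le
  have k4 : 0 ≤ x * (h ^ 2 - (g / 2) ^ 2) := mul_nonneg hx0 (by linarith)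
  have hl2 : l ^ 2 ≤ 1 / 4 := by nlinarith
  have k5 : 0 ≤ x * g * (1 / 2 - 4 * l ^ 2 * h) := by
    have : l ^ 2 * h ≤ 1 / 4 * (1 / 2) := mul_le_mul hl2 hh'.le hh.le (by norm_num)
    have : 0 ≤ 1 / 2 - 4 * l ^ 2 * h := by linarith
    positivity
  have k6 : 0 ≤ x * g * (1 / 2 - l) := by
    have : 0 ≤ 1 / 2 - l := by linarith
    positivity
  have k7 : 0 ≤ (1 - x) * g * ((1 - l) - g * (1 + 5 * l ^ 2)) := by
    have : (1 - l) - g * (1 + 5 * l ^ 2) = (1 - g) / 2 * (1 - 5 / 2 * (g * (1 - g))) := by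
      rw [hl]; ring
    rw [this]
    have h1 : g * (1 - g) ≤ 1 / 4 := by nlinarith [sq_nonneg (g - 1 / 2)]
    have : 0 < 1 - 5 / 2 * (g * (1 - g)) := by linarith
    have : 0 < (1 - g) / 2 := by linarith
    positivity
  linarith

/-- A path leaving the cell through the left edge of the opening is followed until it reaches the
axis, at depth g(1 - x) / (2h). Its discs do not reach the opposite edge (`c1`). If they fall below
the mouth, they stay between the two edges of the thin triangle (`c2`, `c3`). -/
theorem ball_LR (H : KochParam g h) {ρ x y : ℝ} (hρ : 0 < ρ) (hx : ρ / 2 ≤ x)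
    (hx1 : x ≤ 1 - ρ / 2) (hy : y ≤ 0) (hy1 : -(g * (1 - x) / (2 * h)) ≤ y) {ζ : ℂ}
    (hζ : ‖ζ - ⟨x, y⟩‖ < g * (h * ρ - y)) (h0 : ζ.im < 0) :
    kochL h (kochR h ζ) ∈ kochWedge g h 1 (1 / 2) ∪ kochThin g h := by
  have hg := H.g_pos
  have hg' := H.g_lt
  have hh := H.h_pos
  have hh' := H.h_lt
  have hh2 := H.lt_h
  have hs := H.sq_gt
  have hlam := H.lambda_sq
  have hsq := H.sq
  set l := (1 - g) / 2 with hl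
  have hl0 : 0 < l := by rw [hl]; linarith
  have hl1 : l < 1 / 2 := by rw [hl]; linarith
  have hx0 : 0 < x := by linarith
  have hx2 : 0 < 1 - x := by linarith
  have hy2 : -y * (2 * h) ≤ g * (1 - x) := by
    rw [← le_div_iff₀ (by positivity)]; linarith
  have l1 := linear_gt_of_norm_lt (α := -(g * h)) (β := h ^ 2 - (g / 2) ^ 2) (N := l ^ 2)
    (by positivity) (by rw [hlam]; nlinarith) hζ
  have l2 := linear_gt_of_norm_lt (α := 1) (β := 0) (N := 1) (by norm_num) (by norm_num) hζ
  have l3 := linear_gt_of_norm_lt (α := 2 * (h ^ 2 - (g / 2) ^ 2)) (β := 2 * g * h) (N := 2 * l ^ 2)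
    (by positivity) (by rw [hlam]; nlinarith) hζ
  simp only at l1 l2 l3
  -- the edge of the opening on the other side
  have c1 : 0 < g * h * (1 - ζ.re) + (h ^ 2 - (g / 2) ^ 2) * ζ.im := by
    have k1 : l ^ 2 * (g * (h * ρ - y)) ≤ l ^ 2 * (g * (h * (2 * (1 - x)) - y)) := by
      gcongr; linarith
    have k2 : 0 ≤ g * h * (1 - x) + (h ^ 2 - (g / 2) ^ 2) * y -
        l ^ 2 * (g * (h * (2 * (1 - x)) - y)) := by
      have k3 : 0 ≤ (2 * h) * (g * h * (1 - x) + (h ^ 2 - (g / 2) ^ 2) * y -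
        l ^ 2 * (g * (h * (2 * (1 - x)) - y))) := by
        have k4 := mul_le_mul_of_nonneg_left hy2
          (show 0 ≤ h ^ 2 - (g / 2) ^ 2 + l ^ 2 * g by have : 0 < l ^ 2 * g := by positivity
                                                       linarith)
        have k5 : 0 ≤ g * (1 - x) * (l ^ 2 * g) := by positivity
        have k6 : 2 * h ^ 2 - (h ^ 2 - (g / 2) ^ 2 + l ^ 2 * g) - 4 * h ^ 2 * l ^ 2 = l ^ 2 * g := by
          rw [hsq]; linear_combination -hlam
        have k7 : (2 * h) * (g * h * (1 - x) + (h ^ 2 - (g / 2) ^ 2) * y -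
            l ^ 2 * (g * (h * (2 * (1 - x)) - y))) = g * (1 - x) * (2 * h ^ 2 - 4 * h ^ 2 * l ^ 2) -
            (h ^ 2 - (g / 2) ^ 2 + l ^ 2 * g) * (-y * (2 * h)) := by ring
        rw [k7]
        have k8 : g * (1 - x) * (2 * h ^ 2 - 4 * h ^ 2 * l ^ 2) =
          (h ^ 2 - (g / 2) ^ 2 + l ^ 2 * g) * (g * (1 - x)) + g * (1 - x) * (l ^ 2 * g) := by
          linear_combination (g * (1 - x)) * k6
        linarith
      exact nonneg_of_mul_nonneg_right k3 (by linarith)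
    linarith
  have hr : g * (h * ρ - y) ≤ g * (h * (2 * x) - y) := by gcongr; linarith
  have hyb : -y ≤ 5 / 2 * (g * (1 - x)) := by
    have := mul_le_mul_of_nonneg_left hh2.le (neg_nonneg.2 hy)
    linarith
  have hgx : g * (1 - x) ≤ 2 / 5 := by
    have := mul_le_mul hg'.le (show 1 - x ≤ 1 by linarith) hx2.le (by norm_num)
    linarith
  have c2 : 0 < 2 * l * ζ.re + g := by
    have k1 : g * (h * (2 * x)) ≤ x := by
      have : g * (2 * h) ≤ 1 := by nlinarith
      have := mul_le_mul_of_nonneg_right this hx0.le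
      linarith
    have k2 : -y * (2 * l) ≤ 1 * 1 := mul_le_mul (by linarith) (by linarith) (by positivity) one_pos.le
    have k3 : g * y < ζ.re := by linarith
    have k4 := mul_lt_mul_of_pos_left k3 (show 0 < 2 * l by positivity)
    have k5 := mul_le_mul_of_nonneg_left k2 hg.le
    linarith
  have c3 := ball_LR_aux H hx0.le hx2.le hyb hy2 hr hl l3
  have hre := H.LR_re ζ
  have him := H.LR_im ζ
  rcases le_or_gt 0 (kochL h (kochR h ζ)).im with h1 | h1
  · refine Or.inl ⟨h1, ?_⟩
    rw [hre, him, ← hl]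
    have q2 : 0 < -ζ.im * (h ^ 2 + (g / 2) ^ 2) := mul_pos (by linarith) (by positivity)
    rcases abs_cases (l + g / 2 * ζ.re - h * ζ.im - 1 / 2) with ⟨e, -⟩ | ⟨e, -⟩ <;>
      rw [e, hl] <;> linarith
  · refine Or.inr ⟨h1, ?_, ?_⟩
    · rw [hre, him, ← hl]
      have : 2 * h * (h * ζ.re + g / 2 * ζ.im) + g * (l + g / 2 * ζ.re - h * ζ.im) =
        l * (2 * l * ζ.re + g) := by linear_combination (-2 * ζ.re) * hlam
      rw [this]; positivity
    · rw [hre, him, ← hl]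
      linarith

/-- The exit direction of this cell is perpendicular to the left edge of the opening. The path
crosses to the axis of the opening, turns, and follows the axis out of the mouth by
`KochDescent.axis`. -/
theorem LR (H : KochParam g h) (hΦ : KochDescent g h Φ κ)
    (hM : MapsTo Φ (kochWedge g h 1 (1 / 2)) (kochDomain g h)) :
    KochDescent g h (fun z => Φ (kochL h (kochR h z))) (κ * ((1 - g) / 2)) := by
  have hg := H.g_pos
  have hg' := H.g_lt
  have hh := H.h_pos
  have hκ := hΦ.sim.pos
  have hlam := H.lambda_sq
  have hsq := H.sq
  have hsim : IsSimilarity (fun z => Φ (kochL h (kochR h z))) (κ * ((1 - g) / 2)) := by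
    have := hΦ.sim.comp (H.isSimilarity_L.comp H.isSimilarity_R)
    rwa [H.apex_mul_apex] at this
  refine ⟨hsim, fun ζ hζ => hM (thin_LR H hζ), ?_⟩
  intro ρ x s hρ hx hx1 hs hs1 hW
  -- The depth below the base of the small cell at which the vertical through x meets the axis of
  -- the opening.
  set σ := g * (1 - x) / (2 * h) with hσ
  have hsσ : s ≤ σ := by
    refine hs1.trans ?_
    rw [hσ, div_le_div_iff₀ (by positivity) (by positivity)]
    have : ρ * g ^ 2 ≤ 2 * (g * (1 - x)) := by
      have : ρ * g ≤ 2 * (1 - x) := by nlinarith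
      nlinarith
    nlinarith
  refine JohnFrom.descend hsim (y₂ := -σ) (by linarith) (fun y hy ζ hζ => ?_) ?_
  · have hζ' : ‖ζ - ⟨x, y⟩‖ < g * (h * ρ - y) := by convert hζ using 2; ring
    rcases le_or_gt 0 ζ.im with h0 | h0
    · exact hW (H.mem_wedge (by nlinarith [hy.2]) hζ' h0)
    · rcases ball_LR H hρ hx hx1 (by linarith [hy.2]) hy.1 hζ' h0 with h1 | h1
      · exact hM h1
      · exact hΦ.thin h1
  -- The distance of the meeting point from the apex. The carrot has length at most 2h(1 - x) + σ =
  -- ((1 - g) / 2)(1 - x) / h in the units of the small cell, and scaling by (1 - g) / 2 turns this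
  -- bound into y. So the carrot that starts at the apex and runs down the axis is at least as long,
  -- and the curve of `axis` serves. The largest y, near x = 0, is h + g² / (4h).
  · set y := ((1 - g) / 2) ^ 2 * (1 - x) / h with hy
    have e : kochL h (kochR h ⟨x, -σ⟩) = ⟨1 / 2, h - y⟩ := by
      apply Complex.ext
      · rw [H.LR_re, hσ]; field_simp; ring
      · rw [H.LR_im, hσ, hy, hlam]; field_simp; ring
    rw [e]
    have hy0 : 0 ≤ y := by
      have : 0 ≤ 1 - x := by linarith
      positivity
    refine (hΦ.axis H hM hy0 ?_).mono hg.le ?_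
    · rw [hy, hlam, div_le_iff₀ hh]
      have : (h + g ^ 2 / (4 * h)) * h = h ^ 2 + (g / 2) ^ 2 := by field_simp; ring
      rw [this]
      have : 0 ≤ (h ^ 2 + (g / 2) ^ 2) * x := by
        have : 0 < x := by linarith
        positivity
      linarith
    · rw [mul_assoc]
      refine mul_le_mul_of_nonneg_left ?_ hκ.le
      have : h * ρ + s + (-s - -σ) = h * ρ + σ := by ring
      rw [this]
      have h1 : h * ρ ≤ h * (2 * (1 - x)) := by gcongr; linarith
      have h2 : h * (2 * (1 - x)) + σ = (1 - g) / 2 * (1 - x) / h := by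
        rw [hσ]; field_simp; linear_combination (1 - x) * hsq
      have h3 : y = (1 - g) / 2 * ((1 - g) / 2 * (1 - x) / h) := by rw [hy]; ring
      rw [h3, ← h2]
      exact mul_le_mul_of_nonneg_left (by linarith) (by linarith)
end KochDescent

namespace KochParam
variable {g h : ℝ} (H : KochParam g h)
include H

theorem wedge_subset : kochWedge g h 1 (1 / 2) ⊆ kochB g h \ kochK h := by
  rintro ζ ⟨h0, h1⟩
  have hh := H.h_pos
  have a1 := mul_le_mul_of_nonneg_left (le_abs_self (ζ.re - 1 / 2)) hh.le
  have a2 := mul_le_mul_of_nonneg_left (neg_le_abs (ζ.re - 1 / 2)) hh.le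
  refine ⟨Or.inr (mem_iUnion₂.2 ⟨0, Even.zero, h0, by linarith, by linarith⟩), fun hK => ?_⟩
  rw [H.K_eq] at hK
  rcases hK with hK | hK
  · have := image_mono H.K_subset hK
    rw [H.image_L] at this
    linarith [this.2]
  · have := image_mono H.K_subset hK
    rw [H.image_R] at this
    linarith [this.2]

/-- A point of the opening first moves horizontally to the axis. The way is at most (g / (2h)) times
the height difference to the apex, hence at most that difference, so the carrot along the axis is
long enough to take over. -/
theorem john_of_M {κ : ℝ} {Φ : ℂ → ℂ} (hΦ : KochDescent g h Φ κ)
    (hM : MapsTo Φ (kochWedge g h 1 (1 / 2)) (kochDomain g h)) {m : ℂ} (hm : m ∈ kochM g h) :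
    JohnFrom g (kochDomain g h) kochCenter 0 (Φ m) := by
  have hg := H.g_pos
  have hg' := H.g_lt
  have hh := H.h_pos
  have hh' := H.h_lt
  have hh2 := H.lt_h
  obtain ⟨m0, m1, m2⟩ := hm
  set d := |1 / 2 - m.re| with hd
  have hd0 : 0 ≤ d := abs_nonneg _
  have hmd : h * d + g / 2 * m.im ≤ h * g / 2 := by
    rcases abs_cases (1 / 2 - m.re) with ⟨e, -⟩ | ⟨e, -⟩ <;> rw [hd, e] <;> linarith
  have hdg : d ≤ g / 2 := by
    have : 0 ≤ g / 2 * m.im := by positivity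
    refine le_of_mul_le_mul_left (a := h) ?_ hh
    linarith
  set v : ℂ := ⟨1 / 2, m.im⟩ with hv
  have e : v - m = ((1 / 2 - m.re : ℝ) : ℂ) := by apply Complex.ext <;> simp [hv]
  have hn : ‖v - m‖ = d := by rw [e, Complex.norm_real, Real.norm_eq_abs]
  rw [← mul_zero κ]
  refine JohnFrom.step hΦ.sim (v := v) (fun τ hτ ζ hζ => ?_) ?_
  · rw [hn, zero_add] at hζ
    set X := m.re + τ * (1 / 2 - m.re) with hX
    have e2 : m + τ * (v - m) = ⟨X, m.im⟩ := by
      rw [e]; apply Complex.ext <;> simp [hX]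
    rw [e2] at hζ
    have hXd : |X - 1 / 2| = (1 - τ) * d := by
      have : X - 1 / 2 = -((1 - τ) * (1 / 2 - m.re)) := by rw [hX]; ring
      rw [this, abs_neg, abs_mul, abs_of_nonneg (sub_nonneg.2 hτ.2)]
    have hX1 := (abs_le.1 hXd.le).1
    have hX2 := (abs_le.1 hXd.le).2
    have hτd : 0 ≤ τ * d := mul_nonneg hτ.1 hd0
    have hτd1 : τ * d ≤ g / 2 := (mul_le_of_le_one_left hd0 hτ.2).trans hdg
    rcases le_or_gt 0 ζ.im with h0 | h0
    · refine hM ⟨h0, ?_⟩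
      have hl : h ^ 2 + (g / 2) ^ 2 ≤ ((1 - g) / 2) ^ 2 := H.lambda_sq.ge
      have l1 := linear_gt_of_norm_lt (α := -h) (β := -(g / 2)) (N := (1 - g) / 2)
        (by linarith) (by rwa [neg_sq, neg_sq]) hζ
      have l2 := linear_gt_of_norm_lt (α := h) (β := -(g / 2)) (N := (1 - g) / 2)
        (by linarith) (by rwa [neg_sq]) hζ
      simp only at l1 l2
      have k1 : (1 - g) / 2 * (g * (τ * d)) ≤ h * (τ * d) := by
        have : (1 - g) / 2 * g ≤ h := by nlinarith
        have := mul_le_mul_of_nonneg_right this hτd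
        linarith
      have k2 := mul_le_mul_of_nonneg_left hX1 hh.le
      have k3 := mul_le_mul_of_nonneg_left hX2 hh.le
      rcases abs_cases (ζ.re - 1 / 2) with ⟨e, -⟩ | ⟨e, -⟩ <;> rw [e] <;> linarith
    · have e : (2 * h) ^ 2 + g ^ 2 ≤ (1 - g) ^ 2 := by linarith [H.sq]
      have l1 := linear_gt_of_norm_lt (α := g) (β := 2 * h) (N := 1 - g) (by linarith)
        (by linarith) hζ
      have l2 := linear_gt_of_norm_lt (α := -g) (β := 2 * h) (N := 1 - g) (by linarith)
        (by rw [neg_sq]; linarith) hζ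
      simp only at l1 l2
      have k0 : 0 ≤ h * m.im := by positivity
      have k1 : (1 - g) * (g * (τ * d)) ≤ g * (g / 2) := by
        have := mul_le_mul_of_nonneg_left hτd1 hg.le
        have h3 : 0 ≤ g * (τ * d) := by positivity
        nlinarith
      have hX3 : |X - 1 / 2| ≤ g / 2 := hXd.le.trans
        ((mul_le_of_le_one_left hd0 (by linarith [hτ.1])).trans hdg)
      have k2 := mul_le_mul_of_nonneg_left (abs_le.1 hX3).1 hg.le
      have k3 := mul_le_mul_of_nonneg_left (abs_le.1 hX3).2 hg.le
      have k4 : 0 < g * (1 / 2 - g) := mul_pos hg (by linarith)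
      exact hΦ.thin ⟨h0, by linarith, by linarith⟩
  · rw [hn, zero_add]
    have hmh : m.im ≤ h := by
      refine le_of_mul_le_mul_left (a := g / 2) ?_ (by linarith)
      have : 0 ≤ h * d := by positivity
      linarith
    have hax := hΦ.axis H hM (y := h - m.im) (by linarith) (by
      have : 0 ≤ g ^ 2 / (4 * h) := by positivity
      linarith)
    rw [sub_sub_cancel] at hax
    refine hax.mono hg.le (mul_le_mul_of_nonneg_left ?_ hΦ.sim.pos.le)
    have hgh : g / 2 ≤ h := by nlinarith
    have k1 := mul_le_mul_of_nonneg_right hgh (sub_nonneg.2 hmh)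
    refine le_of_mul_le_mul_left (a := h) ?_ hh
    linarith

/-- Induction on the word, two letters at a time, with the accumulated similarity as a parameter.
Words beginning on the right are conjugated by the reflection, which the notion of descent respects.
-/
theorem john_of_U (k : ℕ) : ∀ (Φ : ℂ → ℂ) (κ : ℝ), KochDescent g h Φ κ →
    MapsTo Φ (kochB g h \ kochK h) (kochDomain g h) → ∀ m ∈ kochU g h (2 * k),
      JohnFrom g (kochDomain g h) kochCenter 0 (Φ m) := by
  induction k with
  | zero => exact fun Φ κ hΦ hB m hm => H.john_of_M hΦ (hB.mono_left H.wedge_subset) hm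
  | succ k ih =>
    intro Φ κ hΦ hB m hm
    have hLm : MapsTo (kochL h) (kochT h \ kochK h) (kochT h \ kochK h) := fun z hz =>
      ⟨H.mapsTo_L hz.1, fun hK => hz.2 (H.of_L_mem_K hz.1 hK)⟩
    have hRm : MapsTo (kochR h) (kochT h \ kochK h) (kochT h \ kochK h) := fun z hz =>
      ⟨H.mapsTo_R hz.1, fun hK => hz.2 (H.of_R_mem_K hz.1 hK)⟩
    have hT : ∀ z ∈ kochB g h \ kochK h, z ∈ kochT h \ kochK h := fun z hz =>
      ⟨H.B_subset_T hz.1, hz.2⟩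
    have hwr : MapsTo (fun z => Φ (kochReflect z)) (kochWedge g h 1 (1 / 2)) (kochDomain g h) := by
      intro ζ hζ
      refine hB (H.wedge_subset ⟨by simpa using hζ.1, ?_⟩)
      have h2 := hζ.2
      rw [← abs_neg] at h2
      convert h2 using 3
      · simp; ring_nf
      · simp
    rcases hm with ⟨_, ⟨m, hm, rfl⟩ | ⟨m, hm, rfl⟩, rfl⟩ | ⟨_, ⟨m, hm, rfl⟩ | ⟨m, hm, rfl⟩, rfl⟩
    · exact ih _ _ (hΦ.LL H) (fun z hz => hB ⟨H.LL_mem hz.1, (hLm (hLm (hT z hz))).2⟩) m hm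
    · exact ih _ _ (hΦ.LR H (hB.mono_left H.wedge_subset))
        (fun z hz => hB ⟨H.LR_mem hz.1, (hLm (hRm (hT z hz))).2⟩) m hm
    · have := (hΦ.reflect.LR H hwr).reflect
      simp only [reflect_kochL, reflect_kochR, kochReflect_reflect] at this
      exact ih _ _ this (fun z hz => hB ⟨H.RL_mem hz.1, (hRm (hLm (hT z hz))).2⟩) m hm
    · have := (hΦ.reflect.LL H).reflect
      simp only [reflect_kochL, kochReflect_reflect] at this
      exact ih _ _ this (fun z hz => hB ⟨H.RR_mem hz.1, (hRm (hRm (hT z hz))).2⟩) m hm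

theorem ball_center_subset : ball kochCenter 1 ⊆ kochP h ∩ {z | z.im < 0} := by
  intro ζ hζ
  rw [mem_ball, dist_eq_norm] at hζ
  have hh := H.h_pos
  have hh' := H.h_lt
  have hsq : 4 * h ^ 2 + 1 ≤ (1 + h) ^ 2 := by nlinarith
  have l1 := linear_gt_of_norm_lt (α := 2 * h) (β := -1) (N := 1 + h) (by linarith)
    (by linarith) hζ
  have l2 := linear_gt_of_norm_lt (α := -(2 * h)) (β := -1) (N := 1 + h) (by linarith)
    (by linarith) hζ
  have l3 := linear_gt_of_norm_lt (α := 1) (β := 0) (N := 1) (by norm_num) (by norm_num) hζ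
  have l4 := linear_gt_of_norm_lt (α := -1) (β := 0) (N := 1) (by norm_num) (by norm_num) hζ
  have l5 := linear_gt_of_norm_lt (α := 0) (β := 1) (N := 1) (by norm_num) (by norm_num) hζ
  have l6 := linear_gt_of_norm_lt (α := 0) (β := -1) (N := 1) (by norm_num) (by norm_num) hζ
  simp only [kochCenter_re, kochCenter_im] at l1 l2 l3 l4 l5 l6
  refine ⟨⟨?_, ?_, ?_, ?_, ?_⟩, ?_⟩
  · linarith
  · linarith
  · linarith
  · linarith
  · linarith
  · show ζ.im < 0
    linarith

theorem john_below {z : ℂ} (hz : z ∈ kochP h ∩ {z | z.im < 0}) :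
    JohnFrom g (kochDomain g h) kochCenter 0 z := by
  have hg := H.g_pos
  have hg' := H.g_lt
  have hQ : Convex ℝ (kochP h ∩ {z : ℂ | z.im < 0}) :=
    (convex_kochP h).inter (convex_halfSpace_im_lt 0)
  have hn : ‖kochCenter - z‖ ≤ 5 / 2 := by
    obtain ⟨⟨-, -, a3, a4, a5⟩, a6⟩ := hz
    have a6 : z.im < 0 := a6
    refine (Complex.norm_le_abs_re_add_abs_im _).trans ?_
    rw [Complex.sub_re, Complex.sub_im, kochCenter_re, kochCenter_im]
    have e1 : |1 / 2 - z.re| ≤ 3 / 2 := abs_le.2 ⟨by linarith, by linarith⟩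
    have e2 : |-1 - z.im| ≤ 1 := abs_le.2 ⟨by linarith, by linarith⟩
    linarith
  have key : ∀ τ ∈ Icc (0 : ℝ) 1, ∀ ζ : ℂ, ‖ζ - (z + τ * (kochCenter - z))‖ <
      g * (0 + τ * ‖kochCenter - z‖) → ζ ∈ kochDomain g h := by
    intro τ hτ ζ hζ
    rcases eq_or_ne τ 0 with rfl | h0
    · simp only [zero_mul, zero_add, mul_zero] at hζ
      exact absurd hζ (not_lt.2 (norm_nonneg _))
    refine H.below_subset (hQ.ball_lineMap_subset (u := z) (v := kochCenter) (R := 1) le_rfl one_pos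
      (by simpa using fun _ _ => hz) H.ball_center_subset hτ.1 hτ.2 h0 ?_)
    rw [mem_ball, dist_eq_norm]
    refine hζ.trans_le ?_
    have h1 := mul_le_mul hg'.le hn (norm_nonneg _) (by norm_num)
    have := mul_le_mul_of_nonneg_left h1 hτ.1
    linarith
  have := JohnFrom.step (J := g) (x₀ := kochCenter) (t := 0) IsSimilarity.id (u := z)
    (v := kochCenter) key ?_
  · simpa using this
  · refine JohnFrom.refl fun ζ hζ => ?_
    rw [mem_ball, dist_eq_norm] at hζ
    exact key 1 (by simp) ζ (by simpa using hζ)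

theorem johnFrom_center {z : ℂ} (hz : z ∈ kochDomain g h) :
    JohnFrom g (kochDomain g h) kochCenter 0 z := by
  rcases lt_or_ge z.im 0 with h0 | h0
  · exact H.john_below ⟨hz.1, h0⟩
  rcases H.domain_subset hz with ⟨hB, hK⟩ | h1
  · rcases hB with hB | hB
    · exact absurd hB hK
    · obtain ⟨n, hn, hU⟩ := mem_iUnion₂.1 hB
      obtain ⟨k, rfl⟩ := even_iff_exists_two_mul.1 hn
      exact H.john_of_U k _ 1 H.descent_id (fun z hz => H.B_diff_K_subset hz) z hU
  · exact absurd h1 (not_lt.2 h0)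
end KochParam

/-! ### Transfer to the Euclidean plane and the John domains -/

/-- The isometry between the complex numbers and the Euclidean plane. -/
noncomputable def toPlane : ℂ ≃ₗᵢ[ℝ] EuclideanSpace ℝ (Fin 2) :=
  Complex.orthonormalBasisOneI.repr

theorem toPlane_frontier (Ω : Set ℂ) : frontier (toPlane '' Ω) = toPlane '' frontier Ω :=
  (toPlane.toHomeomorph.image_frontier Ω).symm

theorem toPlane_infDist (z : ℂ) (Ω : Set ℂ) :
    infDist (toPlane z) (frontier (toPlane '' Ω)) = infDist z (frontier Ω) := by
  rw [toPlane_frontier, infDist_image toPlane.isometry]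

theorem toPlane_dimH (Ω : Set ℂ) : dimH (frontier (toPlane '' Ω)) = dimH (frontier Ω) := by
  rw [toPlane_frontier, toPlane.isometry.dimH_image]

theorem HasUnitSpeedOn.toPlane {γ : ℝ → ℂ} {s : Set ℝ} (h : HasUnitSpeedOn γ s) :
    HasUnitSpeedOn (fun t => _root_.toPlane (γ t)) s := by
  intro x hx y hy
  rw [← h hx hy]
  simp only [eVariationOn, _root_.toPlane.isometry.edist_eq]

theorem isJordanDomain_toPlane {Ω : Set ℂ} (h1 : IsOpen Ω) (h2 : IsConnected Ω)
    (h3 : Bornology.IsBounded Ω) (h4 : IsJordanCurve (frontier Ω)) :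
    IsJordanDomain (toPlane '' Ω) := by
  refine ⟨toPlane.toHomeomorph.isOpenMap _ h1, h2.image _ toPlane.continuous.continuousOn,
    toPlane.lipschitz.isBounded_image h3, ?_⟩
  rw [toPlane_frontier]
  exact h4.image toPlane.continuous.continuousOn toPlane.injective.injOn

theorem isConnected_of_johnFrom {J : ℝ} {Ω : Set ℂ} {x₀ : ℂ} (hJ : 0 < J) (hx : x₀ ∈ Ω)
    (h : ∀ z ∈ Ω, JohnFrom J Ω x₀ 0 z) : IsConnected Ω := by
  refine ⟨⟨x₀, hx⟩, isPreconnected_of_forall x₀ fun z hz => ?_⟩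
  obtain ⟨l, γ, h1, h2, h3, h4, h5⟩ := h z hz
  refine ⟨γ '' Icc 0 l, ?_, ⟨l, right_mem_Icc.2 h1, h4⟩, ⟨0, left_mem_Icc.2 h1, h3⟩,
    isPreconnected_Icc.image _ (UnitSpeed.lipschitzOnWith h2).continuousOn⟩
  rintro _ ⟨t, ht, rfl⟩
  rcases ht.1.eq_or_lt with rfl | h0
  · rwa [h3]
  · exact h5 t ht (mem_ball_self (by rw [zero_add]; positivity))

theorem isJohnDomain_toPlane {J : ℝ} {Ω : Set ℂ} {x₀ : ℂ} (hJ : 0 < J) (ho : IsOpen Ω)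
    (hf : (frontier Ω).Nonempty) (hx : x₀ ∈ Ω)
    (h : ∀ z ∈ Ω, JohnFrom J Ω x₀ 0 z) : IsJohnDomain J (toPlane '' Ω) := by
  refine ⟨hJ, toPlane x₀, mem_image_of_mem _ hx, ?_⟩
  rintro _ ⟨z, hz, rfl⟩
  obtain ⟨l, γ, h1, h2, h3, h4, h5⟩ := h z hz
  refine ⟨l, fun t => toPlane (γ t), h1, h2.toPlane, congrArg toPlane h3, congrArg toPlane h4, fun t ht => ⟨?_, ?_⟩⟩
  · refine mem_image_of_mem _ ?_
    rcases ht.1.eq_or_lt with rfl | h0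
    · rwa [h3]
    · exact h5 t ht (mem_ball_self (by rw [zero_add]; positivity))
  · rw [toPlane_infDist]
    refine (le_infDist hf).2 fun y hy => ?_
    by_contra hlt
    push Not at hlt
    have := h5 t ht (show y ∈ ball (γ t) (J * (0 + t)) by rwa [mem_ball, dist_comm, zero_add])
    rw [ho.frontier_eq] at hy
    exact hy.2 this

namespace KochParam
variable {g h : ℝ} (H : KochParam g h)
include H

theorem isJordanDomain : IsJordanDomain (toPlane '' kochDomain g h) :=
  isJordanDomain_toPlane H.isOpen_domain
    (isConnected_of_johnFrom H.g_pos H.center_mem_domain fun _ hz => H.johnFrom_center hz)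
    (H.isBounded_P.subset sdiff_subset) H.isJordanCurve_frontier

theorem isJohnDomain : IsJohnDomain g (toPlane '' kochDomain g h) := by
  refine isJohnDomain_toPlane H.g_pos H.isOpen_domain ?_ H.center_mem_domain
    fun _ hz => H.johnFrom_center hz
  rw [H.frontier_domain]
  exact ⟨0, Or.inl H.zero_mem_K⟩
end KochParam

theorem exists_kochParam {g : ℝ} (h0 : 0 < g) (h1 : g < 2 / 5) : ∃ h, KochParam g h := by
  refine ⟨√((1 - 2 * g) / 4), h0, h1, Real.sqrt_pos.2 (by linarith), ?_⟩
  rw [Real.sq_sqrt (by linarith)]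
  ring

theorem johnFrom_ball {z : ℂ} (hz : z ∈ ball (0 : ℂ) 1) : JohnFrom 1 (ball (0 : ℂ) 1) 0 0 z := by
  have hz : ‖z‖ < 1 := by simpa using hz
  have key : ∀ τ ∈ Icc (0 : ℝ) 1, ∀ ζ : ℂ, ‖ζ - (z + τ * (0 - z))‖ < 1 * (0 + τ * ‖0 - z‖) →
      ζ ∈ ball (0 : ℂ) 1 := by
    intro τ hτ ζ hζ
    rw [mem_ball, dist_zero_right]
    rw [zero_sub, norm_neg, one_mul, zero_add] at hζ
    have e : z + τ * (-z) = ((1 - τ : ℝ) : ℂ) * z := by push_cast; ring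
    rw [e] at hζ
    have h1 : ‖((1 - τ : ℝ) : ℂ) * z‖ = (1 - τ) * ‖z‖ := by
      rw [norm_mul, Complex.norm_real, Real.norm_eq_abs, abs_of_nonneg (by linarith [hτ.2])]
    have h2 := norm_le_norm_add_norm_sub' ζ (((1 - τ : ℝ) : ℂ) * z)
    linarith
  have := JohnFrom.step (J := 1) (x₀ := 0) (t := 0) IsSimilarity.id (u := z) (v := 0) key ?_
  · simpa using this
  · refine JohnFrom.refl fun ζ hζ => ?_
    rw [mem_ball, dist_eq_norm] at hζ
    exact key 1 (by simp) ζ (by simpa using hζ)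

theorem one_le_dimH_sphere : 1 ≤ dimH (sphere (0 : ℂ) 1) := by
  have h1 : Icc (-1 : ℝ) 1 ⊆ Complex.re '' sphere (0 : ℂ) 1 := by
    intro x hx
    refine ⟨⟨x, √(1 - x ^ 2)⟩, ?_, rfl⟩
    rw [mem_sphere_zero_iff_norm, ← sq_eq_sq₀ (norm_nonneg _) one_pos.le,
      ← Complex.normSq_eq_norm_sq, Complex.normSq_apply]
    have : √(1 - x ^ 2) * √(1 - x ^ 2) = 1 - x ^ 2 := Real.mul_self_sqrt (by nlinarith [hx.1, hx.2])
    show x * x + √(1 - x ^ 2) * √(1 - x ^ 2) = 1 ^ 2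
    rw [this]; ring
  have h2 : dimH (Icc (-1 : ℝ) 1) = 1 := by
    rw [Real.dimH_of_nonempty_interior (by rw [interior_Icc]; exact nonempty_Ioo.2 (by norm_num))]
    simp
  have h3 : LipschitzWith 1 Complex.re := by
    refine LipschitzWith.of_dist_le_mul fun z w => ?_
    rw [NNReal.coe_one, one_mul, Real.dist_eq, dist_eq_norm, ← Complex.sub_re]
    exact Complex.abs_re_le_norm _
  calc 1 = dimH (Icc (-1 : ℝ) 1) := h2.symm
    _ ≤ _ := dimH_mono h1
    _ ≤ _ := h3.dimH_image_le _

theorem IsJohnDomain.mono {J J' : ℝ} {Ω : Set (EuclideanSpace ℝ (Fin 2))} (h : IsJohnDomain J Ω)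
    (h0 : 0 < J') (hJ : J' ≤ J) : IsJohnDomain J' Ω := by
  obtain ⟨-, x₀, hx₀, H⟩ := h
  refine ⟨h0, x₀, hx₀, fun x hx => ?_⟩
  obtain ⟨l, γ, h1, h2, h3, h4, h5⟩ := H x hx
  exact ⟨l, γ, h1, h2, h3, h4, fun t ht => ⟨(h5 t ht).1,
    (mul_le_mul_of_nonneg_right hJ ht.1).trans (h5 t ht).2⟩⟩

/-- For J ≥ 2/5 the Koch parameters are not available, but 2J ≥ 4/5 > log 2 makes the required
dimension at most 1. The unit disc is 1-John and its boundary has dimension at least 1. -/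
theorem exists_john_domain {J : ℝ} (h0 : 0 < J) (h1 : J < 1 / 2) :
    ∃ Ω : Set (EuclideanSpace ℝ (Fin 2)), IsJordanDomain Ω ∧ IsJohnDomain J Ω ∧
      ENNReal.ofReal (2 - 2 / Real.log 2 * J) ≤ dimH (frontier Ω) := by
  rcases lt_or_ge J (2 / 5) with h2 | h2
  · obtain ⟨h, H⟩ := exists_kochParam h0 h2
    refine ⟨_, H.isJordanDomain, H.isJohnDomain, ?_⟩
    rw [toPlane_dimH]
    exact H.two_sub_le_dimH_frontier
  · have hfr : frontier (ball (0 : ℂ) 1) = sphere 0 1 := frontier_ball _ one_ne_zero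
    refine ⟨toPlane '' ball 0 1, isJordanDomain_toPlane isOpen_ball
      (isConnected_of_johnFrom one_pos (mem_ball_self one_pos) fun _ => johnFrom_ball)
      isBounded_ball (hfr ▸ isJordanCurve_sphere), ?_, ?_⟩
    · refine (isJohnDomain_toPlane one_pos isOpen_ball ?_ (mem_ball_self one_pos)
        fun _ => johnFrom_ball).mono h0 (by linarith)
      rw [hfr]
      exact ⟨1, by simp⟩
    · rw [toPlane_dimH, hfr]
      refine le_trans ?_ one_le_dimH_sphere
      rw [← ENNReal.ofReal_one]
      refine ENNReal.ofReal_le_ofReal ?_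
      have hl1 : Real.log 2 < 0.7 := Real.log_two_lt_d9.trans (by norm_num)
      have hl : 0 < Real.log 2 := Real.log_pos one_lt_two
      have : 1 ≤ 2 / Real.log 2 * J := by
        rw [div_mul_eq_mul_div, le_div_iff₀ hl]
        linarith
      linarith

/-! ### Joining points to the hub below the base -/

/-- The closed thin triangle below the base. -/
def kochD (g h : ℝ) : Set ℂ :=
  {ζ | ζ.im ≤ 0 ∧ 0 ≤ 2 * h * ζ.im + g * ζ.re ∧ 0 ≤ 2 * h * ζ.im + g * (1 - ζ.re)}

/-- The kite formed by the opening and a part of the thin triangle. -/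
def kochKite (g h : ℝ) : Set ℂ :=
  {ζ | g / 2 * ζ.im ≤ h * (ζ.re - (1 - g) / 2) ∧ g / 2 * ζ.im ≤ h * ((1 + g) / 2 - ζ.re) ∧
    0 ≤ 2 * h * ζ.im + g * ζ.re ∧ 0 ≤ 2 * h * ζ.im + g * (1 - ζ.re)}

/-- The region below the Koch curve, together with the thin triangle. -/
def kochX (g h : ℝ) : Set ℂ := kochB g h ∪ kochD g h

/-- The center of the thin triangle. -/
noncomputable def kochHub (g h : ℝ) : ℂ := ⟨1 / 2, -(g / (8 * h))⟩

@[simp] theorem kochHub_re (g h : ℝ) : (kochHub g h).re = 1 / 2 := rfl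
@[simp] theorem kochHub_im (g h : ℝ) : (kochHub g h).im = -(g / (8 * h)) := rfl
theorem convex_halfPlane (α β γ : ℝ) : Convex ℝ {z : ℂ | 0 ≤ α * z.re + β * z.im + γ} := by
  intro z hz w hw s t hs ht hst
  have hz : 0 ≤ α * z.re + β * z.im + γ := hz
  have hw : 0 ≤ α * w.re + β * w.im + γ := hw
  have e : s = 1 - t := by linarith
  show 0 ≤ α * (s • z + t • w).re + β * (s • z + t • w).im + γ
  simp only [Complex.add_re, Complex.add_im, Complex.real_smul, Complex.mul_re, Complex.mul_im,
    Complex.ofReal_re, Complex.ofReal_im, zero_mul, sub_zero, add_zero]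
  have := mul_nonneg hs hz
  have := mul_nonneg ht hw
  subst e
  linarith

theorem convex_kochD (g h : ℝ) : Convex ℝ (kochD g h) := by
  have : kochD g h = {z : ℂ | 0 ≤ 0 * z.re + (-1) * z.im + 0} ∩
      ({z : ℂ | 0 ≤ g * z.re + 2 * h * z.im + 0} ∩
      {z : ℂ | 0 ≤ -g * z.re + 2 * h * z.im + g}) := by
    ext z
    simp only [kochD, mem_ofPred_eq, mem_inter_iff]
    refine and_congr ⟨fun h => by linarith, fun h => by linarith⟩
      (and_congr ⟨fun h => by linarith, fun h => by linarith⟩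
      ⟨fun h => by linarith, fun h => by linarith⟩)
  rw [this]
  exact (convex_halfPlane _ _ _).inter ((convex_halfPlane _ _ _).inter (convex_halfPlane _ _ _))

theorem convex_kochKite (g h : ℝ) : Convex ℝ (kochKite g h) := by
  have : kochKite g h = {z : ℂ | 0 ≤ h * z.re + (-(g / 2)) * z.im + -(h * (1 - g) / 2)} ∩
      ({z : ℂ | 0 ≤ -h * z.re + (-(g / 2)) * z.im + h * (1 + g) / 2} ∩
      ({z : ℂ | 0 ≤ g * z.re + 2 * h * z.im + 0} ∩
      {z : ℂ | 0 ≤ -g * z.re + 2 * h * z.im + g})) := by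
    ext z
    simp only [kochKite, mem_ofPred_eq, mem_inter_iff]
    refine and_congr ⟨fun h => by linarith, fun h => by linarith⟩
      (and_congr ⟨fun h => by linarith, fun h => by linarith⟩
      (and_congr ⟨fun h => by linarith, fun h => by linarith⟩
      ⟨fun h => by linarith, fun h => by linarith⟩))
  rw [this]
  exact (convex_halfPlane _ _ _).inter ((convex_halfPlane _ _ _).inter
    ((convex_halfPlane _ _ _).inter (convex_halfPlane _ _ _)))

theorem kochD_subset (g h : ℝ) : kochD g h ⊆ kochX g h := subset_union_right
theorem kochReflect_mem_D {g h : ℝ} {z : ℂ} (hz : z ∈ kochD g h) : kochReflect z ∈ kochD g h :=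
  ⟨by simpa using hz.1, by simpa using hz.2.2, by simpa using hz.2.1⟩

theorem kochReflect_hub (g h : ℝ) : kochReflect (kochHub g h) = kochHub g h := by
  apply Complex.ext
  · simp; norm_num
  · simp

namespace KochParam
variable {g h : ℝ} (H : KochParam g h)
include H

theorem M_subset_B : kochM g h ⊆ kochB g h := fun _ hz => Or.inr (mem_iUnion₂.2 ⟨0, Even.zero, hz⟩)

theorem kite_subset : kochKite g h ⊆ kochX g h := by
  rintro z ⟨h1, h2, h3, h4⟩
  rcases le_total 0 z.im with h0 | h0
  · exact Or.inl (H.M_subset_B ⟨h0, h1, h2⟩)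
  · exact Or.inr ⟨h0, h3, h4⟩

theorem M_subset_kite : kochM g h ⊆ kochKite g h := by
  intro z hz
  have hT := H.M_subset hz
  have h1 := H.re_nonneg_of_mem_T hT
  have h2 := H.re_le_of_mem_T hT
  have hh := H.h_pos
  have hg := H.g_pos
  have h3 : 0 ≤ h * z.im := mul_nonneg hh.le hz.1
  refine ⟨hz.2.1, hz.2.2, ?_, ?_⟩ <;> nlinarith

theorem hub_bound : g / 4 ≤ g / (8 * h) := by
  have hh := H.h_pos
  have hg := H.g_pos
  have hh' := H.h_lt
  rw [div_le_div_iff₀ (by norm_num) (by positivity)]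
  nlinarith

/-- The thin triangle and the kite are convex, and both contain this ball. Segments to the hub
therefore have room that grows linearly, both from cells on the base and from cells on the sides of
the opening. -/
theorem ball_hub_subset : ball (kochHub g h) (g / 4) ⊆ kochD g h ∩ kochKite g h := by
  intro ζ hζ
  rw [mem_ball, dist_eq_norm] at hζ
  have hg := H.g_pos
  have hg' := H.g_lt
  have hh := H.h_pos
  have hb := H.hub_bound
  have hh2 := H.lt_h
  have e1 : h * (g / (8 * h)) = g / 8 := by field_simp
  have hgp : 0 ≤ g / (8 * h) := by positivity
  have l0 := linear_gt_of_norm_lt (α := 0) (β := -1) (N := 1) (by norm_num) (by norm_num) hζ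
  have l1 := linear_gt_of_norm_lt (α := g) (β := 2 * h) (N := 1 - g) (by linarith)
    (by linarith [H.sq]) hζ
  have l2 := linear_gt_of_norm_lt (α := -g) (β := 2 * h) (N := 1 - g) (by linarith)
    (by linarith [H.sq]) hζ
  have l3 := linear_gt_of_norm_lt (α := h) (β := -(g / 2)) (N := (1 - g) / 2) (by linarith)
    (by linarith [H.sq]) hζ
  have l4 := linear_gt_of_norm_lt (α := -h) (β := -(g / 2)) (N := (1 - g) / 2) (by linarith)
    (by linarith [H.sq]) hζ
  simp only [kochHub_re, kochHub_im] at l0 l1 l2 l3 l4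
  have k1 : 0 ≤ g / 2 * (g / (8 * h)) := by positivity
  have k2 : (1 - g) / 2 * (g / 4) ≤ h * (g / 2) := by
    have : 1 - g ≤ 4 * h := by nlinarith [H.sq]
    nlinarith
  have k3 : (1 - g) * (g / 4) ≤ g / 4 := by nlinarith
  refine ⟨⟨?_, ?_, ?_⟩, ?_, ?_, ?_, ?_⟩ <;> linarith

theorem hub_mem : kochHub g h ∈ kochD g h ∩ kochKite g h :=
  H.ball_hub_subset (mem_ball_self (by linarith [H.g_pos]))

theorem LL_mem_D {z : ℂ} (hz : z ∈ kochD g h) : kochL h (kochL h z) ∈ kochD g h := by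
  obtain ⟨h1, h2, h3⟩ := hz
  have hg := H.g_pos
  have hg' := H.g_lt
  refine ⟨?_, ?_, ?_⟩
  · rw [H.LL_im]; nlinarith
  · rw [H.LL_im, H.LL_re]; nlinarith
  · rw [H.LL_im, H.LL_re]; nlinarith

theorem LR_mem_M {z : ℂ} (hz : z ∈ kochD g h) : kochL h (kochR h z) ∈ kochM g h := by
  obtain ⟨h0, h1, h2⟩ := hz
  have hg := H.g_pos
  have hg' := H.g_lt
  have hh := H.h_pos
  have hs := H.sq_gt
  have p1 : 0 ≤ z.re := nonneg_of_mul_nonneg_right (a := g) (by nlinarith) hg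
  have p2 : 0 ≤ 1 - z.re := nonneg_of_mul_nonneg_right (a := g) (by nlinarith) hg
  have q1 : 0 ≤ g * h * (1 - z.re) + (h ^ 2 - (g / 2) ^ 2) * z.im := by
    have : 0 ≤ 2 * h * (g * h * (1 - z.re) + (h ^ 2 - (g / 2) ^ 2) * z.im) := by
      have i1 := mul_nonneg (sub_nonneg.2 hs.le) h2
      have i2 : 0 ≤ g * (1 - z.re) * (h ^ 2 + (g / 2) ^ 2) := by positivity
      nlinarith
    exact nonneg_of_mul_nonneg_right this (by linarith)
  have q2 : 0 ≤ -z.im * (h ^ 2 + (g / 2) ^ 2) := mul_nonneg (by linarith) (by positivity)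
  refine ⟨?_, ?_, ?_⟩
  · rw [H.LR_im]
    have : 0 ≤ 2 * h * (h * z.re + g / 2 * z.im) := by
      have := mul_nonneg (sub_nonneg.2 hs.le) p1
      nlinarith
    exact nonneg_of_mul_nonneg_right this (by linarith)
  · rw [H.LR_im, H.LR_re]; linarith
  · rw [H.LR_im, H.LR_re]; linarith

theorem LL_mem_X {z : ℂ} (hz : z ∈ kochX g h) : kochL h (kochL h z) ∈ kochX g h :=
  hz.imp H.LL_mem H.LL_mem_D

theorem LR_mem_X {z : ℂ} (hz : z ∈ kochX g h) : kochL h (kochR h z) ∈ kochX g h := by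
  rcases hz with hz | hz
  · exact Or.inl (H.LR_mem hz)
  · exact Or.inl (H.M_subset_B (H.LR_mem_M hz))

theorem reflect_mem_U (n : ℕ) : ∀ z ∈ kochU g h n, kochReflect z ∈ kochU g h n := by
  induction n with
  | zero =>
    rintro z ⟨h0, h1, h2⟩
    refine ⟨by simpa using h0, ?_, ?_⟩
    · rw [kochReflect_re, kochReflect_im]; linarith
    · rw [kochReflect_re, kochReflect_im]; linarith
  | succ n ih =>
    rintro _ (⟨z, hz, rfl⟩ | ⟨z, hz, rfl⟩)
    · rw [reflect_kochL]
      exact Or.inr (mem_image_of_mem _ (ih z hz))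
    · rw [reflect_kochR]
      exact Or.inl (mem_image_of_mem _ (ih z hz))

/-- The openings are permuted by the reflection, and the curve is both approximated by them and
close to them at every level. -/
theorem reflect_mem_K {z : ℂ} (hz : z ∈ kochK h) : kochReflect z ∈ kochK h := by
  rw [H.isCompact_K.isClosed.mem_iff_infDist_zero ⟨0, H.zero_mem_K⟩]
  have hlim : Tendsto (fun n : ℕ => 2 * ‖kochApex h‖ ^ n + 2 * ‖kochApex h‖ ^ n) atTop (𝓝 0) := by
    simpa using H.tendsto_apex_pow.add H.tendsto_apex_pow
  refine le_antisymm (ge_of_tendsto' hlim fun n => ?_) infDist_nonneg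
  obtain ⟨w, hw, -, h1⟩ := H.K_near_U n z hz
  obtain ⟨k, hk, h2⟩ := H.U_near_K n _ (H.reflect_mem_U n w hw)
  refine (infDist_le_dist_of_mem hk).trans ((dist_triangle _ (kochReflect w) _).trans ?_)
  rw [isSimilarity_reflect.dist_eq, one_mul, dist_comm z]
  exact add_le_add h1 h2

theorem reflect_mem_B {z : ℂ} (hz : z ∈ kochB g h) : kochReflect z ∈ kochB g h := by
  rcases hz with hz | hz
  · exact Or.inl (H.reflect_mem_K hz)
  · obtain ⟨n, hn, hz⟩ := mem_iUnion₂.1 hz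
    exact Or.inr (mem_iUnion₂.2 ⟨n, hn, H.reflect_mem_U n z hz⟩)

theorem reflect_mem_X {z : ℂ} (hz : z ∈ kochX g h) : kochReflect z ∈ kochX g h :=
  hz.imp H.reflect_mem_B kochReflect_mem_D

theorem RL_eq (z : ℂ) : kochR h (kochL h z) = kochReflect (kochL h (kochR h (kochReflect z))) := by
  rw [reflect_kochL, reflect_kochR, kochReflect_reflect]

theorem RR_eq (z : ℂ) : kochR h (kochR h z) = kochReflect (kochL h (kochL h (kochReflect z))) := by
  rw [reflect_kochL, reflect_kochL, kochReflect_reflect]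

theorem RL_mem_X {z : ℂ} (hz : z ∈ kochX g h) : kochR h (kochL h z) ∈ kochX g h := by
  rw [H.RL_eq]
  exact H.reflect_mem_X (H.LR_mem_X (H.reflect_mem_X hz))

theorem RR_mem_X {z : ℂ} (hz : z ∈ kochX g h) : kochR h (kochR h z) ∈ kochX g h := by
  rw [H.RR_eq]
  exact H.reflect_mem_X (H.LL_mem_X (H.reflect_mem_X hz))

theorem norm_hub_sq (h6 : g < 1 / 6) : ‖kochHub g h‖ ≤ 51 / 100 := by
  have hh := H.h_pos
  have hg := H.g_pos
  have h1 : 1 / 3 < h := by nlinarith [H.sq]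
  have h2 : g / (8 * h) ≤ 1 / 16 := by
    rw [div_le_iff₀ (by positivity)]; linarith
  have h3 : 0 ≤ g / (8 * h) := by positivity
  refine (le_abs_self _).trans (abs_le_of_sq_le_sq ?_ (by norm_num))
  rw [← Complex.normSq_eq_norm_sq, Complex.normSq_apply, kochHub_re, kochHub_im]
  nlinarith

theorem dist_hub_M (h6 : g < 1 / 6) {z : ℂ} (hz : z ∈ kochM g h) : ‖z - kochHub g h‖ ≤ 1 / 2 := by
  have hh := H.h_pos
  have hg := H.g_pos
  have hsq := H.sq
  obtain ⟨h0, h1, h2⟩ := hz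
  have h13 : 2 / 5 < h := by nlinarith
  have hhb : g / (8 * h) * (8 * h) = g := by field_simp
  set b := g / (8 * h)
  have hb0 : 0 ≤ b := by positivity
  have hb1 : h + b ≤ 1 / 2 := by
    have k1 : 2 - 3 * g ≤ 4 * h := by nlinarith
    have : (h + b) * (8 * h) ≤ 1 / 2 * (8 * h) := by nlinarith
    exact le_of_mul_le_mul_right this (by positivity)
  obtain ⟨t, ht⟩ : ∃ t, z.im = h * t := ⟨z.im / h, by field_simp⟩
  have ht0 : 0 ≤ t := nonneg_of_mul_nonneg_right (by rwa [← ht]) hh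
  have e1 : z.re - 1 / 2 ≤ g / 2 * (1 - t) := by
    refine le_of_mul_le_mul_left (a := h) ?_ hh
    rw [ht] at h2; linarith
  have e2 : -(g / 2 * (1 - t)) ≤ z.re - 1 / 2 := by
    refine le_of_mul_le_mul_left (a := h) ?_ hh
    rw [ht] at h1; linarith
  have ht1 : t ≤ 1 := by
    have : 0 ≤ g / 2 * (1 - t) := by linarith
    linarith [nonneg_of_mul_nonneg_right this (by linarith)]
  refine (le_abs_self _).trans (abs_le_of_sq_le_sq ?_ (by norm_num))
  rw [← Complex.normSq_eq_norm_sq, Complex.normSq_apply, Complex.sub_re, Complex.sub_im,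
    kochHub_re, kochHub_im, ← pow_two, ← pow_two, ht]
  have k1 := sq_le_sq' e2 e1
  have k2 : (g / 2 * (1 - t)) ^ 2 ≤ 1 / 144 * (1 - t) := by
    have i1 : (g / 2) ^ 2 ≤ 1 / 144 := by nlinarith
    have i2 : (1 - t) ^ 2 ≤ 1 - t := by nlinarith
    rw [mul_pow]
    exact mul_le_mul i1 i2 (sq_nonneg _) (by norm_num)
  have hbb : b ≤ 1 / 10 := by linarith
  have k3 : (h * t - -b) ^ 2 ≤ t * (h + b) ^ 2 + (1 - t) * b ^ 2 := by
    have : t * (h + b) ^ 2 + (1 - t) * b ^ 2 - (h * t - -b) ^ 2 = h ^ 2 * (t * (1 - t)) := by ring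
    have h3 : 0 ≤ h ^ 2 * (t * (1 - t)) := by
      have : 0 ≤ 1 - t := by linarith
      positivity
    linarith
  have k4 : (h + b) ^ 2 ≤ 1 / 4 := by nlinarith
  have k5 : b ^ 2 ≤ 1 / 100 := by nlinarith
  have k6 := mul_le_mul_of_nonneg_left k4 ht0
  have k7 := mul_le_mul_of_nonneg_left k5 (sub_nonneg.2 ht1)
  linarith

/-- The factor 1 - (1 - g) / 2 matters: it cancels the denominator 1 - κ in the cost of
`Joins.segment` and leaves a bound with the telescoping factor 1 - κ ^ a. -/
theorem dist_hub_LL (h6 : g < 1 / 6) :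
    ‖kochL h (kochL h (kochHub g h)) - kochHub g h‖ ≤ (1 - (1 - g) / 2) * (51 / 100) := by
  have e : kochL h (kochL h (kochHub g h)) - kochHub g h =
      ((-(1 - (1 - g) / 2) : ℝ) : ℂ) * kochHub g h := by
    apply Complex.ext
    · rw [Complex.sub_re, H.LL_re, Complex.re_ofReal_mul]; ring
    · rw [Complex.sub_im, H.LL_im, Complex.im_ofReal_mul]; ring
  rw [e, norm_mul, Complex.norm_real, norm_neg, Real.norm_eq_abs,
    abs_of_pos (by linarith [H.g_pos])]
  exact mul_le_mul_of_nonneg_left (H.norm_hub_sq h6) (by linarith [H.g_pos])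

theorem dist_hub_LR (h6 : g < 1 / 6) :
    ‖kochL h (kochR h (kochHub g h)) - kochHub g h‖ ≤ (1 - (1 - g) / 2) * (51 / 100) := by
  have hh := H.h_pos
  have hg := H.g_pos
  have hsq := H.sq
  have h13 : 2 / 5 < h := by nlinarith
  have hhb : g / (8 * h) * (8 * h) = g := by field_simp
  refine (le_abs_self _).trans (abs_le_of_sq_le_sq ?_ (by linarith))
  rw [← Complex.normSq_eq_norm_sq, Complex.normSq_apply, Complex.sub_re, Complex.sub_im,
    H.LR_re, H.LR_im, kochHub_re, kochHub_im]
  set b := g / (8 * h)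
  have hb0 : 0 ≤ b := by positivity
  have hb1 : h + b ≤ 1 / 2 := by
    have k1 : 2 - 3 * g ≤ 4 * h := by nlinarith
    have : (h + b) * (8 * h) ≤ 1 / 2 * (8 * h) := by nlinarith
    exact le_of_mul_le_mul_right this (by positivity)
  have e1 : (1 - g) / 2 + g / 2 * (1 / 2) - h * -b - 1 / 2 = -(g / 8) := by linarith
  rw [e1]
  have hb2 : b ≤ 1 / 16 := by nlinarith
  have k1 : h * (1 / 2) + g / 2 * -b - -b ≤ 1 / 4 + g / 12 := by nlinarith
  have k2 : 0 ≤ h * (1 / 2) + g / 2 * -b - -b := by nlinarith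
  have k3 := mul_self_le_mul_self k2 k1
  nlinarith
end KochParam

/-- The unit of cost at scale `x`. -/
noncomputable def kochCost (a g N x : ℝ) : ℝ := N / (a * g) * (g * x) ^ a

theorem kochCost_scale {a g N x ρ : ℝ} (hg : 0 ≤ g) (hx : 0 ≤ x) (hρ : 0 ≤ ρ) :
    ρ ^ a * kochCost a g N x = kochCost a g N (ρ * x) := by
  rw [kochCost, kochCost, mul_left_comm g ρ x, Real.mul_rpow hρ (by positivity)]
  ring

theorem kochCost_mono {a g N M x y : ℝ} (ha : 0 < a) (hg : 0 < g) (hN : 0 ≤ N) (hNM : N ≤ M)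
    (hx : 0 ≤ x) (hxy : x ≤ y) : kochCost a g N x ≤ kochCost a g M y := by
  have hM : 0 ≤ M := hN.trans hNM
  unfold kochCost
  gcongr

theorem kochCost_le {a g N x r : ℝ} (ha : 0 < a) (hg : 0 < g) (hN : 0 ≤ N) (hx : 0 ≤ x)
    (hxr : g * x ≤ r) : kochCost a g N x ≤ N / (a * g) * r ^ a := by
  unfold kochCost
  gcongr

/-- The four similarities of the second level. -/
def kochSecond (h : ℝ) : Set (ℂ → ℂ) :=
  {fun z => kochL h (kochL h z), fun z => kochL h (kochR h z), fun z => kochR h (kochL h z),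
    fun z => kochR h (kochR h z)}

namespace KochParam
variable {g h a : ℝ} (H : KochParam g h)
include H

theorem L_LL (z w : ℂ) : dist (kochL h (kochL h z)) (kochL h (kochL h w)) =
    (1 - g) / 2 * dist z w := by
  rw [dist_kochL, dist_kochL, ← mul_assoc, H.apex_mul_apex]

theorem L_LR (z w : ℂ) : dist (kochL h (kochR h z)) (kochL h (kochR h w)) =
    (1 - g) / 2 * dist z w := by
  rw [dist_kochL, dist_kochR, ← mul_assoc, H.apex_mul_apex]

theorem L_RL (z w : ℂ) : dist (kochR h (kochL h z)) (kochR h (kochL h w)) =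
    (1 - g) / 2 * dist z w := by
  rw [dist_kochR, dist_kochL, ← mul_assoc, H.apex_mul_apex]

/-- A similarity of the second level moves the hub along a segment of small cost. -/
theorem joins_hub (h6 : g < 1 / 6) (ha : 0 < a) (ha1 : a ≤ 1) {G : ℂ → ℂ}
    (hG : G ∈ kochSecond h) :
    ∃ L, L ≤ 1 ∧ Joins a (kochX g h) (kochHub g h) (G (kochHub g h)) L
      (ENNReal.ofReal (51 / 100 * (g / 4) ^ (a - 1) / a * (1 - ((1 - g) / 2) ^ a))) := by
  have hg := H.g_pos
  have hl0 : 0 < (1 - g) / 2 := by linarith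
  have hl1 : (1 - g) / 2 < 1 := by linarith
  have hla : ((1 - g) / 2) ^ a ≤ 1 := Real.rpow_le_one hl0.le hl1.le ha.le
  have key : ∀ G : ℂ → ℂ, IsSimilarity G ((1 - g) / 2) → ∀ Q : Set ℂ, Convex ℝ Q → Q ⊆ kochX g h →
      ball (kochHub g h) (g / 4) ⊆ Q → MapsTo G (kochD g h) Q →
      ‖G (kochHub g h) - kochHub g h‖ ≤ (1 - (1 - g) / 2) * (51 / 100) →
      ∃ L, L ≤ 1 ∧ Joins a (kochX g h) (kochHub g h) (G (kochHub g h)) L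
        (ENNReal.ofReal (51 / 100 * (g / 4) ^ (a - 1) / a * (1 - ((1 - g) / 2) ^ a))) := by
    intro G hG Q hQ hQX hball hGD hd
    refine ⟨_, ?_, ((Joins.segment (X := kochX g h) ha ha1 (u := G (kochHub g h)) (v := kochHub g h)
      (R := g / 4) (κ := (1 - g) / 2) (by positivity) hl0.le hl1 (hQX (hGD H.hub_mem.1)) ?_).mono
      ha1 Subset.rfl ?_).symm⟩
    · rw [norm_sub_rev]
      nlinarith
    · intro t ht0 ht1 ht
      refine (hQ.ball_lineMap_subset hl0.le hl1 ?_ hball ht0 ht1 ht).trans hQX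
      intro η hη
      have h1 : G (kochHub g h) + ((1 - g) / 2 : ℝ) * η ∈
          ball (G (kochHub g h)) ((1 - g) / 2 * (g / 4)) := by
        rw [mem_ball, dist_eq_norm, add_sub_cancel_left, norm_mul, Complex.norm_real,
          Real.norm_eq_abs, abs_of_pos hl0]
        exact mul_lt_mul_of_pos_left hη hl0
      obtain ⟨w, hw, e⟩ := hG.ball_subset_image _ _ h1
      rw [← e]
      exact hGD (H.ball_hub_subset hw).1
    · refine ENNReal.ofReal_le_ofReal ?_
      have h1 : ‖kochHub g h - G (kochHub g h)‖ / (1 - (1 - g) / 2) ≤ 51 / 100 := by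
        rw [div_le_iff₀ (by linarith), norm_sub_rev]
        linarith
      have h2 : 0 ≤ (1 - ((1 - g) / 2) ^ a) / a := div_nonneg (by linarith) ha.le
      calc _ ≤ 51 / 100 * (g / 4) ^ (a - 1) * ((1 - ((1 - g) / 2) ^ a) / a) := by gcongr
        _ = _ := by ring
  have hr : ∀ G G' : ℂ → ℂ, (∀ z, G' z = kochReflect (G (kochReflect z))) →
      (∃ L, L ≤ 1 ∧ Joins a (kochX g h) (kochHub g h) (G (kochHub g h)) L
        (ENNReal.ofReal (51 / 100 * (g / 4) ^ (a - 1) / a * (1 - ((1 - g) / 2) ^ a)))) →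
      ∃ L, L ≤ 1 ∧ Joins a (kochX g h) (kochHub g h) (G' (kochHub g h)) L
        (ENNReal.ofReal (51 / 100 * (g / 4) ^ (a - 1) / a * (1 - ((1 - g) / 2) ^ a))) := by
    rintro G G' hGG ⟨L, hL, hJ⟩
    have := hJ.similar ha1 one_pos (φ := kochReflect) (fun x y => by
      rw [edist_dist, edist_dist, isSimilarity_reflect.dist_eq, one_mul, ENNReal.ofReal_one, one_mul])
      isSimilarity_reflect.surj
    rw [Real.one_rpow, ENNReal.ofReal_one, one_mul, one_mul, kochReflect_hub] at this
    refine ⟨L, hL, ?_⟩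
    rw [hGG, kochReflect_hub]
    exact this.mono ha1 (image_subset_iff.2 fun z hz => H.reflect_mem_X hz) le_rfl
  have hsL : IsSimilarity (fun z => kochL h (kochL h z)) ((1 - g) / 2) := by
    have := H.isSimilarity_L.comp H.isSimilarity_L
    rwa [H.apex_mul_apex] at this
  have hsR : IsSimilarity (fun z => kochL h (kochR h z)) ((1 - g) / 2) := by
    have := H.isSimilarity_L.comp H.isSimilarity_R
    rwa [H.apex_mul_apex] at this
  have k1 := key _ hsL _ (convex_kochD g h) (kochD_subset g h)
    (H.ball_hub_subset.trans inter_subset_left) (fun z hz => H.LL_mem_D hz) (H.dist_hub_LL h6)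
  have k2 := key _ hsR _ (convex_kochKite g h) H.kite_subset
    (H.ball_hub_subset.trans inter_subset_right) (fun z hz => H.M_subset_kite (H.LR_mem_M hz))
    (H.dist_hub_LR h6)
  rcases hG with rfl | rfl | rfl | rfl
  · exact k1
  · exact k2
  · exact hr (fun z => kochL h (kochR h z)) _ H.RL_eq k2
  · exact hr (fun z => kochL h (kochL h z)) _ H.RR_eq k1

theorem isSimilarity_second {G : ℂ → ℂ}
    (hG : G ∈ kochSecond h) :
    IsSimilarity G ((1 - g) / 2) := by
  rw [← H.apex_mul_apex]
  rcases hG with rfl | rfl | rfl | rfl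
  · exact H.isSimilarity_L.comp H.isSimilarity_L
  · exact H.isSimilarity_L.comp H.isSimilarity_R
  · exact H.isSimilarity_R.comp H.isSimilarity_L
  · exact H.isSimilarity_R.comp H.isSimilarity_R

theorem mapsTo_second {G : ℂ → ℂ}
    (hG : G ∈ kochSecond h) :
    MapsTo G (kochX g h) (kochX g h) := by
  rcases hG with rfl | rfl | rfl | rfl
  · exact fun z hz => H.LL_mem_X hz
  · exact fun z hz => H.LR_mem_X hz
  · exact fun z hz => H.RL_mem_X hz
  · exact fun z hz => H.RR_mem_X hz

theorem exists_second_of_K {z : ℂ} (hz : z ∈ kochK h) : ∃ (G : ℂ → ℂ) (w : ℂ),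
    G ∈ kochSecond h ∧
    w ∈ kochK h ∧ G w = z := by
  rw [H.K_eq] at hz
  rcases hz with ⟨w, hw, rfl⟩ | ⟨w, hw, rfl⟩ <;> rw [H.K_eq] at hw <;>
    rcases hw with ⟨v, hv, rfl⟩ | ⟨v, hv, rfl⟩
  · exact ⟨_, v, Or.inl rfl, hv, rfl⟩
  · exact ⟨_, v, Or.inr (Or.inl rfl), hv, rfl⟩
  · exact ⟨_, v, Or.inr (Or.inr (Or.inl rfl)), hv, rfl⟩
  · exact ⟨_, v, Or.inr (Or.inr (Or.inr rfl)), hv, rfl⟩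

theorem exists_second_of_U {n : ℕ} {z : ℂ} (hz : z ∈ kochU g h (n + 2)) : ∃ (G : ℂ → ℂ) (w : ℂ),
    G ∈ kochSecond h ∧
    w ∈ kochU g h n ∧ G w = z := by
  rcases hz with ⟨w, hw, rfl⟩ | ⟨w, hw, rfl⟩ <;>
    rcases hw with ⟨v, hv, rfl⟩ | ⟨v, hv, rfl⟩
  · exact ⟨_, v, Or.inl rfl, hv, rfl⟩
  · exact ⟨_, v, Or.inr (Or.inl rfl), hv, rfl⟩
  · exact ⟨_, v, Or.inr (Or.inr (Or.inl rfl)), hv, rfl⟩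
  · exact ⟨_, v, Or.inr (Or.inr (Or.inr rfl)), hv, rfl⟩

/-- With λ = (1 - g) / 2 and B the claimed bound, one step of the hub costs at most B(1 - λ ^ a),
and the rest is the rescaled problem with cost λ ^ a B. So B reproduces itself at every level. -/
theorem conn_hub_U (h6 : g < 1 / 6) (ha : 0 < a) (ha1 : a ≤ 1) (k : ℕ) :
    ∀ z ∈ kochU g h (2 * k), Conn a (kochX g h) (kochHub g h) z (51 / 100 * (g / 4) ^ (a - 1) / a) := by
  have hg := H.g_pos
  have hl0 : 0 < (1 - g) / 2 := by linarith
  have hla : ((1 - g) / 2) ^ a ≤ 1 := Real.rpow_le_one hl0.le (by linarith) ha.le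
  induction k with
  | zero =>
    intro z hz
    refine ((Conn.of_convex ha ha1 (convex_kochKite g h) H.kite_subset (R := g / 4) (by positivity)
      (H.M_subset_kite hz) (H.ball_hub_subset.trans inter_subset_right)).le ha1 ?_).symm
    gcongr
    rw [norm_sub_rev]
    linarith [H.dist_hub_M h6 hz]
  | succ k ih =>
    intro z hz
    obtain ⟨G, w, hG, hw, rfl⟩ := H.exists_second_of_U hz
    obtain ⟨L, -, hJ⟩ := H.joins_hub h6 ha ha1 hG
    have hs := H.isSimilarity_second hG
    have h1 : Conn a (kochX g h) (kochHub g h) (G (kochHub g h)) _ :=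
      ⟨mul_nonneg (by positivity) (by linarith), L, hJ⟩
    have h2 := (ih w hw).similar ha1 hs.pos hs.dist_eq hs.surj (H.mapsTo_second hG).image_subset
    refine (h1.trans h2).le ha1 (le_of_eq ?_)
    ring

/-- A point of the curve has an infinite address. The hubs of the cells of its address converge to
it, and the costs B(1 - λ ^ a)(λ ^ a) ^ n sum to B. -/
theorem conn_hub_K (h6 : g < 1 / 6) (ha : 0 < a) (ha1 : a ≤ 1) {z : ℂ} (hz : z ∈ kochK h) :
    Conn a (kochX g h) (kochHub g h) z (51 / 100 * (g / 4) ^ (a - 1) / a) := by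
  have hg := H.g_pos
  have hg' := H.g_lt
  set l := (1 - g) / 2 with hl
  have hl0 : 0 < l := by rw [hl]; linarith
  have hl1 : l < 1 := by rw [hl]; linarith
  have hla : l ^ a < 1 := Real.rpow_lt_one hl0.le hl1 ha
  have hla0 : 0 < l ^ a := Real.rpow_pos_of_pos hl0 a
  have hstep : ∀ w : ℂ, ∃ (G : ℂ → ℂ) (v : ℂ), w ∈ kochK h →
      G ∈ kochSecond h ∧
      v ∈ kochK h ∧ G v = w := by
    intro w
    by_cases hw : w ∈ kochK h
    · obtain ⟨G, v, h⟩ := H.exists_second_of_K hw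
      exact ⟨G, v, fun _ => h⟩
    · exact ⟨fun z => z, 0, fun h => absurd h hw⟩
  choose G T hGT using hstep
  set w : ℕ → ℂ := fun n => T^[n] z with hw
  have hwK : ∀ n, w n ∈ kochK h := by
    intro n
    induction n with
    | zero => exact hz
    | succ n ih =>
      rw [hw]; simp only [Function.iterate_succ_apply']
      exact (hGT _ ih).2.1
  -- The composition of the first n maps of the address; `w n` is the remaining point, so `F n (w
  -- n)` is always z.
  set F : ℕ → ℂ → ℂ := fun n => Nat.rec (fun z => z) (fun n F z => F (G (w n) z)) n with hF
  have hFs : ∀ n v, F (n + 1) v = F n (G (w n) v) := fun _ _ => rfl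
  have hFsim : ∀ n, IsSimilarity (F n) (l ^ n) := by
    intro n
    induction n with
    | zero => rw [pow_zero]; exact IsSimilarity.id
    | succ n ih =>
      rw [pow_succ]
      exact ih.comp (H.isSimilarity_second (hGT _ (hwK n)).1)
  have hFX : ∀ n, MapsTo (F n) (kochX g h) (kochX g h) := by
    intro n
    induction n with
    | zero => exact fun z hz => hz
    | succ n ih => exact fun v hv => ih (H.mapsTo_second (hGT _ (hwK n)).1 hv)
  have hFz : ∀ n, F n (w n) = z := by
    intro n
    induction n with
    | zero => rfl
    | succ n ih =>
      have : w (n + 1) = T (w n) := by rw [hw]; simp only [Function.iterate_succ_apply']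
      rw [hFs, this, (hGT _ (hwK n)).2.2, ih]
  set B := 51 / 100 * (g / 4) ^ (a - 1) / a with hB
  have hB0 : 0 ≤ B := by positivity
  have hJ : ∀ n, ∃ L, L ≤ l ^ n ∧ Joins a (kochX g h) (F n (kochHub g h)) (F (n + 1) (kochHub g h)) L
      (ENNReal.ofReal (B * (1 - l ^ a) * (l ^ a) ^ n)) := by
    intro n
    obtain ⟨L, hL, hJ⟩ := H.joins_hub h6 ha ha1 (hGT _ (hwK n)).1
    have hs := hFsim n
    refine ⟨l ^ n * L, mul_le_of_le_one_right hs.pos.le hL, ?_⟩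
    have := (hJ.similar ha1 hs.pos (fun x y => by
      rw [edist_dist, edist_dist, hs.dist_eq, ENNReal.ofReal_mul hs.pos.le]) hs.surj).mono ha1
      (hFX n).image_subset le_rfl
    rw [← ENNReal.ofReal_mul (by positivity), ← Real.rpow_natCast, ← Real.rpow_mul hl0.le,
      mul_comm (n : ℝ) a, Real.rpow_mul hl0.le, mul_comm ((l ^ a) ^ (n : ℝ)), Real.rpow_natCast,
      Real.rpow_natCast] at this
    exact this
  choose L hL hJ using hJ
  have hgeo := (hasSum_geometric_of_lt_one hla0.le hla).mul_left (B * (1 - l ^ a))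
  have hsum : ∑' n, ENNReal.ofReal (B * (1 - l ^ a) * (l ^ a) ^ n) = ENNReal.ofReal B := by
    rw [← ENNReal.ofReal_tsum_of_nonneg (fun n => by
      have : 0 ≤ 1 - l ^ a := by linarith
      positivity) hgeo.summable, hgeo.tsum_eq, mul_assoc,
      mul_inv_cancel₀ (by linarith), mul_one]
  have hlim : Tendsto (fun n => F n (kochHub g h)) atTop (𝓝 z) := by
    rw [tendsto_iff_dist_tendsto_zero]
    have h0 : Tendsto (fun n : ℕ => l ^ n * 3) atTop (𝓝 0) := by
      simpa using (tendsto_pow_atTop_nhds_zero_of_lt_one hl0.le hl1).mul_const 3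
    refine squeeze_zero (fun _ => dist_nonneg) (fun n => ?_) h0
    have h1 : dist (F n (kochHub g h)) z = l ^ n * dist (kochHub g h) (w n) := by
      rw [← (hFsim n).dist_eq, hFz]
    rw [h1]
    refine mul_le_mul_of_nonneg_left ?_ (by positivity)
    have h2 := H.dist_le_of_mem_T (H.K_subset H.zero_mem_K) (H.K_subset (hwK n))
    have h3 := H.norm_hub_sq h6
    have h4 := dist_triangle (kochHub g h) 0 (w n)
    rw [dist_zero_right] at h4
    linarith
  have := Joins.infinite hJ (Summable.of_nonneg_of_le (fun n => (hJ n).1) hL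
    (summable_geometric_of_lt_one hl0.le hl1)) hlim (Or.inl (K_subset_B hz))
  rw [hsum] at this
  exact ⟨hB0, _, this⟩

theorem conn_hub (h6 : g < 1 / 6) (ha : 0 < a) (ha1 : a ≤ 1) {z : ℂ} (hz : z ∈ kochB g h) :
    Conn a (kochX g h) (kochHub g h) z (51 / 100 * (g / 4) ^ (a - 1) / a) := by
  rcases hz with hz | hz
  · exact H.conn_hub_K h6 ha ha1 hz
  · obtain ⟨n, hn, hU⟩ := mem_iUnion₂.1 hz
    obtain ⟨k, rfl⟩ := even_iff_exists_two_mul.1 hn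
    exact H.conn_hub_U h6 ha ha1 k z hU

/-- Two trips to the hub cost 1.02 (g / 4) ^ (a - 1) / a, which is 4.08 units of cost at scale 1/4.
The constant 9/2 leaves a small margin. -/
theorem conn_via_hub (h6 : g < 1 / 6) (ha : 0 < a) (ha1 : a ≤ 1) {z w : ℂ} (hz : z ∈ kochB g h)
    (hw : w ∈ kochB g h) {r : ℝ} (hr : 1 / 4 ≤ r) :
    Conn a (kochX g h) z w (kochCost a g (9 / 2) r) := by
  have hg := H.g_pos
  refine ((H.conn_hub h6 ha ha1 hz).symm.trans (H.conn_hub h6 ha ha1 hw)).le ha1 ?_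
  have e : 51 / 100 * (g / 4) ^ (a - 1) / a + 51 / 100 * (g / 4) ^ (a - 1) / a =
      kochCost a g (408 / 100) (1 / 4) := by
    rw [kochCost, Real.rpow_sub_one (by positivity), mul_one_div]
    field_simp
    norm_num
  rw [e]
  exact kochCost_mono ha hg (by norm_num) (by norm_num) (by norm_num) hr
end KochParam

theorem dist_le_abs_re_add_abs_im (z w : ℂ) : dist z w ≤ |z.re - w.re| + |z.im - w.im| := by
  rw [dist_eq_norm, ← Complex.sub_re, ← Complex.sub_im]
  exact Complex.norm_le_abs_re_add_abs_im _

theorem abs_re_sub_le_dist (z w : ℂ) : |z.re - w.re| ≤ dist z w := by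
  rw [dist_eq_norm, ← Complex.sub_re]
  exact Complex.abs_re_le_norm _

theorem abs_im_sub_le_dist (z w : ℂ) : |z.im - w.im| ≤ dist z w := by
  rw [dist_eq_norm, ← Complex.sub_im]
  exact Complex.abs_im_le_norm _

@[simp] theorem kochReflect_one : kochReflect 1 = 0 := by simp [kochReflect]

theorem kochCost_nonneg {a g N x : ℝ} (ha : 0 < a) (hg : 0 < g) (hN : 0 ≤ N) (hx : 0 ≤ x) :
    0 ≤ kochCost a g N x := by
  unfold kochCost; positivity

namespace KochParam
variable {g h a : ℝ} (H : KochParam g h)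
include H

theorem B_cases {z : ℂ} (hz : z ∈ kochB g h) : z ∈ kochM g h ∨
    (∃ w ∈ kochB g h, z = kochL h (kochL h w)) ∨ (∃ w ∈ kochB g h, z = kochL h (kochR h w)) ∨
    (∃ w ∈ kochB g h, z = kochR h (kochL h w)) ∨ ∃ w ∈ kochB g h, z = kochR h (kochR h w) := by
  rw [H.B_eq] at hz
  rcases hz with hz | ⟨w, hw, rfl⟩ | ⟨w, hw, rfl⟩
  · exact Or.inl hz
  · rw [H.A_eq] at hw
    rcases hw with ⟨v, hv, rfl⟩ | ⟨v, hv, rfl⟩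
    · exact Or.inr (Or.inl ⟨v, hv, rfl⟩)
    · exact Or.inr (Or.inr (Or.inl ⟨v, hv, rfl⟩))
  · rw [H.A_eq] at hw
    rcases hw with ⟨v, hv, rfl⟩ | ⟨v, hv, rfl⟩
    · exact Or.inr (Or.inr (Or.inr (Or.inl ⟨v, hv, rfl⟩)))
    · exact Or.inr (Or.inr (Or.inr (Or.inr ⟨v, hv, rfl⟩)))

theorem conn_reflect (ha1 : a ≤ 1) {z w : ℂ} {I : ℝ}
    (hc : Conn a (kochX g h) (kochReflect z) (kochReflect w) I) : Conn a (kochX g h) z w I := by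
  have := hc.similar ha1 one_pos isSimilarity_reflect.dist_eq isSimilarity_reflect.surj
    (image_subset_iff.2 fun z hz => H.reflect_mem_X hz)
  rwa [kochReflect_reflect, kochReflect_reflect, Real.one_rpow, one_mul] at this

theorem conn_second (ha1 : a ≤ 1) {G : ℂ → ℂ} (hG : G ∈ kochSecond h) {z w : ℂ} {N x : ℝ}
    (hx : 0 ≤ x) (hc : Conn a (kochX g h) z w (kochCost a g N x)) :
    Conn a (kochX g h) (G z) (G w) (kochCost a g N ((1 - g) / 2 * x)) := by
  have hs := H.isSimilarity_second hG
  rw [← kochCost_scale H.g_pos.le hx hs.pos.le]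
  exact hc.similar ha1 hs.pos hs.dist_eq hs.surj (H.mapsTo_second hG).image_subset

omit H in
theorem LL_mem_second : (fun z => kochL h (kochL h z)) ∈ kochSecond h := Or.inl rfl
omit H in
theorem LR_mem_second : (fun z => kochL h (kochR h z)) ∈ kochSecond h := Or.inr (Or.inl rfl)
omit H in
theorem RL_mem_second : (fun z => kochR h (kochL h z)) ∈ kochSecond h :=
  Or.inr (Or.inr (Or.inl rfl))
omit H in
theorem RR_mem_second : (fun z => kochR h (kochR h z)) ∈ kochSecond h :=
  Or.inr (Or.inr (Or.inr rfl))

theorem half_le_apex (h6 : g < 1 / 6) : 1 / 2 ≤ ‖kochApex h‖ := by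
  have := H.norm_sq_apex
  nlinarith [H.apex_pos]

theorem half_le_norm_R {z : ℂ} (hz : z ∈ kochT h) : 1 / 2 ≤ ‖kochR h z‖ :=
  (H.re_ge_of_mem_R hz).trans ((le_abs_self _).trans (Complex.abs_re_le_norm _))

/-- Away from 0 the hub serves. A point of modulus below 1/4 can only lie in the cell at 0, and the
homothety of this cell enlarges it by a factor of at least 2. -/
theorem conn_zero (h6 : g < 1 / 6) (ha : 0 < a) (ha1 : a ≤ 1) {z : ℂ} (hz : z ∈ kochB g h) :
    Conn a (kochX g h) z 0 (kochCost a g (9 / 2) ‖z‖) := by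
  have hg := H.g_pos
  have hs := H.half_le_apex h6
  have key : ∀ n : ℕ, ∀ z ∈ kochB g h, 1 / 4 * (1 / 2) ^ n ≤ ‖z‖ →
      Conn a (kochX g h) z 0 (kochCost a g (9 / 2) ‖z‖) := by
    intro n
    induction n with
    | zero =>
      exact fun z hz h1 => H.conn_via_hub h6 ha ha1 hz (K_subset_B H.zero_mem_K) (by simpa using h1)
    | succ n ih =>
      intro z hz h1
      rcases le_or_gt (1 / 4) ‖z‖ with h2 | h2
      · exact H.conn_via_hub h6 ha ha1 hz (K_subset_B H.zero_mem_K) h2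
      have hre : z.re < 1 / 4 := ((le_abs_self _).trans (Complex.abs_re_le_norm _)).trans_lt h2
      rcases H.B_cases hz with hM | ⟨w, hw, rfl⟩ | ⟨w, hw, rfl⟩ | ⟨w, hw, rfl⟩ | ⟨w, hw, rfl⟩
      · have h3 := hM.2.1
        have h4 := mul_nonneg hg.le hM.1
        have h5 : 0 ≤ h * (z.re - (1 - g) / 2) := by linarith
        have := nonneg_of_mul_nonneg_right h5 H.h_pos
        linarith
      · have e := H.L_LL w 0
        rw [kochL_zero, kochL_zero, dist_zero_right, dist_zero_right] at e
        have := H.conn_second ha1 LL_mem_second (norm_nonneg _) (ih w hw ?_)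
        · rw [kochL_zero, kochL_zero, ← e] at this
          exact this
        · rw [pow_succ] at h1
          have : (1 - g) / 2 * ‖w‖ ≤ 1 / 2 * ‖w‖ := by
            have := norm_nonneg w
            gcongr; linarith
          linarith
      · have e := dist_kochL h (kochR h w) 0
        rw [kochL_zero, dist_zero_right, dist_zero_right] at e
        have := mul_le_mul hs (H.half_le_norm_R (H.B_subset_T hw)) (by norm_num) H.apex_pos.le
        linarith
      · linarith [H.re_ge_of_mem_R (H.mapsTo_L (H.B_subset_T hw))]
      · linarith [H.re_ge_of_mem_R (H.mapsTo_R (H.B_subset_T hw))]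
  rcases eq_or_ne z 0 with rfl | h0
  · exact (Conn.refl (Or.inl (K_subset_B H.zero_mem_K))).le ha1
      (kochCost_nonneg ha hg (by norm_num) (norm_nonneg _))
  · obtain ⟨n, hn⟩ := exists_pow_lt_of_lt_one (show 0 < 4 * ‖z‖ by positivity)
      (by norm_num : (1 / 2 : ℝ) < 1)
    exact key n z hz (by linarith)

theorem conn_one (h6 : g < 1 / 6) (ha : 0 < a) (ha1 : a ≤ 1) {z : ℂ} (hz : z ∈ kochB g h) :
    Conn a (kochX g h) z 1 (kochCost a g (9 / 2) (dist z 1)) := by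
  refine H.conn_reflect ha1 ?_
  have e : dist z 1 = ‖kochReflect z‖ := by
    rw [← dist_zero_right, ← kochReflect_one, isSimilarity_reflect.dist_eq, one_mul]
  rw [kochReflect_one, e]
  exact H.conn_zero h6 ha ha1 (H.reflect_mem_B hz)

theorem dist_le_half_of_mem_M (h6 : g < 1 / 6) {z w : ℂ} (hz : z ∈ kochM g h)
    (hw : w ∈ kochM g h) : dist z w ≤ 1 / 2 := by
  have hh := H.h_pos
  have hg := H.g_pos
  have key : ∀ z ∈ kochM g h, -(g / 2) ≤ z.re - 1 / 2 ∧ z.re - 1 / 2 ≤ g / 2 := by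
    rintro z ⟨z0, z1, z2⟩
    have h3 := mul_nonneg hg.le z0
    constructor
    · refine le_of_mul_le_mul_left (a := h) ?_ hh
      linarith
    · refine le_of_mul_le_mul_left (a := h) ?_ hh
      linarith
  have k1 := H.im_le_of_mem_T (H.M_subset hz)
  have k2 := H.im_le_of_mem_T (H.M_subset hw)
  have z0 := hz.1
  have w0 := hw.1
  obtain ⟨z1, z2⟩ := key z hz
  obtain ⟨w1, w2⟩ := key w hw
  refine (le_abs_self _).trans (abs_le_of_sq_le_sq ?_ (by norm_num))
  rw [dist_eq_norm, ← Complex.normSq_eq_norm_sq, Complex.normSq_apply, Complex.sub_re,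
    Complex.sub_im, ← pow_two, ← pow_two]
  have e1 : (z.re - w.re) ^ 2 ≤ g ^ 2 := sq_le_sq' (by linarith) (by linarith)
  have e2 : (z.im - w.im) ^ 2 ≤ h ^ 2 := sq_le_sq' (by linarith) (by linarith)
  nlinarith [H.sq]

theorem conn_M (h6 : g < 1 / 6) (ha : 0 < a) (ha1 : a ≤ 1) {z w : ℂ} (hz : z ∈ kochM g h)
    (hw : w ∈ kochM g h) : Conn a (kochX g h) z w (kochCost a g 6 (dist z w / 2)) := by
  have hg := H.g_pos
  rcases eq_or_ne z w with rfl | hne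
  · exact (Conn.refl (Or.inl (H.M_subset_B hz))).le ha1
      (kochCost_nonneg ha hg (by norm_num) (by simp))
  have hr : 0 < dist z w := dist_pos.2 hne
  -- The fraction μ = 2|z - w| of the way to the hub makes the radius of the intermediate ball g|z -
  -- w| / 2, and μ ≤ 1 since the opening has diameter at most 1/2.
  have := Conn.pair_convex ha ha1 (convex_kochKite g h) H.kite_subset (R := g / 4) (D := 1 / 2)
    (μ := 2 * dist z w) (by positivity) (H.M_subset_kite hz) (H.M_subset_kite hw)
    (H.ball_hub_subset.trans inter_subset_right) (by rw [norm_sub_rev]; exact H.dist_hub_M h6 hz)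
    (by rw [norm_sub_rev]; exact H.dist_hub_M h6 hw) (by positivity)
    (by linarith [H.dist_le_half_of_mem_M h6 hz hw])
  refine this.le ha1 (le_of_eq ?_)
  have e : ‖w - z‖ = dist z w := by rw [dist_comm, dist_eq_norm]
  rw [e, kochCost]
  set r := dist z w
  have e2 : 2 * r * (g / 4) = g * (r / 2) := by ring
  rw [e2, Real.rpow_sub_one (by positivity)]
  field_simp
  norm_num

/-- In the opening one descends vertically. In a cell on the side of the opening the lower vertex of
the cell is on the base, at distance comparable to the height, since h > 2/5 makes the side steep.
In the cells at the ends of the base one zooms in. This replaces `conn_one` when the target is a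
whole edge and not a vertex. -/
theorem exists_conn_base (h6 : g < 1 / 6) (ha : 0 < a) (ha1 : a ≤ 1) {z : ℂ}
    (hz : z ∈ kochB g h) : ∃ e ∈ kochB g h, e.im = 0 ∧ dist z e ≤ 5 / 2 * z.im ∧
      Conn a (kochX g h) z e (kochCost a g 6 (5 / 2 * z.im)) := by
  have hg := H.g_pos
  have hh := H.h_pos
  have hh2 : 2 / 5 < h := by nlinarith [H.sq]
  have hh3 := H.h_lt
  have hLR : ∀ w ∈ kochB g h, ∃ e ∈ kochB g h, e.im = 0 ∧
      dist (kochL h (kochR h w)) e ≤ 5 / 2 * (kochL h (kochR h w)).im ∧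
      Conn a (kochX g h) (kochL h (kochR h w)) e
        (kochCost a g 6 (5 / 2 * (kochL h (kochR h w)).im)) := by
    intro w hw
    have hT := H.B_subset_T hw
    have hd : (1 - g) / 2 * ‖w‖ ≤ 5 / 2 * (kochL h (kochR h w)).im := by
      have h1 := H.re_nonneg_of_mem_T hT
      have h2 := hT.1
      have h3 : ‖w‖ ≤ 2 * w.re := by
        refine (Complex.norm_le_abs_re_add_abs_im w).trans ?_
        rw [abs_of_nonneg h1, abs_of_nonneg h2]
        nlinarith [hT.2.1]
      rw [H.LR_im]
      have h4 : (1 - g) / 2 * ‖w‖ ≤ 1 / 2 * (2 * w.re) :=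
        mul_le_mul (by linarith) h3 (norm_nonneg _) (by norm_num)
      have h5 : 0 ≤ g * w.im := by positivity
      nlinarith
    have e := H.L_LR w 0
    rw [dist_zero_right] at e
    refine ⟨kochL h (kochR h 0), H.LR_mem (K_subset_B H.zero_mem_K), ?_, by rwa [e], ?_⟩
    · rw [H.LR_im]; simp
    · refine (H.conn_second ha1 LR_mem_second (norm_nonneg _) (H.conn_zero h6 ha ha1 hw)).le ha1 ?_
      exact kochCost_mono ha hg (by norm_num) (by norm_num)
        (mul_nonneg (by linarith) (norm_nonneg _)) hd
  have hrefl : ∀ z : ℂ, (∃ e ∈ kochB g h, e.im = 0 ∧ dist (kochReflect z) e ≤ 5 / 2 * z.im ∧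
      Conn a (kochX g h) (kochReflect z) e (kochCost a g 6 (5 / 2 * z.im))) →
      ∃ e ∈ kochB g h, e.im = 0 ∧ dist z e ≤ 5 / 2 * z.im ∧
      Conn a (kochX g h) z e (kochCost a g 6 (5 / 2 * z.im)) := by
    rintro z ⟨e, he, h1, h2, h3⟩
    refine ⟨kochReflect e, H.reflect_mem_B he, by simpa using h1, ?_, ?_⟩
    · rwa [← one_mul (dist z _), ← isSimilarity_reflect.dist_eq, kochReflect_reflect]
    · exact H.conn_reflect ha1 (by rwa [kochReflect_reflect])
  have hLL : ∀ w : ℂ, (∃ e ∈ kochB g h, e.im = 0 ∧ dist w e ≤ 5 / 2 * w.im ∧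
      Conn a (kochX g h) w e (kochCost a g 6 (5 / 2 * w.im))) → w ∈ kochB g h →
      ∃ e ∈ kochB g h, e.im = 0 ∧
      dist (kochL h (kochL h w)) e ≤ 5 / 2 * (kochL h (kochL h w)).im ∧
      Conn a (kochX g h) (kochL h (kochL h w)) e
        (kochCost a g 6 (5 / 2 * (kochL h (kochL h w)).im)) := by
    rintro w ⟨e, he, h1, h2, h3⟩ hw
    have hw0 := (H.B_subset_T hw).1
    have hl0 : 0 ≤ (1 - g) / 2 := by linarith
    refine ⟨kochL h (kochL h e), H.LL_mem he, by rw [H.LL_im, h1, mul_zero], ?_, ?_⟩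
    · rw [H.L_LL, H.LL_im]
      have := mul_le_mul_of_nonneg_left h2 hl0
      linarith
    · have := H.conn_second ha1 LL_mem_second (by positivity) h3
      rw [H.LL_im, mul_left_comm]
      exact this
  have key : ∀ n : ℕ, ∀ z ∈ kochB g h, (1 / 2) ^ n ≤ z.im → ∃ e ∈ kochB g h, e.im = 0 ∧
      dist z e ≤ 5 / 2 * z.im ∧ Conn a (kochX g h) z e (kochCost a g 6 (5 / 2 * z.im)) := by
    intro n
    induction n with
    | zero =>
      intro z hz h1
      rw [pow_zero] at h1
      linarith [H.im_le_of_mem_T (H.B_subset_T hz)]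
    | succ n ih =>
      intro z hz h1
      rw [pow_succ] at h1
      have hz0 : 0 < z.im := lt_of_lt_of_le (by positivity) h1
      have hbig : ∀ w : ℂ, (1 - g) / 2 * w.im = z.im → (1 / 2) ^ n ≤ w.im := fun w hw => by
        have h0 : 0 < w.im := pos_of_mul_pos_right (a := (1 - g) / 2) (by linarith) (by linarith)
        nlinarith
      rcases H.B_cases hz with hM | ⟨w, hw, rfl⟩ | ⟨w, hw, rfl⟩ | ⟨w, hw, rfl⟩ | ⟨w, hw, rfl⟩
      · set e : ℂ := (z.re : ℂ)
        have h3 := mul_nonneg hg.le hM.1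
        have he : e ∈ kochM g h := by
          refine ⟨le_of_eq (Complex.ofReal_im _).symm, ?_, ?_⟩
          · rw [Complex.ofReal_im, Complex.ofReal_re]; linarith [hM.2.1]
          · rw [Complex.ofReal_im, Complex.ofReal_re]; linarith [hM.2.2]
        have hd : dist z e ≤ z.im := by
          refine (dist_le_abs_re_add_abs_im z e).trans ?_
          rw [Complex.ofReal_im, Complex.ofReal_re, sub_self, abs_zero, sub_zero, zero_add,
            abs_of_pos hz0]
        refine ⟨e, H.M_subset_B he, Complex.ofReal_im _, by linarith, ?_⟩
        refine (H.conn_M h6 ha ha1 hM he).le ha1 ?_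
        exact kochCost_mono ha hg (by norm_num) le_rfl (by positivity) (by linarith)
      · exact hLL w (ih w hw (hbig w (H.LL_im w).symm)) hw
      · exact hLR w hw
      · refine hrefl _ ?_
        have := hLR _ (H.reflect_mem_B hw)
        have e : kochReflect (kochR h (kochL h w)) = kochL h (kochR h (kochReflect w)) := by
          rw [H.RL_eq, kochReflect_reflect]
        have e2 : (kochL h (kochR h (kochReflect w))).im = (kochR h (kochL h w)).im := by
          rw [← e, kochReflect_im]
        rw [e2] at this
        rwa [e]
      · refine hrefl _ ?_
        have e : kochReflect (kochR h (kochR h w)) = kochL h (kochL h (kochReflect w)) := by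
          rw [H.RR_eq, kochReflect_reflect]
        have e2 : (kochL h (kochL h (kochReflect w))).im = (kochR h (kochR h w)).im := by
          rw [← e, kochReflect_im]
        have hb := hbig (kochReflect w) (by rw [← e2, H.LL_im])
        have := hLL _ (ih _ (H.reflect_mem_B hw) hb) (H.reflect_mem_B hw)
        rw [e2] at this
        rwa [e]
  have hz0 := (H.B_subset_T hz).1
  rcases hz0.eq_or_lt with h0 | h0
  · refine ⟨z, hz, h0.symm, by simp [← h0], ?_⟩
    exact (Conn.refl (Or.inl hz)).le ha1 (kochCost_nonneg ha hg (by norm_num) (by positivity))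
  · obtain ⟨n, hn⟩ := exists_pow_lt_of_lt_one h0 (by norm_num : (1 / 2 : ℝ) < 1)
    exact key n z hz hn.le
end KochParam

/-! ### Joining two points below the curve -/

namespace KochParam
variable {g h a : ℝ} (H : KochParam g h)
include H

/-- The vertex p shared by the opening and the cell at 0 is close to both points: they lie on
different sides of the vertical through p, and the leg of the cell has slope 2h < 1. The factors 2
and 3 lost here are absorbed by g < 1/6. -/
theorem pair_M_LL (h6 : g < 1 / 6) (ha : 0 < a) (ha1 : a ≤ 1) {z v : ℂ} (hz : z ∈ kochM g h)
    (hv : v ∈ kochB g h) : Conn a (kochX g h) z (kochL h (kochL h v))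
      (12 / (a * g) * dist z (kochL h (kochL h v)) ^ a) := by
  have hg := H.g_pos
  have hh := H.h_pos
  have hh3 := H.h_lt
  set w := kochL h (kochL h v) with hw
  set p := kochL h (kochL h 1) with hp
  have hpre : p.re = (1 - g) / 2 := by rw [hp, H.LL_re]; simp
  have hpim : p.im = 0 := by rw [hp, H.LL_im]; simp
  have hpM : p ∈ kochM g h := by
    refine ⟨hpim.ge, ?_, ?_⟩ <;> rw [hpim, hpre] <;> nlinarith
  set r := dist z w with hr
  have hT := H.B_subset_T hv
  have h1 : w.im ≤ 2 * h * ((1 - g) / 2 - w.re) := by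
    rw [hw, H.LL_re, H.LL_im]
    have := mul_le_mul_of_nonneg_left hT.2.2 (show 0 ≤ (1 - g) / 2 by linarith)
    linarith
  have h0 : 0 ≤ w.im := (H.B_subset_T (H.LL_mem hv)).1
  have h2 : 0 ≤ z.re - (1 - g) / 2 := by
    have := mul_nonneg hg.le hz.1
    exact nonneg_of_mul_nonneg_right (a := h) (by linarith [hz.2.1]) hh
  have h3 : 0 ≤ (1 - g) / 2 - w.re := nonneg_of_mul_nonneg_right (a := 2 * h) (by linarith)
    (by positivity)
  have h4 : (1 - g) / 2 - w.re ≤ r := by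
    have := (le_abs_self _).trans (abs_re_sub_le_dist z w)
    linarith
  have hd1 : dist w p ≤ 2 * r := by
    refine (dist_le_abs_re_add_abs_im w p).trans ?_
    rw [hpre, hpim, sub_zero, abs_of_nonneg h0, abs_of_nonpos (by linarith)]
    nlinarith
  have hd2 : dist z p ≤ 3 * r := by
    have := dist_triangle z w p
    linarith
  have hr0 : 0 ≤ r := dist_nonneg
  have c1 := H.conn_M h6 ha ha1 hz hpM
  have c2 := H.conn_second ha1 LL_mem_second dist_nonneg (H.conn_one h6 ha ha1 hv)
  rw [← H.L_LL] at c2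
  refine (c1.trans c2.symm).le ha1 ?_
  have k1 := kochCost_le (a := a) (x := dist z p / 2) (r := r) ha hg (show (0 : ℝ) ≤ 6 by norm_num)
    (by positivity) (by nlinarith)
  have k2 := kochCost_le (a := a) (x := dist w p) (r := r) ha hg (show (0 : ℝ) ≤ 9 / 2 by norm_num)
    dist_nonneg (by nlinarith)
  refine (add_le_add k1 k2).trans ?_
  rw [← add_mul, ← add_div]
  gcongr
  norm_num

/-- The cell lies along the left edge of the opening, and the height of v in the cell, scaled by (1
- g) / 2, is the distance of its image from that edge. So this height is controlled by |z - w|, and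
`exists_conn_base` leads to a point of the edge from where one continues inside the opening. -/
theorem pair_M_LR (h6 : g < 1 / 6) (ha : 0 < a) (ha1 : a ≤ 1) {z v : ℂ} (hz : z ∈ kochM g h)
    (hv : v ∈ kochB g h) : Conn a (kochX g h) z (kochL h (kochR h v))
      (12 / (a * g) * dist z (kochL h (kochR h v)) ^ a) := by
  have hg := H.g_pos
  have hh := H.h_pos
  have hl0 : 0 < (1 - g) / 2 := by linarith
  obtain ⟨e, he, he0, hed, hec⟩ := H.exists_conn_base h6 ha ha1 hv
  have hvT := H.B_subset_T hv
  have heT := H.B_subset_T he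
  have heM : kochL h (kochR h e) ∈ kochM g h := by
    refine H.LR_mem_M ⟨he0.le, ?_, ?_⟩ <;> rw [he0]
    · have := mul_nonneg hg.le (H.re_nonneg_of_mem_T heT)
      linarith
    · have := mul_nonneg hg.le (sub_nonneg.2 (H.re_le_of_mem_T heT))
      linarith
  have hwre := H.LR_re v
  have hwim := H.LR_im v
  set w := kochL h (kochR h v) with hw
  set p := kochL h (kochR h e) with hp
  set r := dist z w with hr
  have hr0 : 0 ≤ r := dist_nonneg
  have hlam := H.lambda_sq
  have h1 : (1 - g) / 2 * v.im ≤ r := by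
    have e1 : h * (z.re - w.re) + -(g / 2) * (z.im - w.im) ≤ (1 - g) / 2 * dist z w := by
      refine (le_abs_self _).trans (abs_le_of_sq_le_sq ?_ (by positivity))
      rw [mul_pow, dist_eq_norm, ← Complex.normSq_eq_norm_sq, Complex.normSq_apply, hlam,
        Complex.sub_re, Complex.sub_im]
      nlinarith [sq_nonneg (h * (z.im - w.im) + g / 2 * (z.re - w.re))]
    have e2 : h * (w.re - (1 - g) / 2) - g / 2 * w.im = -(((1 - g) / 2) ^ 2 * v.im) := by
      rw [hwre, hwim, hlam]; ring
    have e3 := hz.2.1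
    refine le_of_mul_le_mul_left (a := (1 - g) / 2) ?_ hl0
    rw [hr]
    linarith
  have hd1 : dist w p ≤ 5 / 2 * r := by
    rw [H.L_LR]
    have := mul_le_mul_of_nonneg_left hed hl0.le
    linarith
  have hd2 : dist z p ≤ 7 / 2 * r := by
    have := dist_triangle z w p
    linarith
  have c1 := H.conn_M h6 ha ha1 hz heM
  have c2 := H.conn_second ha1 LR_mem_second (by have := hvT.1; positivity) hec
  refine (c1.trans c2.symm).le ha1 ?_
  have k1 := kochCost_le (a := a) (x := dist z p / 2) (r := r) ha hg (show (0 : ℝ) ≤ 6 by norm_num)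
    (by positivity) (by nlinarith)
  have k2 := kochCost_le (a := a) (x := (1 - g) / 2 * (5 / 2 * v.im)) (r := r) ha hg
    (show (0 : ℝ) ≤ 6 by norm_num) (by have := hvT.1; positivity) (by nlinarith)
  refine (add_le_add k1 k2).trans ?_
  rw [← add_mul, ← add_div]
  gcongr
  norm_num

/-- The two cells share a vertex, but the separation estimate controls the distances to it only by
|z - w| / g. Since `kochCost` measures scale by gx, this loss is exactly compensated. -/
theorem pair_LL_LR (h6 : g < 1 / 6) (ha : 0 < a) (ha1 : a ≤ 1) {v u : ℂ} (hv : v ∈ kochB g h)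
    (hu : u ∈ kochB g h) : Conn a (kochX g h) (kochL h (kochL h v)) (kochL h (kochR h u))
      (12 / (a * g) * dist (kochL h (kochL h v)) (kochL h (kochR h u)) ^ a) := by
  have hg := H.g_pos
  have hvL : kochL h v ∈ kochL h '' kochT h := mem_image_of_mem _ (H.B_subset_T hv)
  have huR : kochR h u ∈ kochR h '' kochT h := mem_image_of_mem _ (H.B_subset_T hu)
  have s1 := H.separation_L hvL huR
  have s2 := H.separation_R hvL huR
  have e1 := dist_kochL h (kochL h v) (kochApex h)
  have e2 := dist_kochL h (kochR h u) (kochApex h)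
  have c1 := H.conn_second ha1 LL_mem_second dist_nonneg (H.conn_one h6 ha ha1 hv)
  have c2 := H.conn_second ha1 LR_mem_second (norm_nonneg _) (H.conn_zero h6 ha ha1 hu)
  rw [← H.L_LL] at c1
  rw [← dist_zero_right, ← H.L_LR] at c2
  simp only [kochL_one, kochR_zero] at c1 c2
  rw [e1] at c1
  rw [e2] at c2
  rw [dist_kochL]
  set r := ‖kochApex h‖ * dist (kochL h v) (kochR h u) with hr
  have hr0 : 0 ≤ r := by positivity
  refine (c1.trans c2.symm).le ha1 ?_
  have k1 := kochCost_le (a := a) (x := ‖kochApex h‖ * dist (kochL h v) (kochApex h)) (r := r) ha hg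
    (show (0 : ℝ) ≤ 9 / 2 by norm_num) (by positivity) (by
      rw [mul_left_comm]; exact mul_le_mul_of_nonneg_left s1 (norm_nonneg _))
  have k2 := kochCost_le (a := a) (x := ‖kochApex h‖ * dist (kochR h u) (kochApex h)) (r := r) ha hg
    (show (0 : ℝ) ≤ 9 / 2 by norm_num) (by positivity) (by
      rw [mul_left_comm]; exact mul_le_mul_of_nonneg_left s2 (norm_nonneg _))
  refine (add_le_add k1 k2).trans ?_
  rw [← add_mul, ← add_div]
  gcongr
  norm_num

theorem pair_LR_RL (h6 : g < 1 / 6) (ha : 0 < a) (ha1 : a ≤ 1) {v u : ℂ} (hv : v ∈ kochB g h)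
    (hu : u ∈ kochB g h) : Conn a (kochX g h) (kochL h (kochR h v)) (kochR h (kochL h u))
      (12 / (a * g) * dist (kochL h (kochR h v)) (kochR h (kochL h u)) ^ a) := by
  have hg := H.g_pos
  have hvL : kochL h (kochR h v) ∈ kochL h '' kochT h :=
    mem_image_of_mem _ (H.mapsTo_R (H.B_subset_T hv))
  have huR : kochR h (kochL h u) ∈ kochR h '' kochT h :=
    mem_image_of_mem _ (H.mapsTo_L (H.B_subset_T hu))
  have s1 := H.separation_L hvL huR
  have s2 := H.separation_R hvL huR
  have c1 := H.conn_second ha1 LR_mem_second dist_nonneg (H.conn_one h6 ha ha1 hv)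
  have c2 := H.conn_second ha1 RL_mem_second (norm_nonneg _) (H.conn_zero h6 ha ha1 hu)
  rw [← H.L_LR] at c1
  rw [← dist_zero_right, ← H.L_RL] at c2
  simp only [kochL_one, kochR_zero, kochR_one, kochL_zero] at c1 c2
  set r := dist (kochL h (kochR h v)) (kochR h (kochL h u)) with hr
  have hr0 : 0 ≤ r := dist_nonneg
  refine (c1.trans c2.symm).le ha1 ?_
  have k1 := kochCost_le (a := a) (r := r) ha hg (show (0 : ℝ) ≤ 9 / 2 by norm_num) dist_nonneg s1
  have k2 := kochCost_le (a := a) (r := r) ha hg (show (0 : ℝ) ≤ 9 / 2 by norm_num) dist_nonneg s2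
  refine (add_le_add k1 k2).trans ?_
  rw [← add_mul, ← add_div]
  gcongr
  norm_num

theorem pair_hub (h6 : g < 1 / 6) (ha : 0 < a) (ha1 : a ≤ 1) {z w : ℂ} (hz : z ∈ kochB g h)
    (hw : w ∈ kochB g h) (hr : g * (1 / 4) ≤ dist z w) :
    Conn a (kochX g h) z w (12 / (a * g) * dist z w ^ a) := by
  have hg := H.g_pos
  refine (H.conn_via_hub h6 ha ha1 hz hw (r := dist z w / g) ?_).le ha1 ?_
  · rw [le_div_iff₀ hg]; linarith
  · refine (kochCost_le (r := dist z w) ha hg (by norm_num) (by positivity) ?_).trans ?_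
    · rw [mul_div_cancel₀ _ hg.ne']
    · gcongr; norm_num

/-- The left end cell keeps distance at least 1/4 from the apex, so by separation the two points are
at least g / 4 apart and the route through the hub is affordable. -/
theorem pair_LL_R (h6 : g < 1 / 6) (ha : 0 < a) (ha1 : a ≤ 1) {v w : ℂ} (hv : v ∈ kochB g h)
    (hw : w ∈ kochB g h) (hwR : w ∈ kochR h '' kochT h) :
    Conn a (kochX g h) (kochL h (kochL h v)) w
      (12 / (a * g) * dist (kochL h (kochL h v)) w ^ a) := by
  refine H.pair_hub h6 ha ha1 (H.LL_mem hv) hw ?_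
  have hT := H.B_subset_T hv
  refine le_trans ?_ (H.separation_L (mem_image_of_mem _ (H.mapsTo_L hT)) hwR)
  refine mul_le_mul_of_nonneg_left ?_ H.g_pos.le
  rw [← kochL_one, dist_kochL]
  have h1 : 1 / 2 ≤ dist (kochL h v) 1 := by
    have := (neg_le_abs _).trans (abs_re_sub_le_dist (kochL h v) 1)
    have h2 := H.re_le_of_mem_L hT
    rw [Complex.one_re] at this
    linarith
  have := mul_le_mul (H.half_le_apex h6) h1 (by norm_num) H.apex_pos.le
  linarith

/-- Pairs of points in different pieces, up to order. -/
theorem pair_different (h6 : g < 1 / 6) (ha : 0 < a) (ha1 : a ≤ 1) {P : ℂ → ℂ → Prop}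
    (hP : ∀ z w, Conn a (kochX g h) z w (12 / (a * g) * dist z w ^ a) → P z w)
    (hrec : ∀ G ∈ kochSecond h, ∀ v ∈ kochB g h, ∀ u ∈ kochB g h, P (G v) (G u)) {z w : ℂ}
    (hz : z ∈ kochB g h) (hw : w ∈ kochB g h) : P z w := by
  have hsymm : ∀ z w, Conn a (kochX g h) z w (12 / (a * g) * dist z w ^ a) → P w z := fun z w hc =>
    hP w z (by rw [dist_comm]; exact hc.symm)
  have hrefl : ∀ z w, Conn a (kochX g h) (kochReflect z) (kochReflect w)
      (12 / (a * g) * dist (kochReflect z) (kochReflect w) ^ a) →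
      Conn a (kochX g h) z w (12 / (a * g) * dist z w ^ a) := fun z w hc => by
    rw [isSimilarity_reflect.dist_eq, one_mul] at hc
    exact H.conn_reflect ha1 hc
  have eRL : ∀ v, kochReflect (kochR h (kochL h v)) = kochL h (kochR h (kochReflect v)) := fun v => by
    rw [H.RL_eq, kochReflect_reflect]
  have eRR : ∀ v, kochReflect (kochR h (kochR h v)) = kochL h (kochL h (kochReflect v)) := fun v => by
    rw [H.RR_eq, kochReflect_reflect]
  have eLR : ∀ v, kochReflect (kochL h (kochR h v)) = kochR h (kochL h (kochReflect v)) := fun v => by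
    rw [reflect_kochL, reflect_kochR]
  have hMr : ∀ z ∈ kochM g h, kochReflect z ∈ kochM g h := fun z hz => H.reflect_mem_U 0 z hz
  have c1 : ∀ z ∈ kochM g h, ∀ v ∈ kochB g h, Conn a (kochX g h) z (kochR h (kochR h v))
      (12 / (a * g) * dist z (kochR h (kochR h v)) ^ a) := fun z hz v hv =>
    hrefl _ _ (by rw [eRR]; exact H.pair_M_LL h6 ha ha1 (hMr z hz) (H.reflect_mem_B hv))
  have c2 : ∀ z ∈ kochM g h, ∀ v ∈ kochB g h, Conn a (kochX g h) z (kochR h (kochL h v))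
      (12 / (a * g) * dist z (kochR h (kochL h v)) ^ a) := fun z hz v hv =>
    hrefl _ _ (by rw [eRL]; exact H.pair_M_LR h6 ha ha1 (hMr z hz) (H.reflect_mem_B hv))
  have c3 : ∀ v ∈ kochB g h, ∀ u ∈ kochB g h,
      Conn a (kochX g h) (kochR h (kochR h v)) (kochR h (kochL h u))
      (12 / (a * g) * dist (kochR h (kochR h v)) (kochR h (kochL h u)) ^ a) := fun v hv u hu =>
    hrefl _ _ (by
      rw [eRR, eRL]; exact H.pair_LL_LR h6 ha ha1 (H.reflect_mem_B hv) (H.reflect_mem_B hu))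
  have c4 : ∀ v ∈ kochB g h, ∀ u ∈ kochB g h,
      Conn a (kochX g h) (kochR h (kochR h v)) (kochL h (kochR h u))
      (12 / (a * g) * dist (kochR h (kochR h v)) (kochL h (kochR h u)) ^ a) := fun v hv u hu =>
    hrefl _ _ (by
      rw [eRR, eLR]; exact H.pair_LL_R h6 ha ha1 (H.reflect_mem_B hv)
        (H.RL_mem (H.reflect_mem_B hu))
        (mem_image_of_mem _ (H.mapsTo_L (H.B_subset_T (H.reflect_mem_B hu)))))
  have c5 : ∀ v ∈ kochB g h, ∀ u ∈ kochB g h,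
      Conn a (kochX g h) (kochL h (kochL h v)) (kochR h (kochL h u))
      (12 / (a * g) * dist (kochL h (kochL h v)) (kochR h (kochL h u)) ^ a) := fun v hv u hu =>
    H.pair_LL_R h6 ha ha1 hv (H.RL_mem hu) (mem_image_of_mem _ (H.mapsTo_L (H.B_subset_T hu)))
  have c6 : ∀ v ∈ kochB g h, ∀ u ∈ kochB g h,
      Conn a (kochX g h) (kochL h (kochL h v)) (kochR h (kochR h u))
      (12 / (a * g) * dist (kochL h (kochL h v)) (kochR h (kochR h u)) ^ a) := fun v hv u hu =>
    H.pair_LL_R h6 ha ha1 hv (H.RR_mem hu) (mem_image_of_mem _ (H.mapsTo_R (H.B_subset_T hu)))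
  rcases H.B_cases hz with hM | ⟨v, hv, rfl⟩ | ⟨v, hv, rfl⟩ | ⟨v, hv, rfl⟩ | ⟨v, hv, rfl⟩ <;>
    rcases H.B_cases hw with kM | ⟨u, hu, rfl⟩ | ⟨u, hu, rfl⟩ | ⟨u, hu, rfl⟩ | ⟨u, hu, rfl⟩
  · refine hP _ _ ((H.conn_M h6 ha ha1 hM kM).le ha1 ?_)
    refine (kochCost_le (r := dist z w) ha H.g_pos (by norm_num) (by positivity) ?_).trans ?_
    · have := @dist_nonneg _ _ z w
      nlinarith
    · have := H.g_pos
      gcongr; norm_num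
  · exact hP _ _ (H.pair_M_LL h6 ha ha1 hM hu)
  · exact hP _ _ (H.pair_M_LR h6 ha ha1 hM hu)
  · exact hP _ _ (c2 z hM u hu)
  · exact hP _ _ (c1 z hM u hu)
  · exact hsymm _ _ (H.pair_M_LL h6 ha ha1 kM hv)
  · exact hrec _ LL_mem_second v hv u hu
  · exact hP _ _ (H.pair_LL_LR h6 ha ha1 hv hu)
  · exact hP _ _ (c5 v hv u hu)
  · exact hP _ _ (c6 v hv u hu)
  · exact hsymm _ _ (H.pair_M_LR h6 ha ha1 kM hv)
  · exact hsymm _ _ (H.pair_LL_LR h6 ha ha1 hu hv)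
  · exact hrec _ LR_mem_second v hv u hu
  · exact hP _ _ (H.pair_LR_RL h6 ha ha1 hv hu)
  · exact hsymm _ _ (c4 u hu v hv)
  · exact hsymm _ _ (c2 w kM v hv)
  · exact hsymm _ _ (c5 u hu v hv)
  · exact hsymm _ _ (H.pair_LR_RL h6 ha ha1 hu hv)
  · exact hrec _ RL_mem_second v hv u hu
  · exact hsymm _ _ (c3 u hu v hv)
  · exact hsymm _ _ (c1 w kM v hv)
  · exact hsymm _ _ (c6 u hu v hv)
  · exact hP _ _ (c4 v hv u hu)
  · exact hP _ _ (c3 v hv u hu)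
  · exact hrec _ RR_mem_second v hv u hu

theorem conn_pair (h6 : g < 1 / 6) (ha : 0 < a) (ha1 : a ≤ 1) {z w : ℂ} (hz : z ∈ kochB g h)
    (hw : w ∈ kochB g h) : Conn a (kochX g h) z w (12 / (a * g) * dist z w ^ a) := by
  have hg := H.g_pos
  have key : ∀ n : ℕ, ∀ z ∈ kochB g h, ∀ w ∈ kochB g h, (1 / 2) ^ n < dist z w →
      Conn a (kochX g h) z w (12 / (a * g) * dist z w ^ a) := by
    intro n
    induction n with
    | zero =>
      intro z hz w hw
      -- The lower bound for the distance is part of the predicate. Two points of the same second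
      -- level piece are at distance at most 2(1 - g) / 2 < 1, so at the start of the induction this
      -- case is void.
      refine H.pair_different h6 ha ha1 (P := fun z w => (1 / 2 : ℝ) ^ 0 < dist z w →
        Conn a (kochX g h) z w (12 / (a * g) * dist z w ^ a)) (fun _ _ hc _ => hc) ?_ hz hw
      intro G hG v hv u hu h1
      rw [(H.isSimilarity_second hG).dist_eq, pow_zero] at h1
      have := H.dist_le_of_mem_T (H.B_subset_T hv) (H.B_subset_T hu)
      nlinarith
    | succ n ih =>
      intro z hz w hw
      refine H.pair_different h6 ha ha1 (P := fun z w => (1 / 2 : ℝ) ^ (n + 1) < dist z w →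
        Conn a (kochX g h) z w (12 / (a * g) * dist z w ^ a)) (fun _ _ hc _ => hc) ?_ hz hw
      intro G hG v hv u hu h1
      have hs := H.isSimilarity_second hG
      rw [hs.dist_eq] at h1
      have hd : (1 / 2) ^ n < dist v u := by
        rw [pow_succ] at h1
        have := @dist_nonneg _ _ v u
        nlinarith
      have := (ih v hv u hu hd).similar ha1 hs.pos hs.dist_eq hs.surj (H.mapsTo_second hG).image_subset
      rw [hs.dist_eq, Real.mul_rpow hs.pos.le dist_nonneg]
      refine this.le ha1 (le_of_eq ?_)
      ring
  rcases eq_or_ne z w with rfl | hne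
  · exact (Conn.refl (Or.inl hz)).le ha1 (by positivity)
  · obtain ⟨n, hn⟩ := exists_pow_lt_of_lt_one (dist_pos.2 hne) (by norm_num : (1 / 2 : ℝ) < 1)
    exact key n z hz w hw hn
end KochParam

/-! ### Half-planes and the exterior of the pentagon -/

/-- The half-plane with inner normal `n` and offset `β`. -/
def halfPlane (n : ℂ) (β : ℝ) : Set ℂ := {z | β ≤ n.re * z.re + n.im * z.im}

theorem convex_halfPlane' (n : ℂ) (β : ℝ) : Convex ℝ (halfPlane n β) := by
  have := convex_halfPlane n.re n.im (-β)
  convert this using 1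
  ext z
  simp only [halfPlane, mem_ofPred_eq]
  constructor <;> intro h <;> linarith

theorem ball_subset_halfPlane {n p : ℂ} {β R : ℝ} (hn : ‖n‖ = 1)
    (hp : β + R ≤ n.re * p.re + n.im * p.im) : ball p R ⊆ halfPlane n β := by
  intro ζ hζ
  rw [mem_ball, dist_eq_norm] at hζ
  have e : n.re ^ 2 + n.im ^ 2 ≤ 1 ^ 2 := by
    rw [← hn, ← Complex.normSq_eq_norm_sq, Complex.normSq_apply]; linarith
  have := linear_gt_of_norm_lt one_pos e hζ
  show β ≤ _
  linarith

theorem halfPlane_le_of_dist {n u v : ℂ} {r : ℝ} (hn : ‖n‖ = 1) (h : dist u v ≤ r) :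
    n.re * u.re + n.im * u.im - r ≤ n.re * v.re + n.im * v.im := by
  have e : n.re ^ 2 + n.im ^ 2 = 1 := by
    have : ‖n‖ ^ 2 = 1 := by rw [hn, one_pow]
    rw [← Complex.normSq_eq_norm_sq, Complex.normSq_apply] at this; linarith
  have h2 : (u.re - v.re) ^ 2 + (u.im - v.im) ^ 2 ≤ r ^ 2 := by
    rw [dist_eq_norm] at h
    have := pow_le_pow_left₀ (norm_nonneg _) h 2
    rw [← Complex.normSq_eq_norm_sq, Complex.normSq_apply, Complex.sub_re, Complex.sub_im] at this
    linarith
  have hr : 0 ≤ r := dist_nonneg.trans h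
  have h3 : n.re * (u.re - v.re) + n.im * (u.im - v.im) ≤ r := by
    refine abs_le_of_sq_le_sq' ?_ hr |>.2
    have := sq_nonneg (n.re * (u.im - v.im) - n.im * (u.re - v.re))
    have e2 : (n.re * (u.re - v.re) + n.im * (u.im - v.im)) ^ 2 +
      (n.re * (u.im - v.im) - n.im * (u.re - v.re)) ^ 2 =
      (n.re ^ 2 + n.im ^ 2) * ((u.re - v.re) ^ 2 + (u.im - v.im) ^ 2) := by ring
    rw [e, one_mul] at e2
    linarith
  linarith

theorem rpow_scale_le {a k r : ℝ} (ha1 : a ≤ 1) (hk : 1 ≤ k) (hr : 0 ≤ r) :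
    (k * r) ^ a ≤ k * r ^ a := by
  rw [Real.mul_rpow (by linarith) hr]
  gcongr
  calc k ^ a ≤ k ^ (1 : ℝ) := Real.rpow_le_rpow_of_exponent_le hk ha1
    _ = k := Real.rpow_one k

theorem mul_rpow_sub_one {r a : ℝ} (hr : 0 < r) : r * r ^ (a - 1) = r ^ a := by
  rw [Real.rpow_sub_one hr.ne']
  field_simp

namespace Conn
variable {a : ℝ} {X : Set ℂ}

/-- Both points are joined to the midpoint moved inward by r, where a ball of radius r is available.
-/
theorem halfPlane (ha : 0 < a) (ha1 : a ≤ 1) {n : ℂ} {β : ℝ} (hn : ‖n‖ = 1)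
    (hX : halfPlane n β ⊆ X) {u v : ℂ} (hu : u ∈ _root_.halfPlane n β)
    (hv : v ∈ _root_.halfPlane n β) {r : ℝ} (hr : 0 < r) (huv : dist u v ≤ r) :
    Conn a X u v (3 * r ^ a / a) := by
  set m : ℂ := ((1 / 2 : ℝ) : ℂ) * u + ((1 / 2 : ℝ) : ℂ) * v with hm
  set p : ℂ := m + r * n with hp
  have hnn : n.re * n.re + n.im * n.im = 1 := by
    have : ‖n‖ ^ 2 = 1 := by rw [hn, one_pow]
    rwa [← Complex.normSq_eq_norm_sq, Complex.normSq_apply] at this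
  have hpb : ball p r ⊆ _root_.halfPlane n β := by
    refine ball_subset_halfPlane hn ?_
    have hu : β ≤ _ := hu
    have hv : β ≤ _ := hv
    simp only [hp, hm, Complex.add_re, Complex.add_im, Complex.re_ofReal_mul, Complex.im_ofReal_mul]
    have := congrArg (r * ·) hnn
    beta_reduce at this
    linarith
  have hrn : ‖(r : ℂ) * n‖ = r := by
    rw [norm_mul, hn, mul_one, Complex.norm_real, Real.norm_of_nonneg hr.le]
  have key : ∀ w : ℂ, ‖m - w‖ ≤ r / 2 → ‖p - w‖ * r ^ (a - 1) / a ≤ 3 / 2 * r ^ a / a := by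
    intro w hw
    have h1 : ‖p - w‖ ≤ 3 / 2 * r := by
      have : p - w = (m - w) + r * n := by rw [hp]; ring
      rw [this]
      refine (norm_add_le _ _).trans ?_
      rw [hrn]; linarith
    have h2 := mul_le_mul_of_nonneg_right h1 (Real.rpow_nonneg hr.le (a - 1))
    rw [mul_assoc, mul_rpow_sub_one hr] at h2
    gcongr
  have hd : ‖u - v‖ ≤ r := by rwa [← dist_eq_norm]
  have hmu : ‖m - u‖ ≤ r / 2 := by
    have e : m - u = ((-(1 / 2) : ℝ) : ℂ) * (u - v) := by rw [hm]; push_cast; ring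
    rw [e, norm_mul, Complex.norm_real]; norm_num; linarith
  have hmv : ‖m - v‖ ≤ r / 2 := by
    have e : m - v = ((1 / 2 : ℝ) : ℂ) * (u - v) := by rw [hm]; push_cast; ring
    rw [e, norm_mul, Complex.norm_real]; norm_num; linarith
  have c1 := of_convex ha ha1 (convex_halfPlane' n β) hX hr hu hpb
  have c2 := of_convex ha ha1 (convex_halfPlane' n β) hX hr hv hpb
  refine (c1.trans c2.symm).le ha1 ((add_le_add (key u hmu) (key v hmv)).trans (le_of_eq ?_))
  ring

/-- First u is moved by w to a place with a ball of radius r, then the translated segment to m + w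
follows. The end depends on u only through m, so two points with different half-planes can meet
there. -/
theorem push (ha : 0 < a) (ha1 : a ≤ 1) {n : ℂ} {β : ℝ} (hn : ‖n‖ = 1)
    (hX : _root_.halfPlane n β ⊆ X) {u m w : ℂ} (hu : u ∈ _root_.halfPlane n β) {r : ℝ} (hr : 0 < r)
    (hm : dist u m ≤ r / 2) (hw : ‖w‖ ≤ 10 * r) (hnw : r ≤ n.re * w.re + n.im * w.im) :
    Conn a X u (m + w) (11 * r ^ a / a) := by
  have hu' : β ≤ _ := hu
  have hb1 : ball (u + w) r ⊆ _root_.halfPlane n β := by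
    refine ball_subset_halfPlane hn ?_
    simp only [Complex.add_re, Complex.add_im]
    linarith
  have hb2 : ball (m + w) (r / 2) ⊆ _root_.halfPlane n β := by
    refine ball_subset_halfPlane hn ?_
    have := halfPlane_le_of_dist hn hm
    simp only [Complex.add_re, Complex.add_im]
    linarith
  have c1 := of_convex ha ha1 (convex_halfPlane' n β) hX hr hu hb1
  have c2 := of_convex ha ha1 (convex_halfPlane' n β) hX (half_pos hr) (hb1 (mem_ball_self hr)) hb2
  refine (c1.trans c2).le ha1 ?_
  have e1 : ‖u + w - u‖ * r ^ (a - 1) / a ≤ 10 * r ^ a / a := by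
    have h2 := mul_le_mul_of_nonneg_right hw (Real.rpow_nonneg hr.le (a - 1))
    rw [mul_assoc, mul_rpow_sub_one hr] at h2
    rw [add_sub_cancel_left]
    gcongr
  have e2 : ‖m + w - (u + w)‖ * (r / 2) ^ (a - 1) / a ≤ r ^ a / a := by
    rw [add_sub_add_right_eq_sub, norm_sub_rev, ← dist_eq_norm]
    calc _ ≤ r / 2 * (r / 2) ^ (a - 1) / a := by gcongr
      _ = (r / 2) ^ a / a := by rw [mul_rpow_sub_one (half_pos hr)]
      _ ≤ _ := by gcongr; linarith
  refine (add_le_add e1 e2).trans (le_of_eq ?_)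
  ring

/-- Both points are pushed in the direction n₁ + n₂. The normal components of the push 5r(n₁ + n₂)
are 5r(1 + n₁ · n₂), and the bound -4/5 on the inner product makes them at least r. -/
theorem halfPlane_pair (ha : 0 < a) (ha1 : a ≤ 1) {n₁ n₂ : ℂ} {β₁ β₂ : ℝ} (hn₁ : ‖n₁‖ = 1)
    (hn₂ : ‖n₂‖ = 1) (hd : -(4 / 5) ≤ n₁.re * n₂.re + n₁.im * n₂.im)
    (hX₁ : _root_.halfPlane n₁ β₁ ⊆ X) (hX₂ : _root_.halfPlane n₂ β₂ ⊆ X) {u v : ℂ}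
    (hu : u ∈ _root_.halfPlane n₁ β₁) (hv : v ∈ _root_.halfPlane n₂ β₂) {r : ℝ} (hr : 0 < r)
    (huv : dist u v ≤ r) : Conn a X u v (22 * r ^ a / a) := by
  have hsq : ∀ {n : ℂ}, ‖n‖ = 1 → n.re * n.re + n.im * n.im = 1 := by
    intro n hn
    have : ‖n‖ ^ 2 = 1 := by rw [hn, one_pow]
    rwa [← Complex.normSq_eq_norm_sq, Complex.normSq_apply] at this
  have s1 := hsq hn₁
  have s2 := hsq hn₂
  set m : ℂ := ((1 / 2 : ℝ) : ℂ) * u + ((1 / 2 : ℝ) : ℂ) * v with hm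
  set w : ℂ := ((5 * r : ℝ) : ℂ) * (n₁ + n₂) with hw
  have hwn : ‖w‖ ≤ 10 * r := by
    rw [hw, norm_mul, Complex.norm_real, Real.norm_of_nonneg (by positivity)]
    have := norm_add_le n₁ n₂
    rw [hn₁, hn₂] at this
    have := mul_le_mul_of_nonneg_left this (show 0 ≤ 5 * r by positivity)
    linarith
  have hd' := mul_le_mul_of_nonneg_left hd (show 0 ≤ 5 * r by positivity)
  have t1 := congrArg (5 * r * ·) s1
  have t2 := congrArg (5 * r * ·) s2
  beta_reduce at t1 t2
  have hmu : dist u m ≤ r / 2 := by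
    have e : u - m = ((1 / 2 : ℝ) : ℂ) * (u - v) := by rw [hm]; push_cast; ring
    rw [dist_eq_norm, e, norm_mul, Complex.norm_real, ← dist_eq_norm]; norm_num; linarith
  have hmv : dist v m ≤ r / 2 := by
    have e : v - m = ((-(1 / 2) : ℝ) : ℂ) * (u - v) := by rw [hm]; push_cast; ring
    rw [dist_eq_norm, e, norm_mul, Complex.norm_real, ← dist_eq_norm]; norm_num; linarith
  have c1 := push (w := w) ha ha1 hn₁ hX₁ hu hr hmu hwn (by
    simp only [hw, Complex.re_ofReal_mul, Complex.im_ofReal_mul, Complex.add_re, Complex.add_im]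
    linarith)
  have c2 := push (w := w) ha ha1 hn₂ hX₂ hv hr hmv hwn (by
    simp only [hw, Complex.re_ofReal_mul, Complex.im_ofReal_mul, Complex.add_re, Complex.add_im]
    linarith)
  refine (c1.trans c2.symm).le ha1 (le_of_eq ?_)
  ring
end Conn

/-- The unit normals and offsets of the five half-planes whose union is the complement of the
pentagon. -/
noncomputable def kochSides (h : ℝ) : Set (ℂ × ℝ) :=
  {(⟨-(h / ‖kochApex h‖), 1 / (2 * ‖kochApex h‖)⟩, 0),
    (⟨h / ‖kochApex h‖, 1 / (2 * ‖kochApex h‖)⟩, h / ‖kochApex h‖), (-1, 1), (1, 2),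
    (-Complex.I, 2)}

theorem Conn.of_pos {a : ℝ} {X : Set ℂ} (ha : 0 < a) {u v : ℂ} (hu : u ∈ X) {K : ℝ}
    (h : 0 < dist u v → Conn a X u v (K * dist u v ^ a)) : Conn a X u v (K * dist u v ^ a) := by
  rcases (dist_nonneg (x := u) (y := v)).eq_or_lt with h0 | h0
  · have := dist_eq_zero.1 h0.symm
    subst this
    rw [dist_self, Real.zero_rpow ha.ne', mul_zero]
    exact Conn.refl hu
  · exact h h0

namespace KochParam
variable {g h a : ℝ} (H : KochParam g h)
include H

theorem lt_h' (h6 : g < 1 / 6) : 2 / 5 < h := by nlinarith [H.sq, H.h_pos]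

theorem apex_sq' : 4 * ‖kochApex h‖ ^ 2 = 1 + 4 * h ^ 2 := by
  rw [H.norm_sq_apex]; linarith [H.sq]

theorem mem_left_iff {z : ℂ} : z ∈ halfPlane ⟨-(h / ‖kochApex h‖), 1 / (2 * ‖kochApex h‖)⟩ 0 ↔
    2 * h * z.re ≤ z.im := by
  have := H.apex_pos
  simp only [halfPlane, mem_ofPred_eq]
  have e : -(h / ‖kochApex h‖) * z.re + 1 / (2 * ‖kochApex h‖) * z.im =
    (z.im - 2 * h * z.re) / (2 * ‖kochApex h‖) := by field_simp; ring
  rw [e, le_div_iff₀ (by positivity), zero_mul, sub_nonneg]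

theorem mem_right_iff {z : ℂ} :
    z ∈ halfPlane ⟨h / ‖kochApex h‖, 1 / (2 * ‖kochApex h‖)⟩ (h / ‖kochApex h‖) ↔
      2 * h * (1 - z.re) ≤ z.im := by
  have := H.apex_pos
  simp only [halfPlane, mem_ofPred_eq]
  rw [← sub_nonneg]
  have e : h / ‖kochApex h‖ * z.re + 1 / (2 * ‖kochApex h‖) * z.im - h / ‖kochApex h‖ =
    (z.im - 2 * h * (1 - z.re)) / (2 * ‖kochApex h‖) := by field_simp; ring
  rw [e, le_div_iff₀ (by positivity), zero_mul, sub_nonneg]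

theorem exists_side {z : ℂ} (hz : z ∉ kochP h) :
    ∃ s ∈ kochSides h, z ∈ halfPlane s.1 s.2 := by
  by_contra hc
  push Not at hc
  refine hz ⟨?_, ?_, ?_, ?_, ?_⟩
  · have := hc _ (Or.inl rfl)
    rw [H.mem_left_iff] at this
    linarith
  · have := hc _ (Or.inr (Or.inl rfl))
    rw [H.mem_right_iff] at this
    linarith
  · have := hc _ (Or.inr (Or.inr (Or.inl rfl)))
    simp [halfPlane] at this
    linarith
  · have := hc _ (Or.inr (Or.inr (Or.inr (Or.inl rfl))))
    simpa [halfPlane] using this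
  · have := hc _ (Or.inr (Or.inr (Or.inr (Or.inr rfl))))
    simp [halfPlane] at this
    linarith

theorem side_subset {s : ℂ × ℝ} (hs : s ∈ kochSides h) :
    halfPlane s.1 s.2 ⊆ (kochDomain g h)ᶜ := by
  rintro z hz ⟨⟨a1, a2, a3, a4, a5⟩, -⟩
  rcases hs with rfl | rfl | rfl | rfl | rfl
  · rw [H.mem_left_iff] at hz; linarith
  · rw [H.mem_right_iff] at hz; linarith
  · simp [halfPlane] at hz; linarith
  · simp [halfPlane] at hz; linarith
  · simp [halfPlane] at hz; linarith

theorem norm_side {s : ℂ × ℝ} (hs : s ∈ kochSides h) : ‖s.1‖ = 1 := by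
  have := H.apex_pos
  have h4 := H.apex_sq'
  have key : ∀ x : ℝ, x ^ 2 = (h / ‖kochApex h‖) ^ 2 →
      ‖(⟨x, 1 / (2 * ‖kochApex h‖)⟩ : ℂ)‖ = 1 := by
    intro x hx
    rw [← sq_eq_sq₀ (norm_nonneg _) one_pos.le, ← Complex.normSq_eq_norm_sq, Complex.normSq_mk,
      ← pow_two, hx]
    field_simp
    linarith
  rcases hs with rfl | rfl | rfl | rfl | rfl
  · exact key _ (by ring)
  · exact key _ rfl
  · simp
  · simp
  · simp

/-- Only the two vertical sides face each other; all other pairs of normals are far from opposite.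
-/
theorem side_dot (h6 : g < 1 / 6) {s t : ℂ × ℝ} (hs : s ∈ kochSides h) (ht : t ∈ kochSides h) :
    -(4 / 5) ≤ s.1.re * t.1.re + s.1.im * t.1.im ∨
      (s = (-1, 1) ∧ t = (1, 2)) ∨ (s = (1, 2) ∧ t = (-1, 1)) := by
  have hp := H.apex_pos
  have h4 := H.apex_sq'
  have hh := H.h_pos
  have hhl := H.h_lt
  have hh2 := H.lt_h' h6
  have e1 : h / ‖kochApex h‖ ≤ 4 / 5 := by
    rw [div_le_iff₀ hp]
    nlinarith
  have e2 : 1 / (2 * ‖kochApex h‖) ≤ 4 / 5 := by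
    rw [div_le_iff₀ (by positivity)]
    nlinarith
  have e3 : (h / ‖kochApex h‖) * (h / ‖kochApex h‖) +
      1 / (2 * ‖kochApex h‖) * (1 / (2 * ‖kochApex h‖)) = 1 := by
    field_simp; linarith
  have e4 : 0 ≤ h / ‖kochApex h‖ := by positivity
  have e5 : 0 ≤ 1 / (2 * ‖kochApex h‖) := by positivity
  have e6 : (h / ‖kochApex h‖) * (h / ‖kochApex h‖) ≤ 4 / 5 * (4 / 5) := by gcongr
  generalize hX : h / ‖kochApex h‖ = X at *
  generalize hY : 1 / (2 * ‖kochApex h‖) = Y at *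
  rw [kochSides, hX, hY] at hs ht
  rcases hs with rfl | rfl | rfl | rfl | rfl <;> rcases ht with rfl | rfl | rfl | rfl | rfl <;>
    first
    | exact Or.inr (Or.inl ⟨rfl, rfl⟩)
    | exact Or.inr (Or.inr ⟨rfl, rfl⟩)
    | (left
       simp only [Complex.neg_re, Complex.neg_im, Complex.one_re, Complex.one_im, Complex.I_re,
         Complex.I_im]
       linarith)

/-- Two points outside of the pentagon. -/
theorem conn_outside (h6 : g < 1 / 6) (ha : 0 < a) (ha1 : a ≤ 1) {z w : ℂ} (hz : z ∉ kochP h)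
    (hw : w ∉ kochP h) {r : ℝ} (hr : 0 < r) (hzw : dist z w ≤ r) :
    Conn a (kochDomain g h)ᶜ z w (22 * r ^ a / a) := by
  have far : ∀ {z w : ℂ}, z ∈ halfPlane (-1) 1 → w ∈ halfPlane 1 2 → z ∉ kochP h → w ∉ kochP h →
      dist z w ≤ r → Conn a (kochDomain g h)ᶜ z w (22 * r ^ a / a) := by
    intro z w hz hw hzP hwP hd
    have m3 : ((-1, 1) : ℂ × ℝ) ∈ kochSides h := Or.inr (Or.inr (Or.inl rfl))
    have m4 : ((1, 2) : ℂ × ℝ) ∈ kochSides h := Or.inr (Or.inr (Or.inr (Or.inl rfl)))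
    have m5 : ((-Complex.I, 2) : ℂ × ℝ) ∈ kochSides h := Or.inr (Or.inr (Or.inr (Or.inr rfl)))
    have z1 : z.re ≤ -1 := by
      simp [halfPlane] at hz; linarith
    have w1 : 2 ≤ w.re := by simpa [halfPlane] using hw
    have hre := (abs_le.1 (abs_re_sub_le_dist z w)).1
    -- If one of the points also lies beyond another side, the pair falls under `halfPlane_pair`.
    -- Otherwise both are at heights between -2 and 0, and the route goes down to height -2, along
    -- it, and up again. It is affordable because the two vertical sides are 3 apart.
    by_cases hgood : ∃ s ∈ kochSides h, ((z ∈ halfPlane s.1 s.2 ∧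
        -(4 / 5) ≤ s.1.re * (1 : ℂ).re + s.1.im * (1 : ℂ).im) ∨ (w ∈ halfPlane s.1 s.2 ∧
        -(4 / 5) ≤ (-1 : ℂ).re * s.1.re + (-1 : ℂ).im * s.1.im))
    · obtain ⟨s, hs, ⟨h1, h2⟩ | ⟨h1, h2⟩⟩ := hgood
      · exact Conn.halfPlane_pair ha ha1 (H.norm_side hs) (by simp) h2 (H.side_subset hs)
          (H.side_subset m4) h1 hw hr hd
      · exact Conn.halfPlane_pair ha ha1 (by simp) (H.norm_side hs) h2
          (H.side_subset m3) (H.side_subset hs) hz h1 hr hd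
    have bd : ∀ s ∈ kochSides h, s ≠ (1, 2) → s ≠ (-1, 1) →
        z ∉ halfPlane s.1 s.2 ∧ w ∉ halfPlane s.1 s.2 := by
      intro s hs h1 h2
      push Not at hgood
      have := hgood s hs
      refine ⟨fun hzs => ?_, fun hws => ?_⟩
      · rcases H.side_dot h6 hs m4 with h3 | h3 | h3
        · exact absurd h3 (not_le.2 (this.1 hzs))
        · exact h2 h3.1
        · exact h1 h3.1
      · rcases H.side_dot h6 m3 hs with h3 | h3 | h3
        · exact absurd h3 (not_le.2 (this.2 hws))
        · exact h1 h3.2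
        · exact h2 h3.2
    have hI : ((-Complex.I, 2) : ℂ × ℝ) ≠ (1, 2) ∧ ((-Complex.I, 2) : ℂ × ℝ) ≠ (-1, 1) := by
      constructor <;> simp [Complex.ext_iff]
    have b5 := bd _ m5 hI.1 hI.2
    have hs0 : (1 : ℝ) / (2 * ‖kochApex h‖) ≠ 0 := by have := H.apex_pos; positivity
    have b1 := bd _ (Or.inl rfl) (by intro hc; simp [Complex.ext_iff] at hc)
      (by intro hc; simp [Complex.ext_iff] at hc)
    have b2 := bd _ (Or.inr (Or.inl rfl)) (fun hc => hs0 (congrArg (fun s => s.1.im) hc))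
      (fun hc => hs0 (by simpa using congrArg (fun s => s.1.im) hc))
    rw [H.mem_left_iff] at b1
    have b2 := b2.2
    rw [H.mem_right_iff] at b2
    have z2 : z.im < 0 := by
      have := b1.1; have := mul_le_mul_of_nonneg_left z1 H.h_pos.le; linarith [H.h_pos]
    have w2 : w.im < 0 := by
      have := mul_le_mul_of_nonneg_left w1 H.h_pos.le; linarith [H.h_pos]
    have z3 : -2 < z.im := by have := b5.1; simp [halfPlane] at this; linarith
    have w3 : -2 < w.im := by have := b5.2; simp [halfPlane] at this; linarith
    have hd1 : ∀ v : ℂ, v.im < 0 → -2 < v.im → dist v ⟨v.re, -2⟩ ≤ r := by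
      intro v h1 h2
      refine (dist_le_abs_re_add_abs_im _ _).trans ?_
      simp only [sub_self, abs_zero, zero_add]
      rw [abs_of_nonneg (by linarith)]
      linarith
    have c1 := Conn.halfPlane (v := ⟨z.re, -2⟩) ha ha1 (by simp) (H.side_subset m3) hz
      (by simp [halfPlane]; linarith) hr (hd1 z z2 z3)
    have c2 := Conn.halfPlane (v := ⟨w.re, -2⟩) ha ha1 (by simp) (H.side_subset m4) hw
      (by simpa [halfPlane] using w1) hr (hd1 w w2 w3)
    have c3 := Conn.halfPlane (u := ⟨z.re, -2⟩) (v := ⟨w.re, -2⟩) ha ha1 (by simp)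
      (H.side_subset m5) (by simp [halfPlane]) (by simp [halfPlane]) hr (by
        refine (dist_le_abs_re_add_abs_im _ _).trans ?_
        simp only [sub_self, abs_zero, add_zero]
        exact (abs_re_sub_le_dist z w).trans hd)
    refine ((c1.trans c3).trans c2.symm).le ha1 ?_
    rw [← add_div, ← add_div]
    gcongr
    have := Real.rpow_nonneg hr.le a
    linarith
  obtain ⟨s, hs, hzs⟩ := H.exists_side hz
  obtain ⟨t, ht, hwt⟩ := H.exists_side hw
  rcases H.side_dot h6 hs ht with h1 | ⟨rfl, rfl⟩ | ⟨rfl, rfl⟩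
  · exact Conn.halfPlane_pair ha ha1 (H.norm_side hs) (H.norm_side ht) h1 (H.side_subset hs)
      (H.side_subset ht) hzs hwt hr hzw
  · exact far hzs hwt hz hw hzw
  · exact (far hwt hzs hw hz (by rwa [dist_comm])).symm
end KochParam

/-! ### The curve condition for the Koch domain -/

namespace KochParam
variable {g h a : ℝ} (H : KochParam g h)
include H

/-- The map exchanges the sides of the curve, so the part below goes to the part above. It sends the
base to the left leg and hence the thin triangle to the exterior of the pentagon. -/
theorem L_mem_compl {z : ℂ} (hz : z ∈ kochX g h) : kochL h z ∈ (kochDomain g h)ᶜ := by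
  rcases hz with hz | hz
  · intro hc
    exact hc.2 (by rw [H.A_eq]; exact Or.inl (mem_image_of_mem _ hz))
  · rintro ⟨⟨h1, -⟩, -⟩
    rw [kochL_re, kochL_im] at h1
    have h2 := hz.1
    have h3 : (1 - g) * z.im ≤ 0 := mul_nonpos_of_nonneg_of_nonpos (by linarith [H.g_lt]) h2
    have e : 2 * h * (z.re / 2 + h * z.im) - (h * z.re - z.im / 2) = (1 - g) * z.im := by
      have := H.sq
      linear_combination z.im / 2 * this
    linarith

theorem reflect_mem_A {z : ℂ} (hz : z ∈ kochA g h) : kochReflect z ∈ kochA g h := by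
  rw [H.A_eq] at hz ⊢
  rcases hz with ⟨w, hw, rfl⟩ | ⟨w, hw, rfl⟩
  · rw [reflect_kochL]; exact Or.inr (mem_image_of_mem _ (H.reflect_mem_B hw))
  · rw [reflect_kochR]; exact Or.inl (mem_image_of_mem _ (H.reflect_mem_B hw))

omit H in
theorem reflect_mem_P {z : ℂ} (hz : z ∈ kochP h) : kochReflect z ∈ kochP h := by
  obtain ⟨h1, h2, h3, h4, h5⟩ := hz
  refine ⟨?_, ?_, ?_, ?_, ?_⟩ <;> simp only [kochReflect_re, kochReflect_im] <;> linarith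

theorem reflect_mem_compl {z : ℂ} (hz : z ∈ (kochDomain g h)ᶜ) :
    kochReflect z ∈ (kochDomain g h)ᶜ := by
  rintro ⟨h1, h2⟩
  refine hz ⟨?_, fun hA => h2 (H.reflect_mem_A hA)⟩
  rw [← kochReflect_reflect z]
  exact reflect_mem_P h1

theorem conn_L (ha1 : a ≤ 1) {z w : ℂ} {I : ℝ} (hc : Conn a (kochX g h) z w I) :
    Conn a (kochDomain g h)ᶜ (kochL h z) (kochL h w) (‖kochApex h‖ ^ a * I) :=
  hc.similar ha1 H.apex_pos H.isSimilarity_L.dist_eq H.isSimilarity_L.surj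
    (image_subset_iff.2 fun _ hz => H.L_mem_compl hz)

theorem conn_compl_reflect (ha1 : a ≤ 1) {z w : ℂ} {I : ℝ}
    (hc : Conn a (kochDomain g h)ᶜ (kochReflect z) (kochReflect w) I) :
    Conn a (kochDomain g h)ᶜ z w I := by
  have := hc.similar ha1 one_pos isSimilarity_reflect.dist_eq isSimilarity_reflect.surj
    (Y := (kochDomain g h)ᶜ) (image_subset_iff.2 fun z hz => H.reflect_mem_compl hz)
  rwa [kochReflect_reflect, kochReflect_reflect, Real.one_rpow, one_mul] at this

omit H in
theorem dist_reflect (z w : ℂ) : dist (kochReflect z) (kochReflect w) = dist z w := by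
  rw [isSimilarity_reflect.dist_eq, one_mul]

theorem conn_L_apex (h6 : g < 1 / 6) (ha : 0 < a) (ha1 : a ≤ 1) {z : ℂ} (hz : z ∈ kochB g h) :
    Conn a (kochDomain g h)ᶜ (kochL h z) (kochApex h)
      (kochCost a g (9 / 2) (dist (kochL h z) (kochApex h))) := by
  have := H.conn_L ha1 (H.conn_one h6 ha ha1 hz)
  rwa [kochL_one, kochCost_scale H.g_pos.le dist_nonneg H.apex_pos.le, ← dist_kochL,
    kochL_one] at this

theorem conn_L_L (h6 : g < 1 / 6) (ha : 0 < a) (ha1 : a ≤ 1) {z w : ℂ} (hz : z ∈ kochB g h)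
    (hw : w ∈ kochB g h) : Conn a (kochDomain g h)ᶜ (kochL h z) (kochL h w)
      (12 / (a * g) * dist (kochL h z) (kochL h w) ^ a) := by
  refine (H.conn_L ha1 (H.conn_pair h6 ha ha1 hz hw)).le ha1 (le_of_eq ?_)
  rw [dist_kochL, Real.mul_rpow H.apex_pos.le dist_nonneg]
  ring

theorem conn_L_R (h6 : g < 1 / 6) (ha : 0 < a) (ha1 : a ≤ 1) {z w : ℂ} (hz : z ∈ kochB g h)
    (hw : w ∈ kochB g h) : Conn a (kochDomain g h)ᶜ (kochL h z) (kochR h w)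
      (12 / (a * g) * dist (kochL h z) (kochR h w) ^ a) := by
  have hg := H.g_pos
  have hzL : kochL h z ∈ kochL h '' kochT h := mem_image_of_mem _ (H.B_subset_T hz)
  have hwR : kochR h w ∈ kochR h '' kochT h := mem_image_of_mem _ (H.B_subset_T hw)
  have s1 := H.separation_L hzL hwR
  have s2 := H.separation_R hzL hwR
  have c1 := H.conn_L_apex h6 ha ha1 hz
  have c2 : Conn a (kochDomain g h)ᶜ (kochR h w) (kochApex h)
      (kochCost a g (9 / 2) (dist (kochR h w) (kochApex h))) := by
    refine H.conn_compl_reflect ha1 ?_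
    have := H.conn_L_apex h6 ha ha1 (H.reflect_mem_B hw)
    rw [← reflect_kochR] at this
    have e : kochReflect (kochApex h) = kochApex h := by
      apply Complex.ext <;> simp; norm_num
    have e2 := dist_reflect (kochR h w) (kochApex h)
    rw [e] at e2 ⊢
    rwa [e2] at this
  set r := dist (kochL h z) (kochR h w) with hr
  refine (c1.trans c2.symm).le ha1 ?_
  have k1 := kochCost_le (a := a) ha hg (show (0 : ℝ) ≤ 9 / 2 by norm_num) dist_nonneg s1
  have k2 := kochCost_le (a := a) ha hg (show (0 : ℝ) ≤ 9 / 2 by norm_num) dist_nonneg s2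
  refine (add_le_add k1 k2).trans ?_
  rw [← add_mul, ← add_div]
  gcongr
  norm_num

/-- Three positions of v are distinguished. Beyond the left leg the route passes through a point of
that leg; beyond the right leg, or outside of the large box only, it passes through the apex. -/
theorem conn_L_outside (h6 : g < 1 / 6) (ha : 0 < a) (ha1 : a ≤ 1) {w v : ℂ}
    (hw : w ∈ kochB g h) (hv : v ∉ kochP h) {r : ℝ} (hr : 0 < r)
    (hd : dist (kochL h w) v ≤ r) :
    Conn a (kochDomain g h)ᶜ (kochL h w) v (12 / (a * g) * r ^ a) := by
  have hg := H.g_pos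
  have hh := H.h_pos
  have hh2 := H.lt_h' h6
  have hh3 := H.h_lt
  have hs := H.apex_pos
  have hd' : dist v (kochL h w) ≤ r := by rwa [dist_comm]
  have hwT := H.B_subset_T hw
  have hra : 0 < r ^ a := Real.rpow_pos_of_pos hr a
  -- Costs in half-planes carry no factor 1 / g, so g < 1/6 lets them count for only a sixth.
  have unit : ∀ N : ℝ, 0 ≤ N → N * r ^ a / a ≤ N / 6 * (r ^ a / (a * g)) := by
    intro N hN
    have e : N / 6 * (r ^ a / (a * g)) = N * r ^ a / a * (1 / (6 * g)) := by field_simp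
    rw [e]
    refine le_mul_of_one_le_right (by positivity) ?_
    rw [le_div_iff₀ (by positivity)]
    linarith
  have m1 : ((⟨-(h / ‖kochApex h‖), 1 / (2 * ‖kochApex h‖)⟩, 0) : ℂ × ℝ) ∈ kochSides h := Or.inl rfl
  have m2 : ((⟨h / ‖kochApex h‖, 1 / (2 * ‖kochApex h‖)⟩, h / ‖kochApex h‖) : ℂ × ℝ) ∈
    kochSides h := Or.inr (Or.inl rfl)
  have fin : ∀ {I J : ℝ} {x : ℂ}, Conn a (kochDomain g h)ᶜ (kochL h w) x I →
      Conn a (kochDomain g h)ᶜ x v J → I + J ≤ 12 * (r ^ a / (a * g)) →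
      Conn a (kochDomain g h)ᶜ (kochL h w) v (12 / (a * g) * r ^ a) := by
    intro I J x h1 h2 h3
    refine (h1.trans h2).le ha1 (h3.trans (le_of_eq ?_))
    ring
  -- The distance of `kochL h w` from the left leg is ‖apex‖ w.im. As v lies beyond this leg, the
  -- height of w in its cell is controlled by r, and the base point of `exists_conn_base` is carried
  -- to the leg.
  by_cases hv1 : 2 * h * v.re ≤ v.im
  · obtain ⟨e, heB, he0, hde, hce⟩ := H.exists_conn_base h6 ha ha1 hw
    have hsw : ‖kochApex h‖ * w.im ≤ r := by
      have k3 := halfPlane_le_of_dist (n := ⟨-(h / ‖kochApex h‖), 1 / (2 * ‖kochApex h‖)⟩)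
        (H.norm_side m1) hd'
      have k2 : 0 ≤ -(h / ‖kochApex h‖) * v.re + 1 / (2 * ‖kochApex h‖) * v.im :=
        H.mem_left_iff.2 hv1
      simp only at k3
      have e1 : -(h / ‖kochApex h‖) * (kochL h w).re + 1 / (2 * ‖kochApex h‖) * (kochL h w).im =
          -(‖kochApex h‖ * w.im) := by
        rw [kochL_re, kochL_im]
        have := H.apex_sq'
        field_simp
        linear_combination w.im * this
      linarith
    have hw0 := hwT.1
    have c1 := H.conn_L ha1 hce
    rw [kochCost_scale hg.le (by positivity) hs.le] at c1
    have k1 := kochCost_le (a := a) (x := ‖kochApex h‖ * (5 / 2 * w.im)) (r := r) ha hg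
      (show (0 : ℝ) ≤ 6 by norm_num) (by positivity) (by
        have : g * (‖kochApex h‖ * (5 / 2 * w.im)) ≤ g * (5 / 2 * r) := by
          refine mul_le_mul_of_nonneg_left ?_ hg.le
          linarith
        refine this.trans ?_
        have := mul_le_mul_of_nonneg_right h6.le hr.le
        linarith)
    have hde' : dist (kochL h e) v ≤ 7 / 2 * r := by
      have t1 := dist_triangle_left (kochL h e) v (kochL h w)
      have t2 := dist_kochL h w e
      have t3 := mul_le_mul_of_nonneg_left hde hs.le
      linarith
    have c2 := Conn.halfPlane ha ha1 (H.norm_side m1) (H.side_subset m1) (u := kochL h e)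
      (H.mem_left_iff.2 (by rw [kochL_re, kochL_im, he0]; apply le_of_eq; ring))
      (H.mem_left_iff.2 hv1) (by positivity) hde'
    refine fin c1 c2 ?_
    have k2 : 3 * (7 / 2 * r) ^ a / a ≤ (21 / 2) * r ^ a / a := by
      have := rpow_scale_le ha1 (show (1 : ℝ) ≤ 7 / 2 by norm_num) hr.le
      exact div_le_div_of_nonneg_right (by linarith) ha.le
    have k3 := unit (21 / 2) (by norm_num)
    have e2 : 6 / (a * g) * r ^ a = 6 * (r ^ a / (a * g)) := by ring
    have : 0 < r ^ a / (a * g) := by positivity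
    linarith
  · push Not at hv1
    have hcP : kochApex h ∉ kochP h := by
      rintro ⟨h1, -⟩
      simp at h1
      linarith
    have c1 := H.conn_L_apex h6 ha ha1 hw
    have near : ∀ k : ℝ, k ≤ 2 → dist (kochL h w) (kochApex h) ≤ k * r →
        kochCost a g (9 / 2) (dist (kochL h w) (kochApex h)) ≤ 9 / 2 * (r ^ a / (a * g)) := by
      intro k hk hdk
      refine (kochCost_le (a := a) (r := r) ha hg (show (0 : ℝ) ≤ 9 / 2 by norm_num)
        dist_nonneg ?_).trans (le_of_eq (by ring))
      have t1 := mul_le_mul_of_nonneg_left hdk hg.le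
      have t2 := mul_le_mul_of_nonneg_right hk hr.le
      have t3 := mul_le_mul h6.le t2 (dist_nonneg.trans hdk) (by norm_num)
      linarith
    -- Now the distance to the line of the right leg is at most r. The left subtriangle approaches
    -- this line only at the apex, at an angle that gives distance at most 2r from the apex.
    by_cases hv2 : 2 * h * (1 - v.re) ≤ v.im
    · have hdc : dist (kochL h w) (kochApex h) ≤ 2 * r := by
        have k3 := halfPlane_le_of_dist (n := ⟨h / ‖kochApex h‖, 1 / (2 * ‖kochApex h‖)⟩)
          (H.norm_side m2) hd'
        have k2 : h / ‖kochApex h‖ ≤ h / ‖kochApex h‖ * v.re + 1 / (2 * ‖kochApex h‖) * v.im :=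
          H.mem_right_iff.2 hv2
        simp only at k3
        have e1 : h / ‖kochApex h‖ - (h / ‖kochApex h‖ * (kochL h w).re +
            1 / (2 * ‖kochApex h‖) * (kochL h w).im) =
            (2 * h * (1 - w.re) + g * w.im) / (2 * ‖kochApex h‖) := by
          rw [kochL_re, kochL_im]
          have := H.sq
          field_simp
          linear_combination (-w.im) * this
        have k4 : (2 * h * (1 - w.re) + g * w.im) / (2 * ‖kochApex h‖) ≤ r := by linarith
        rw [div_le_iff₀ (by positivity)] at k4
        have hx : 0 ≤ 1 - w.re := sub_nonneg.2 (H.re_le_of_mem_T hwT)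
        have k5 : dist w 1 ≤ (1 - w.re) + w.im := by
          refine (dist_le_abs_re_add_abs_im _ _).trans ?_
          rw [abs_of_nonpos (by simpa using hx), abs_of_nonneg (by simpa using hwT.1)]
          simp
        rw [← kochL_one h, dist_kochL]
        have hsq := H.norm_sq_apex
        have k6 : ‖kochApex h‖ ^ 2 * ((1 - w.re) + w.im) ≤ 2 * h * (1 - w.re) + g * w.im := by
          have t1 : (1 + 2 * h) * (1 + (2 * h) ^ 2) ≤ 4 * (2 * h) := by
            have : 0 ≤ (1 - 2 * h) * ((2 * h) ^ 2 + 2 * (2 * h) - 1) :=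
              mul_nonneg (by linarith) (by nlinarith)
            linarith
          have t2 := mul_le_mul_of_nonneg_right t1 hx
          have t3 := hwT.2.2
          have t4 := H.apex_sq'
          have t5 : 0 ≤ g * w.im := mul_nonneg hg.le hwT.1
          have t6 := mul_le_mul_of_nonneg_left t3 (sq_nonneg ‖kochApex h‖)
          have t7 : ‖kochApex h‖ ^ 2 * (1 - w.re) * (1 + 2 * h) * 4 ≤ 4 * (2 * h) * (1 - w.re) := by
            have : ‖kochApex h‖ ^ 2 * (1 - w.re) * (1 + 2 * h) * 4 =
              (1 + 2 * h) * (1 + (2 * h) ^ 2) * (1 - w.re) := by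
                linear_combination (1 - w.re) * (1 + 2 * h) * t4
            linarith
          linarith
        have k7 := mul_le_mul_of_nonneg_left k5 (sq_nonneg ‖kochApex h‖)
        refine le_of_mul_le_mul_left ?_ hs
        have : ‖kochApex h‖ * (‖kochApex h‖ * dist w 1) = ‖kochApex h‖ ^ 2 * dist w 1 := by ring
        linarith
      have hd3 : dist (kochApex h) v ≤ 3 * r := by
        have := dist_triangle_left (kochApex h) v (kochL h w)
        linarith
      have c2 := Conn.halfPlane ha ha1 (H.norm_side m2) (H.side_subset m2) (u := kochApex h)
        (H.mem_right_iff.2 (by simp; linarith)) (H.mem_right_iff.2 hv2) (by positivity) hd3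
      refine fin c1 c2 ?_
      have k1 := near 2 le_rfl hdc
      have k2 : 3 * (3 * r) ^ a / a ≤ 9 * r ^ a / a := by
        have := rpow_scale_le ha1 (show (1 : ℝ) ≤ 3 by norm_num) hr.le
        exact div_le_div_of_nonneg_right (by linarith) ha.le
      have k3 := unit 9 (by norm_num)
      have : 0 < r ^ a / (a * g) := by positivity
      linarith
    -- Here v violates a condition of the large box, so r ≥ 1 and the distance to the apex is at
    -- most r. This is the case that nearly uses up the constant 12: the sum is 9/2 + 44/6.
    · push Not at hv2
      have hz := H.mapsTo_L hwT
      have hzr := H.re_le_of_mem_L hwT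
      have hzr0 := H.re_nonneg_of_mem_T hz
      have hzi := hz.1
      have hzi' := H.im_le_of_mem_T hz
      have hr1 : 1 ≤ r := by
        have d1 := abs_le.1 ((abs_re_sub_le_dist _ _).trans hd)
        have d2 := abs_le.1 ((abs_im_sub_le_dist _ _).trans hd)
        by_contra hr1
        push Not at hr1
        exact hv ⟨hv1, hv2, by linarith, by linarith, by linarith⟩
      have hdc : dist (kochL h w) (kochApex h) ≤ 1 * r := by
        refine (dist_le_abs_re_add_abs_im _ _).trans ?_
        rw [kochApex_re, kochApex_im, abs_of_nonpos (by linarith), abs_of_nonpos (by linarith)]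
        linarith
      have hd3 : dist (kochApex h) v ≤ 2 * r := by
        have := dist_triangle_left (kochApex h) v (kochL h w)
        linarith
      have c2 := H.conn_outside h6 ha ha1 hcP hv (by positivity) hd3
      refine fin c1 c2 ?_
      have k1 := near 1 (by norm_num) hdc
      have k2 : 22 * (2 * r) ^ a / a ≤ 44 * r ^ a / a := by
        have := rpow_scale_le ha1 (show (1 : ℝ) ≤ 2 by norm_num) hr.le
        exact div_le_div_of_nonneg_right (by linarith) ha.le
      have k3 := unit 44 (by norm_num)
      have : 0 < r ^ a / (a * g) := by positivity
      linarith

theorem conn_compl (h6 : g < 1 / 6) (ha : 0 < a) (ha1 : a ≤ 1) {z w : ℂ}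
    (hz : z ∈ (kochDomain g h)ᶜ) (hw : w ∈ (kochDomain g h)ᶜ) :
    Conn a (kochDomain g h)ᶜ z w (12 / (a * g) * dist z w ^ a) := by
  have hg := H.g_pos
  have cases : ∀ {z : ℂ}, z ∈ (kochDomain g h)ᶜ → z ∉ kochP h ∨ (∃ v ∈ kochB g h, z = kochL h v) ∨
      ∃ v ∈ kochB g h, z = kochR h v := by
    intro z hz
    by_cases hP : z ∈ kochP h
    · have : z ∈ kochA g h := by
        by_contra hA
        exact hz ⟨hP, hA⟩
      rw [H.A_eq] at this
      rcases this with ⟨v, hv, rfl⟩ | ⟨v, hv, rfl⟩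
      · exact Or.inr (Or.inl ⟨v, hv, rfl⟩)
      · exact Or.inr (Or.inr ⟨v, hv, rfl⟩)
    · exact Or.inl hP
  have RO : ∀ {v u : ℂ}, v ∈ kochB g h → u ∉ kochP h → ∀ {r : ℝ}, 0 < r → dist (kochR h v) u ≤ r →
      Conn a (kochDomain g h)ᶜ (kochR h v) u (12 / (a * g) * r ^ a) := by
    intro v u hv hu r hr hd
    refine H.conn_compl_reflect ha1 ?_
    rw [reflect_kochR]
    refine H.conn_L_outside h6 ha ha1 (H.reflect_mem_B hv) (fun hP => hu ?_) hr ?_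
    · rw [← kochReflect_reflect u]; exact reflect_mem_P hP
    · rwa [← reflect_kochR, dist_reflect]
  refine Conn.of_pos ha hz fun hr => ?_
  rcases cases hz with hz | ⟨v, hv, rfl⟩ | ⟨v, hv, rfl⟩ <;>
    rcases cases hw with hw | ⟨u, hu, rfl⟩ | ⟨u, hu, rfl⟩
  · refine (H.conn_outside h6 ha ha1 hz hw hr le_rfl).le ha1 ?_
    have hra := Real.rpow_pos_of_pos hr a
    have e : 12 / (a * g) * dist z w ^ a = 12 / g * dist z w ^ a / a := by field_simp
    rw [e]
    have : 22 ≤ 12 / g := by rw [le_div_iff₀ hg]; linarith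
    gcongr
  · rw [dist_comm] at hr ⊢
    exact (H.conn_L_outside h6 ha ha1 hu hz hr le_rfl).symm
  · rw [dist_comm] at hr ⊢
    exact (RO hu hz hr le_rfl).symm
  · exact H.conn_L_outside h6 ha ha1 hv hw hr le_rfl
  · exact H.conn_L_L h6 ha ha1 hv hu
  · exact H.conn_L_R h6 ha ha1 hv hu
  · exact RO hv hw hr le_rfl
  · rw [dist_comm]
    exact (H.conn_L_R h6 ha ha1 hu hv).symm
  · refine H.conn_compl_reflect ha1 ?_
    have := H.conn_L_L h6 ha ha1 (H.reflect_mem_B hv) (H.reflect_mem_B hu)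
    rwa [← reflect_kochR, ← reflect_kochR, dist_reflect] at this
end KochParam

/-- `Conn` in the complement of Ω measures the distance to Ω itself, which is at most the distance
to its boundary. The exponent is nonpositive, so the cost only decreases. -/
theorem satisfiesCurveCondition_toPlane {p C : ℝ} (hp : 1 ≤ p) {Ω : Set ℂ} (hf : (frontier Ω).Nonempty)
    (h : ∀ z ∈ Ωᶜ, ∀ w ∈ Ωᶜ, Conn (2 - p) Ωᶜ z w (C * dist z w ^ (2 - p))) :
    SatisfiesCurveCondition p C (toPlane '' Ω) := by
  have hc : (toPlane '' Ω)ᶜ = toPlane '' Ωᶜ := (image_compl_eq toPlane.bijective).symm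
  rw [SatisfiesCurveCondition, hc]
  rintro _ ⟨z, hz, rfl⟩ _ ⟨w, hw, rfl⟩
  obtain ⟨-, l, hl, γ, h1, h2, h3, h4, h5⟩ := h z hz w hw
  refine ⟨l, fun t => toPlane (γ t), hl, h1.toPlane, congrArg toPlane h2, congrArg toPlane h3,
    fun t ht => mem_image_of_mem _ (h4 t ht), ?_⟩
  rw [← map_sub, LinearIsometryEquiv.norm_map, ← dist_eq_norm]
  refine le_trans (lintegral_mono fun t => ?_) h5
  rw [toPlane_infDist, show 2 - p - 1 = 1 - p by ring]
  refine ENNReal.rpow_anti_of_nonpos (by linarith) ?_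
  rw [compl_compl, infDist, ENNReal.ofReal_toReal (infEDist_ne_top hf)]
  rw [← infEDist_closure]
  exact infEDist_anti frontier_subset_closure

/-- The width g = 12 / ((2 - p)C) makes the constant of `conn_compl` equal to C. The condition g <
1/6 is C > 72 / (2 - p), and 2g / log 2 is the stated loss of dimension. -/
theorem exists_curve_condition_dimH {p C : ℝ} (hp : 1 < p) (hp2 : p < 2) (hC : 72 / (2 - p) < C) :
    ∃ Ω : Set (EuclideanSpace ℝ (Fin 2)), IsJordanDomain Ω ∧ SatisfiesCurveCondition p C Ω ∧
      ENNReal.ofReal (2 - 24 / (Real.log 2 * (2 - p) * C)) ≤ dimH (frontier Ω) := by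
  have ha : 0 < 2 - p := by linarith
  have hC0 : 0 < C := lt_trans (by positivity) hC
  rw [div_lt_iff₀ ha] at hC
  have hg6 : 12 / ((2 - p) * C) < 1 / 6 := by
    rw [div_lt_iff₀ (by positivity)]; linarith
  obtain ⟨h, H⟩ := exists_kochParam (g := 12 / ((2 - p) * C)) (by positivity) (by linarith)
  refine ⟨_, H.isJordanDomain, satisfiesCurveCondition_toPlane hp.le ?_ ?_, ?_⟩
  · rw [H.frontier_domain]
    exact ⟨0, Or.inl H.zero_mem_K⟩
  · intro z hz w hw
    have := H.conn_compl hg6 ha (by linarith) hz hw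
    convert this using 2
    field_simp
  · rw [toPlane_dimH]
    convert H.two_sub_le_dimH_frontier using 3
    have : Real.log 2 ≠ 0 := (Real.log_pos one_lt_two).ne'
    field_simp
    norm_num

/-! ### Refinement of paths in the square grid -/

/-- The four unit steps of the square grid. -/
def IsStep (u : ℤ × ℤ) : Prop := u = (1, 0) ∨ u = (-1, 0) ∨ u = (0, 1) ∨ u = (0, -1)

/-- Two cells of the grid which touch each other. -/
def Near (p q : ℤ × ℤ) : Prop := |p.1 - q.1| ≤ 1 ∧ |p.2 - q.2| ≤ 1

/-- A path in the square grid such that only neighboring cells touch. -/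
structure IsSnake (p : ℤ → ℤ × ℤ) : Prop where
  step : ∀ k, IsStep (p (k + 1) - p k)
  turn : ∀ k, p (k + 2) ≠ p k
  near : ∀ i j, Near (p i) (p j) → |i - j| ≤ 2

/-- The cells passed by the path when it runs straight through a block. -/
def straightBlock : List (ℤ × ℤ) :=
  [(-3, 0), (-2, 0), (-2, 1), (-1, 1), (0, 1), (1, 1), (2, 1), (2, 0), (3, 0)]

/-- The cells passed by the path when it turns in a block. -/
def turnBlock : List (ℤ × ℤ) :=
  [(-3, 0), (-2, 0), (-2, -1), (-1, -1), (0, -1), (0, 0), (0, 1), (0, 2), (0, 3)]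

/-- The cells passed in a block, by entrance and exit. -/
def snakeBlock (u v : ℤ × ℤ) : List (ℤ × ℤ) := if u = v then straightBlock else turnBlock

/-- The second axis of a block. -/
def snakeAxis (u v : ℤ × ℤ) : ℤ × ℤ := if u = v then (-u.2, u.1) else v

/-- The position in a block with given axes. -/
def blockPos (u w x : ℤ × ℤ) : ℤ × ℤ := (x.1 * u.1 + x.2 * w.1, x.1 * u.2 + x.2 * w.2)

/-- The `j`-th position in a block. -/
def snakeOffset (u v : ℤ × ℤ) (j : ℕ) : ℤ × ℤ :=
  blockPos u (snakeAxis u v) ((snakeBlock u v).getD j 0)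

/-- The refinement of a path. -/
def snakeRefine (p : ℤ → ℤ × ℤ) (k : ℤ) : ℤ × ℤ :=
  (7 * (p (k / 9)).1, 7 * (p (k / 9)).2) +
    snakeOffset (p (k / 9) - p (k / 9 - 1)) (p (k / 9 + 1) - p (k / 9)) (k % 9).toNat

/-- The axes of a block are orthonormal. -/
structure IsAxes (u w : ℤ × ℤ) : Prop where
  left : IsStep u
  cross : w = (-u.2, u.1) ∨ w = (u.2, -u.1)

namespace IsAxes
variable {u w : ℤ × ℤ} (h : IsAxes u w)
include h

theorem cases : (u = (1, 0) ∧ (w = (0, 1) ∨ w = (0, -1))) ∨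
    (u = (-1, 0) ∧ (w = (0, 1) ∨ w = (0, -1))) ∨
    (u = (0, 1) ∧ (w = (1, 0) ∨ w = (-1, 0))) ∨ (u = (0, -1) ∧ (w = (1, 0) ∨ w = (-1, 0))) := by
  obtain ⟨h1, h2⟩ := h
  rcases h1 with rfl | rfl | rfl | rfl <;> rcases h2 with rfl | rfl <;> simp

theorem pos_cases :
    ((∀ x, blockPos u w x = (x.1, x.2)) ∨ (∀ x, blockPos u w x = (x.1, -x.2)) ∨
    (∀ x, blockPos u w x = (-x.1, x.2)) ∨ (∀ x, blockPos u w x = (-x.1, -x.2)) ∨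
    (∀ x, blockPos u w x = (x.2, x.1)) ∨ (∀ x, blockPos u w x = (x.2, -x.1)) ∨
    (∀ x, blockPos u w x = (-x.2, x.1)) ∨ (∀ x, blockPos u w x = (-x.2, -x.1))) := by
  rcases h.cases with ⟨rfl, rfl | rfl⟩ | ⟨rfl, rfl | rfl⟩ | ⟨rfl, rfl | rfl⟩ | ⟨rfl, rfl | rfl⟩ <;>
    simp [blockPos]
end IsAxes

theorem isAxes_snakeAxis {u v : ℤ × ℤ} (hu : IsStep u) (hv : IsStep v) (huv : u + v ≠ 0) :
    IsAxes u (snakeAxis u v) := by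
  refine ⟨hu, ?_⟩
  unfold snakeAxis
  rcases hu with rfl | rfl | rfl | rfl <;> rcases hv with rfl | rfl | rfl | rfl <;>
    first | (exact absurd rfl huv) | decide

theorem snakeBlock_cases (u v : ℤ × ℤ) :
    snakeBlock u v = straightBlock ∨ snakeBlock u v = turnBlock := by
  unfold snakeBlock; split_ifs <;> simp

/-- The finite facts about the two blocks are decided in standard position, and `IsAxes.pos_cases`
transports them by the eight symmetries of the square. Decisive here: the path avoids the corners of
a block and meets its rim only at the entrance and the exit. -/
theorem block_bound : ∀ B ∈ [straightBlock, turnBlock], ∀ j < 9, |(B.getD j 0).1| ≤ 3 ∧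
    |(B.getD j 0).2| ≤ 3 ∧ (|(B.getD j 0).1| < 3 ∨ |(B.getD j 0).2| < 3) ∧
    (|(B.getD j 0).1| = 3 ∨ |(B.getD j 0).2| = 3 → j = 0 ∨ j = 8) := by decide

theorem block_step : ∀ B ∈ [straightBlock, turnBlock], ∀ j < 8,
    IsStep (B.getD (j + 1) 0 - B.getD j 0) := by
  unfold IsStep; decide

theorem block_near : ∀ B ∈ [straightBlock, turnBlock], ∀ i < 9, ∀ j < 9, i ≤ j →
    Near (B.getD i 0) (B.getD j 0) → j ≤ i + 2 := by
  unfold Near; decide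

theorem block_turn : ∀ B ∈ [straightBlock, turnBlock], ∀ j < 7,
    B.getD (j + 2) 0 ≠ B.getD j 0 := by decide

section Offsets
variable {u v : ℤ × ℤ} (hu : IsStep u) (hv : IsStep v) (huv : u + v ≠ 0)
include hu hv huv

theorem snakeOffset_zero : snakeOffset u v 0 = (-3 * u.1, -3 * u.2) := by
  unfold snakeOffset snakeAxis snakeBlock
  rcases hu with rfl | rfl | rfl | rfl <;> rcases hv with rfl | rfl | rfl | rfl <;>
    first | (exact absurd rfl huv) | decide

theorem snakeOffset_eight : snakeOffset u v 8 = (3 * v.1, 3 * v.2) := by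
  unfold snakeOffset snakeAxis snakeBlock
  rcases hu with rfl | rfl | rfl | rfl <;> rcases hv with rfl | rfl | rfl | rfl <;>
    first | (exact absurd rfl huv) | decide

theorem snakeBlock_mem : snakeBlock u v ∈ [straightBlock, turnBlock] := by
  rcases snakeBlock_cases u v with h | h <;> simp [h]

theorem snakeOffset_bound {j : ℕ} (hj : j < 9) : |(snakeOffset u v j).1| ≤ 3 ∧
    |(snakeOffset u v j).2| ≤ 3 ∧ (|(snakeOffset u v j).1| < 3 ∨ |(snakeOffset u v j).2| < 3) ∧
    (|(snakeOffset u v j).1| = 3 ∨ |(snakeOffset u v j).2| = 3 → j = 0 ∨ j = 8) := by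
  have := block_bound _ (snakeBlock_mem hu hv huv) j hj
  unfold snakeOffset
  rcases (isAxes_snakeAxis hu hv huv).pos_cases with h | h | h | h | h | h | h | h <;>
    rw [h] <;> simp only [abs_neg] <;> tauto

theorem snakeOffset_step {j : ℕ} (hj : j < 8) :
    IsStep (snakeOffset u v (j + 1) - snakeOffset u v j) := by
  have := block_step _ (snakeBlock_mem hu hv huv) j hj
  unfold snakeOffset
  generalize (snakeBlock u v).getD (j + 1) 0 = x at *
  generalize (snakeBlock u v).getD j 0 = y at *
  simp only [IsStep, Prod.ext_iff, Prod.fst_sub, Prod.snd_sub] at this ⊢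
  rcases (isAxes_snakeAxis hu hv huv).pos_cases with h | h | h | h | h | h | h | h <;>
    rw [h, h] <;> simp only <;> omega

theorem snakeOffset_near {i j : ℕ} (hi : i < 9) (hj : j < 9) (hij : i ≤ j)
    (hn : Near (snakeOffset u v i) (snakeOffset u v j)) : j ≤ i + 2 := by
  refine block_near _ (snakeBlock_mem hu hv huv) i hi j hj hij ?_
  unfold snakeOffset at hn
  unfold Near at hn ⊢
  generalize (snakeBlock u v).getD i 0 = x at *
  generalize (snakeBlock u v).getD j 0 = y at *
  rcases (isAxes_snakeAxis hu hv huv).pos_cases with h | h | h | h | h | h | h | h <;>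
    rw [h, h] at hn <;> simp only [abs_le] at hn ⊢ <;> omega

theorem snakeOffset_turn {j : ℕ} (hj : j < 7) : snakeOffset u v (j + 2) ≠ snakeOffset u v j := by
  have := block_turn _ (snakeBlock_mem hu hv huv) j hj
  unfold snakeOffset
  generalize (snakeBlock u v).getD (j + 2) 0 = x at *
  generalize (snakeBlock u v).getD j 0 = y at *
  simp only [ne_eq, Prod.ext_iff] at this ⊢
  rcases (isAxes_snakeAxis hu hv huv).pos_cases with h | h | h | h | h | h | h | h <;>
    rw [h, h] <;> simp only <;> omega

theorem eq_eight_of_dot {j : ℕ} (hj : j < 9)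
    (h : (snakeOffset u v j).1 * v.1 + (snakeOffset u v j).2 * v.2 = 3) : j = 8 := by
  have b := snakeOffset_bound hu hv huv hj
  have e := snakeOffset_zero hu hv huv
  rcases b.2.2.2 (by
    simp only [abs_eq (show (0 : ℤ) ≤ 3 by norm_num)]
    rcases hv with rfl | rfl | rfl | rfl <;> simp only at h <;> omega) with rfl | h8
  · exfalso
    rw [e] at h
    rcases hu with rfl | rfl | rfl | rfl <;> rcases hv with rfl | rfl | rfl | rfl <;>
      simp at h huv
  · exact h8

theorem eq_zero_of_dot {j : ℕ} (hj : j < 9)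
    (h : (snakeOffset u v j).1 * u.1 + (snakeOffset u v j).2 * u.2 = -3) : j = 0 := by
  have b := snakeOffset_bound hu hv huv hj
  have e := snakeOffset_eight hu hv huv
  rcases b.2.2.2 (by
    simp only [abs_eq (show (0 : ℤ) ≤ 3 by norm_num)]
    rcases hu with rfl | rfl | rfl | rfl <;> simp only at h <;> omega) with h0 | rfl
  · exact h0
  · exfalso
    rw [e] at h
    rcases hu with rfl | rfl | rfl | rfl <;> rcases hv with rfl | rfl | rfl | rfl <;>
      simp at h huv
end Offsets

/-- Cells of adjacent blocks can touch only if they lie on the facing sides. Combined with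
`eq_eight_of_dot` and `eq_zero_of_dot`, they must be an exit and the following entrance. -/
theorem dot_of_adjacent {v o o' : ℤ × ℤ} (hv : IsStep v) (h1 : |o.1| ≤ 3) (h2 : |o.2| ≤ 3)
    (h3 : |o'.1| ≤ 3) (h4 : |o'.2| ≤ 3)
    (h : Near o ((7 * v.1, 7 * v.2) + o')) :
    o.1 * v.1 + o.2 * v.2 = 3 ∧ o'.1 * v.1 + o'.2 * v.2 = -3 := by
  unfold Near at h
  rcases hv with rfl | rfl | rfl | rfl <;>
    simp only [Prod.fst_add, Prod.snd_add, abs_le] at * <;> omega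

theorem snakeRefine_eq (p : ℤ → ℤ × ℤ) (q : ℤ) {j : ℕ} (hj : j < 9) :
    snakeRefine p (9 * q + j) = (7 * (p q).1, 7 * (p q).2) +
      snakeOffset (p q - p (q - 1)) (p (q + 1) - p q) j := by
  unfold snakeRefine
  have h1 : (9 * q + j) / 9 = q := by omega
  have h2 : ((9 * q + j) % 9).toNat = j := by omega
  rw [h1, h2]

theorem exists_block (k : ℤ) : ∃ (q : ℤ) (j : ℕ), j < 9 ∧ k = 9 * q + j :=
  ⟨k / 9, (k % 9).toNat, by omega, by omega⟩

namespace IsSnake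
variable {p : ℤ → ℤ × ℤ} (H : IsSnake p)
include H

theorem step' (k : ℤ) : IsStep (p k - p (k - 1)) := by
  have := H.step (k - 1)
  rwa [sub_add_cancel] at this

theorem add_ne (k : ℤ) : (p k - p (k - 1)) + (p (k + 1) - p k) ≠ 0 := by
  have := H.turn (k - 1)
  rw [show k - 1 + 2 = k + 1 by ring] at this
  intro h
  apply this
  rw [add_comm, sub_add_sub_cancel, sub_eq_zero] at h
  exact h

theorem injective : Function.Injective p := by
  intro i j hij
  by_contra hne
  wlog hlt : i < j generalizing i j
  · exact this hij.symm (Ne.symm hne) (lt_of_le_of_ne (not_lt.1 hlt) (Ne.symm hne))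
  have h1 := H.near i j (by rw [hij]; unfold Near; simp)
  rw [abs_le] at h1
  rcases (show j = i + 1 ∨ j = i + 2 by omega) with rfl | rfl
  · have := H.step i
    rw [hij, sub_self] at this
    rcases this with h | h | h | h <;> simp [Prod.ext_iff] at h
  · exact H.turn i hij.symm

theorem refine_eq_add (q : ℤ) : snakeRefine p (9 * (q + 1)) =
    (7 * (p q).1 + 4 * (p (q + 1) - p q).1, 7 * (p q).2 + 4 * (p (q + 1) - p q).2) := by
  have := snakeRefine_eq p (q + 1) (j := 0) (by norm_num)
  rw [Nat.cast_zero, add_zero, snakeOffset_zero (H.step' _) (H.step _) (H.add_ne _)] at this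
  rw [this, add_sub_cancel_right]
  ext <;> simp <;> ring

/-- Touching cells lie in touching blocks, so the block indices differ by at most 2. Within a block
the table decides, and for consecutive blocks only exit and entrance touch. Blocks two apart in the
path can touch only diagonally, at corner cells, which the path avoids. -/
theorem refine_near_of_le {i j : ℤ} (hij : i ≤ j)
    (hn : Near (snakeRefine p i) (snakeRefine p j)) : j ≤ i + 2 := by
  obtain ⟨q, s, hs, rfl⟩ := exists_block i
  obtain ⟨r, t, ht, rfl⟩ := exists_block j
  rw [snakeRefine_eq p q hs, snakeRefine_eq p r ht] at hn
  have b1 := snakeOffset_bound (H.step' q) (H.step q) (H.add_ne q) hs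
  have b2 := snakeOffset_bound (H.step' r) (H.step r) (H.add_ne r) ht
  have near : Near (p q) (p r) := by
    unfold Near at hn ⊢
    simp only [Prod.fst_add, Prod.snd_add, abs_le] at *
    omega
  have hqr := H.near _ _ near
  rw [abs_le] at hqr
  rcases (show r = q ∨ r = q + 1 ∨ r = q + 2 by omega) with rfl | rfl | rfl
  · have : Near (snakeOffset (p r - p (r - 1)) (p (r + 1) - p r) s)
        (snakeOffset (p r - p (r - 1)) (p (r + 1) - p r) t) := by
      unfold Near at hn ⊢
      simpa using hn
    have := snakeOffset_near (H.step' r) (H.step r) (H.add_ne r) hs ht (by omega) this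
    omega
  · have hd := dot_of_adjacent (H.step q) b1.1 b1.2.1 b2.1 b2.2.1 (by
      unfold Near at hn ⊢
      simp only [Prod.fst_add, Prod.snd_add, Prod.fst_sub, Prod.snd_sub, abs_le] at *
      omega)
    have hs8 := eq_eight_of_dot (H.step' q) (H.step q) (H.add_ne q) hs hd.1
    have ht0 := eq_zero_of_dot (H.step' (q + 1)) (H.step (q + 1)) (H.add_ne (q + 1)) ht (by
      rw [add_sub_cancel_right]; rw [add_sub_cancel_right] at hd; exact hd.2)
    subst hs8 ht0
    push_cast
    omega
  · exfalso
    have h1 := H.step q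
    have h2 := H.step (q + 1)
    have h3 := H.turn q
    rw [show q + 1 + 1 = q + 2 by ring] at h2
    unfold Near IsStep at *
    simp only [Prod.fst_add, Prod.snd_add, Prod.ext_iff, Prod.fst_sub, Prod.snd_sub,
      abs_le, abs_lt, ne_eq] at *
    omega

theorem refine : IsSnake (snakeRefine p) := by
  refine ⟨fun k => ?_, fun k => ?_, fun i j hn => ?_⟩
  · obtain ⟨q, j, hj, rfl⟩ := exists_block k
    rcases (show j < 8 ∨ j = 8 by omega) with h8 | rfl
    · have e : 9 * q + (j : ℤ) + 1 = 9 * q + ((j + 1 : ℕ) : ℤ) := by push_cast; ring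
      rw [e, snakeRefine_eq p q (by omega), snakeRefine_eq p q hj, add_sub_add_left_eq_sub]
      exact snakeOffset_step (H.step' q) (H.step q) (H.add_ne q) h8
    · have e : 9 * q + ((8 : ℕ) : ℤ) + 1 = 9 * (q + 1) := by push_cast; ring
      rw [e, H.refine_eq_add, snakeRefine_eq p q hj,
        snakeOffset_eight (H.step' q) (H.step q) (H.add_ne q)]
      convert H.step q using 1
      ext <;> simp <;> ring
  · obtain ⟨q, j, hj, rfl⟩ := exists_block k
    rcases (show j < 7 ∨ j = 7 ∨ j = 8 by omega) with h7 | rfl | rfl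
    · have e : 9 * q + (j : ℤ) + 2 = 9 * q + ((j + 2 : ℕ) : ℤ) := by push_cast; ring
      rw [e, snakeRefine_eq p q (by omega), snakeRefine_eq p q hj]
      intro h
      exact snakeOffset_turn (H.step' q) (H.step q) (H.add_ne q) h7 (add_left_cancel h)
    · have e : 9 * q + ((7 : ℕ) : ℤ) + 2 = 9 * (q + 1) := by push_cast; ring
      rw [e, H.refine_eq_add, snakeRefine_eq p q hj]
      have b := snakeOffset_bound (H.step' q) (H.step q) (H.add_ne q) hj
      have hst := H.step q
      intro h
      unfold IsStep at hst
      simp only [Prod.ext_iff, Prod.fst_sub, Prod.snd_sub, Prod.fst_add, Prod.snd_add,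
        abs_le] at *
      omega
    · have e : 9 * q + ((8 : ℕ) : ℤ) + 2 = 9 * (q + 1) + (1 : ℕ) := by push_cast; ring
      rw [e, snakeRefine_eq p _ (by norm_num), snakeRefine_eq p q hj,
        snakeOffset_eight (H.step' q) (H.step q) (H.add_ne q)]
      have b := snakeOffset_bound (H.step' (q + 1)) (H.step (q + 1)) (H.add_ne (q + 1))
        (j := 1) (by norm_num)
      have hst := H.step q
      intro h
      unfold IsStep at hst
      simp only [Prod.ext_iff, Prod.fst_sub, Prod.snd_sub, Prod.fst_add, Prod.snd_add,
        abs_le] at *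
      omega
  · rcases le_total i j with h | h
    · have := H.refine_near_of_le h hn
      rw [abs_le]; omega
    · have := H.refine_near_of_le h (by
        unfold Near at hn ⊢; rw [abs_sub_comm, abs_sub_comm (snakeRefine p j).2]; exact hn)
      rw [abs_le]; omega
end IsSnake

/-- The paths whose thickenings are the fractal corridors. -/
def snakePath : ℕ → ℤ → ℤ × ℤ
  -- The index set is all of ℤ so that every cell has an entrance and an exit direction; the
  -- corridor uses only the indices from 0 to 9 ^ n - 1.
  | 0 => fun k => (k, 0)
  | n + 1 => snakeRefine (snakePath n)

theorem isSnake_snakePath (n : ℕ) : IsSnake (snakePath n) := by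
  induction n with
  | zero =>
    refine ⟨fun k => Or.inl (by ext <;> simp [snakePath]), fun k => by simp [snakePath],
      fun i j h => ?_⟩
    unfold Near at h
    simp only [snakePath] at h
    linarith [h.1]
  | succ n ih => exact ih.refine

theorem snakePath_bound (n : ℕ) : ∀ k : ℤ, 0 ≤ k → k < 9 ^ n →
    |2 * (snakePath n k).1| ≤ 7 ^ n - 1 ∧ |2 * (snakePath n k).2| ≤ 7 ^ n - 1 := by
  induction n with
  | zero =>
    intro k h0 h1
    have : k = 0 := by rw [pow_zero] at h1; omega
    subst this
    simp [snakePath]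
  | succ n ih =>
    intro k h0 h1
    obtain ⟨q, j, hj, rfl⟩ := exists_block k
    have H := isSnake_snakePath n
    rw [pow_succ] at h1
    have := ih q (by omega) (by omega)
    have b := snakeOffset_bound (H.step' q) (H.step q) (H.add_ne q) hj
    show |2 * (snakeRefine (snakePath n) _).1| ≤ _ ∧ |2 * (snakeRefine (snakePath n) _).2| ≤ _
    rw [snakeRefine_eq _ q hj, pow_succ]
    simp only [Prod.fst_add, Prod.snd_add, abs_le] at *
    omega

theorem convex_reProdIm {s t : Set ℝ} (hs : Convex ℝ s) (ht : Convex ℝ t) : Convex ℝ (s ×ℂ t) :=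
  (hs.linear_preimage Complex.reLm).inter (ht.linear_preimage Complex.imLm)

/-! ### Attaching a square to a Jordan region -/

/-- A closed Jordan region. -/
structure IsJordanRegion (U : Set ℂ) : Prop where
  closed : IsClosed U
  jordan : IsJordanCurve (frontier U)
  conn : IsConnected (interior U)
  regular : U ⊆ closure (interior U)

/-- The square attached to the edge from `-i/2` to `i/2`. -/
def rightSquare : Set ℂ := {z | 0 ≤ z.re ∧ z.re ≤ 1 ∧ |z.im| ≤ 1 / 2}

/-- The truncation to `[-1/2, 1/2]`. -/
noncomputable def clampHalf (t : ℝ) : ℝ := max (-(1 / 2)) (min (1 / 2) t)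

/-- The first coordinate of the parametrization of the other three sides of the square. -/
noncomputable def sideHeight (y : ℝ) : ℝ := max 0 (min 1 (3 * (1 / 2 - |y|)))

/-- A map of the plane which pushes an edge of the square onto the other three sides. -/
noncomputable def pushEdge (z : ℂ) : ℂ :=
  ⟨z.re + max 0 (1 - 2 * |z.re|) * sideHeight z.im,
    z.im + max 0 (1 - 2 * |z.re|) * (clampHalf (3 * z.im) - clampHalf z.im)⟩

theorem clampHalf_of_mem {t : ℝ} (h : |t| ≤ 1 / 2) : clampHalf t = t := by
  rw [abs_le] at h
  rw [clampHalf, min_eq_right h.2, max_eq_right h.1]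

theorem clampHalf_of_ge {t : ℝ} (h : 1 / 2 ≤ t) : clampHalf t = 1 / 2 := by
  rw [clampHalf, min_eq_left h, max_eq_right (by norm_num)]

theorem clampHalf_of_le {t : ℝ} (h : t ≤ -(1 / 2)) : clampHalf t = -(1 / 2) := by
  rw [clampHalf, min_eq_right (by linarith), max_eq_left h]

theorem sideHeight_of_ge {y : ℝ} (h : 1 / 2 ≤ |y|) : sideHeight y = 0 := by
  rw [sideHeight, max_eq_left (min_le_of_right_le (by linarith))]

theorem sideHeight_of_mem {y : ℝ} (h : 1 / 6 ≤ |y|) (h' : |y| ≤ 1 / 2) :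
    sideHeight y = 3 * (1 / 2 - |y|) := by
  rw [sideHeight, min_eq_right (by linarith), max_eq_right (by linarith)]

theorem sideHeight_of_le {y : ℝ} (h : |y| ≤ 1 / 6) : sideHeight y = 1 := by
  rw [sideHeight, min_eq_left (by linarith), max_eq_right (by norm_num)]

theorem continuous_pushEdge : Continuous pushEdge := by
  have h1 : Continuous fun z : ℂ => z.re + max 0 (1 - 2 * |z.re|) * sideHeight z.im := by
    unfold sideHeight; fun_prop
  have h2 : Continuous fun z : ℂ => z.im +
      max 0 (1 - 2 * |z.re|) * (clampHalf (3 * z.im) - clampHalf z.im) := by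
    unfold clampHalf; fun_prop
  exact Complex.equivRealProdCLM.symm.continuous.comp (h1.prodMk h2)

theorem pushEdge_of_edge {z : ℂ} (h0 : z.re = 0) (h1 : |z.im| ≤ 1 / 2) :
    pushEdge z = ⟨sideHeight z.im, clampHalf (3 * z.im)⟩ := by
  apply Complex.ext <;> simp [pushEdge, h0, clampHalf_of_mem h1]

theorem pushEdge_of_far {z : ℂ} (h : 1 / 2 ≤ |z.re| ∨ 1 / 2 ≤ |z.im|) : pushEdge z = z := by
  rcases h with h | h
  · have : max 0 (1 - 2 * |z.re|) = 0 := max_eq_left (by linarith)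
    apply Complex.ext <;> simp [pushEdge, this]
  · have h2 : clampHalf (3 * z.im) = clampHalf z.im := by
      rcases le_abs.1 h with h | h
      · rw [clampHalf_of_ge h, clampHalf_of_ge (by linarith)]
      · rw [clampHalf_of_le (by linarith), clampHalf_of_le (by linarith)]
    apply Complex.ext <;> simp [pushEdge, sideHeight_of_ge h, h2]

/-- The three other sides of the square, without the corners on the edge. -/
def threeSides : Set ℂ := {z | 0 < z.re ∧ z.re ≤ 1 ∧ |z.im| ≤ 1 / 2 ∧ (z.re = 1 ∨ |z.im| = 1 / 2)}

/-- The open edge. -/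
def openEdge : Set ℂ := {z | z.re = 0 ∧ |z.im| < 1 / 2}

theorem pushEdge_image_openEdge : pushEdge '' openEdge = threeSides := by
  ext z
  constructor
  · rintro ⟨w, ⟨h0, h1⟩, rfl⟩
    rw [pushEdge_of_edge h0 h1.le]
    rcases le_total |w.im| (1 / 6) with h | h
    · rw [sideHeight_of_le h, clampHalf_of_mem (by rw [abs_mul, abs_of_pos three_pos]; linarith)]
      exact ⟨one_pos, le_rfl, by
        show |3 * w.im| ≤ _
        rw [abs_mul, abs_of_pos three_pos]; linarith, Or.inl rfl⟩
    · have : |clampHalf (3 * w.im)| = 1 / 2 := by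
        rcases le_abs.1 h with h | h
        · rw [clampHalf_of_ge (by linarith)]; norm_num
        · rw [clampHalf_of_le (by linarith)]; norm_num
      rw [sideHeight_of_mem h h1.le]
      exact ⟨by show 0 < 3 * (1 / 2 - |w.im|); linarith,
        by show 3 * (1 / 2 - |w.im|) ≤ 1; linarith, this.le, Or.inr this⟩
  · rintro ⟨h0, h1, h2, h3⟩
    by_cases hr : z.re = 1
    · have h6 : |z.im / 3| ≤ 1 / 6 := by
        rw [abs_div, abs_of_pos (show (0 : ℝ) < 3 by norm_num)]; linarith
      refine ⟨⟨0, z.im / 3⟩, ⟨rfl, h6.trans_lt (by norm_num)⟩, ?_⟩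
      rw [pushEdge_of_edge rfl (h6.trans (by norm_num))]
      simp only
      rw [sideHeight_of_le h6, mul_div_cancel₀ _ three_ne_zero, clampHalf_of_mem h2]
      exact Complex.ext hr.symm rfl
    · have h4 := h3.resolve_left hr
      rcases (abs_eq (by norm_num)).1 h4 with h5 | h5
      · have e : |(1 / 2 - z.re / 3)| = 1 / 2 - z.re / 3 := abs_of_nonneg (by linarith)
        refine ⟨⟨0, 1 / 2 - z.re / 3⟩, ⟨rfl, by rw [e]; linarith⟩, ?_⟩
        rw [pushEdge_of_edge rfl (by simp only [e]; linarith)]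
        simp only
        rw [sideHeight_of_mem (by rw [e]; linarith) (by rw [e]; linarith), e,
          clampHalf_of_ge (by linarith)]
        exact Complex.ext (by simp only; ring) h5.symm
      · have e : |(z.re / 3 - 1 / 2)| = 1 / 2 - z.re / 3 := by
          rw [abs_of_nonpos (by linarith)]; ring
        refine ⟨⟨0, z.re / 3 - 1 / 2⟩, ⟨rfl, by rw [e]; linarith⟩, ?_⟩
        rw [pushEdge_of_edge rfl (by simp only [e]; linarith)]
        simp only
        rw [sideHeight_of_mem (by rw [e]; linarith) (by rw [e]; linarith), e,
          clampHalf_of_le (by linarith)]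
        exact Complex.ext (by simp only; ring) h5.symm

theorem pushEdge_injOn_openEdge : InjOn pushEdge openEdge := by
  rintro z ⟨h0, h1⟩ w ⟨k0, k1⟩ h
  rw [pushEdge_of_edge h0 h1.le, pushEdge_of_edge k0 k1.le, Complex.ext_iff] at h
  obtain ⟨e1, e2⟩ := h
  simp only at e1 e2
  have key : ∀ y : ℝ, |y| < 1 / 2 → (|y| ≤ 1 / 6 ∧ sideHeight y = 1 ∧ clampHalf (3 * y) = 3 * y) ∨
      (1 / 6 < y ∧ sideHeight y = 3 * (1 / 2 - y) ∧ clampHalf (3 * y) = 1 / 2) ∨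
      (y < -(1 / 6) ∧ sideHeight y = 3 * (1 / 2 + y) ∧ clampHalf (3 * y) = -(1 / 2)) := by
    intro y hy
    rcases le_or_gt |y| (1 / 6) with h | h
    · exact Or.inl ⟨h, sideHeight_of_le h,
        clampHalf_of_mem (by rw [abs_mul, abs_of_pos three_pos]; linarith)⟩
    · right
      have e := sideHeight_of_mem h.le hy.le
      rcases lt_abs.1 h with h | h
      · rw [abs_of_pos (by linarith)] at e
        exact Or.inl ⟨h, e, clampHalf_of_ge (by linarith)⟩
      · rw [abs_of_neg (by linarith), sub_neg_eq_add] at e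
        exact Or.inr ⟨by linarith, e, clampHalf_of_le (by linarith)⟩
  refine Complex.ext (by rw [h0, k0]) ?_
  rcases key _ h1 with ⟨a1, a2, a3⟩ | ⟨a1, a2, a3⟩ | ⟨a1, a2, a3⟩ <;>
    rcases key _ k1 with ⟨b1, b2, b3⟩ | ⟨b1, b2, b3⟩ | ⟨b1, b2, b3⟩ <;>
    rw [a2, b2] at e1 <;> rw [a3, b3] at e2 <;> linarith

theorem isClosed_rightSquare : IsClosed rightSquare := by
  have h1 : IsClosed {z : ℂ | 0 ≤ z.re} := isClosed_le (by fun_prop) (by fun_prop)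
  have h2 : IsClosed {z : ℂ | z.re ≤ 1} := isClosed_le (by fun_prop) (by fun_prop)
  have h3 : IsClosed {z : ℂ | |z.im| ≤ 1 / 2} := isClosed_le (by fun_prop) (by fun_prop)
  exact h1.inter (h2.inter h3)

theorem interior_rightSquare_subset : interior rightSquare ⊆ {z | z.re < 1 ∧ |z.im| < 1 / 2} := by
  intro z hz
  have h1 := interior_mono (show rightSquare ⊆ {z | z.re ≤ 1} from fun _ h => h.2.1) hz
  have h2 := interior_mono (show rightSquare ⊆ {z | z.im ≤ 1 / 2} from
    fun _ h => (abs_le.1 h.2.2).2) hz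
  have h3 := interior_mono (show rightSquare ⊆ {z | -(1 / 2) ≤ z.im} from
    fun _ h => (abs_le.1 h.2.2).1) hz
  rw [Complex.interior_setOfPred_re_le] at h1
  rw [Complex.interior_setOfPred_im_le] at h2
  rw [Complex.interior_setOfPred_le_im] at h3
  exact ⟨h1, abs_lt.2 ⟨h3, h2⟩⟩

/-- The map `pushEdge` is the identity on the old boundary outside the open edge, and it sends this
edge bijectively to the other three sides. So the new boundary is an injective continuous image of
the old one. The condition on the two corners ensures that the ends of the edge remain boundary
points. -/
theorem IsJordanRegion.add_square {U : Set ℂ} (hU : IsJordanRegion U)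
    (hQ : ∀ z ∈ U, z ∈ rightSquare → z.re = 0)
    (hR : ∀ z : ℂ, -1 ≤ z.re → z.re ≤ 0 → |z.im| ≤ 1 / 2 → z ∈ U)
    (hc : ∀ z : ℂ, z.re = 0 → |z.im| = 1 / 2 → z ∉ interior (U ∪ rightSquare)) :
    IsJordanRegion (U ∪ rightSquare) := by
  have hcl : IsClosed (U ∪ rightSquare) := hU.closed.union isClosed_rightSquare
  have hboxe : ∀ a b : ℝ, {z : ℂ | (a < z.re ∧ z.re < b) ∧ |z.im| < 1 / 2} =
      Ioo a b ×ℂ Ioo (-(1 / 2)) (1 / 2) := by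
    intro a b
    ext z
    simp only [Complex.mem_reProdIm, mem_ofPred_eq, mem_Ioo, abs_lt]
  have hboxo : ∀ a b : ℝ, IsOpen {z : ℂ | (a < z.re ∧ z.re < b) ∧ |z.im| < 1 / 2} := fun a b => by
    rw [hboxe]; exact isOpen_Ioo.reProdIm isOpen_Ioo
  have hbox : ∀ a b : ℝ, Convex ℝ {z : ℂ | (a < z.re ∧ z.re < b) ∧ |z.im| < 1 / 2} := fun a b => by
    rw [hboxe]; exact convex_reProdIm (convex_Ioo a b) (convex_Ioo _ _)
  have hboxc : rightSquare ⊆ closure {z : ℂ | (0 < z.re ∧ z.re < 1) ∧ |z.im| < 1 / 2} := by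
    rw [hboxe, Complex.closure_reProdIm, closure_Ioo (by norm_num), closure_Ioo (by norm_num)]
    exact fun z hz => ⟨⟨hz.1, hz.2.1⟩, abs_le.1 hz.2.2⟩
  have hleft : {z : ℂ | (-1 < z.re ∧ z.re < 0) ∧ |z.im| < 1 / 2} ⊆ interior U :=
    interior_maximal (fun z hz => hR z hz.1.1.le hz.1.2.le hz.2.le) (hboxo _ _)
  -- The open box across the edge makes the open edge interior and connects the old interior with
  -- the new square.
  have hD : {z : ℂ | (-1 < z.re ∧ z.re < 1) ∧ |z.im| < 1 / 2} ⊆ interior (U ∪ rightSquare) := by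
    refine interior_maximal (fun z hz => ?_) (hboxo _ _)
    rcases le_total z.re 0 with h | h
    · exact Or.inl (hR z hz.1.1.le h hz.2.le)
    · exact Or.inr ⟨h, hz.1.2.le, hz.2.le⟩
  have hedge : openEdge ⊆ frontier U := by
    rintro z ⟨h0, h1⟩
    rw [hU.closed.frontier_eq]
    refine ⟨hR z (by rw [h0]; norm_num) h0.le h1.le, fun hz => ?_⟩
    obtain ⟨ε, hε, hb⟩ := Metric.mem_nhds_iff.1 (mem_interior_iff_mem_nhds.1 hz)
    set δ := min (ε / 2) 1 with hδ
    have hδ0 : 0 < δ := by positivity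
    have hmem : z + (δ : ℂ) ∈ U := hb (by
      rw [mem_ball, dist_eq_norm, add_sub_cancel_left, Complex.norm_real,
        Real.norm_of_nonneg hδ0.le]
      exact (min_le_left _ _).trans_lt (by linarith))
    have := hQ _ hmem ⟨by simp [h0, hδ0.le], by simp [h0, hδ], by simpa using h1.le⟩
    simp [h0] at this
    exact hδ0.ne' this
  have hnear : ∀ z ∈ frontier U, z ∉ openEdge → 1 / 2 ≤ |z.re| ∨ 1 / 2 ≤ |z.im| := by
    intro z hz hne
    rw [hU.closed.frontier_eq] at hz
    by_contra hcon
    push Not at hcon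
    have h1 := abs_lt.1 hcon.1
    rcases lt_or_ge z.re 0 with h | h
    · exact hz.2 (hleft ⟨⟨by linarith, h⟩, hcon.2⟩)
    · exact hne ⟨hQ z hz.1 ⟨h, by linarith, hcon.2.le⟩, hcon.2⟩
  have hfr : frontier (U ∪ rightSquare) = (frontier U \ openEdge) ∪ threeSides := by
    rw [hcl.frontier_eq]
    ext z
    constructor
    · rintro ⟨hz, hzi⟩
      by_cases hzU : z ∈ U
      · left
        rw [hU.closed.frontier_eq]
        refine ⟨⟨hzU, fun h => hzi (interior_mono subset_union_left h)⟩, fun h => hzi (hD ?_)⟩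
        exact ⟨by rw [h.1]; norm_num, h.2⟩
      · right
        obtain ⟨h1, h2, h3⟩ := hz.resolve_left hzU
        have h0 : 0 < z.re := lt_of_le_of_ne h1 fun h => hzU (hR z (by linarith) h.ge h3)
        refine ⟨h0, h2, h3, ?_⟩
        by_contra hcon
        push Not at hcon
        exact hzi (hD ⟨⟨by linarith, lt_of_le_of_ne h2 hcon.1⟩, lt_of_le_of_ne h3 hcon.2⟩)
    · rintro (⟨hz, hne⟩ | ⟨h0, h1, h2, h3⟩)
      · rw [hU.closed.frontier_eq] at hz
        refine ⟨Or.inl hz.1, fun hi => ?_⟩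
        by_cases hzQ : z ∈ rightSquare
        · have h0 := hQ z hz.1 hzQ
          refine hc z h0 (le_antisymm hzQ.2.2 ?_) hi
          by_contra hlt
          exact hne ⟨h0, not_le.1 hlt⟩
        · refine hz.2 (mem_interior.2 ⟨interior (U ∪ rightSquare) ∩ rightSquareᶜ, ?_,
            isOpen_interior.inter isClosed_rightSquare.isOpen_compl, hi, hzQ⟩)
          exact fun w hw => (interior_subset hw.1).resolve_right hw.2
      · refine ⟨Or.inr ⟨h0.le, h1, h2⟩, fun hi => ?_⟩
        have hzU : z ∉ U := fun h => h0.ne' (hQ z h ⟨h0.le, h1, h2⟩)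
        have := interior_rightSquare_subset (mem_interior.2
          ⟨interior (U ∪ rightSquare) ∩ Uᶜ, fun w hw => (interior_subset hw.1).resolve_left hw.2,
            isOpen_interior.inter hU.closed.isOpen_compl, hi, hzU⟩)
        rcases h3 with h3 | h3
        · exact this.1.ne h3
        · exact this.2.ne h3
  have hfix : ∀ z ∈ frontier U, z ∉ openEdge → pushEdge z = z := fun z hz hne =>
    pushEdge_of_far (hnear z hz hne)
  have hsideU : ∀ z ∈ threeSides, z ∉ U := fun z hz hzU =>
    hz.1.ne' (hQ z hzU ⟨hz.1.le, hz.2.1, hz.2.2.1⟩)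
  have himg : pushEdge '' frontier U = frontier (U ∪ rightSquare) := by
    rw [hfr, ← pushEdge_image_openEdge]
    conv_lhs => rw [← sdiff_union_of_subset hedge, image_union]
    congr 1
    refine (image_congr fun z hz => hfix z hz.1 hz.2).trans (image_id' _)
  refine ⟨hcl, ?_, ?_, ?_⟩
  · rw [← himg]
    refine hU.jordan.image continuous_pushEdge.continuousOn ?_
    intro z hz w hw hzw
    have mixed : ∀ z ∈ frontier U, z ∉ openEdge → ∀ w ∈ openEdge, pushEdge z ≠ pushEdge w := by
      intro z hz hne w hw h
      rw [hfix z hz hne] at h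
      refine hsideU z ?_ (hU.closed.frontier_subset hz)
      rw [h, ← pushEdge_image_openEdge]
      exact mem_image_of_mem _ hw
    by_cases h1 : z ∈ openEdge <;> by_cases h2 : w ∈ openEdge
    · exact pushEdge_injOn_openEdge h1 h2 hzw
    · exact absurd hzw.symm (mixed w hw h2 z h1)
    · exact absurd hzw (mixed z hz h1 w h2)
    · rwa [hfix z hz h1, hfix w hw h2] at hzw
  · have hc1 : IsConnected (interior U ∪ {z : ℂ | (-1 < z.re ∧ z.re < 1) ∧ |z.im| < 1 / 2}) := by
      refine IsConnected.union ?_ hU.conn ⟨⟨0, by simp⟩, (hbox _ _).isPreconnected⟩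
      exact ⟨⟨-(1 / 2), 0⟩, hleft (by simp; norm_num), by simp; norm_num⟩
    refine hc1.subset_closure (union_subset (interior_mono subset_union_left) hD) ?_
    refine interior_subset.trans (union_subset
      (hU.regular.trans (closure_mono subset_union_left)) (hboxc.trans (closure_mono ?_)))
    exact fun z hz => Or.inr ⟨⟨by linarith [hz.1.1], hz.1.2⟩, hz.2⟩
  · refine union_subset (hU.regular.trans (closure_mono (interior_mono subset_union_left)))
      (hboxc.trans (closure_mono (interior_maximal (fun z hz => ?_) (hboxo _ _))))
    exact Or.inr ⟨hz.1.1.le, hz.1.2.le, hz.2.le⟩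

namespace IsJordanRegion
variable {U : Set ℂ} (hU : IsJordanRegion U)
include hU

theorem image (e : ℂ ≃ₜ ℂ) : IsJordanRegion (e '' U) := by
  refine ⟨e.isClosedMap _ hU.closed, ?_, ?_, ?_⟩
  · rw [← e.image_frontier]
    exact hU.jordan.image e.continuous.continuousOn e.injective.injOn
  · rw [← e.image_interior]
    exact hU.conn.image _ e.continuous.continuousOn
  · rw [← e.image_interior, ← e.image_closure]
    exact image_mono hU.regular

theorem frontier_interior : frontier (interior U) = frontier U := by
  have h : closure (interior U) = U :=
    subset_antisymm (hU.closed.closure_subset_iff.2 interior_subset) hU.regular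
  rw [isOpen_interior.frontier_eq, h, hU.closed.frontier_eq]
end IsJordanRegion

/-! ### Unions of grid cells along a path -/

/-- The closed unit square around a point of the grid. -/
def gridCell (q : ℤ × ℤ) : Set ℂ :=
  Icc (q.1 - 1 / 2 : ℝ) (q.1 + 1 / 2) ×ℂ Icc (q.2 - 1 / 2 : ℝ) (q.2 + 1 / 2)

theorem mem_gridCell {q : ℤ × ℤ} {z : ℂ} : z ∈ gridCell q ↔
    (q.1 - 1 / 2 ≤ z.re ∧ z.re ≤ q.1 + 1 / 2) ∧ (q.2 - 1 / 2 ≤ z.im ∧ z.im ≤ q.2 + 1 / 2) := Iff.rfl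

theorem convex_gridCell (q : ℤ × ℤ) : Convex ℝ (gridCell q) :=
  convex_reProdIm (convex_Icc _ _) (convex_Icc _ _)

theorem isClosed_gridCell (q : ℤ × ℤ) : IsClosed (gridCell q) :=
  isClosed_Icc.reProdIm isClosed_Icc

theorem interior_gridCell (q : ℤ × ℤ) : interior (gridCell q) =
    Ioo (q.1 - 1 / 2 : ℝ) (q.1 + 1 / 2) ×ℂ Ioo (q.2 - 1 / 2 : ℝ) (q.2 + 1 / 2) := by
  rw [gridCell, Complex.interior_reProdIm, interior_Icc, interior_Icc]

theorem gridCell_subset_closure (q : ℤ × ℤ) : gridCell q ⊆ closure (interior (gridCell q)) := by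
  rw [interior_gridCell, Complex.closure_reProdIm, closure_Ioo (by linarith),
    closure_Ioo (by linarith), gridCell]

theorem isJordanRegion_gridCell (q : ℤ × ℤ) : IsJordanRegion (gridCell q) := by
  have hne : (interior (gridCell q)).Nonempty := by
    rw [interior_gridCell]
    exact ⟨⟨q.1, q.2⟩, ⟨by simp, by simp⟩, ⟨by simp, by simp⟩⟩
  have hb : Bornology.IsBounded (gridCell q) := by
    have h1 := isBounded_Icc (q.1 - 1 / 2 : ℝ) (q.1 + 1 / 2)
    have h2 := isBounded_Icc (q.2 - 1 / 2 : ℝ) (q.2 + 1 / 2)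
    exact h1.reProdIm h2
  have hcl : closure (interior (gridCell q)) = gridCell q := subset_antisymm
    ((isClosed_gridCell q).closure_subset_iff.2 interior_subset) (gridCell_subset_closure q)
  refine ⟨isClosed_gridCell q, ?_, (convex_gridCell q).interior.isConnected hne,
    gridCell_subset_closure q⟩
  have := (convex_gridCell q).interior.isJordanCurve_frontier isOpen_interior hne
    (hb.subset interior_subset)
  rwa [isOpen_interior.frontier_eq, hcl, ← (isClosed_gridCell q).frontier_eq] at this

theorem near_of_mem {q q' : ℤ × ℤ} {z w : ℂ} (hz : z ∈ gridCell q) (hw : w ∈ gridCell q')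
    (hd : dist z w < 1) : Near q q' := by
  rw [mem_gridCell] at hz hw
  have h1 := abs_lt.1 ((abs_re_sub_le_dist z w).trans_lt hd)
  have h2 := abs_lt.1 ((abs_im_sub_le_dist z w).trans_lt hd)
  have e1 : (q.1 : ℝ) - q'.1 < 2 := by linarith
  have e2 : (q'.1 : ℝ) - q.1 < 2 := by linarith
  have e3 : (q.2 : ℝ) - q'.2 < 2 := by linarith
  have e4 : (q'.2 : ℝ) - q.2 < 2 := by linarith
  norm_cast at e1 e2 e3 e4
  exact ⟨abs_le.2 ⟨by omega, by omega⟩, abs_le.2 ⟨by omega, by omega⟩⟩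

theorem exists_mem_gridCell (z : ℂ) : ∃ q, z ∈ gridCell q := by
  refine ⟨(round z.re, round z.im), ?_⟩
  have h1 := abs_le.1 (abs_sub_round z.re)
  have h2 := abs_le.1 (abs_sub_round z.im)
  rw [mem_gridCell]
  simp only
  refine ⟨⟨?_, ?_⟩, ?_, ?_⟩ <;> linarith

theorem eq_of_mem_interior {q q' : ℤ × ℤ} {z : ℂ} (hz : z ∈ interior (gridCell q))
    (hz' : z ∈ gridCell q') : q = q' := by
  rw [interior_gridCell] at hz
  rw [mem_gridCell] at hz'
  obtain ⟨⟨h1, h2⟩, h3, h4⟩ := hz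
  have e1 : (q.1 : ℝ) - q'.1 < 1 := by linarith
  have e2 : (q'.1 : ℝ) - q.1 < 1 := by linarith
  have e3 : (q.2 : ℝ) - q'.2 < 1 := by linarith
  have e4 : (q'.2 : ℝ) - q.2 < 1 := by linarith
  norm_cast at e1 e2 e3 e4
  ext <;> omega

/-- The union of the cells of an initial piece of a path. -/
def snakeBody (p : ℤ → ℤ × ℤ) (m : ℕ) : Set ℂ := {z | ∃ i : ℕ, i < m ∧ z ∈ gridCell (p i)}

/-- The cells which do not belong to an initial piece of a path. -/
def emptyCells (p : ℤ → ℤ × ℤ) (m : ℕ) : Set (ℤ × ℤ) := {q | ∀ i : ℕ, i < m → p i ≠ q}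

theorem notMem_interior_body {p : ℤ → ℤ × ℤ} {m : ℕ} {q : ℤ × ℤ} (hq : q ∈ emptyCells p m) {z : ℂ}
    (hz : z ∈ gridCell q) : z ∉ interior (snakeBody p m) := by
  intro hi
  obtain ⟨w, hw, hwq⟩ := mem_closure_iff.1 (gridCell_subset_closure q hz) _ isOpen_interior hi
  obtain ⟨i, him, hwi⟩ := interior_subset hw
  exact hq i him (eq_of_mem_interior hwq hwi).symm

/-- The point is a limit of points outside the body, each in a free cell. Only finitely many cells
come near the point, so the union of the relevant free cells is closed and contains it. -/
theorem exists_emptyCell {p : ℤ → ℤ × ℤ} {m : ℕ} {z : ℂ} (hz : z ∉ interior (snakeBody p m)) :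
    ∃ q ∈ emptyCells p m, z ∈ gridCell q := by
  set S : Set (ℤ × ℤ) := emptyCells p m ∩ Icc (⌊z.re⌋ - 3, ⌊z.im⌋ - 3) (⌊z.re⌋ + 3, ⌊z.im⌋ + 3)
  have hS : S.Finite := (finite_Icc _ _).subset inter_subset_right
  have hY : IsClosed (⋃ q ∈ S, gridCell q) := hS.isClosed_biUnion fun q _ => isClosed_gridCell q
  have hmem : z ∈ closure (⋃ q ∈ S, gridCell q) := by
    have h1 : z ∈ closure (snakeBody p m)ᶜ := by rwa [closure_compl]
    rw [Metric.mem_closure_iff] at h1 ⊢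
    intro ε hε
    obtain ⟨w, hw, hd⟩ := h1 (min ε 1) (by positivity)
    obtain ⟨q, hq⟩ := exists_mem_gridCell w
    refine ⟨w, mem_iUnion₂.2 ⟨q, ⟨fun i hi he => hw ⟨i, hi, he ▸ hq⟩, ?_⟩, hq⟩,
      hd.trans_le (min_le_left _ _)⟩
    have hd1 := hd.trans_le (min_le_right _ _)
    have k1 := abs_lt.1 ((abs_re_sub_le_dist z w).trans_lt hd1)
    have k2 := abs_lt.1 ((abs_im_sub_le_dist z w).trans_lt hd1)
    rw [mem_gridCell] at hq
    have f1 := Int.floor_le z.re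
    have f2 := Int.lt_floor_add_one z.re
    have f3 := Int.floor_le z.im
    have f4 := Int.lt_floor_add_one z.im
    have e1 : (⌊z.re⌋ : ℝ) - 3 < q.1 := by linarith
    have e2 : (q.1 : ℝ) < ⌊z.re⌋ + 3 := by linarith
    have e3 : (⌊z.im⌋ : ℝ) - 3 < q.2 := by linarith
    have e4 : (q.2 : ℝ) < ⌊z.im⌋ + 3 := by linarith
    norm_cast at e1 e2 e3 e4
    exact ⟨⟨e1.le, e3.le⟩, ⟨e2.le, e4.le⟩⟩
  rw [hY.closure_eq] at hmem
  obtain ⟨q, hq, hzq⟩ := mem_iUnion₂.1 hmem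
  exact ⟨q, hq.1, hzq⟩

/-- Coordinates adapted to two neighboring cells. -/
theorem exists_edge_coordinates {q q' : ℤ × ℤ} (h : IsStep (q' - q)) : ∃ e : ℂ ≃ₜ ℂ,
    (∀ z, e z ∈ gridCell q' ↔ z ∈ rightSquare) ∧
    (∀ z, e z ∈ gridCell q ↔ (-1 ≤ z.re ∧ z.re ≤ 0) ∧ |z.im| ≤ 1 / 2) ∧
    ∀ z : ℂ, z.re = 0 → |z.im| = 1 / 2 → ∃ w, IsStep w ∧ w ≠ q' - q ∧ w ≠ q - q' ∧
      e z ∈ gridCell (q' + w) := by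
  obtain ⟨a, b⟩ := q
  obtain ⟨a', b'⟩ := q'
  have main : ∀ u : ℂ, u ≠ 0 → ∃ e : ℂ ≃ₜ ℂ, (∀ z, (e z).re = ((a : ℝ) + a') / 2 + (u * z).re) ∧
      ∀ z, (e z).im = ((b : ℝ) + b') / 2 + (u * z).im := by
    intro u hu
    refine ⟨(Homeomorph.mulLeft₀ u hu).trans (Homeomorph.addLeft
      (⟨((a : ℝ) + a') / 2, ((b : ℝ) + b') / 2⟩ : ℂ)), fun z => ?_, fun z => ?_⟩ <;> simp
  have fin : ∀ (e : ℂ ≃ₜ ℂ) (s t : ℤ), IsStep (s, t) → a' = a + s → b' = b + t →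
      (∀ z, (e z).re = ((a : ℝ) + a') / 2 + (s * z.re - t * z.im)) →
      (∀ z, (e z).im = ((b : ℝ) + b') / 2 + (t * z.re + s * z.im)) →
      (∀ z, e z ∈ gridCell (a', b') ↔ z ∈ rightSquare) ∧
      (∀ z, e z ∈ gridCell (a, b) ↔ (-1 ≤ z.re ∧ z.re ≤ 0) ∧ |z.im| ≤ 1 / 2) ∧
      ∀ z : ℂ, z.re = 0 → |z.im| = 1 / 2 → ∃ w, IsStep w ∧ w ≠ (a', b') - (a, b) ∧
        w ≠ (a, b) - (a', b') ∧ e z ∈ gridCell ((a', b') + w) := by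
    rintro e s t hst rfl rfl hre him
    refine ⟨fun z => ?_, fun z => ?_, fun z h0 h1 => ?_⟩
    · rw [mem_gridCell, hre, him]
      simp only [rightSquare, mem_ofPred_eq, abs_le, and_assoc]
      rcases hst with h | h | h | h <;> obtain ⟨rfl, rfl⟩ := Prod.ext_iff.1 h <;> push_cast <;>
        constructor <;> rintro ⟨h1, h2, h3, h4⟩ <;> refine ⟨?_, ?_, ?_, ?_⟩ <;> linarith
    · rw [mem_gridCell, hre, him]
      simp only [abs_le, and_assoc]
      rcases hst with h | h | h | h <;> obtain ⟨rfl, rfl⟩ := Prod.ext_iff.1 h <;> push_cast <;>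
        constructor <;> rintro ⟨h1, h2, h3, h4⟩ <;> refine ⟨?_, ?_, ?_, ?_⟩ <;> linarith
    · rcases (abs_eq (by norm_num)).1 h1 with h1 | h1
      · refine ⟨(-t, s), ?_, ?_, ?_, ?_⟩
        · unfold IsStep at *; simp only [Prod.ext_iff] at *; omega
        · unfold IsStep at *; simp only [Prod.ext_iff, ne_eq, Prod.fst_sub, Prod.snd_sub] at *; omega
        · unfold IsStep at *; simp only [Prod.ext_iff, ne_eq, Prod.fst_sub, Prod.snd_sub] at *; omega
        · rw [mem_gridCell, hre, him, h0, h1]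
          rcases hst with h | h | h | h <;> obtain ⟨rfl, rfl⟩ := Prod.ext_iff.1 h <;>
            simp only [Prod.fst_add, Prod.snd_add] <;> push_cast <;>
            refine ⟨⟨?_, ?_⟩, ?_, ?_⟩ <;> linarith
      · refine ⟨(t, -s), ?_, ?_, ?_, ?_⟩
        · unfold IsStep at *; simp only [Prod.ext_iff] at *; omega
        · unfold IsStep at *; simp only [Prod.ext_iff, ne_eq, Prod.fst_sub, Prod.snd_sub] at *; omega
        · unfold IsStep at *; simp only [Prod.ext_iff, ne_eq, Prod.fst_sub, Prod.snd_sub] at *; omega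
        · rw [mem_gridCell, hre, him, h0, h1]
          rcases hst with h | h | h | h <;> obtain ⟨rfl, rfl⟩ := Prod.ext_iff.1 h <;>
            simp only [Prod.fst_add, Prod.snd_add] <;> push_cast <;>
            refine ⟨⟨?_, ?_⟩, ?_, ?_⟩ <;> linarith
  obtain ⟨e, h1, h2⟩ := main ⟨((a' - a : ℤ) : ℝ), ((b' - b : ℤ) : ℝ)⟩ (by
    intro h0
    unfold IsStep at h
    simp only [Complex.ext_iff, Complex.zero_re, Complex.zero_im, Int.cast_eq_zero, Prod.ext_iff,
      Prod.fst_sub, Prod.snd_sub] at *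
    omega)
  refine ⟨e, fin e (a' - a) (b' - b) h (by ring) (by ring) (fun z => ?_) fun z => ?_⟩
  · rw [h1, Complex.mul_re]
  · rw [h2, Complex.mul_im]; ring

namespace IsSnake
variable {p : ℤ → ℤ × ℤ} (H : IsSnake p)
include H

/-- An earlier cell meets the newest one only if it is its predecessor or lies two steps back at a
turn. In the latter case the common corner belongs to the predecessor too, so the new square meets
the old body only along the shared edge. -/
theorem mem_of_mem_of_mem {i j : ℤ} (hij : i < j) {z : ℂ} (hi : z ∈ gridCell (p i))
    (hj : z ∈ gridCell (p j)) : z ∈ gridCell (p (j - 1)) := by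
  have hn := H.near i j (near_of_mem hi hj (by simp))
  rw [abs_le] at hn
  rcases (show i = j - 1 ∨ i = j - 2 by omega) with rfl | rfl
  · exact hi
  · have h1 := H.step' j
    have h2 := H.step' (j - 1)
    rw [show j - 1 - 1 = j - 2 by ring] at h2
    have hn := near_of_mem hi hj (by simp)
    have ht := H.turn (j - 2)
    rw [sub_add_cancel] at ht
    have key : ((p (j - 1)).1 = (p j).1 ∨ (p (j - 1)).1 = (p (j - 2)).1) ∧
        ((p (j - 1)).2 = (p j).2 ∨ (p (j - 1)).2 = (p (j - 2)).2) := by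
      unfold Near IsStep at *
      simp only [Prod.ext_iff, Prod.fst_sub, Prod.snd_sub, abs_le, ne_eq] at *
      omega
    rw [mem_gridCell] at *
    refine ⟨?_, ?_⟩
    · rcases key.1 with h | h <;> rw [h]
      exacts [hj.1, hi.1]
    · rcases key.2 with h | h <;> rw [h]
      exacts [hj.2, hi.2]

/-- The cells beside the newest one are free. They contain the ends of the shared edge, which
therefore stay on the boundary. -/
theorem side_notMem {i j : ℤ} (hij : i ≤ j) {w : ℤ × ℤ} (hw : IsStep w)
    (h1 : w ≠ p j - p (j - 1)) (h2 : w ≠ p (j - 1) - p j) : p i ≠ p j + w := by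
  intro he
  have hn := H.near i j (by
    rw [he]; unfold Near IsStep at *
    simp only [Prod.ext_iff, Prod.fst_add, Prod.snd_add, abs_le] at *; omega)
  rw [abs_le] at hn
  rcases (show i = j ∨ i = j - 1 ∨ i = j - 2 by omega) with rfl | rfl | rfl
  · have : w = 0 := by simpa using he
    subst this
    simp [IsStep, Prod.ext_iff] at hw
  · exact h2 (by rw [he]; simp)
  · have h3 := H.step' j
    have h4 := H.step' (j - 1)
    rw [show j - 1 - 1 = j - 2 by ring, he] at h4
    unfold IsStep at *
    simp only [Prod.ext_iff, Prod.fst_sub, Prod.snd_sub, Prod.fst_add, Prod.snd_add, ne_eq] at *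
    omega

theorem isJordanRegion_body (m : ℕ) : IsJordanRegion (snakeBody p (m + 1)) := by
  induction m with
  | zero =>
    convert isJordanRegion_gridCell (p 0) using 1
    ext z
    simp [snakeBody]
  | succ m ih =>
    obtain ⟨e, he1, he2, he3⟩ := exists_edge_coordinates (H.step (m : ℤ))
    have hU : snakeBody p (m + 1 + 1) = snakeBody p (m + 1) ∪ gridCell (p (m + 1 : ℤ)) := by
      ext z
      constructor
      · rintro ⟨i, hi, hz⟩
        rcases Nat.lt_succ_iff_lt_or_eq.1 hi with h | rfl
        · exact Or.inl ⟨i, h, hz⟩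
        · exact Or.inr (by exact_mod_cast hz)
      · rintro (⟨i, hi, hz⟩ | hz)
        · exact ⟨i, by omega, hz⟩
        · exact ⟨m + 1, by omega, by exact_mod_cast hz⟩
    have hR : e.symm '' gridCell (p (m + 1 : ℤ)) = rightSquare := by
      rw [e.image_symm]
      ext z
      exact he1 z
    have hsum : e.symm '' snakeBody p (m + 1) ∪ rightSquare = e.symm '' snakeBody p (m + 1 + 1) := by
      rw [hU, image_union, hR]
    have hadd := (ih.image e.symm).add_square ?_ ?_ ?_
    · have := hadd.image e
      rw [hsum, ← image_comp, e.self_comp_symm, image_id] at this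
      exact this
    · rintro z hz hzQ
      rw [e.image_symm] at hz
      obtain ⟨i, hi, hz⟩ := hz
      have := H.mem_of_mem_of_mem (i := i) (j := m + 1) (by omega) hz ((he1 z).2 hzQ)
      rw [add_sub_cancel_right] at this
      exact le_antisymm ((he2 z).1 this).1.2 hzQ.1
    · intro z h1 h2 h3
      rw [e.image_symm]
      exact ⟨m, by omega, (he2 z).2 ⟨⟨h1, h2⟩, h3⟩⟩
    · intro z h0 h1 hi
      obtain ⟨w, hw, hw1, hw2, hz⟩ := he3 z h0 h1
      rw [hsum, ← e.symm.image_interior, e.image_symm] at hi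
      refine notMem_interior_body (q := p (m + 1 : ℤ) + w) ?_ hz hi
      intro i hi
      refine H.side_notMem (by omega) hw ?_ ?_
      · rwa [add_sub_cancel_right]
      · rwa [add_sub_cancel_right]
end IsSnake

/-! ### Escaping from the corridor through the coarser grids -/

/-- The center of a cell. -/
noncomputable def gridPoint (q : ℤ × ℤ) : ℂ := ⟨q.1, q.2⟩

@[simp] theorem gridPoint_re (q : ℤ × ℤ) : (gridPoint q).re = q.1 := rfl
@[simp] theorem gridPoint_im (q : ℤ × ℤ) : (gridPoint q).im = q.2 := rfl

theorem mem_of_ball_gridPoint {z w : ℂ} {r : ℝ} (h : w ∈ ball z r) :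
    |w.re - z.re| < r ∧ |w.im - z.im| < r :=
  ⟨(abs_re_sub_le_dist w z).trans_lt h, (abs_im_sub_le_dist w z).trans_lt h⟩

theorem half_rpow_le {a : ℝ} (ha : 0 ≤ a) : (1 / 2 : ℝ) ^ (a - 1) ≤ 2 := by
  calc (1 / 2 : ℝ) ^ (a - 1) ≤ (1 / 2 : ℝ) ^ (-1 : ℝ) :=
        Real.rpow_le_rpow_of_exponent_ge (by norm_num) (by norm_num) (by linarith)
    _ = 2 := by rw [Real.rpow_neg_one]; norm_num

section Grid
variable {p : ℤ → ℤ × ℤ} {m : ℕ} {a : ℝ}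

theorem gridCell_subset {q : ℤ × ℤ} (hq : q ∈ emptyCells p m) :
    gridCell q ⊆ (interior (snakeBody p m))ᶜ := fun _ hz => notMem_interior_body hq hz

/-- The balls of radius 1/2 along the segment stay in the union of the two cells, so the cost is at
most (1/2) ^ (a - 1) ≤ 2. -/
theorem conn_step (ha : 0 ≤ a) (ha1 : a ≤ 1) {q q' : ℤ × ℤ} (hq : q ∈ emptyCells p m)
    (hq' : q' ∈ emptyCells p m) (h : IsStep (q' - q)) :
    Conn a (interior (snakeBody p m))ᶜ (gridPoint q) (gridPoint q') 2 := by
  obtain ⟨x, y⟩ := q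
  obtain ⟨x', y'⟩ := q'
  have key : ∀ t : ℝ, 0 ≤ t → t ≤ 1 → ball (gridPoint (x, y) + t * (gridPoint (x', y') -
      gridPoint (x, y))) (1 / 2) ⊆ (interior (snakeBody p m))ᶜ := by
    intro t h0 h1 w hw
    have hb := mem_of_ball_gridPoint hw
    simp only [Complex.add_re, Complex.add_im, Complex.re_ofReal_mul, Complex.im_ofReal_mul,
      Complex.sub_re, Complex.sub_im, gridPoint_re, gridPoint_im, abs_lt] at hb
    have hcase : w ∈ gridCell (x, y) ∨ w ∈ gridCell (x', y') := by
      rw [mem_gridCell, mem_gridCell]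
      simp only
      rcases h with h | h | h | h
      · obtain ⟨h1, h2⟩ := Prod.ext_iff.1 h
        obtain rfl : x' = x + 1 := by simp at h1; omega
        obtain rfl : y' = y := by simp at h2; omega
        push_cast at hb ⊢
        rcases le_total w.re (x + 1 / 2) with hw | hw
        · left; refine ⟨⟨?_, hw⟩, ?_, ?_⟩ <;> linarith
        · right; refine ⟨⟨?_, ?_⟩, ?_, ?_⟩ <;> linarith
      · obtain ⟨h1, h2⟩ := Prod.ext_iff.1 h
        obtain rfl : x' = x - 1 := by simp at h1; omega
        obtain rfl : y' = y := by simp at h2; omega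
        push_cast at hb ⊢
        rcases le_total w.re (x - 1 / 2) with hw | hw
        · right; refine ⟨⟨?_, ?_⟩, ?_, ?_⟩ <;> linarith
        · left; refine ⟨⟨?_, ?_⟩, ?_, ?_⟩ <;> linarith
      · obtain ⟨h1, h2⟩ := Prod.ext_iff.1 h
        obtain rfl : x' = x := by simp at h1; omega
        obtain rfl : y' = y + 1 := by simp at h2; omega
        push_cast at hb ⊢
        rcases le_total w.im (y + 1 / 2) with hw | hw
        · left; refine ⟨⟨?_, ?_⟩, ?_, ?_⟩ <;> linarith
        · right; refine ⟨⟨?_, ?_⟩, ?_, ?_⟩ <;> linarith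
      · obtain ⟨h1, h2⟩ := Prod.ext_iff.1 h
        obtain rfl : x' = x := by simp at h1; omega
        obtain rfl : y' = y - 1 := by simp at h2; omega
        push_cast at hb ⊢
        rcases le_total w.im (y - 1 / 2) with hw | hw
        · right; refine ⟨⟨?_, ?_⟩, ?_, ?_⟩ <;> linarith
        · left; refine ⟨⟨?_, ?_⟩, ?_, ?_⟩ <;> linarith
    rcases hcase with hc | hc
    · exact gridCell_subset hq hc
    · exact gridCell_subset hq' hc
  have hn : ‖gridPoint (x', y') - gridPoint (x, y)‖ ≤ 1 := by
    refine (Complex.norm_le_abs_re_add_abs_im _).trans ?_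
    simp only [Complex.sub_re, Complex.sub_im, gridPoint_re, gridPoint_im]
    have : |x' - x| + |y' - y| ≤ 1 := by
      rcases h with h | h | h | h <;> obtain ⟨h1, h2⟩ := Prod.ext_iff.1 h <;>
        simp only [Prod.fst_sub, Prod.snd_sub] at h1 h2 <;> rw [h1, h2] <;> decide
    exact_mod_cast this
  refine ⟨by norm_num, _, (Joins.segment_const ha1 (by norm_num) key).mono ha1 Subset.rfl
    (ENNReal.ofReal_le_ofReal ?_)⟩
  have := half_rpow_le ha
  nlinarith [norm_nonneg (gridPoint (x', y') - gridPoint (x, y)),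
    Real.rpow_nonneg (show (0 : ℝ) ≤ 1 / 2 by norm_num) (a - 1)]

theorem conn_line (ha : 0 ≤ a) (ha1 : a ≤ 1) {d : ℤ × ℤ} (hd : IsStep d) (q : ℤ × ℤ) (k : ℕ)
    (h : ∀ t : ℕ, t ≤ k → q + t • d ∈ emptyCells p m) :
    Conn a (interior (snakeBody p m))ᶜ (gridPoint q) (gridPoint (q + k • d)) (2 * k) := by
  induction k with
  | zero =>
    have := h 0 le_rfl
    simp only [zero_smul, add_zero, Nat.cast_zero, mul_zero] at this ⊢
    refine Conn.refl (gridCell_subset this ?_)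
    rw [mem_gridCell]
    simp only [gridPoint_re, gridPoint_im]
    refine ⟨⟨?_, ?_⟩, ?_, ?_⟩ <;> linarith
  | succ k ih =>
    have c1 := ih fun t ht => h t (by omega)
    have c2 := conn_step ha ha1 (h k (by omega)) (h (k + 1) le_rfl) (by
      rw [succ_nsmul, ← add_assoc, add_sub_cancel_left]; exact hd)
    refine (c1.trans c2).le ha1 (le_of_eq ?_)
    push_cast; ring
end Grid

/-- A finite check: from each free cell of either block an L-shaped route of free cells leads to a
corner (3σ, 3τ), with the horizontal or the vertical part first. -/
theorem exists_corner_route : ∀ B ∈ [straightBlock, turnBlock],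
    ∀ x ∈ [-3, -2, -1, 0, 1, 2, (3 : ℤ)], ∀ y ∈ [-3, -2, -1, 0, 1, 2, (3 : ℤ)], (x, y) ∉ B →
      ∃ σ ∈ [1, (-1 : ℤ)], ∃ τ ∈ [1, (-1 : ℤ)],
        ((∀ t ∈ [-3, -2, -1, 0, 1, 2, (3 : ℤ)], 0 ≤ σ * (t - x) → (t, y) ∉ B) ∧
          ∀ t ∈ [-3, -2, -1, 0, 1, 2, (3 : ℤ)], 0 ≤ τ * (t - y) → (3 * σ, t) ∉ B) ∨
        ((∀ t ∈ [-3, -2, -1, 0, 1, 2, (3 : ℤ)], 0 ≤ τ * (t - y) → (x, t) ∉ B) ∧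
          ∀ t ∈ [-3, -2, -1, 0, 1, 2, (3 : ℤ)], 0 ≤ σ * (t - x) → (t, 3 * τ) ∉ B) := by
  decide

/-- The cells outside of the fractal corridor. -/
def snakeEmpty (n : ℕ) : Set (ℤ × ℤ) := emptyCells (snakePath n) (9 ^ n)

/-- The fractal corridor. -/
def snakeDomain (n : ℕ) : Set ℂ := interior (snakeBody (snakePath n) (9 ^ n))

theorem mem_seven {x : ℤ} : x ∈ [-3, -2, -1, 0, 1, 2, (3 : ℤ)] ↔ -3 ≤ x ∧ x ≤ 3 := by
  simp only [List.mem_cons, List.not_mem_nil, or_false]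
  omega

/-- The position of a cell in a block. -/
def inBlock (q o : ℤ × ℤ) : ℤ × ℤ := (7 * q.1 + o.1, 7 * q.2 + o.2)

theorem exists_inBlock (e : ℤ × ℤ) : ∃ q o : ℤ × ℤ, |o.1| ≤ 3 ∧ |o.2| ≤ 3 ∧ e = inBlock q o := by
  refine ⟨((e.1 + 3) / 7, (e.2 + 3) / 7), ((e.1 + 3) % 7 - 3, (e.2 + 3) % 7 - 3), ?_, ?_, ?_⟩
  · simp only [abs_le]; omega
  · simp only [abs_le]; omega
  · ext <;> simp only [inBlock] <;> omega

theorem eq_of_snakePath_succ {n : ℕ} {i : ℤ} {q o : ℤ × ℤ} (h1 : |o.1| ≤ 3) (h2 : |o.2| ≤ 3)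
    (h : snakePath (n + 1) i = inBlock q o) : ∃ (k : ℤ) (j : ℕ), j < 9 ∧ i = 9 * k + j ∧
      snakePath n k = q ∧ snakeOffset (snakePath n k - snakePath n (k - 1))
        (snakePath n (k + 1) - snakePath n k) j = o := by
  have H := isSnake_snakePath n
  obtain ⟨k, j, hj, rfl⟩ := exists_block i
  have b := snakeOffset_bound (H.step' k) (H.step k) (H.add_ne k) hj
  have h' : snakeRefine (snakePath n) (9 * k + j) = inBlock q o := h
  rw [snakeRefine_eq _ k hj] at h'
  refine ⟨k, j, hj, rfl, ?_, ?_⟩ <;>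
    simp only [inBlock, Prod.ext_iff, Prod.fst_add, Prod.snd_add, abs_le] at * <;> omega

theorem inBlock_mem_of_empty {n : ℕ} {q o : ℤ × ℤ} (hq : q ∈ snakeEmpty n) (h1 : |o.1| ≤ 3)
    (h2 : |o.2| ≤ 3) : inBlock q o ∈ snakeEmpty (n + 1) := by
  intro i hi he
  obtain ⟨k, j, hj, hk, hq', -⟩ := eq_of_snakePath_succ h1 h2 he
  rw [pow_succ] at hi
  have hk0 : 0 ≤ k := by omega
  refine hq k.toNat ?_ ?_
  · zify
    rw [Int.toNat_of_nonneg hk0]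
    have : (i : ℤ) < 9 ^ n * 9 := by exact_mod_cast hi
    omega
  · rwa [Int.toNat_of_nonneg hk0]

theorem corner_mem (n : ℕ) (q : ℤ × ℤ) {o : ℤ × ℤ} (h1 : |o.1| = 3) (h2 : |o.2| = 3) :
    inBlock q o ∈ snakeEmpty (n + 1) := by
  intro i hi he
  have H := isSnake_snakePath n
  obtain ⟨k, j, hj, -, -, ho⟩ := eq_of_snakePath_succ h1.le h2.le he
  have b := snakeOffset_bound (H.step' k) (H.step k) (H.add_ne k) hj
  rw [ho] at b
  rcases b.2.2.1 with h | h <;> omega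

theorem inBlock_mem {n : ℕ} {k : ℤ} {u w : ℤ × ℤ}
    (hu : u = snakePath n k - snakePath n (k - 1))
    (hw : w = snakeAxis u (snakePath n (k + 1) - snakePath n k)) (x : ℤ × ℤ)
    (h1 : -3 ≤ x.1 ∧ x.1 ≤ 3) (h2 : -3 ≤ x.2 ∧ x.2 ≤ 3)
    (hx : x ∉ snakeBlock u (snakePath n (k + 1) - snakePath n k)) :
    inBlock (snakePath n k) (blockPos u w x) ∈ snakeEmpty (n + 1) := by
  have H := isSnake_snakePath n
  have hax : IsAxes u w := by
    rw [hw, hu]; exact isAxes_snakeAxis (H.step' k) (H.step k) (H.add_ne k)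
  intro i hi he
  have hb : |(blockPos u w x).1| ≤ 3 ∧ |(blockPos u w x).2| ≤ 3 := by
    rcases hax.pos_cases with h | h | h | h | h | h | h | h <;>
      rw [h] <;> simp only [abs_le] <;> omega
  obtain ⟨k', j, hj, -, hk, ho⟩ := eq_of_snakePath_succ hb.1 hb.2 he
  obtain rfl := H.injective hk
  rw [← hu, snakeOffset, ← hw] at ho
  have hget : (snakeBlock u (snakePath n (k' + 1) - snakePath n k')).getD j 0 = x := by
    generalize (snakeBlock u (snakePath n (k' + 1) - snakePath n k')).getD j 0 = y at ho
    rcases hax.pos_cases with h | h | h | h | h | h | h | h <;>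
      rw [h, h] at ho <;> simp only [Prod.ext_iff] at ho ⊢ <;> omega
  apply hx
  have hl : j < (snakeBlock u (snakePath n (k' + 1) - snakePath n k')).length := by
    rcases snakeBlock_cases u (snakePath n (k' + 1) - snakePath n k') with h | h <;> rw [h] <;>
      exact hj
  rw [← hget, List.getD_eq_getElem _ _ hl]
  exact List.getElem_mem hl

theorem inBlock_add (q x y : ℤ × ℤ) : inBlock q x + y = inBlock q (x + y) := by
  ext <;> simp [inBlock, add_assoc]

section Conn
variable {a : ℝ} (ha : 0 ≤ a) (ha1 : a ≤ 1)
include ha ha1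

/-- The route of `exists_corner_route` consists of two lines of at most 6 steps, each step at cost
2. -/
theorem conn_corner {n : ℕ} {k : ℤ} {o : ℤ × ℤ} (h1 : |o.1| ≤ 3) (h2 : |o.2| ≤ 3)
    (he : inBlock (snakePath n k) o ∈ snakeEmpty (n + 1)) (hk : 0 ≤ k) (hk9 : k < 9 ^ n) :
    ∃ c : ℤ × ℤ, |c.1| = 3 ∧ |c.2| = 3 ∧ Conn a (snakeDomain (n + 1))ᶜ
      (gridPoint (inBlock (snakePath n k) o)) (gridPoint (inBlock (snakePath n k) c)) 24 := by
  have H := isSnake_snakePath n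
  obtain ⟨u, hu⟩ : ∃ u, u = snakePath n k - snakePath n (k - 1) := ⟨_, rfl⟩
  obtain ⟨v, hv⟩ : ∃ v, v = snakePath n (k + 1) - snakePath n k := ⟨_, rfl⟩
  obtain ⟨w, hw⟩ : ∃ w, w = snakeAxis u v := ⟨_, rfl⟩
  have hax : IsAxes u w := by
    rw [hw, hu, hv]; exact isAxes_snakeAxis (H.step' k) (H.step k) (H.add_ne k)
  have hmem := fun x => inBlock_mem hu (hv ▸ hw) x
  rw [← hv] at hmem
  have hinv : ∃ x : ℤ × ℤ, (-3 ≤ x.1 ∧ x.1 ≤ 3) ∧ (-3 ≤ x.2 ∧ x.2 ≤ 3) ∧ blockPos u w x = o := by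
    rw [abs_le] at h1 h2
    rcases hax.pos_cases with h | h | h | h | h | h | h | h
    · exact ⟨(o.1, o.2), by omega, by omega, by rw [h]⟩
    · exact ⟨(o.1, -o.2), by omega, by omega, by rw [h]; simp⟩
    · exact ⟨(-o.1, o.2), by omega, by omega, by rw [h]; simp⟩
    · exact ⟨(-o.1, -o.2), by omega, by omega, by rw [h]; simp⟩
    · exact ⟨(o.2, o.1), by omega, by omega, by rw [h]⟩
    · exact ⟨(-o.2, o.1), by omega, by omega, by rw [h]; simp⟩
    · exact ⟨(o.2, -o.1), by omega, by omega, by rw [h]; simp⟩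
    · exact ⟨(-o.2, -o.1), by omega, by omega, by rw [h]; simp⟩
  obtain ⟨x, hx1, hx2, rfl⟩ := hinv
  have hxB : x ∉ snakeBlock u v := by
    intro hx
    obtain ⟨j, hj, hjx⟩ := List.mem_iff_getElem.1 hx
    have hj9 : j < 9 := by
      rcases snakeBlock_cases u v with h | h <;> rw [h] at hj <;> exact hj
    have hk' : ((k.toNat : ℕ) : ℤ) = k := Int.toNat_of_nonneg hk
    refine he (9 * k.toNat + j) ?_ ?_
    · rw [pow_succ]
      have : k.toNat < 9 ^ n := by zify; rwa [hk']
      omega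
    · push_cast
      rw [hk']
      show snakeRefine (snakePath n) _ = _
      rw [snakeRefine_eq _ k hj9, ← hu, ← hv, snakeOffset, ← hw, List.getD_eq_getElem _ _ hj, hjx]
      rfl
  have hpos : ∀ (x y : ℤ × ℤ), blockPos u w x + blockPos u w y = blockPos u w (x + y) := by
    intro x y; ext <;> simp [blockPos] <;> ring
  have hsmul : ∀ (t : ℕ) (y : ℤ × ℤ), t • blockPos u w y = blockPos u w (t • y) := by
    intro t y; ext <;> simp [blockPos] <;> ring
  have line : ∀ (x d : ℤ × ℤ) (t : ℕ), IsStep d → (∀ s : ℕ, s ≤ t → (-3 ≤ (x + s • d).1 ∧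
      (x + s • d).1 ≤ 3) ∧ (-3 ≤ (x + s • d).2 ∧ (x + s • d).2 ≤ 3) ∧
      x + s • d ∉ snakeBlock u v) → t ≤ 6 →
      Conn a (snakeDomain (n + 1))ᶜ (gridPoint (inBlock (snakePath n k) (blockPos u w x)))
        (gridPoint (inBlock (snakePath n k) (blockPos u w (x + t • d)))) 12 := by
    intro x d t hd hs ht
    have hd' : IsStep (blockPos u w d) := by
      unfold IsStep at *
      rcases hax.pos_cases with h | h | h | h | h | h | h | h <;>
        rw [h] <;> simp only [Prod.ext_iff] at * <;> omega
    have := conn_line (p := snakePath (n + 1)) (m := 9 ^ (n + 1)) ha ha1 hd'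
      (inBlock (snakePath n k) (blockPos u w x)) t fun s hst => by
        rw [hsmul, inBlock_add, hpos]
        exact hmem _ (hs s hst).1 (hs s hst).2.1 (hs s hst).2.2
    rw [hsmul, inBlock_add, hpos] at this
    refine this.le ha1 ?_
    have : (t : ℝ) ≤ 6 := by exact_mod_cast ht
    linarith
  have fin : ∀ σ τ : ℤ, (σ = 1 ∨ σ = -1) → (τ = 1 ∨ τ = -1) →
      |(blockPos u w (3 * σ, 3 * τ)).1| = 3 ∧ |(blockPos u w (3 * σ, 3 * τ)).2| = 3 := by
    intro σ τ hσ hτ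
    rcases hax.pos_cases with h | h | h | h | h | h | h | h <;> rw [h] <;>
      rcases hσ with rfl | rfl <;> rcases hτ with rfl | rfl <;> simp
  obtain ⟨σ, hσ, τ, hτ, hr⟩ := exists_corner_route _ (by
    rcases snakeBlock_cases u v with h | h <;> simp [h]) x.1 (mem_seven.2 hx1) x.2
    (mem_seven.2 hx2) hxB
  have hσ : σ = 1 ∨ σ = -1 := by simpa using hσ
  have hτ : τ = 1 ∨ τ = -1 := by simpa using hτ
  have hs1 : IsStep (σ, 0) := by unfold IsStep; rcases hσ with rfl | rfl <;> simp
  have hs2 : IsStep (0, τ) := by unfold IsStep; rcases hτ with rfl | rfl <;> simp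
  have e1 : ∃ t : ℕ, (t : ℤ) * σ = 3 * σ - x.1 ∧ t ≤ 6 :=
    ⟨(3 - σ * x.1).toNat, by rcases hσ with rfl | rfl <;> omega, by rcases hσ with rfl | rfl <;> omega⟩
  have e2 : ∃ t : ℕ, (t : ℤ) * τ = 3 * τ - x.2 ∧ t ≤ 6 :=
    ⟨(3 - τ * x.2).toNat, by rcases hτ with rfl | rfl <;> omega, by rcases hτ with rfl | rfl <;> omega⟩
  obtain ⟨t1, ht1, ht1'⟩ := e1
  obtain ⟨t2, ht2, ht2'⟩ := e2
  refine ⟨_, (fin σ τ hσ hτ).1, (fin σ τ hσ hτ).2, ?_⟩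
  have a1 : ∀ (y : ℤ × ℤ) (s : ℕ), y + s • (σ, (0 : ℤ)) = (y.1 + s * σ, y.2) := by
    intro y s; ext <;> simp
  have a2 : ∀ (y : ℤ × ℤ) (s : ℕ), y + s • ((0 : ℤ), τ) = (y.1, y.2 + s * τ) := by
    intro y s; ext <;> simp
  have b1 : ∀ s : ℕ, s ≤ t1 → (-3 ≤ x.1 + s * σ ∧ x.1 + s * σ ≤ 3) ∧
      0 ≤ σ * (x.1 + s * σ - x.1) := by
    intro s hs; rcases hσ with rfl | rfl <;> omega
  have b2 : ∀ s : ℕ, s ≤ t2 → (-3 ≤ x.2 + s * τ ∧ x.2 + s * τ ≤ 3) ∧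
      0 ≤ τ * (x.2 + s * τ - x.2) := by
    intro s hs; rcases hτ with rfl | rfl <;> omega
  have b3 : -3 ≤ 3 * σ ∧ 3 * σ ≤ 3 := by rcases hσ with rfl | rfl <;> omega
  have b4 : -3 ≤ 3 * τ ∧ 3 * τ ≤ 3 := by rcases hτ with rfl | rfl <;> omega
  have z1 : x.1 + t1 * σ = 3 * σ := by omega
  have z2 : x.2 + t2 * τ = 3 * τ := by omega
  rcases hr with ⟨r1, r2⟩ | ⟨r1, r2⟩
  · have c1 := line x (σ, 0) t1 hs1 (fun s hs => by
      rw [a1]; exact ⟨(b1 s hs).1, hx2, r1 _ (mem_seven.2 (b1 s hs).1) (b1 s hs).2⟩) ht1'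
    have c2 := line (3 * σ, x.2) (0, τ) t2 hs2 (fun s hs => by
      rw [a2]; exact ⟨b3, (b2 s hs).1, r2 _ (mem_seven.2 (b2 s hs).1) (b2 s hs).2⟩) ht2'
    rw [a1, z1] at c1
    rw [a2, z2] at c2
    exact (c1.trans c2).le ha1 (by norm_num)
  · have c1 := line x (0, τ) t2 hs2 (fun s hs => by
      rw [a2]; exact ⟨hx1, (b2 s hs).1, r1 _ (mem_seven.2 (b2 s hs).1) (b2 s hs).2⟩) ht2'
    have c2 := line (x.1, 3 * τ) (σ, 0) t1 hs1 (fun s hs => by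
      rw [a1]; exact ⟨(b1 s hs).1, b4, r2 _ (mem_seven.2 (b1 s hs).1) (b1 s hs).2⟩) ht1'
    rw [a2, z2] at c1
    rw [a1, z1] at c2
    exact (c1.trans c2).le ha1 (by norm_num)

omit ha ha1 in
-- Four mutually touching cells on the path would have four different indices with pairwise
-- differences at most 2, which is impossible.
theorem exists_empty_of_square (n : ℕ) (q : ℤ × ℤ) {σ τ : ℤ} (hσ : |σ| = 1) (hτ : |τ| = 1) :
    q ∈ snakeEmpty n ∨ q + (σ, 0) ∈ snakeEmpty n ∨ q + (0, τ) ∈ snakeEmpty n ∨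
      q + (σ, τ) ∈ snakeEmpty n := by
  have H := isSnake_snakePath n
  by_contra hcon
  simp only [snakeEmpty, emptyCells, mem_ofPred_eq] at hcon
  push Not at hcon
  obtain ⟨⟨i, -, hi⟩, ⟨j, -, hj⟩, ⟨k, -, hk⟩, ⟨l, -, hl⟩⟩ := hcon
  rw [abs_eq (by norm_num)] at hσ hτ
  have key : ∀ {s t : ℕ} {x y : ℤ × ℤ}, snakePath n s = x → snakePath n t = y → x ≠ y → Near x y →
      (s : ℤ) ≠ t ∧ |(s : ℤ) - t| ≤ 2 := by
    rintro s t x y rfl rfl hne hn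
    exact ⟨fun h => hne (by rw [h]), H.near _ _ hn⟩
  have h1 := key hi hj (by simp only [ne_eq, Prod.ext_iff, Prod.fst_add, Prod.snd_add]; omega)
    (by simp only [Near, Prod.fst_add, Prod.snd_add, abs_le]; omega)
  have h2 := key hi hk (by simp only [ne_eq, Prod.ext_iff, Prod.fst_add, Prod.snd_add]; omega)
    (by simp only [Near, Prod.fst_add, Prod.snd_add, abs_le]; omega)
  have h3 := key hi hl (by simp only [ne_eq, Prod.ext_iff, Prod.fst_add, Prod.snd_add]; omega)
    (by simp only [Near, Prod.fst_add, Prod.snd_add, abs_le]; omega)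
  have h4 := key hj hk (by simp only [ne_eq, Prod.ext_iff, Prod.fst_add, Prod.snd_add]; omega)
    (by simp only [Near, Prod.fst_add, Prod.snd_add, abs_le]; omega)
  have h5 := key hj hl (by simp only [ne_eq, Prod.ext_iff, Prod.fst_add, Prod.snd_add]; omega)
    (by simp only [Near, Prod.fst_add, Prod.snd_add, abs_le]; omega)
  have h6 := key hk hl (by simp only [ne_eq, Prod.ext_iff, Prod.fst_add, Prod.snd_add]; omega)
    (by simp only [Near, Prod.fst_add, Prod.snd_add, abs_le]; omega)
  rw [abs_le] at h1 h2 h3 h4 h5 h6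
  omega

omit ha ha1 in
theorem block_subset {n : ℕ} {q : ℤ × ℤ} (hq : q ∈ snakeEmpty n) {z : ℂ}
    (h1 : |z.re - 7 * q.1| ≤ 7 / 2) (h2 : |z.im - 7 * q.2| ≤ 7 / 2) :
    z ∈ (snakeDomain (n + 1))ᶜ := by
  have round : ∀ x : ℝ, |x| ≤ 7 / 2 → ∃ o : ℤ, |o| ≤ 3 ∧ |x - o| ≤ 1 / 2 := by
    intro x hx
    rw [abs_le] at hx
    rcases le_or_gt (5 / 2) x with h | h
    · exact ⟨3, by norm_num, abs_le.2 ⟨by push_cast; linarith, by push_cast; linarith⟩⟩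
    rcases le_or_gt x (-(5 / 2)) with h' | h'
    · exact ⟨-3, by norm_num, abs_le.2 ⟨by push_cast; linarith, by push_cast; linarith⟩⟩
    · have hr := abs_sub_round x
      refine ⟨round x, ?_, hr⟩
      rw [abs_le] at hr
      have e1 : (round x : ℝ) < 4 := by linarith
      have e2 : (-4 : ℝ) < round x := by linarith
      norm_cast at e1 e2
      exact abs_le.2 ⟨by omega, by omega⟩
  obtain ⟨s, hs, hs'⟩ := round _ h1
  obtain ⟨t, ht, ht'⟩ := round _ h2
  refine gridCell_subset (inBlock_mem_of_empty hq (o := (s, t)) hs ht) ?_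
  rw [mem_gridCell, inBlock]
  rw [abs_le] at hs' ht'
  push_cast
  refine ⟨⟨?_, ?_⟩, ?_, ?_⟩ <;> linarith

/-- From a cell of an empty block to its center. -/
theorem conn_block_center {n : ℕ} {q o : ℤ × ℤ} (hq : q ∈ snakeEmpty n) (h1 : |o.1| ≤ 3)
    (h2 : |o.2| ≤ 3) : Conn a (snakeDomain (n + 1))ᶜ (gridPoint (inBlock q o))
      (7 * gridPoint q) 12 := by
  have r1 : |(o.1 : ℝ)| ≤ 3 := by exact_mod_cast h1
  have r2 : |(o.2 : ℝ)| ≤ 3 := by exact_mod_cast h2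
  have hn : ‖7 * gridPoint q - gridPoint (inBlock q o)‖ ≤ 6 := by
    refine (Complex.norm_le_abs_re_add_abs_im _).trans ?_
    have e1 : (7 * gridPoint q - gridPoint (inBlock q o)).re = -o.1 := by simp [inBlock]
    have e2 : (7 * gridPoint q - gridPoint (inBlock q o)).im = -o.2 := by simp [inBlock]
    rw [e1, e2, abs_neg, abs_neg]
    linarith
  refine ⟨by norm_num, _, (Joins.segment_const (R := 1 / 2) ha1 (by norm_num) ?_).mono ha1
    Subset.rfl (ENNReal.ofReal_le_ofReal ?_)⟩
  · intro t h0 ht w hw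
    have hb := mem_of_ball_gridPoint hw
    have hre : (gridPoint (inBlock q o) + t * (7 * gridPoint q - gridPoint (inBlock q o))).re =
        7 * q.1 + (1 - t) * o.1 := by simp [inBlock]; ring
    have him : (gridPoint (inBlock q o) + t * (7 * gridPoint q - gridPoint (inBlock q o))).im =
        7 * q.2 + (1 - t) * o.2 := by simp [inBlock]; ring
    rw [hre, him] at hb
    have k1 : |(1 - t) * (o.1 : ℝ)| ≤ 3 := by
      rw [abs_mul, abs_of_nonneg (by linarith)]; nlinarith [abs_nonneg (o.1 : ℝ)]
    have k2 : |(1 - t) * (o.2 : ℝ)| ≤ 3 := by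
      rw [abs_mul, abs_of_nonneg (by linarith)]; nlinarith [abs_nonneg (o.2 : ℝ)]
    rw [abs_le] at k1 k2
    rw [abs_lt, abs_lt] at hb
    exact block_subset hq (abs_le.2 ⟨by linarith, by linarith⟩) (abs_le.2 ⟨by linarith, by linarith⟩)
  · have h3 := half_rpow_le ha
    have := mul_le_mul hn h3 (Real.rpow_nonneg (by norm_num) _) (by norm_num)
    linarith

/-- If the block of the cell is free, its center is reached directly. Otherwise one goes to a corner
of the block; one of the four blocks meeting there is free, and its center is at most two steps and
one segment away. The cost is at most 24 + 2 + 2 + 12 = 40. -/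
theorem escape_step {n : ℕ} {e : ℤ × ℤ} (he : e ∈ snakeEmpty (n + 1)) : ∃ q ∈ snakeEmpty n,
    Conn a (snakeDomain (n + 1))ᶜ (gridPoint e) (7 * gridPoint q) 40 ∧
      dist (gridPoint e) (7 * gridPoint q) ≤ 20 := by
  obtain ⟨q, o, h1, h2, rfl⟩ := exists_inBlock e
  have hdist : ∀ q' : ℤ × ℤ, |q'.1 - q.1| ≤ 1 → |q'.2 - q.2| ≤ 1 →
      dist (gridPoint (inBlock q o)) (7 * gridPoint q') ≤ 20 := by
    intro q' h3 h4
    refine (dist_le_abs_re_add_abs_im _ _).trans ?_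
    have e1 : (gridPoint (inBlock q o)).re - (7 * gridPoint q').re = ((7 * q.1 + o.1 - 7 * q'.1 : ℤ) : ℝ) := by
      simp [inBlock]
    have e2 : (gridPoint (inBlock q o)).im - (7 * gridPoint q').im = ((7 * q.2 + o.2 - 7 * q'.2 : ℤ) : ℝ) := by
      simp [inBlock]
    rw [e1, e2]
    have f1 : |7 * q.1 + o.1 - 7 * q'.1| ≤ 10 := by rw [abs_le] at *; omega
    have f2 : |7 * q.2 + o.2 - 7 * q'.2| ≤ 10 := by rw [abs_le] at *; omega
    have : |7 * q.1 + o.1 - 7 * q'.1| + |7 * q.2 + o.2 - 7 * q'.2| ≤ 20 := by linarith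
    exact_mod_cast this
  by_cases hq : q ∈ snakeEmpty n
  · exact ⟨q, hq, (conn_block_center ha ha1 hq h1 h2).le ha1 (by norm_num),
      hdist q (by simp) (by simp)⟩
  · have hq' := hq
    simp only [snakeEmpty, emptyCells, mem_ofPred_eq] at hq'
    push Not at hq'
    obtain ⟨k, hk, rfl⟩ := hq'
    obtain ⟨c, hc1, hc2, hc⟩ := conn_corner ha ha1 h1 h2 he (by omega) (by exact_mod_cast hk)
    obtain ⟨σ, hσ⟩ : ∃ σ, c.1 = 3 * σ := ⟨c.1 / 3, by rw [abs_eq (by norm_num)] at hc1; omega⟩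
    obtain ⟨τ, hτ⟩ : ∃ τ, c.2 = 3 * τ := ⟨c.2 / 3, by rw [abs_eq (by norm_num)] at hc2; omega⟩
    have hσ1 : |σ| = 1 := by rw [hσ, abs_mul] at hc1; norm_num at hc1; omega
    have hτ1 : |τ| = 1 := by rw [hτ, abs_mul] at hc2; norm_num at hc2; omega
    obtain ⟨q, hqe⟩ : ∃ q, q = snakePath n k := ⟨_, rfl⟩
    rw [← hqe] at hc hdist hq ⊢
    have s1 : IsStep (σ, 0) := by
      rw [abs_eq (by norm_num)] at hσ1; unfold IsStep; rcases hσ1 with rfl | rfl <;> simp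
    have s2 : IsStep (0, τ) := by
      rw [abs_eq (by norm_num)] at hτ1; unfold IsStep; rcases hτ1 with rfl | rfl <;> simp
    have m0 := corner_mem n q hc1 hc2
    have m1 := corner_mem n (q + (σ, 0)) (o := (-c.1, c.2)) (by rwa [abs_neg]) hc2
    have m2 := corner_mem n (q + (0, τ)) (o := (c.1, -c.2)) hc1 (by rwa [abs_neg])
    have m3 := corner_mem n (q + (σ, τ)) (o := (-c.1, -c.2)) (by rwa [abs_neg]) (by rwa [abs_neg])
    have c1 := conn_step ha ha1 m0 m1 (by
      convert s1 using 1; ext <;> simp [inBlock, hσ]; ring)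
    have c2 := conn_step ha ha1 m0 m2 (by
      convert s2 using 1; ext <;> simp [inBlock, hτ]; ring)
    have c3 := conn_step ha ha1 m1 m3 (by
      convert s2 using 1; ext <;> simp [inBlock, hτ]; ring)
    rcases exists_empty_of_square n q hσ1 hτ1 with h | h | h | h
    · exact absurd h hq
    · exact ⟨_, h, ((hc.trans c1).trans (conn_block_center ha ha1 h (by rw [abs_neg, hc1])
        hc2.le)).le ha1 (by norm_num), hdist _ (by simpa using hσ1.le) (by simp)⟩
    · exact ⟨_, h, ((hc.trans c2).trans (conn_block_center ha ha1 h hc1.le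
        (by rw [abs_neg, hc2]))).le ha1 (by norm_num), hdist _ (by simp) (by simpa using hτ1.le)⟩
    · exact ⟨_, h, (((hc.trans c1).trans c3).trans (conn_block_center ha ha1 h
        (by rw [abs_neg, hc1]) (by rw [abs_neg, hc2]))).le ha1 (by norm_num),
        hdist _ (by simpa using hσ1.le) (by simpa using hτ1.le)⟩
end Conn

/-- The lower bound a for 7 ^ a - 1 is what sums the recursion of the escape costs uniformly in a.
-/
theorem one_add_le_seven_rpow {a : ℝ} (ha : 0 ≤ a) : 1 + a ≤ (7 : ℝ) ^ a := by
  have h7 : 1 ≤ Real.log 7 := by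
    rw [Real.le_log_iff_exp_le (by norm_num)]
    exact Real.exp_one_lt_d9.le.trans (by norm_num)
  rw [Real.rpow_def_of_pos (by norm_num)]
  have := Real.add_one_le_exp (Real.log 7 * a)
  nlinarith

/-- The center of a free block is 7 times the center of a free cell one generation earlier, where
the escape route is known. The costs satisfy E(n + 1) ≤ 40 + 7 ^ a E(n), which the stated bound
solves because 7 ^ a ≥ 1 + a. At level 0 the center of a free cell is already outside the square. -/
theorem exists_escape {a : ℝ} (ha : 0 < a) (ha1 : a ≤ 1) (n : ℕ) : ∀ e ∈ snakeEmpty n, ∃ f : ℂ,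
    Conn a (snakeDomain n)ᶜ (gridPoint e) f (40 * (((7 : ℝ) ^ a) ^ n - 1) / a) ∧
      dist (gridPoint e) f ≤ 4 * 7 ^ n - 4 ∧ ((7 : ℝ) ^ n / 2 ≤ |f.re| ∨ (7 : ℝ) ^ n / 2 ≤ |f.im|) := by
  induction n with
  | zero =>
    intro e he
    refine ⟨gridPoint e, ?_, by simp, ?_⟩
    · rw [pow_zero, sub_self, mul_zero, zero_div]
      refine Conn.refl (gridCell_subset he ?_)
      rw [mem_gridCell]
      simp only [gridPoint_re, gridPoint_im]
      refine ⟨⟨?_, ?_⟩, ?_, ?_⟩ <;> linarith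
    · have h0 := he 0 (by norm_num)
      have : 1 ≤ |e.1| ∨ 1 ≤ |e.2| := by
        by_contra hcon
        push Not at hcon
        rw [Int.abs_lt_one_iff, Int.abs_lt_one_iff] at hcon
        exact h0 (by ext <;> simp [snakePath, hcon.1, hcon.2])
      rcases this with h | h
      · left
        have : (1 : ℝ) ≤ |(e.1 : ℝ)| := by exact_mod_cast h
        simp only [gridPoint_re, pow_zero]
        linarith
      · right
        have : (1 : ℝ) ≤ |(e.2 : ℝ)| := by exact_mod_cast h
        simp only [gridPoint_im, pow_zero]
        linarith
  | succ n ih =>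
    intro e he
    obtain ⟨q, hq, c1, d1⟩ := escape_step ha.le ha1 he
    obtain ⟨f, c2, d2, hf⟩ := ih q hq
    have hd7 : ∀ x y : ℂ, dist (7 * x) (7 * y) = 7 * dist x y := by
      intro x y
      rw [dist_eq_norm, ← mul_sub, norm_mul, dist_eq_norm]
      norm_num
    have c3 := c2.similar ha1 (show (0 : ℝ) < 7 by norm_num) (φ := fun z => 7 * z) hd7
      (fun z => ⟨z / 7, mul_div_cancel₀ _ (by norm_num)⟩) (Y := (snakeDomain (n + 1))ᶜ) (by
        rintro _ ⟨z, hz, rfl⟩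
        obtain ⟨r, hr, hzr⟩ := exists_emptyCell hz
        rw [mem_gridCell] at hzr
        refine block_subset hr (abs_le.2 ?_) (abs_le.2 ?_) <;> simp <;> constructor <;> linarith)
    refine ⟨7 * f, (c1.trans c3).le ha1 ?_, ?_, ?_⟩
    · have h1 := one_add_le_seven_rpow ha.le
      rw [pow_succ]
      have e : 40 + (7 : ℝ) ^ a * (40 * (((7 : ℝ) ^ a) ^ n - 1) / a) =
          40 * (a + (7 : ℝ) ^ a * ((7 : ℝ) ^ a) ^ n - (7 : ℝ) ^ a) / a := by
        field_simp; ring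
      rw [e]
      gcongr 40 * ?_ / a
      linarith
    · have := dist_triangle (gridPoint e) (7 * gridPoint q) (7 * f)
      rw [hd7] at this
      rw [pow_succ]
      linarith
    · rw [pow_succ]
      have e1 : (7 * f).re = 7 * f.re := by simp
      have e2 : (7 * f).im = 7 * f.im := by simp
      rw [e1, e2, abs_mul, abs_mul, abs_of_pos (show (0 : ℝ) < 7 by norm_num)]
      rcases hf with hf | hf
      · left; linarith
      · right; linarith

/-! ### Joining points outside a square and the curve condition for the corridor -/

namespace Conn
variable {a : ℝ} {X : Set ℂ}

/-- Joining two points on opposite sides of a square of side `2 * β`. -/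
theorem halfPlane_opposite (ha : 0 < a) (ha1 : a ≤ 1) {n : ℂ} {β : ℝ} (hn : ‖n‖ = 1)
    (h1 : _root_.halfPlane n β ⊆ X) (h2 : _root_.halfPlane (-n) β ⊆ X)
    (h3 : _root_.halfPlane (n * Complex.I) β ⊆ X) (h4 : _root_.halfPlane (-(n * Complex.I)) β ⊆ X)
    {u v : ℂ} (hu : u ∈ _root_.halfPlane n β) (hv : v ∈ _root_.halfPlane (-n) β) {r : ℝ}
    (hr : 0 < r) (hβ : 2 * β ≤ r) (huv : dist u v ≤ r) : Conn a X u v (66 * r ^ a / a) := by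
  have hn' : ‖n * Complex.I‖ = 1 := by simpa using hn
  have hsq : n.re ^ 2 + n.im ^ 2 = 1 := by
    have : ‖n‖ ^ 2 = 1 := by rw [hn, one_pow]
    rw [← Complex.normSq_eq_norm_sq, Complex.normSq_apply] at this; linarith
  have hle : 22 * r ^ a / a ≤ 66 * r ^ a / a := by gcongr; norm_num
  by_cases c1 : u ∈ _root_.halfPlane (n * Complex.I) β
  · exact (halfPlane_pair ha ha1 hn' (by simpa using hn) (by simp; linarith) h3 h2 c1 hv hr huv).le
      ha1 hle
  by_cases c2 : u ∈ _root_.halfPlane (-(n * Complex.I)) β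
  · exact (halfPlane_pair ha ha1 (by simpa using hn) (by simpa using hn) (by simp; linarith) h4 h2
      c2 hv hr huv).le ha1 hle
  simp only [_root_.halfPlane, mem_ofPred_eq, not_le, Complex.neg_re, Complex.neg_im] at hu c1 c2
  -- The point u is in the strip between the two remaining half-planes, so sliding it sideways by t
  -- < 2β ≤ r brings it into one of them, and from there both other half-planes are adjacent.
  set t : ℝ := β - ((n * Complex.I).re * u.re + (n * Complex.I).im * u.im) with ht
  have ht0 : 0 < t := by linarith
  set m : ℂ := u + t * (n * Complex.I) with hm
  have hum : dist u m ≤ r := by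
    rw [dist_eq_norm, hm, sub_add_cancel_left, norm_neg, norm_mul, hn', Complex.norm_real,
      Real.norm_of_nonneg ht0.le]
    linarith
  have hmv : dist m v ≤ 2 * r := by
    have := dist_triangle m u v
    rw [dist_comm m u] at this; linarith
  have hm3 : m ∈ _root_.halfPlane (n * Complex.I) β := by
    simp only [_root_.halfPlane, mem_ofPred_eq, hm]
    simp only [Complex.add_re, Complex.add_im, Complex.re_ofReal_mul, Complex.im_ofReal_mul,
      Complex.mul_I_re, Complex.mul_I_im] at ht ⊢
    nlinarith
  have e1 := halfPlane_pair ha ha1 hn hn' (by simp; linarith) h1 h3 hu hm3 hr hum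
  have e2 := halfPlane_pair ha ha1 hn' (by simpa using hn) (by simp; linarith) h3 h2 hm3 hv
    (by positivity) hmv
  refine (e1.trans e2).le ha1 ?_
  have := rpow_scale_le (r := r) ha1 (one_le_two) hr.le
  rw [← add_div]
  gcongr
  linarith

/-- Joining two points outside of a square of side `s`. -/
theorem outside_square (ha : 0 < a) (ha1 : a ≤ 1) {s : ℝ}
    (hX : ∀ z : ℂ, s / 2 ≤ |z.re| ∨ s / 2 ≤ |z.im| → z ∈ X) {u v : ℂ}
    (hu : s / 2 ≤ |u.re| ∨ s / 2 ≤ |u.im|) (hv : s / 2 ≤ |v.re| ∨ s / 2 ≤ |v.im|) {r : ℝ}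
    (hr : 0 < r) (hs : s ≤ r) (huv : dist u v ≤ r) : Conn a X u v (66 * r ^ a / a) := by
  have k1 : _root_.halfPlane 1 (s / 2) ⊆ X := fun z hz => hX z (Or.inl (by
    simp [_root_.halfPlane] at hz; exact hz.trans (le_abs_self _)))
  have k2 : _root_.halfPlane (-1) (s / 2) ⊆ X := fun z hz => hX z (Or.inl (by
    simp [_root_.halfPlane] at hz; exact hz.trans (neg_le_abs _)))
  have k3 : _root_.halfPlane Complex.I (s / 2) ⊆ X := fun z hz => hX z (Or.inr (by
    simp [_root_.halfPlane] at hz; exact hz.trans (le_abs_self _)))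
  have k4 : _root_.halfPlane (-Complex.I) (s / 2) ⊆ X := fun z hz => hX z (Or.inr (by
    simp [_root_.halfPlane] at hz; exact hz.trans (neg_le_abs _)))
  have hle : 22 * r ^ a / a ≤ 66 * r ^ a / a := by gcongr; norm_num
  have side : ∀ {z : ℂ}, s / 2 ≤ |z.re| ∨ s / 2 ≤ |z.im| →
      z ∈ _root_.halfPlane 1 (s / 2) ∨ z ∈ _root_.halfPlane (-1) (s / 2) ∨
        z ∈ _root_.halfPlane Complex.I (s / 2) ∨ z ∈ _root_.halfPlane (-Complex.I) (s / 2) := by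
    intro z hz
    simp only [le_abs] at hz
    simp [_root_.halfPlane]
    tauto
  have hs' : 2 * (s / 2) ≤ r := by linarith
  have go : ∀ {m n : ℂ}, ‖m‖ = 1 → ‖n‖ = 1 → _root_.halfPlane m (s / 2) ⊆ X →
      _root_.halfPlane n (s / 2) ⊆ X → u ∈ _root_.halfPlane m (s / 2) →
      v ∈ _root_.halfPlane n (s / 2) → -(4 / 5) ≤ m.re * n.re + m.im * n.im →
      Conn a X u v (66 * r ^ a / a) := fun hm hn hmX hnX hu hv hd =>
    (halfPlane_pair ha ha1 hm hn hd hmX hnX hu hv hr huv).le ha1 hle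
  rcases side hu with hu | hu | hu | hu <;> rcases side hv with hv | hv | hv | hv
  · exact go (by simp) (by simp) k1 k1 hu hv (by norm_num)
  · exact halfPlane_opposite ha ha1 (n := 1) (by simp) k1 k2 (by simpa using k3)
      (by simpa using k4) hu hv hr hs' huv
  · exact go (by simp) (by simp) k1 k3 hu hv (by norm_num)
  · exact go (by simp) (by simp) k1 k4 hu hv (by norm_num)
  · exact halfPlane_opposite ha ha1 (n := -1) (by simp) k2 (by simpa using k1) (by simpa using k4)
      (by simpa using k3) hu (by simpa using hv) hr hs' huv
  · exact go (by simp) (by simp) k2 k2 hu hv (by norm_num)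
  · exact go (by simp) (by simp) k2 k3 hu hv (by norm_num)
  · exact go (by simp) (by simp) k2 k4 hu hv (by norm_num)
  · exact go (by simp) (by simp) k3 k1 hu hv (by norm_num)
  · exact go (by simp) (by simp) k3 k2 hu hv (by norm_num)
  · exact go (by simp) (by simp) k3 k3 hu hv (by norm_num)
  · exact halfPlane_opposite ha ha1 (n := Complex.I) (by simp) k3 k4 (by simpa using k2)
      (by simpa using k1) hu hv hr hs' huv
  · exact go (by simp) (by simp) k4 k1 hu hv (by norm_num)
  · exact go (by simp) (by simp) k4 k2 hu hv (by norm_num)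
  · exact halfPlane_opposite ha ha1 (n := -Complex.I) (by simp) k4 (by simpa using k3)
      (by simpa using k1) (by simpa using k2) hu (by simpa using hv) hr hs' huv
  · exact go (by simp) (by simp) k4 k4 hu hv (by norm_num)
end Conn

theorem snakeDomain_subset (n : ℕ) : snakeDomain n ⊆
    Ioo (-((7 : ℝ) ^ n / 2)) (7 ^ n / 2) ×ℂ Ioo (-((7 : ℝ) ^ n / 2)) (7 ^ n / 2) := by
  have h : snakeBody (snakePath n) (9 ^ n) ⊆
      Icc (-((7 : ℝ) ^ n / 2)) (7 ^ n / 2) ×ℂ Icc (-((7 : ℝ) ^ n / 2)) (7 ^ n / 2) := by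
    rintro z ⟨i, hi, hz⟩
    obtain ⟨b1, b2⟩ := snakePath_bound n i (by positivity) (by exact_mod_cast hi)
    rw [mem_gridCell] at hz
    have b1' : |2 * ((snakePath n i).1 : ℝ)| ≤ 7 ^ n - 1 := by exact_mod_cast b1
    have b2' : |2 * ((snakePath n i).2 : ℝ)| ≤ 7 ^ n - 1 := by exact_mod_cast b2
    rw [abs_le] at b1' b2'
    exact ⟨⟨by linarith, by linarith⟩, by constructor <;> linarith⟩
  have := interior_mono h
  rwa [Complex.interior_reProdIm, interior_Icc] at this

theorem mem_compl_snakeDomain {n : ℕ} {z : ℂ}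
    (hz : (7 : ℝ) ^ n / 2 ≤ |z.re| ∨ (7 : ℝ) ^ n / 2 ≤ |z.im|) : z ∈ (snakeDomain n)ᶜ := by
  intro hc
  obtain ⟨h1, h2⟩ := snakeDomain_subset n hc
  rcases hz with hz | hz
  · exact absurd (abs_lt.2 h1) (not_lt.2 hz)
  · exact absurd (abs_lt.2 h2) (not_lt.2 hz)

section Cells
variable {p : ℤ → ℤ × ℤ} {m : ℕ} {a : ℝ}

theorem ball_gridPoint_subset (q : ℤ × ℤ) : ball (gridPoint q) (1 / 2) ⊆ gridCell q := by
  intro w hw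
  have hb := mem_of_ball_gridPoint hw
  simp only [gridPoint_re, gridPoint_im, abs_lt] at hb
  rw [mem_gridCell]
  refine ⟨⟨?_, ?_⟩, ?_, ?_⟩ <;> linarith

theorem norm_gridPoint_sub {q : ℤ × ℤ} {z : ℂ} (hz : z ∈ gridCell q) : ‖gridPoint q - z‖ ≤ 1 := by
  refine (Complex.norm_le_abs_re_add_abs_im _).trans ?_
  rw [mem_gridCell] at hz
  have h1 : |(gridPoint q - z).re| ≤ 1 / 2 := by
    rw [Complex.sub_re, gridPoint_re, abs_le]; constructor <;> linarith
  have h2 : |(gridPoint q - z).im| ≤ 1 / 2 := by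
    rw [Complex.sub_im, gridPoint_im, abs_le]; constructor <;> linarith
  linarith

theorem conn_gridPoint (ha : 0 < a) (ha1 : a ≤ 1) {q : ℤ × ℤ} (hq : q ∈ emptyCells p m) {z : ℂ}
    (hz : z ∈ gridCell q) : Conn a (interior (snakeBody p m))ᶜ z (gridPoint q) (2 / a) := by
  refine (Conn.of_convex ha ha1 (convex_gridCell q) (gridCell_subset hq) one_half_pos hz
    (ball_gridPoint_subset q)).le ha1 ?_
  gcongr
  calc ‖gridPoint q - z‖ * (1 / 2 : ℝ) ^ (a - 1) ≤ 1 * 2 := by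
        gcongr
        · exact norm_gridPoint_sub hz
        · exact half_rpow_le ha.le
    _ = 2 := one_mul 2

theorem conn_cell (ha : 0 < a) (ha1 : a ≤ 1) {q : ℤ × ℤ} (hq : q ∈ emptyCells p m) {z w : ℂ}
    (hz : z ∈ gridCell q) (hw : w ∈ gridCell q) {r : ℝ} (hr : 0 < r) (hr1 : r ≤ 1)
    (h : dist z w ≤ r) : Conn a (interior (snakeBody p m))ᶜ z w (6 * r ^ a / a) := by
  refine (Conn.pair_convex ha ha1 (convex_gridCell q) (gridCell_subset hq) one_half_pos hz hw
    (ball_gridPoint_subset q) (norm_gridPoint_sub hz) (norm_gridPoint_sub hw) hr hr1).le ha1 ?_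
  rw [dist_comm, dist_eq_norm] at h
  rw [Real.mul_rpow hr.le (by norm_num)]
  have h1 := half_rpow_le ha.le
  have h2 : (‖w - z‖ / 2 + r * 1) * (r ^ (a - 1) * (1 / 2) ^ (a - 1)) ≤
      (r / 2 + r * 1) * (r ^ (a - 1) * 2) := by gcongr
  have h3 := mul_rpow_sub_one (a := a) hr
  rw [← mul_div_assoc]
  refine div_le_div_of_nonneg_right ?_ ha.le
  linarith

/-- In each coordinate z is moved only as far as needed to enter the range of the other cell. The
resulting common point is no farther from z and w than they are from each other. -/
theorem exists_mem_cells {q q' : ℤ × ℤ} (h : Near q q') {z w : ℂ} (hz : z ∈ gridCell q)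
    (hw : w ∈ gridCell q') : ∃ v ∈ gridCell q, v ∈ gridCell q' ∧
      |v.re - z.re| ≤ |w.re - z.re| ∧ |v.im - z.im| ≤ |w.im - z.im| ∧
      |w.re - v.re| ≤ |w.re - z.re| ∧ |w.im - v.im| ≤ |w.im - z.im| := by
  have key : ∀ {i j : ℤ} {x y : ℝ}, |i - j| ≤ 1 → (i - 1 / 2 ≤ x ∧ x ≤ i + 1 / 2) →
      (j - 1 / 2 ≤ y ∧ y ≤ j + 1 / 2) → ∃ t : ℝ, (i - 1 / 2 ≤ t ∧ t ≤ i + 1 / 2) ∧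
        (j - 1 / 2 ≤ t ∧ t ≤ j + 1 / 2) ∧ |t - x| ≤ |y - x| ∧ |y - t| ≤ |y - x| := by
    intro i j x y hij hx hy
    rw [abs_le] at hij
    rcases (show i = j ∨ i = j + 1 ∨ j = i + 1 by omega) with rfl | rfl | rfl
    · exact ⟨x, hx, hx, by simp, le_rfl⟩
    · push_cast at *
      refine ⟨j + 1 / 2, ⟨by linarith, by linarith⟩, ⟨by linarith, by linarith⟩, ?_, ?_⟩ <;>
        rw [abs_of_nonpos (by linarith), abs_of_nonpos (by linarith)] <;> linarith
    · push_cast at *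
      refine ⟨i + 1 / 2, ⟨by linarith, by linarith⟩, ⟨by linarith, by linarith⟩, ?_, ?_⟩ <;>
        rw [abs_of_nonneg (by linarith), abs_of_nonneg (by linarith)] <;> linarith
  rw [mem_gridCell] at hz hw
  obtain ⟨s, s1, s2, s3, s4⟩ := key h.1 hz.1 hw.1
  obtain ⟨t, t1, t2, t3, t4⟩ := key h.2 hz.2 hw.2
  exact ⟨⟨s, t⟩, ⟨s1, t1⟩, ⟨s2, t2⟩, s3, t3, s4, t4⟩

theorem conn_near_cells (ha : 0 < a) (ha1 : a ≤ 1) {q q' : ℤ × ℤ} (hq : q ∈ emptyCells p m)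
    (hq' : q' ∈ emptyCells p m) {z w : ℂ} (hz : z ∈ gridCell q) (hw : w ∈ gridCell q')
    (h0 : 0 < dist z w) (h1 : dist z w < 1) :
    Conn a (interior (snakeBody p m))ᶜ z w (12 * dist z w ^ a / a) := by
  obtain ⟨v, v1, v2, e1, e2, e3, e4⟩ := exists_mem_cells (near_of_mem hz hw h1) hz hw
  have le : ∀ x y : ℂ, |x.re| ≤ |y.re| → |x.im| ≤ |y.im| → ‖x‖ ≤ ‖y‖ := by
    intro x y hr hi
    rw [← sq_le_sq₀ (norm_nonneg _) (norm_nonneg _), ← Complex.normSq_eq_norm_sq,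
      ← Complex.normSq_eq_norm_sq, Complex.normSq_apply, Complex.normSq_apply]
    have := sq_le_sq.2 hr
    have := sq_le_sq.2 hi
    linarith
  have d1 : dist z v ≤ dist z w := by
    rw [dist_comm, dist_comm z w, dist_eq_norm, dist_eq_norm]
    exact le _ _ (by simpa using e1) (by simpa using e2)
  have d2 : dist v w ≤ dist z w := by
    rw [dist_comm, dist_comm z w, dist_eq_norm, dist_eq_norm]
    exact le _ _ (by simpa using e3) (by simpa using e4)
  refine ((conn_cell ha ha1 hq hz v1 h0 h1.le d1).trans
    (conn_cell ha ha1 hq' v2 hw h0 h1.le d2)).le ha1 (le_of_eq ?_)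
  ring
end Cells

/-- At distances below 1 two touching free cells suffice. At larger distances both points escape
from the square of side 7 ^ n and are joined outside; since |z - w| ≥ 1, the fixed cost of order (7
^ a) ^ n / a is absorbed by the right-hand side. -/
theorem conn_snakeDomain_compl {a : ℝ} (ha : 0 < a) (ha1 : a ≤ 1) (n : ℕ) {z w : ℂ}
    (hz : z ∈ (snakeDomain n)ᶜ) (hw : w ∈ (snakeDomain n)ᶜ) :
    Conn a (snakeDomain n)ᶜ z w (1000 * ((7 : ℝ) ^ a) ^ n / a * dist z w ^ a) := by
  refine Conn.of_pos ha hz fun h0 => ?_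
  obtain ⟨q, hq, hzq⟩ := exists_emptyCell hz
  obtain ⟨q', hq', hwq⟩ := exists_emptyCell hw
  have hs : 1 ≤ ((7 : ℝ) ^ a) ^ n := one_le_pow₀ (Real.one_le_rpow (by norm_num) ha.le)
  have hr0 : 0 ≤ dist z w ^ a := by positivity
  rcases lt_or_ge (dist z w) 1 with h1 | h1
  · refine (conn_near_cells ha ha1 hq hq' hzq hwq h0 h1).le ha1 ?_
    rw [div_mul_eq_mul_div]
    gcongr
    linarith
  · obtain ⟨f, c1, d1, hf⟩ := exists_escape ha ha1 n q hq
    obtain ⟨f', c2, d2, hf'⟩ := exists_escape ha ha1 n q' hq'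
    have h7 : (1 : ℝ) ≤ 7 ^ n := one_le_pow₀ (by norm_num)
    have hr1 : 1 ≤ dist z w ^ a := Real.one_le_rpow h1 ha.le
    have n1 : dist z (gridPoint q) ≤ 1 := by
      rw [dist_comm, dist_eq_norm]; exact norm_gridPoint_sub hzq
    have n2 : dist w (gridPoint q') ≤ 1 := by
      rw [dist_comm, dist_eq_norm]; exact norm_gridPoint_sub hwq
    have hprod : (7 : ℝ) ^ n ≤ 7 ^ n * dist z w := le_mul_of_one_le_right (by positivity) h1
    have hprod' : dist z w ≤ 7 ^ n * dist z w := le_mul_of_one_le_left h0.le h7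
    have hd : dist f f' ≤ 9 * (7 ^ n * dist z w) := by
      have t1 := dist_triangle4 f z w f'
      have t2 := dist_triangle z (gridPoint q) f
      have t3 := dist_triangle w (gridPoint q') f'
      rw [dist_comm f z] at t1
      linarith
    have c3 := Conn.outside_square ha ha1 (fun z hz => mem_compl_snakeDomain (n := n) hz) hf hf'
      (r := 9 * (7 ^ n * dist z w)) (by positivity) (by linarith) hd
    have hpow : (9 * (7 ^ n * dist z w)) ^ a ≤ 9 * (((7 : ℝ) ^ a) ^ n * dist z w ^ a) := by
      refine (rpow_scale_le ha1 (by norm_num) (by positivity)).trans (le_of_eq ?_)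
      rw [Real.mul_rpow (by positivity) dist_nonneg, ← Real.rpow_natCast, ← Real.rpow_mul (by norm_num),
        mul_comm (n : ℝ) a, Real.rpow_mul (by norm_num), Real.rpow_natCast]
    refine ((((conn_gridPoint ha ha1 hq hzq).trans c1).trans c3).trans
      (((conn_gridPoint ha ha1 hq' hwq).trans c2).symm)).le ha1 ?_
    have hX : ((7 : ℝ) ^ a) ^ n ≤ ((7 : ℝ) ^ a) ^ n * dist z w ^ a :=
      le_mul_of_one_le_right (by positivity) hr1
    rw [div_mul_eq_mul_div, ← add_div, ← add_div, ← add_div]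
    gcongr
    linarith

/-! ### Failure of the John condition and the choice of the generation -/

theorem infDist_frontier_le_dist {Ω : Set ℂ} {x y : ℂ} (hx : x ∈ Ω) (hy : y ∉ Ω) :
    infDist x (frontier Ω) ≤ dist x y := by
  obtain ⟨z, hz, h⟩ := exists_mem_frontier_infDist_compl_eq_dist hx fun h => hy (h ▸ mem_univ y)
  exact (infDist_le_dist_of_mem hz).trans (h ▸ infDist_le_dist_of_mem hy)

namespace IsSnake
variable {p : ℤ → ℤ × ℤ} (H : IsSnake p)
include H

/-- The nine cells around a cell cannot all be on the path, since cells touching it have at most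
five possible indices. Hence every point of the corridor is within bounded distance of its
complement. -/
theorem exists_empty_near (m : ℕ) (i : ℤ) : ∃ q ∈ emptyCells p m, Near (p i) q := by
  by_contra hc
  push Not at hc
  have key : ∀ q, Near (p i) q → ∃ j : ℤ, p j = q := fun q hq => by
    by_contra hn
    push Not at hn
    exact hc q (fun j _ => hn j) hq
  choose! f hf using key
  have hmem : ∀ q : ℤ × ℤ, q ∈ Finset.Icc ((p i).1 - 1) ((p i).1 + 1) ×ˢ
      Finset.Icc ((p i).2 - 1) ((p i).2 + 1) → Near (p i) q := by
    intro q hq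
    simp only [Finset.mem_product, Finset.mem_Icc] at hq
    exact ⟨abs_le.2 ⟨by omega, by omega⟩, abs_le.2 ⟨by omega, by omega⟩⟩
  have hcard := Finset.card_le_card_of_injOn (s := Finset.Icc ((p i).1 - 1) ((p i).1 + 1) ×ˢ
    Finset.Icc ((p i).2 - 1) ((p i).2 + 1)) (t := Finset.Icc (i - 2) (i + 2)) f ?_ ?_
  · rw [Finset.card_product, Int.card_Icc, Int.card_Icc, Int.card_Icc,
      show (p i).1 + 1 + 1 - ((p i).1 - 1) = 3 by ring,
      show (p i).2 + 1 + 1 - ((p i).2 - 1) = 3 by ring, show i + 2 + 1 - (i - 2) = 5 by ring] at hcard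
    norm_num at hcard
  · intro q hq
    have hq' := hmem q hq
    have := H.near i (f q) (by rw [hf q hq']; exact hq')
    rw [abs_le] at this
    simp only [Finset.coe_Icc, mem_Icc]
    omega
  · intro q hq q' hq' h
    rw [← hf q (hmem q hq), ← hf q' (hmem q' hq'), h]

/-- The index along a path of length `l` changes by at most `4 * l + 4`. -/
theorem abs_sub_index_le {m : ℕ} {δ : ℝ → ℂ} {l : ℝ} (hl : 0 ≤ l)
    (hδ : ∀ t ∈ Icc 0 l, δ t ∈ snakeBody p m) (hL : LipschitzOnWith 1 δ (Icc 0 l)) {i j : ℤ}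
    (hi : δ 0 ∈ gridCell (p i)) (hj : δ l ∈ gridCell (p j)) : (|i - j| : ℝ) ≤ 4 * l + 4 := by
  -- In time 1/2 the curve moves less than 1, so it stays in touching cells and the index changes by
  -- at most 2.
  have key : ∀ k : ℕ, ∀ t ∈ Icc 0 l, t ≤ k / 2 → ∀ j : ℤ, δ t ∈ gridCell (p j) →
      |i - j| ≤ 2 * k + 2 := by
    intro k
    induction k with
    | zero =>
      intro t ht h0 j hj
      obtain rfl : t = 0 := le_antisymm (by simpa using h0) ht.1
      simpa using H.near i j (near_of_mem hi hj (by simp))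
    | succ k ih =>
      intro t ht htk j hj
      push_cast at htk
      have ht' : max 0 (t - 1 / 2) ∈ Icc 0 l := ⟨le_max_left _ _, max_le hl (by linarith [ht.2])⟩
      obtain ⟨j', -, hj'⟩ := hδ _ ht'
      have h1 := ih _ ht' (max_le (by positivity) (by linarith)) j' hj'
      have hd : dist (δ (max 0 (t - 1 / 2))) (δ t) < 1 := by
        refine (hL.dist_le_mul _ ht' _ ht).trans_lt ?_
        rw [NNReal.coe_one, one_mul, Real.dist_eq, abs_lt]
        have h2 := le_max_right 0 (t - 1 / 2)
        have h3 : max 0 (t - 1 / 2) ≤ t := max_le ht.1 (by linarith)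
        constructor <;> linarith
      have h2 := H.near j' j (near_of_mem hj' hj hd)
      rw [abs_le] at *
      push_cast
      omega
  have hk := key ⌈2 * l⌉₊ l ⟨hl, le_rfl⟩ (by linarith [Nat.le_ceil (2 * l)]) j hj
  have h1 := Nat.ceil_lt_add_one (show 0 ≤ 2 * l by linarith)
  have h2 : (|i - j| : ℝ) ≤ 2 * ⌈2 * l⌉₊ + 2 := by exact_mod_cast hk
  linarith
end IsSnake

theorem gridPoint_mem_snakeDomain {n i : ℕ} (hi : i < 9 ^ n) :
    gridPoint (snakePath n i) ∈ snakeDomain n := by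
  have h : gridCell (snakePath n i) ⊆ snakeBody (snakePath n) (9 ^ n) := fun z hz => ⟨i, hi, hz⟩
  exact interior_mono h (mem_interior.2
    ⟨_, ball_gridPoint_subset _, isOpen_ball, mem_ball_self one_half_pos⟩)

theorem infDist_frontier_snakeDomain_le {n : ℕ} {z : ℂ} (hz : z ∈ snakeDomain n) :
    infDist z (frontier (snakeDomain n)) ≤ 3 := by
  obtain ⟨i, -, hi⟩ := interior_subset hz
  obtain ⟨q, hq, h1, h2⟩ := (isSnake_snakePath n).exists_empty_near (9 ^ n) i
  have hq' : gridPoint q ∉ snakeDomain n :=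
    gridCell_subset hq (ball_gridPoint_subset q (mem_ball_self one_half_pos))
  refine (infDist_frontier_le_dist hz hq').trans ?_
  refine (dist_triangle _ (gridPoint (snakePath n i)) _).trans ?_
  have e1 : dist z (gridPoint (snakePath n i)) ≤ 1 := by
    rw [dist_comm, dist_eq_norm]; exact norm_gridPoint_sub hi
  have e2 : dist (gridPoint (snakePath n i)) (gridPoint q) ≤ 1 + 1 := by
    rw [dist_eq_norm]
    refine (Complex.norm_le_abs_re_add_abs_im _).trans ?_
    simp only [Complex.sub_re, Complex.sub_im, gridPoint_re, gridPoint_im]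
    gcongr
    · exact_mod_cast h1
    · exact_mod_cast h2
  linarith

/-- Whatever the center, one end of the path is about half of the 9 ^ n indices away, so the curve
from there has length l ≥ 9 ^ n / 9. This needs 9 ^ n ≥ 81 to swallow the additive constants. At its
end Jl is at most 3. -/
theorem john_le_of_snakeDomain {n : ℕ} (hn : 2 ≤ n) {J : ℝ}
    (h : IsJohnDomain J (toPlane '' snakeDomain n)) : J * 9 ^ n ≤ 27 := by
  obtain ⟨hJ, -, ⟨x₀, hx₀, rfl⟩, h⟩ := h
  obtain ⟨i₀, hi₀, hz₀⟩ := interior_subset hx₀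
  have h9 : (81 : ℝ) ≤ 9 ^ n := by
    calc (81 : ℝ) = 9 ^ 2 := by norm_num
      _ ≤ 9 ^ n := pow_le_pow_right₀ (by norm_num) hn
  have hpos : 0 < 9 ^ n := by positivity
  obtain ⟨i, hi, hfar⟩ : ∃ i : ℕ, i < 9 ^ n ∧ ((9 : ℝ) ^ n - 1) / 2 ≤ |(i : ℝ) - i₀| := by
    rcases le_total (((9 : ℝ) ^ n - 1) / 2) i₀ with h' | h'
    · refine ⟨0, hpos, ?_⟩
      rw [Nat.cast_zero, zero_sub, abs_neg]
      exact h'.trans (le_abs_self _)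
    · refine ⟨9 ^ n - 1, by omega, le_trans ?_ (le_abs_self _)⟩
      rw [Nat.cast_sub (by omega)]
      push_cast
      linarith
  obtain ⟨l, γ, hl, hγ, h0, h1, hJγ⟩ := h _ (mem_image_of_mem _ (gridPoint_mem_snakeDomain hi))
  have hcell : gridPoint (snakePath n i) ∈ gridCell (snakePath n i) :=
    ball_gridPoint_subset _ (mem_ball_self one_half_pos)
  have hlen := (isSnake_snakePath n).abs_sub_index_le (m := 9 ^ n) (δ := fun t => toPlane.symm (γ t))
    (i := i) (j := i₀) hl
    (fun t ht => by
      obtain ⟨z, hz, hzt⟩ := (hJγ t ht).1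
      rw [← hzt, LinearIsometryEquiv.symm_apply_apply]
      exact interior_subset hz)
    (by
      rw [← one_mul (1 : ℝ≥0)]
      exact toPlane.symm.lipschitz.comp_lipschitzOnWith (UnitSpeed.lipschitzOnWith hγ))
    (by simpa [h0] using hcell) (by simpa [h1] using hz₀)
  have hend := (hJγ l ⟨hl, le_rfl⟩).2
  rw [h1, toPlane_infDist] at hend
  have h3 := hend.trans (infDist_frontier_snakeDomain_le hx₀)
  push_cast at hlen
  have : (9 : ℝ) ^ n ≤ 9 * l := by linarith
  calc J * 9 ^ n ≤ J * (9 * l) := by gcongr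
    _ = 9 * (J * l) := by ring
    _ ≤ 9 * 3 := by gcongr
    _ = 27 := by norm_num

theorem isJordanRegion_snakeBody (n : ℕ) : IsJordanRegion (snakeBody (snakePath n) (9 ^ n)) := by
  have := (isSnake_snakePath n).isJordanRegion_body (9 ^ n - 1)
  rwa [Nat.sub_add_cancel (Nat.one_le_pow _ _ (by norm_num))] at this

theorem isJordanCurve_frontier_snakeDomain (n : ℕ) : IsJordanCurve (frontier (snakeDomain n)) := by
  rw [snakeDomain, (isJordanRegion_snakeBody n).frontier_interior]
  exact (isJordanRegion_snakeBody n).jordan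

theorem isJordanDomain_snakeDomain (n : ℕ) : IsJordanDomain (toPlane '' snakeDomain n) := by
  refine isJordanDomain_toPlane isOpen_interior (isJordanRegion_snakeBody n).conn ?_
    (isJordanCurve_frontier_snakeDomain n)
  refine Bornology.IsBounded.subset ?_ (snakeDomain_subset n)
  exact (isBounded_Ioo _ _).reProdIm (isBounded_Ioo _ _)

/-- The number of refinements for which the corridor fits a given curve condition. -/
theorem exists_generation {a N : ℝ} (ha : 0 < a) (ha1 : a ≤ 1) (hN : 1000 ^ 17 < N) :
    ∃ n : ℕ, 2 ≤ n ∧ 1000 * ((7 : ℝ) ^ a) ^ n ≤ N ∧ N ^ (1 / a) ≤ 7 * 9 ^ n := by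
  obtain ⟨n, h1, h2⟩ := exists_nat_pow_near (x := N / 1000) (y := (7 : ℝ) ^ a)
    (by linarith) (Real.one_lt_rpow (by norm_num) ha)
  have hu : (1 : ℝ) ≤ 7 ^ a := Real.one_le_rpow (by norm_num) ha.le
  have hu7 : (7 : ℝ) ^ a ≤ 7 := by
    simpa using Real.rpow_le_rpow_of_exponent_le (show (1 : ℝ) ≤ 7 by norm_num) ha1
  have hn : 2 ≤ n := by
    by_contra hc
    have : ((7 : ℝ) ^ a) ^ (n + 1) ≤ 7 ^ 2 :=
      (pow_le_pow_right₀ hu (by omega)).trans (pow_le_pow_left₀ (by positivity) hu7 2)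
    linarith
  refine ⟨n, hn, by linarith, ?_⟩
  -- Because 7 ≤ (9/7) ^ 8 and n + 1 ≤ 2n, the sixteenth power of the right-hand side exceeds N /
  -- 1000 > 1000 ^ 16. This explains the exponent 17 in the universal constant.
  have hv : (1000 : ℝ) ≤ ((9 / 7 : ℝ) ^ a) ^ n := by
    have hv8 : (7 : ℝ) ^ a ≤ ((9 / 7 : ℝ) ^ a) ^ 8 := by
      rw [← Real.rpow_natCast, ← Real.rpow_mul (by norm_num), mul_comm, Real.rpow_mul (by norm_num),
        Real.rpow_natCast]
      exact Real.rpow_le_rpow (by norm_num) (by norm_num) ha.le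
    refine (lt_of_pow_lt_pow_left₀ 16 (by positivity) ?_).le
    calc (1000 : ℝ) ^ 16 < N / 1000 := by linarith
      _ < ((7 : ℝ) ^ a) ^ (n + 1) := h2
      _ ≤ ((7 : ℝ) ^ a) ^ (2 * n) := pow_le_pow_right₀ hu (by omega)
      _ ≤ (((9 / 7 : ℝ) ^ a) ^ 8) ^ (2 * n) := by gcongr
      _ = (((9 / 7 : ℝ) ^ a) ^ n) ^ 16 := by rw [← pow_mul, ← pow_mul]; congr 1; ring
  -- The factor (9/7) ^ (an) ≥ 1000 pays for the constant 1000 lost in the choice of n before the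
  -- root of order a is taken.
  have hN' : N ≤ (7 * 9 ^ n) ^ a := by
    have e : ((7 : ℝ) * 9 ^ n) ^ a = ((9 / 7 : ℝ) ^ a) ^ n * ((7 : ℝ) ^ a) ^ (n + 1) := by
      rw [show (7 : ℝ) * 9 ^ n = (9 / 7) ^ n * 7 ^ (n + 1) by
          rw [div_pow, pow_succ]; field_simp,
        Real.mul_rpow (by positivity) (by positivity), Real.rpow_pow_comm (by norm_num),
        Real.rpow_pow_comm (by norm_num)]
    rw [e]
    calc N = 1000 * (N / 1000) := by ring
      _ ≤ _ := by gcongr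
  calc N ^ (1 / a) ≤ ((7 * 9 ^ n) ^ a) ^ (1 / a) :=
        Real.rpow_le_rpow (by linarith) hN' (by positivity)
    _ = 7 * 9 ^ n := by
        rw [← Real.rpow_mul (by positivity), mul_one_div_cancel ha.ne', Real.rpow_one]

/-- A John constant J would give J((2 - p)C) ^ (1 / (2 - p)) ≤ 7 · 27, far below the universal
constant. -/
theorem exists_curve_condition_not_john {p C : ℝ} (hp : 1 < p) (hp2 : p < 2)
    (hC : 1000 ^ 17 / (2 - p) < C) :
    ∃ Ω : Set (EuclideanSpace ℝ (Fin 2)), IsJordanDomain Ω ∧ SatisfiesCurveCondition p C Ω ∧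
      ∀ J : ℝ, 1000 ^ 17 * ((2 - p) * C) ^ (1 / (p - 2)) ≤ J → ¬ IsJohnDomain J Ω := by
  have ha : 0 < 2 - p := by linarith
  rw [div_lt_iff₀ ha, mul_comm] at hC
  obtain ⟨n, hn, h1, h2⟩ := exists_generation ha (by linarith) hC
  refine ⟨_, isJordanDomain_snakeDomain n, satisfiesCurveCondition_toPlane hp.le ?_ ?_, ?_⟩
  · obtain ⟨φ, -, -, hφ⟩ := isJordanCurve_frontier_snakeDomain n
    rw [← hφ]
    exact range_nonempty φ
  · intro z hz w hw
    refine (conn_snakeDomain_compl ha (by linarith) n hz hw).le (by linarith) ?_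
    gcongr
    rw [div_le_iff₀ ha]
    linarith
  · intro J hJ hJohn
    have h3 := john_le_of_snakeDomain hn hJohn
    have h9 : (0 : ℝ) < 9 ^ n := by positivity
    have hN : 0 < ((2 - p) * C) ^ (1 / (2 - p)) := Real.rpow_pos_of_pos (by linarith) _
    rw [show 1 / (p - 2) = -(1 / (2 - p)) by rw [← neg_sub, div_neg], Real.rpow_neg (by linarith),
      ← div_eq_mul_inv, div_le_iff₀ hN] at hJ
    have : J * ((2 - p) * C) ^ (1 / (2 - p)) ≤ 7 * 27 := by
      calc J * ((2 - p) * C) ^ (1 / (2 - p)) ≤ J * (7 * 9 ^ n) :=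
            mul_le_mul_of_nonneg_left h2 hJohn.1.le
        _ = 7 * (J * 9 ^ n) := by ring
        _ ≤ 7 * 27 := by gcongr
    linarith

theorem theorem4p1 :
    (∀ J : ℝ, 0 < J → J < 1 / 2 →
      ∃ Ω : Set (EuclideanSpace ℝ (Fin 2)), IsJordanDomain Ω ∧ IsJohnDomain J Ω ∧
        ENNReal.ofReal (2 - 2 / Real.log 2 * J) ≤ dimH (frontier Ω)) ∧
    (∀ p C : ℝ, 1 < p → p < 2 → 72 / (2 - p) < C →
      ∃ Ω : Set (EuclideanSpace ℝ (Fin 2)), IsJordanDomain Ω ∧ SatisfiesCurveCondition p C Ω ∧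
        ENNReal.ofReal (2 - 24 / (Real.log 2 * (2 - p) * C)) ≤ dimH (frontier Ω)) ∧
    (∃ c : ℝ, 0 < c ∧ ∀ p C : ℝ, 1 < p → p < 2 → c / (2 - p) < C →
      ∃ Ω : Set (EuclideanSpace ℝ (Fin 2)), IsJordanDomain Ω ∧ SatisfiesCurveCondition p C Ω ∧
        ∀ J : ℝ, c * ((2 - p) * C) ^ (1 / (p - 2)) ≤ J → ¬ IsJohnDomain J Ω) := by
  refine ⟨fun J h0 h1 => exists_john_domain h0 h1,
    fun p C hp hp2 hC => exists_curve_condition_dimH hp hp2 hC,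
    1000 ^ 17, by norm_num, fun p C hp hp2 hC => exists_curve_condition_not_john hp hp2 hC⟩
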